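/- **Notation.** Let $n\ge 2$, let $q\in\mathbb C^\times$ not be a root of unity ($q=1$ is allowed) and let $p\in\mathbb C^\times$. Let $V=\mathbb C^n$ with basis $v_1,\dots,v_n$ and matrix units $E^{a,b}v_c=\delta_{b,c}v_a$, let $V(z)=\mathbb C[z^{\pm1}]\otimes V$, and put $u_k=z^mv_\epsilon$ for $k=\epsilon-nm$, $1\le\epsilon\le n$. For $N\ge0$ identify $\otimes^NV(z)=\mathbb C[z_1^{\pm1},\dots,z_N^{\pm1}]\otimes(\otimes^NV)$; put $v_{\mathbf e}=v_{\epsilon_1}\otimes\dots\otimes v_{\epsilon_N}$ for $\mathbf e=(\epsilon_1,\dots,\epsilon_N)$. Let $K_{i,j}$ exchange $z_i$ and $z_j$, let $p^{D_i}$ be the substitution $z_i\mapsto pz_i$, and put $$g_{i,j}=\frac{q^{-1}z_i-qz_j}{z_i-z_j}(K_{i,j}-1)+q,\qquad \xi_{i,j}=K_{i,j}g_{i,j},\qquad Y^{(N)}_i=\xi_{i,i+1}^{-1}\cdots\xi_{i,N}^{-1}\,p^{D_i}\,\xi_{1,i}\cdots\xi_{i-1,i},\qquad y_i=q^{1-N}Y_i^{(N)}.$$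 Let $S=-q^{-1}\sum_{\epsilon}E^{\epsilon,\epsilon}\otimes E^{\epsilon,\epsilon}+(q-q^{-1})\sum_{\epsilon<\epsilon'}E^{\epsilon,\epsilon}\otimes E^{\epsilon',\epsilon'}-\sum_{\epsilon\ne\epsilon'}E^{\epsilon,\epsilon'}\otimes E^{\epsilon',\epsilon}$, acting in the factors $i,i+1$ as $S_{i,i+1}$. Put $\wedge^NV(z)=\otimes^NV(z)/\sum_{i=1}^{N-1}\operatorname{Ker}(g_{i,i+1}+S_{i,i+1}^{-1})$ with quotient map $\Lambda$, and $u_{k_1}\wedge\dots\wedge u_{k_N}=\Lambda(u_{k_1}\otimes\dots\otimes u_{k_N})$. Let $U'_q(\widehat{\mathfrak{sl}}_n)$ be the algebra generated by $E_\epsilon,F_\epsilon,K_\epsilon^{\pm1}$ ($0\le\epsilon\le n-1$) with the quantum Kac–Moody relations of type $A^{(1)}_{n-1}$ and $K_0K_1\cdots K_{n-1}=1$; the relation between $E_\epsilon$ and $F_{\epsilon'}$ is taken as $[E_\epsilon,F_{\epsilon'}]=0$ for $\epsilon\ne\epsilon'$ and $(q-q^{-1})[E_\epsilon,F_\epsilon]=K_\epsilon-K_\epsilon^{-1}$,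 so that it makes sense at $q=1$. With $K^\epsilon_i=q^{E_i^{\epsilon,\epsilon}-E_i^{\epsilon+1,\epsilon+1}}$ (upper indices mod $n$; the lower index is the tensor factor) consider on $\otimes^NV(z)$ $$K_\epsilon=K_1^\epsilon\cdots K_N^\epsilon,\quad E_\epsilon=\sum_{i=1}^Ny_i^{-\delta_{0,\epsilon}}E_i^{\epsilon,\epsilon+1}K^\epsilon_{i+1}\cdots K^\epsilon_N,\quad F_\epsilon=\sum_{i=1}^Ny_i^{\delta_{0,\epsilon}}(K^\epsilon_1)^{-1}\cdots(K^\epsilon_{i-1})^{-1}E_i^{\epsilon+1,\epsilon},\quad h^{(N)}_l=\sum_{i=1}^Ny_i^l\quad(l\in\mathbb Z_{\ne0}).$$ A sequence of integers is $n$-strict if no value occurs more than $n$ times. Let $\mathcal M^n_N$ be the set of non-decreasing $n$-strict $\mathbf m\in\mathbb Z^N$, and for $\mathbf m\in\mathcal M_N^n$ let $\mathcal E(\mathbf m)$ be the set of $\mathbf e\in\{1,\dots,n\}^N$ with $\epsilon_i>\epsilon_{i+1}$ whenever $m_i=m_{i+1}$. The normally ordered wedges are $w(\mathbf m,\mathbf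 e)=z^{m_1}v_{\epsilon_1}\wedge\dots\wedge z^{m_N}v_{\epsilon_N}$, $\mathbf m\in\mathcal M^n_N$, $\mathbf e\in\mathcal E(\mathbf m)$. Fix $M\in\mathbb Z$ and $0\le s\le n-1$ with $M\equiv s\pmod n$, and let $\mathbf m^0=(m_i^0)_{i\ge1}$ be the sequence with $s$ terms $\frac{s-M}n$, followed by $n$ terms $\frac{s-M}n+j$ for each $j=1,2,\dots$. For $r\ge0$ let $V_M^{s+nr}\subset\wedge^{s+nr}V(z)$ be the span of the normally ordered $w(\mathbf m,\mathbf e)$ with $m_{s+nr}\le m^0_{s+nr}$, and $V_M^{s+nr,k}$ the span of those of degree $\sum_{i=1}^{s+nr}(m_i^0-m_i)=k$. Let $\rho^M_{r+1,r}:V_M^{s+n(r+1)}\to V_M^{s+nr}$ be the linear map that sends $w(\mathbf m,\mathbf e)$ to the wedge obtained by deleting the last $n$ factors if $m_i=m_i^0$ for all $s+nr<i\le s+n(r+1)$, and to $0$ otherwise; let $V_M^k=\varprojlim_rV_M^{s+nr,k}$, the space of sequences $(f_r)_{r\ge0}$ with $f_r\in V_M^{s+nr,k}$ and $\rho^M_{r+1,r}f_{r+1}=f_r$.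 Put $g_l^{(s+nr)}=h_l^{(s+nr)}-\sum_{j=1}^{s+nr}p^{lm_j^0}q^{2l(1-j)}$. The Fock space $F_M$ is spanned by the semi-infinite monomials $u_{k_1}\wedge u_{k_2}\wedge\cdots$ with $k_i=M-i+1$ for $i\gg1$, modulo the wedge relations in finitely many factors; $|M'\rangle=u_{M'}\wedge u_{M'-1}\wedge\cdots$, and $F_M^k$ is the span of the monomials with $k_1>k_2>\cdots$ and degree $\sum_{i\ge1}(m_i^0-m_i)=k$, where $u_{k_i}=z^{m_i}v_{\epsilon_i}$. **Proposition.** The operators $E_\epsilon,F_\epsilon,K_\epsilon^{\pm1}$ and $h_l^{(N)}$ descend to $\wedge^NV(z)$ and the former define an action $U_0^{(N)}$ of $U_q'(\widehat{\mathfrak{sl}}_n)$ there ($N\ge 0$); the maps $\rho^M_{r+1,r}$ are well defined. (a) For every $k\ge0$ the map $\rho_M^k:V_M^k\to F_M^k$, $f=(f_r)_{r\ge 0}\mapsto f_r\wedge|M-s-nr\rangle$, is independent of the choice of $r\ge k$ and is a linear isomorphism. (b) $F_M=\bigoplus_{k\ge0}F_M^k$. For $x\in U_q'(\widehat{\mathfrak{sl}}_n)$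 and $l\ne0$, $(f_r)_r\mapsto(x^{(s+nr)}f_r)_r$ and $(f_r)_r\mapsto(g_l^{(s+nr)}f_r)_r$ map $V_M^k$ into itself. There are a unique action $U_0$ of $U_q'(\widehat{\mathfrak{sl}}_n)$ on $F_M$ and unique operators $g_l$ ($l\in\mathbb Z_{\ne0}$) on $F_M$ such that for all $k\geq 0$, $r\ge k$ and $f\in V_M^{s+nr,k}$ $$x.(f\wedge|M-s-nr\rangle)=(x^{(s+nr)}f)\wedge|M-s-nr\rangle,\qquad g_l.(f\wedge|M-s-nr\rangle)=(g_l^{(s+nr)}f)\wedge|M-s-nr\rangle.$$ They preserve every $F_M^k$; the $g_l$ commute with one another and with $U_0$. (c) Suppose moreover that $p$ is generic, i.e. $p\notin q^{2\mathbb Q_{\ge0}}$: $p^b\ne q^{2a}$ for all integers $a\ge0$, $b\ge1$. For $\lambda\in\mathbb Z^N$ let $\lambda^+$ be its decreasing rearrangement and $\sigma(i)=\#\{j:\lambda_j>\lambda_i,\text{ or }\lambda_j=\lambda_i\text{ and }j\le i\}$. Write $\mu\prec\lambda$ if $\mu^+$ is strictly smaller than $\lambda^+$ in the dominance order, or $\mu^+=\lambda^+$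 and the last nonzero entry of $\lambda-\mu$ is negative. Let $\Phi^\lambda$ be the non-symmetric Macdonald polynomial, that is, $\Phi^\lambda\in z^\lambda+\sum_{\mu\prec\lambda}\mathbb Cz^\mu$ and $Y_i^{(N)}\Phi^\lambda=p^{\lambda_i}q^{2\sigma(i)-N-1}\Phi^\lambda$ for all $i$. For $\mathbf m\in\mathcal M^n_N$ let $E^{\mathbf m}\subset\wedge^NV(z)$ be the span of the vectors $\Lambda(\Phi^{\mathbf m}\otimes v_{\mathbf e})$, $\mathbf e\in\mathcal E(\mathbf m)$. Let $\mathbf m=(m_1\le m_2\le\cdots)$ be an $n$-strict sequence of integers with $m_i=m^0_i$ for $i\gg1$, put $\|\mathbf m\|=\sum_{i\ge1}(m^0_i-m_i)$, and let $\mathbf m^{(N)}$ consist of its first $N$ terms. Put $N=s+n\|\mathbf m\|$ and $\mathcal F_M^{\mathbf m}=E^{\mathbf m^{(N)}}\wedge|M-N\rangle\subset F_M$. Then $\Phi^{\mathbf m^{(N)}}$ exists and is unique, the vectors $\Lambda(\Phi^{\mathbf m^{(N)}}\otimes v_{\mathbf e})$, $\mathbf e\in\mathcal E(\mathbf m^{(N)})$,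 are linearly independent, $\mathcal F_M^{\mathbf m}$ is invariant under $U_0$, $E^{\mathbf m^{(N)}}$ is invariant under $U_0^{(N)}$, and the two are isomorphic $U_q'(\widehat{\mathfrak{sl}}_n)$-modules. -/

import Mathlib

open scoped TensorProduct

noncomputable section

namespace LevelZero

/-! ## Laurent polynomials and the polynomial representation of the affine Hecke algebra -/

/-- The ring `ℂ[z₁^{±1}, …, z_N^{±1}]`. -/
abbrev Laurent (N : ℕ) : Type := AddMonoidAlgebra ℂ (Fin N → ℤ)

/-- The monomial `z^m = z₁^{m₁} ⋯ z_N^{m_N}`. -/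
def mono {N : ℕ} (m : Fin N → ℤ) : Laurent N := AddMonoidAlgebra.single m 1

/-- The linear operator with prescribed values on the monomials. -/
def opOnMono {N : ℕ} (φ : (Fin N → ℤ) → Laurent N) : Module.End ℂ (Laurent N) :=
  (AddMonoidAlgebra.basis (Fin N → ℤ) ℂ).constr ℂ φ

theorem opOnMono_mono {N : ℕ} (φ : (Fin N → ℤ) → Laurent N) (m : Fin N → ℤ) :
    opOnMono φ (mono m) = φ m := by
  have h : mono m = AddMonoidAlgebra.basis (Fin N → ℤ) ℂ m := by
    rw [AddMonoidAlgebra.basis_apply]; rfl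
  rw [h, opOnMono, Module.Basis.constr_basis]

/-- `K_{i,j}`: the exchange of the variables `z_i` and `z_j`. -/
def swapVar {N : ℕ} (i j : Fin N) : Module.End ℂ (Laurent N) :=
  opOnMono fun m => mono (m ∘ Equiv.swap i j)

/-- Multiplication by `z_i`. -/
def mulVar {N : ℕ} (i : Fin N) : Module.End ℂ (Laurent N) :=
  LinearMap.mulLeft ℂ (mono (Pi.single i 1))

/-- The operator `(z_i - z_j)⁻¹ (K_{i,j} - 1)` (for `i ≠ j`), written out on monomials;
see `mulVar_sub_mul_divDiff`. -/
def divDiff {N : ℕ} (i j : Fin N) : Module.End ℂ (Laurent N) :=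
  opOnMono fun m =>
    (∑ t ∈ Finset.range (m j - m i).toNat,
        mono (Function.update (Function.update m i (m j - 1 - t)) j (m i + t))) -
    ∑ t ∈ Finset.range (m i - m j).toNat,
        mono (Function.update (Function.update m i (m i - 1 - t)) j (m j + t))

theorem mulVar_mono {N : ℕ} (i : Fin N) (m : Fin N → ℤ) :
    mulVar i (mono m) = mono (Pi.single i 1 + m) := by
  simp [mulVar, mono, AddMonoidAlgebra.single_mul_single]

theorem mulVar_sub_mul_divDiff {N : ℕ} {i j : Fin N} (hij : i ≠ j) :
    (mulVar i - mulVar j) * divDiff i j = swapVar i j - 1 := by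
  have upd : ∀ (m : Fin N → ℤ) (a b : ℤ),
      (mulVar i - mulVar j) (mono (Function.update (Function.update m i a) j b)) =
        mono (Function.update (Function.update m i (a + 1)) j b) -
        mono (Function.update (Function.update m i a) j (b + 1)) := by
    intro m a b
    rw [LinearMap.sub_apply, mulVar_mono, mulVar_mono]
    congr 2
    · funext l
      by_cases h1 : l = j
      · subst h1; simp [hij.symm]
      · by_cases h2 : l = i
        · subst h2; simp [h1, add_comm]
        · simp [h1, h2]
    · funext l
      by_cases h1 : l = j
      · subst h1; simp [add_comm]
      · simp [h1]
  have swp : ∀ m : Fin N → ℤ,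
      m ∘ Equiv.swap i j = Function.update (Function.update m i (m j)) j (m i) := by
    intro m
    funext l
    by_cases h1 : l = j
    · subst h1; simp
    · by_cases h2 : l = i
      · subst h2; simp [h1]
      · simp [h1, h2, Equiv.swap_apply_of_ne_of_ne]
  refine (AddMonoidAlgebra.basis (Fin N → ℤ) ℂ).ext fun m => ?_
  have hm : AddMonoidAlgebra.basis (Fin N → ℤ) ℂ m = mono m := by
    rw [AddMonoidAlgebra.basis_apply]; rfl
  have rhs : (swapVar i j - 1) (mono m) =
      mono (Function.update (Function.update m i (m j)) j (m i)) - mono m := by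
    rw [LinearMap.sub_apply, swapVar, opOnMono_mono, swp, Module.End.one_apply]
  rw [hm, Module.End.mul_apply, divDiff, opOnMono_mono, rhs, map_sub, map_sum, map_sum]
  have id1 : mono m = mono (Function.update (Function.update m i (m i)) j (m j)) := by simp
  have tele : ∀ (a b : ℤ) (L : ℕ),
      ∑ t ∈ Finset.range L, (mulVar i - mulVar j)
        (mono (Function.update (Function.update m i (a - 1 - t)) j (b + t))) =
      mono (Function.update (Function.update m i a) j b) -
        mono (Function.update (Function.update m i (a - L)) j (b + L)) := by
    intro a b L
    induction L with
    | zero => simp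
    | succ L ih =>
      rw [Finset.sum_range_succ, ih, upd]
      have e1 : a - 1 - (L : ℤ) + 1 = a - L := by ring
      have e2 : a - 1 - (L : ℤ) = a - ((L + 1 : ℕ) : ℤ) := by push_cast; ring
      have e3 : b + (L : ℤ) + 1 = b + ((L + 1 : ℕ) : ℤ) := by push_cast; ring
      rw [e1, e2, e3]; abel
  rw [tele, tele]
  conv_rhs => rw [id1]
  rcases le_total (m i) (m j) with h | h
  · have e1 : (((m j - m i).toNat : ℕ) : ℤ) = m j - m i := Int.toNat_of_nonneg (by omega)
    have e2 : (m i - m j).toNat = 0 := by omega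
    rw [e1, e2]; simp
  · have e1 : (((m i - m j).toNat : ℕ) : ℤ) = m i - m j := Int.toNat_of_nonneg (by omega)
    have e2 : (m j - m i).toNat = 0 := by omega
    rw [e1, e2]; simp

/-- `g_{i,j} = (q⁻¹ z_i - q z_j) / (z_i - z_j) ⬝ (K_{i,j} - 1) + q`. -/
def heckeG (q : ℂ) {N : ℕ} (i j : Fin N) : Module.End ℂ (Laurent N) :=
  (q⁻¹ • mulVar i - q • mulVar j) * divDiff i j + q • 1

/-- `ξ_{i,j} = K_{i,j} g_{i,j}`. -/
def xi (q : ℂ) {N : ℕ} (i j : Fin N) : Module.End ℂ (Laurent N) :=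
  swapVar i j * heckeG q i j

/-- `p^{D_i}`: the substitution `z_i ↦ p z_i`. -/
def pShift (p : ℂ) {N : ℕ} (i : Fin N) : Module.End ℂ (Laurent N) :=
  opOnMono fun m => p ^ (m i) • mono m

/-- `Y_i = ξ_{i,i+1}⁻¹ ⋯ ξ_{i,N}⁻¹ p^{D_i} ξ_{1,i} ⋯ ξ_{i-1,i}`. -/
def macY (q p : ℂ) {N : ℕ} (i : Fin N) : Module.End ℂ (Laurent N) :=
  (((List.finRange N).filter (fun j => i < j)).map fun j => Ring.inverse (xi q i j)).prod *
    pShift p i *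
    (((List.finRange N).filter (fun j => j < i)).map fun j => xi q j i).prod

/-- `y_i = q^{1-N} Y_i`. -/
def yOp (q p : ℂ) {N : ℕ} (i : Fin N) : Module.End ℂ (Laurent N) :=
  q ^ (1 - (N : ℤ)) • macY q p i

/-- Integer powers of an (invertible) operator. -/
def endZPow {W : Type} [AddCommGroup W] [Module ℂ W] (A : Module.End ℂ W) :
    ℤ → Module.End ℂ W
  | Int.ofNat a => A ^ a
  | Int.negSucc a => Ring.inverse A ^ (a + 1)

/-! ## Non-symmetric Macdonald polynomials -/

/-- The weakly decreasing rearrangement `μ⁺` of `μ`. -/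
def sortDesc {N : ℕ} (μ : Fin N → ℤ) : Fin N → ℤ := μ ∘ Tuple.sort μ ∘ Fin.rev

/-- The dominance order `μ⁺ ≼ ν⁺` on decreasing sequences. -/
def DomLE {N : ℕ} (a b : Fin N → ℤ) : Prop :=
  (∀ i, ∑ j ∈ Finset.Iic i, a j ≤ ∑ j ∈ Finset.Iic i, b j) ∧ ∑ j, a j = ∑ j, b j

/-- The strict partial order `μ ≺ ν` on `ℤ^N`: either `μ⁺` is strictly smaller than `ν⁺` in the
dominance order, or `μ⁺ = ν⁺` and the last nonzero entry of `ν - μ` is negative. -/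
def MacLT {N : ℕ} (μ ν : Fin N → ℤ) : Prop :=
  (sortDesc μ ≠ sortDesc ν ∧ DomLE (sortDesc μ) (sortDesc ν)) ∨
    (sortDesc μ = sortDesc ν ∧ ∃ i, ν i - μ i < 0 ∧ ∀ j, i < j → ν j - μ j = 0)

/-- The position (counted from `1`) of the entry `μ_i` in `μ⁺`, equal entries being kept in their
original order. -/
def pos {N : ℕ} (μ : Fin N → ℤ) (i : Fin N) : ℕ :=
  (Finset.univ.filter fun j => μ i < μ j ∨ (μ j = μ i ∧ j ≤ i)).card

/-- `ζ_i(μ) = p^{μ_i} q^{2σ(i)-N-1}`. -/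
def zeta (q p : ℂ) {N : ℕ} (μ : Fin N → ℤ) (i : Fin N) : ℂ :=
  p ^ (μ i) * q ^ (2 * (pos μ i : ℤ) - N - 1)

/-- `Φ` is the non-symmetric Macdonald polynomial `Φ^μ`. -/
def IsMacdonald (q p : ℂ) {N : ℕ} (μ : Fin N → ℤ) (Φ : Laurent N) : Prop :=
  (∀ i, macY q p i Φ = zeta q p μ i • Φ) ∧ Φ.coeff μ = 1 ∧
    ∀ ν, ν ≠ μ → Φ.coeff ν ≠ 0 → MacLT ν μ

/-! ## Spins and the finite wedge product -/

/-- `(ℂⁿ)^{⊗N}`; the basis vector `v_ε` of `ℂⁿ`, `1 ≤ ε ≤ n`, has the index `ε - 1` in `Fin n`. -/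
abbrev Spin (n N : ℕ) : Type := ⨂[ℂ] _ : Fin N, (Fin n → ℂ)

/-- The matrix unit sending the basis vector of index `b` to the one of index `a`. -/
def eUnit {n : ℕ} (a b : Fin n) : Module.End ℂ (Fin n → ℂ) := Matrix.toLin' (Matrix.single a b 1)

/-- The tensor product of one operator for each factor. -/
def siteOp {n N : ℕ} (A : Fin N → Module.End ℂ (Fin n → ℂ)) : Module.End ℂ (Spin n N) :=
  PiTensorProduct.map A

/-- `A` in the factor `i`, `B` in the factor `j`, the identity elsewhere. -/
def twoSite {n N : ℕ} (i j : Fin N) (A B : Module.End ℂ (Fin n → ℂ)) : Module.End ℂ (Spin n N) :=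
  siteOp fun l => if l = i then A else if l = j then B else 1

/-- The Hecke operator `S` acting in the factors `i` and `j`. -/
def spinS (q : ℂ) {n N : ℕ} (i j : Fin N) : Module.End ℂ (Spin n N) :=
  -(q⁻¹ • ∑ a : Fin n, twoSite i j (eUnit a a) (eUnit a a)) +
    (q - q⁻¹) • (∑ a : Fin n, ∑ b ∈ Finset.univ.filter (fun b => a < b),
      twoSite i j (eUnit a a) (eUnit b b)) -
    ∑ a : Fin n, ∑ b ∈ Finset.univ.filter (fun b => a ≠ b),
      twoSite i j (eUnit a b) (eUnit b a)

/-- `v_e = v_{ε₁} ⊗ ⋯ ⊗ v_{ε_N}`. -/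
def spinVec {n N : ℕ} (e : Fin N → Fin n) : Spin n N :=
  PiTensorProduct.tprod ℂ fun i => Pi.single (e i) (1 : ℂ)

/-- `⊗^N V(z) = ℂ[z₁^{±1}, …, z_N^{±1}] ⊗ (ℂⁿ)^{⊗N}`. -/
abbrev Tens (n N : ℕ) : Type := Laurent N ⊗[ℂ] Spin n N

/-- An operator on Laurent polynomials, acting on `⊗^N V(z)`. -/
def polyOp {n N : ℕ} (A : Module.End ℂ (Laurent N)) : Module.End ℂ (Tens n N) :=
  LinearMap.rTensor (Spin n N) A

/-- An operator on spins, acting on `⊗^N V(z)`. -/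
def spinOp {n N : ℕ} (B : Module.End ℂ (Spin n N)) : Module.End ℂ (Tens n N) :=
  LinearMap.lTensor (Laurent N) B

/-- `Ω = ∑_i Ker (g_{i,i+1} + S_{i,i+1}⁻¹)`. -/
def omega (q : ℂ) (n N : ℕ) : Submodule ℂ (Tens n N) :=
  ⨆ (i : Fin N) (j : Fin N) (_ : (i : ℕ) + 1 = j),
    LinearMap.ker (polyOp (heckeG q i j) + spinOp (Ring.inverse (spinS q i j)) :
      Module.End ℂ (Tens n N))

/-- The `q`-wedge product `∧^N V(z)`. -/
abbrev Wedge (q : ℂ) (n N : ℕ) : Type := Tens n N ⧸ omega q n N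

/-- The quotient map `Λ`. -/
def wedgeMk (q : ℂ) (n N : ℕ) : Tens n N →ₗ[ℂ] Wedge q n N := (omega q n N).mkQ

/-- `z^{m₁} v_{ε₁} ∧ ⋯ ∧ z^{m_N} v_{ε_N}`. -/
def wedgeMon (q : ℂ) {n N : ℕ} (m : Fin N → ℤ) (e : Fin N → Fin n) : Wedge q n N :=
  wedgeMk q n N (mono m ⊗ₜ[ℂ] spinVec e)

/-! ## The algebra `U_q'(ŝl_n)` -/

/-- Generators `E_i, F_i, K_i, K_i⁻¹`, `i ∈ {0, …, n-1}`. -/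
inductive QGen (n : ℕ) : Type
  | E (i : Fin n) : QGen n
  | F (i : Fin n) : QGen n
  | K (i : Fin n) : QGen n
  | Kinv (i : Fin n) : QGen n

/-- The affine Cartan matrix of type `A_{n-1}^{(1)}` for `n ≥ 2` (indices are cyclic; for `n = 2`
the off-diagonal entries are `-2`). -/
def cartan {n : ℕ} [NeZero n] (i j : Fin n) : ℤ :=
  (if i = j then 2 else 0) - (if i = j + 1 then 1 else 0) - (if j = i + 1 then 1 else 0)

/-- `[m]_q = (q^m - q^{-m}) / (q - q⁻¹) = q^{m-1} + q^{m-3} + ⋯ + q^{1-m}`. -/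
def qInt (q : ℂ) (m : ℕ) : ℂ := ∑ j ∈ Finset.range m, q ^ ((m : ℤ) - 1 - 2 * j)

/-- `[m]_q [m-1]_q ⋯ [1]_q`. -/
def qFact (q : ℂ) (m : ℕ) : ℂ := ∏ j ∈ Finset.range m, qInt q (j + 1)

/-- The `q`-binomial coefficient (for `r ≤ m`). -/
def qBinom (q : ℂ) (m r : ℕ) : ℂ := qFact q m / (qFact q r * qFact q (m - r))

/-- The left-hand side of the Serre relation with exponent `1 - a_{ij} = b`. -/
def serre {A : Type} [Ring A] [Algebra ℂ A] (q : ℂ) (b : ℕ) (X Y : A) : A :=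
  ∑ r ∈ Finset.range (b + 1), ((-1) ^ r * qBinom q b r) • (X ^ r * Y * X ^ (b - r))

open FreeAlgebra in
/-- The defining relations of `U_q'(ŝl_n)`. For `q ≠ ±1` the relations `EF_ne` and `EF_eq` are
`[E_i, F_j] = δ_{ij} (K_i - K_i⁻¹) / (q - q⁻¹)`. -/
inductive UqRel (q : ℂ) (n : ℕ) [NeZero n] :
    FreeAlgebra ℂ (QGen n) → FreeAlgebra ℂ (QGen n) → Prop
  | K_Kinv (i : Fin n) : UqRel q n (ι ℂ (QGen.K i) * ι ℂ (QGen.Kinv i)) 1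
  | Kinv_K (i : Fin n) : UqRel q n (ι ℂ (QGen.Kinv i) * ι ℂ (QGen.K i)) 1
  | K_K (i j : Fin n) :
      UqRel q n (ι ℂ (QGen.K i) * ι ℂ (QGen.K j)) (ι ℂ (QGen.K j) * ι ℂ (QGen.K i))
  | K_E (i j : Fin n) :
      UqRel q n (ι ℂ (QGen.K i) * ι ℂ (QGen.E j) * ι ℂ (QGen.Kinv i))
        (q ^ cartan i j • ι ℂ (QGen.E j))
  | K_F (i j : Fin n) :
      UqRel q n (ι ℂ (QGen.K i) * ι ℂ (QGen.F j) * ι ℂ (QGen.Kinv i))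
        (q ^ (-cartan i j) • ι ℂ (QGen.F j))
  | EF_ne (i j : Fin n) (h : i ≠ j) :
      UqRel q n (ι ℂ (QGen.E i) * ι ℂ (QGen.F j)) (ι ℂ (QGen.F j) * ι ℂ (QGen.E i))
  | EF_eq (i : Fin n) :
      UqRel q n ((q - q⁻¹) • (ι ℂ (QGen.E i) * ι ℂ (QGen.F i) - ι ℂ (QGen.F i) * ι ℂ (QGen.E i)))
        (ι ℂ (QGen.K i) - ι ℂ (QGen.Kinv i))
  | serre_E (i j : Fin n) (h : i ≠ j) :
      UqRel q n (serre q (1 - cartan i j).toNat (ι ℂ (QGen.E i)) (ι ℂ (QGen.E j))) 0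
  | serre_F (i j : Fin n) (h : i ≠ j) :
      UqRel q n (serre q (1 - cartan i j).toNat (ι ℂ (QGen.F i)) (ι ℂ (QGen.F j))) 0
  | central : UqRel q n (List.ofFn fun i : Fin n => ι ℂ (QGen.K i)).prod 1

/-- The algebra `U_q'(ŝl_n)`. -/
abbrev Uq (q : ℂ) (n : ℕ) [NeZero n] : Type := RingQuot (UqRel q n)

/-- The generators of `U_q'(ŝl_n)`. -/
def Uq.gen (q : ℂ) {n : ℕ} [NeZero n] (x : QGen n) : Uq q n :=
  RingQuot.mkAlgHom ℂ (UqRel q n) (FreeAlgebra.ι ℂ x)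

/-! ## The level-0 action and the Hamiltonians on `⊗^N V(z)` and on `∧^N V(z)` -/

/-- The power `t` of `q^{E^{ε,ε} - E^{ε+1,ε+1}}`, upper indices modulo `n`. -/
def kSite (q : ℂ) {n : ℕ} [NeZero n] (t : ℤ) (ε : Fin n) : Module.End ℂ (Fin n → ℂ) :=
  Matrix.toLin' (Matrix.diagonal fun a : Fin n =>
    q ^ (t * ((if a = ε - 1 then 1 else 0) - (if a = ε then 1 else 0))))

/-- The operators by which the generators act on `⊗^N V(z)`, with `y_i = q^{1-N} Y_i`. The matrix
unit `E^{ε,ε+1}` (upper indices modulo `n`, in `{1, …, n}`) is `eUnit (ε - 1) ε`. -/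
def genTens (q p : ℂ) (n N : ℕ) [NeZero n] : QGen n → Module.End ℂ (Tens n N)
  | QGen.K ε => spinOp (siteOp fun _ => kSite q 1 ε)
  | QGen.Kinv ε => spinOp (siteOp fun _ => kSite q (-1) ε)
  | QGen.E ε => ∑ i : Fin N, (if ε = 0 then polyOp (Ring.inverse (yOp q p i)) else 1) *
      spinOp (siteOp fun j => if j < i then 1 else if j = i then eUnit (ε - 1) ε else kSite q 1 ε)
  | QGen.F ε => ∑ i : Fin N, (if ε = 0 then polyOp (yOp q p i) else 1) *
      spinOp (siteOp fun j => if j < i then kSite q (-1) ε else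
        if j = i then eUnit ε (ε - 1) else 1)

/-- `∑_i (q^{1-N} Y_i)^l` on `⊗^N V(z)`. -/
def hamTens (q p : ℂ) (n N : ℕ) (l : ℤ) : Module.End ℂ (Tens n N) :=
  polyOp (∑ i : Fin N, endZPow (yOp q p i) l)

/-- `φ` is the action `U_0^{(N)}` of `U_q'(ŝl_n)` on `∧^N V(z)`. -/
def IsLevelZeroAction (q p : ℂ) (n N : ℕ) [NeZero n]
    (φ : Uq q n →ₐ[ℂ] Module.End ℂ (Wedge q n N)) : Prop :=
  ∀ (x : QGen n) (f : Tens n N),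
    φ (Uq.gen q x) (wedgeMk q n N f) = wedgeMk q n N (genTens q p n N x f)

/-- The index set `ℤ_{≠0}`. -/
abbrev NZ : Type := {l : ℤ // l ≠ 0}

/-- `h` is the family of the Hamiltonians `h_l^{(N)}` on `∧^N V(z)`. -/
def IsHamiltonian (q p : ℂ) (n N : ℕ) (h : NZ → Module.End ℂ (Wedge q n N)) : Prop :=
  ∀ (l : NZ) (f : Tens n N), h l (wedgeMk q n N f) = wedgeMk q n N (hamTens q p n N l f)

/-! ## Normally ordered wedges, the spaces `V_M^{s+nr}` and their projective limit -/

/-- No value is taken more than `n` times. -/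
def NStrict (n : ℕ) {ι : Type} (m : ι → ℤ) : Prop := ∀ c : ℤ, {i | m i = c}.encard ≤ n

/-- `m ∈ 𝓜_N^n`. -/
def InM (n : ℕ) {N : ℕ} (m : Fin N → ℤ) : Prop := Monotone m ∧ NStrict n m

/-- `e ∈ 𝓔(m)`. -/
def InE {n N : ℕ} (m : Fin N → ℤ) (e : Fin N → Fin n) : Prop :=
  ∀ i j : Fin N, (i : ℕ) + 1 = j → m i = m j → e j < e i

/-- The vacuum sequence `m⁰ = (m⁰,…,m⁰ (s times), m⁰+1,…,m⁰+1 (n times), …)`, `m⁰ = (s - M) / n`;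
positions are counted from `0`. -/
def mVac (n : ℕ) (M : ℤ) (s : ℕ) (i : ℕ) : ℤ :=
  ((s : ℤ) - M) / n + if i < s then 0 else (((i - s) / n : ℕ) : ℤ) + 1

/-- `(m, e)` labels a normally ordered wedge in `V_M^{s+nr}`. -/
def VLabel {n : ℕ} (M : ℤ) (s r : ℕ) (m : Fin (s + n * r) → ℤ) (e : Fin (s + n * r) → Fin n) :
    Prop :=
  InM n m ∧ InE m e ∧ ∀ i : Fin (s + n * r), (i : ℕ) + 1 = s + n * r → m i ≤ mVac n M s i

/-- `V_M^{s+nr}`. -/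
def VM (q : ℂ) (n : ℕ) (M : ℤ) (s r : ℕ) : Submodule ℂ (Wedge q n (s + n * r)) :=
  Submodule.span ℂ {w | ∃ m e, VLabel M s r m e ∧ w = wedgeMon q m e}

/-- `V_M^{s+nr,k}`. -/
def VMdeg (q : ℂ) (n : ℕ) (M : ℤ) (s r k : ℕ) : Submodule ℂ (Wedge q n (s + n * r)) :=
  Submodule.span ℂ {w | ∃ m e, VLabel M s r m e ∧
    ∑ i : Fin (s + n * r), (mVac n M s i - m i) = k ∧ w = wedgeMon q m e}

theorem len_le (n s r : ℕ) : s + n * r ≤ s + n * (r + 1) := by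
  have := Nat.mul_le_mul_left n (Nat.le_add_right r 1)
  omega

open scoped Classical in
/-- `ρ` is the projection `ρ^M_{r+1,r} : V_M^{s+nr+n} → V_M^{s+nr}`: a normally ordered wedge whose
last `n` entries of `m` are the vacuum ones is truncated, all others are sent to `0`. -/
def IsProjection (q : ℂ) (n : ℕ) (M : ℤ) (s r : ℕ)
    (ρ : VM q n M s (r + 1) →ₗ[ℂ] VM q n M s r) : Prop :=
  ∀ (m : Fin (s + n * (r + 1)) → ℤ) (e : Fin (s + n * (r + 1)) → Fin n),
    VLabel M s (r + 1) m e → ∀ w : VM q n M s (r + 1), (w : Wedge q n _) = wedgeMon q m e →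
      (ρ w : Wedge q n (s + n * r)) =
        if ∀ i : Fin (s + n * (r + 1)), s + n * r ≤ (i : ℕ) → m i = mVac n M s i then
          wedgeMon q (m ∘ Fin.castLE (len_le n s r)) (e ∘ Fin.castLE (len_le n s r))
        else 0

/-- The projective limit `V_M^k` of the spaces `V_M^{s+nr,k}`, `r ≥ 0`. -/
def invLim (q : ℂ) (n : ℕ) (M : ℤ) (s : ℕ)
    (ρ : ∀ r, VM q n M s (r + 1) →ₗ[ℂ] VM q n M s r) (k : ℕ) :
    Submodule ℂ (∀ r, VM q n M s r) where
  carrier := {f | ∀ r, (f r : Wedge q n (s + n * r)) ∈ VMdeg q n M s r k ∧ ρ r (f (r + 1)) = f r}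
  add_mem' := fun ha hb r =>
    ⟨Submodule.add_mem _ (ha r).1 (hb r).1, by simp [(ha r).2, (hb r).2]⟩
  zero_mem' := fun _ => ⟨Submodule.zero_mem _, by simp⟩
  smul_mem' := fun c _ ha r => ⟨Submodule.smul_mem _ c (ha r).1, by simp [(ha r).2]⟩

/-- The eigenvalue `h_l^{(s+nr)}(m⁰)`. -/
def hVac (p q : ℂ) (n : ℕ) (M : ℤ) (s r : ℕ) (l : ℤ) : ℂ :=
  ∑ j ∈ Finset.range (s + n * r), p ^ (l * mVac n M s j) * q ^ (-2 * l * (j : ℤ))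

/-! ## Semi-infinite wedges -/

/-- Labels `(k₁, k₂, …)` of semi-infinite monomials: `k_i = M - i + 1` for all large `i`
(positions are counted from `0` below). -/
abbrev SIMon (M : ℤ) : Type := {k : ℕ → ℤ // ∃ L : ℕ, ∀ i, L ≤ i → k i = M - i}

/-- `(k₁, …, k_N) ↦ (k₁, …, k_N, M-N, M-N-1, …)`. -/
def appendVac (M : ℤ) {N : ℕ} (k : Fin N → ℤ) : SIMon M :=
  ⟨fun i => if h : i < N then k ⟨i, h⟩ else M - i, N, fun i hi => by simp [Nat.not_lt.mpr hi]⟩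

/-- The basis `z^m ⊗ v_e` of `⊗^N V(z)`. -/
def tensBasis (n N : ℕ) : Module.Basis ((Fin N → ℤ) × (Fin N → Fin n)) ℂ (Tens n N) :=
  (AddMonoidAlgebra.basis (Fin N → ℤ) ℂ).tensorProduct
    (Basis.piTensorProduct fun _ : Fin N => Pi.basisFun ℂ (Fin n))

theorem tensBasis_apply (n N : ℕ) (m : Fin N → ℤ) (e : Fin N → Fin n) :
    tensBasis n N (m, e) = mono m ⊗ₜ[ℂ] spinVec e := by
  simp [tensBasis, mono, spinVec, Module.Basis.tensorProduct_apply]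

/-- The index `k = ε - n m` of `u_k = z^m v_ε`. -/
def uIndex {n : ℕ} (m : ℤ) (a : Fin n) : ℤ := ((a : ℕ) : ℤ) + 1 - n * m

/-- `f ↦ f ⊗ u_{M-N} ⊗ u_{M-N-1} ⊗ ⋯`, with values in the space spanned freely by the semi-infinite
tensor monomials. -/
def tensVac (n : ℕ) (M : ℤ) (N : ℕ) : Tens n N →ₗ[ℂ] (SIMon M →₀ ℂ) :=
  (tensBasis n N).constr ℂ fun me =>
    Finsupp.single (appendVac M fun i => uIndex (me.1 i) (me.2 i)) 1

/-- The space `F_M` of semi-infinite wedges: the span of the semi-infinite monomials modulo the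
relations of the wedge products of finitely many of the first factors. -/
abbrev Fock (q : ℂ) (n : ℕ) (M : ℤ) : Type :=
  (SIMon M →₀ ℂ) ⧸ (⨆ N : ℕ, (omega q n N).map (tensVac n M N))

/-- The semi-infinite wedge `u_{k₁} ∧ u_{k₂} ∧ ⋯`. -/
def siWedge (q : ℂ) (n : ℕ) {M : ℤ} (k : SIMon M) : Fock q n M :=
  Submodule.Quotient.mk (Finsupp.single k 1)

/-- The map `∧^N V(z) → F_M`, `f ↦ f ∧ |M - N⟩`. -/
def wedgeVac (q : ℂ) (n : ℕ) (M : ℤ) (N : ℕ) : Wedge q n N →ₗ[ℂ] Fock q n M :=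
  Submodule.mapQ _ _ (tensVac n M N) (Submodule.map_le_iff_le_comap.mp
    (le_iSup (fun N : ℕ => (omega q n N).map (tensVac n M N)) N))

/-- The exponent `m` in `u_k = z^m v_ε`. -/
def mOf (n : ℕ) (k : ℤ) : ℤ := -((k - 1) / n)

theorem mOf_uIndex {n : ℕ} (m : ℤ) (a : Fin n) : mOf n (uIndex m a) = m := by
  have hn : (0 : ℤ) < n := by exact_mod_cast a.pos
  have e : uIndex m a - 1 = ((a : ℕ) : ℤ) + n * (-m) := by unfold uIndex; ring
  have ha : ((a : ℕ) : ℤ) / n = 0 := Int.ediv_eq_zero_of_lt (by positivity) (by exact_mod_cast a.2)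
  rw [mOf, e, Int.add_mul_ediv_left _ _ hn.ne', ha]; ring

/-- The degree `∑_{i ≥ 1} (m⁰_i - m_i)` of a semi-infinite monomial (a finite sum). -/
def siDegree (n : ℕ) {M : ℤ} (s : ℕ) (k : SIMon M) : ℤ :=
  ∑ᶠ i : ℕ, (mVac n M s i - mOf n (k.1 i))

/-- `F_M^t`: the span of the normally ordered semi-infinite wedges of degree `t`. -/
def fockDeg (q : ℂ) (n : ℕ) (M : ℤ) (s t : ℕ) : Submodule ℂ (Fock q n M) :=
  Submodule.span ℂ {w | ∃ k : SIMon M, StrictAnti k.1 ∧ siDegree n s k = t ∧ w = siWedge q n k}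

/-- `Θ` is the action `U_0` on `F_M` defined by `x.(f ∧ |M-s-nr⟩) = (x^{(s+nr)}.f) ∧ |M-s-nr⟩` for
`f ∈ V_M^{s+nr,k}`, `r ≥ k`. -/
def IsFockAction (q : ℂ) (n : ℕ) [NeZero n] (M : ℤ) (s : ℕ)
    (π : ∀ N, Uq q n →ₐ[ℂ] Module.End ℂ (Wedge q n N))
    (Θ : Uq q n →ₐ[ℂ] Module.End ℂ (Fock q n M)) : Prop :=
  ∀ (k r : ℕ), k ≤ r → ∀ f ∈ VMdeg q n M s r k, ∀ x : Uq q n,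
    Θ x (wedgeVac q n M (s + n * r) f) = wedgeVac q n M (s + n * r) (π (s + n * r) x f)

/-- The operator `g_l^{(s+nr)} = h_l^{(s+nr)} - h_l^{(s+nr)}(m⁰)`. -/
def gFin (q p : ℂ) (n : ℕ) (M : ℤ) (s : ℕ) (h : ∀ N, NZ → Module.End ℂ (Wedge q n N)) (r : ℕ)
    (l : NZ) : Module.End ℂ (Wedge q n (s + n * r)) :=
  h (s + n * r) l - hVac p q n M s r l • 1

/-- `G` is the family of operators `g_l` on `F_M` defined by
`g_l.(f ∧ |M-s-nr⟩) = (g_l^{(s+nr)}.f) ∧ |M-s-nr⟩` for `f ∈ V_M^{s+nr,k}`, `r ≥ k`. -/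
def IsFockHamiltonian (q p : ℂ) (n : ℕ) (M : ℤ) (s : ℕ)
    (h : ∀ N, NZ → Module.End ℂ (Wedge q n N)) (G : NZ → Module.End ℂ (Fock q n M)) : Prop :=
  ∀ (k r : ℕ), k ≤ r → ∀ f ∈ VMdeg q n M s r k, ∀ l : NZ,
    G l (wedgeVac q n M (s + n * r) f) = wedgeVac q n M (s + n * r) (gFin q p n M s h r l f)

/-! ## The spaces `E^m` and `𝓕_M^m` -/

/-- `E^m`: the span of the vectors `Λ(Φ^m ⊗ v_e)`, `e ∈ 𝓔(m)`. -/
def Emod (q p : ℂ) (n : ℕ) {N : ℕ} (m : Fin N → ℤ) : Submodule ℂ (Wedge q n N) :=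
  Submodule.span ℂ {w | ∃ (Φ : Laurent N) (e : Fin N → Fin n), IsMacdonald q p m Φ ∧ InE m e ∧
    w = wedgeMk q n N (Φ ⊗ₜ[ℂ] spinVec e)}

/-- `m ∈ 𝓜ⁿ[M]`. -/
def InMinf (n : ℕ) (M : ℤ) (s : ℕ) (m : ℕ → ℤ) : Prop :=
  Monotone m ∧ NStrict n m ∧ ∃ L : ℕ, ∀ i, L ≤ i → m i = mVac n M s i

/-- `‖m‖ = ∑_{i ≥ 1} (m⁰_i - m_i)`, a nonnegative integer for `m ∈ 𝓜ⁿ[M]`. -/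
def degInf (n : ℕ) (M : ℤ) (s : ℕ) (m : ℕ → ℤ) : ℕ := (∑ᶠ i : ℕ, (mVac n M s i - m i)).toNat

/-- The first `N` terms of a sequence. -/
def trunc (m : ℕ → ℤ) (N : ℕ) : Fin N → ℤ := fun i => m i

/-- `E^{m^{(s+n‖m‖)}}`. -/
def Ecut (q p : ℂ) (n : ℕ) (M : ℤ) (s : ℕ) (m : ℕ → ℤ) :
    Submodule ℂ (Wedge q n (s + n * degInf n M s m)) :=
  Emod q p n (trunc m (s + n * degInf n M s m))

/-- `𝓕_M^m = E^{m^{(s+n‖m‖)}} ∧ |M-s-n‖m‖⟩`. -/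
def fockComp (q p : ℂ) (n : ℕ) (M : ℤ) (s : ℕ) (m : ℕ → ℤ) : Submodule ℂ (Fock q n M) :=
  (Ecut q p n M s m).map (wedgeVac q n M (s + n * degInf n M s m))

end LevelZero

end

open LevelZero

noncomputable section

namespace LevelZero

/-! ### Permutations of the variables and the Hecke relations on Laurent polynomials -/

theorem basis_eq_mono {N : ℕ} (m : Fin N → ℤ) :
    AddMonoidAlgebra.basis (Fin N → ℤ) ℂ m = mono m := by
  rw [AddMonoidAlgebra.basis_apply]; rfl

theorem ext_mono {N : ℕ} {W : Type*} [AddCommMonoid W] [Module ℂ W] {A B : Laurent N →ₗ[ℂ] W}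
    (h : ∀ m, A (mono m) = B (mono m)) : A = B :=
  (AddMonoidAlgebra.basis (Fin N → ℤ) ℂ).ext fun m => by rw [basis_eq_mono]; exact h m

theorem mono_mul_mono {N : ℕ} (a b : Fin N → ℤ) : mono a * mono b = mono (a + b) := by
  simp [mono, AddMonoidAlgebra.single_mul_single]

theorem map_mul_of_mono {N : ℕ} {A : Module.End ℂ (Laurent N)}
    (h : ∀ a b, A (mono (a + b)) = A (mono a) * A (mono b)) (f g : Laurent N) :
    A (f * g) = A f * A g := by
  have key : (LinearMap.mul ℂ (Laurent N)).compr₂ A =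
      (LinearMap.mul ℂ (Laurent N)).compl₁₂ A A := by
    refine ext_mono fun a => ext_mono fun b => ?_
    simp [mono_mul_mono, h]
  simpa using congrArg (fun B => B f g) key

/-- The permutation `σ` of the variables. -/
def permOp {N : ℕ} (σ : Equiv.Perm (Fin N)) : Module.End ℂ (Laurent N) :=
  opOnMono fun m => mono (m ∘ σ.symm)

theorem permOp_mono {N : ℕ} (σ : Equiv.Perm (Fin N)) (m : Fin N → ℤ) :
    permOp σ (mono m) = mono (m ∘ σ.symm) := opOnMono_mono _ _

theorem swapVar_eq {N : ℕ} (i j : Fin N) : swapVar i j = permOp (Equiv.swap i j) := by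
  simp [swapVar, permOp]

theorem swapVar_mono {N : ℕ} (i j : Fin N) (m : Fin N → ℤ) :
    swapVar i j (mono m) = mono (m ∘ Equiv.swap i j) := opOnMono_mono _ _

theorem permOp_mul {N : ℕ} (σ τ : Equiv.Perm (Fin N)) :
    permOp (σ * τ) = permOp σ * permOp τ := by
  refine ext_mono fun m => ?_
  simp only [permOp_mono, Module.End.mul_apply]
  rfl

theorem permOp_one {N : ℕ} : permOp (1 : Equiv.Perm (Fin N)) = 1 := by
  refine ext_mono fun m => ?_
  simp only [permOp_mono, Module.End.one_apply]
  rfl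

theorem permOp_map_mul {N : ℕ} (σ : Equiv.Perm (Fin N)) (f g : Laurent N) :
    permOp σ (f * g) = permOp σ f * permOp σ g :=
  map_mul_of_mono (fun a b => by simp [permOp_mono, mono_mul_mono]; rfl) f g

/-- The variable `z_i`. -/
def zVar {N : ℕ} (i : Fin N) : Laurent N := mono (Pi.single i 1)

theorem permOp_zVar {N : ℕ} (σ : Equiv.Perm (Fin N)) (i : Fin N) :
    permOp σ (zVar i) = zVar (σ i) := by
  rw [zVar, permOp_mono, zVar]
  congr 1
  funext l
  simp [Pi.single_apply, Equiv.symm_apply_eq]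

theorem mono_injective {N : ℕ} : Function.Injective (mono : (Fin N → ℤ) → Laurent N) := by
  intro a b h
  rw [← basis_eq_mono, ← basis_eq_mono] at h
  exact (AddMonoidAlgebra.basis (Fin N → ℤ) ℂ).injective h

instance {N : ℕ} : IsDomain (Laurent N) := NoZeroDivisors.to_isDomain _

theorem zVar_sub_ne {N : ℕ} {i j : Fin N} (hij : i ≠ j) : (zVar i - zVar j : Laurent N) ≠ 0 := by
  intro h
  have := mono_injective (sub_eq_zero.1 h)
  have := congrFun this i
  simp [hij] at this

theorem zVar_sub_mul_heckeG (q : ℂ) {N : ℕ} {i j : Fin N} (hij : i ≠ j) (f : Laurent N) :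
    (zVar i - zVar j) * heckeG q i j f =
      (q⁻¹ • zVar i - q • zVar j) * (swapVar i j f - f) + q • ((zVar i - zVar j) * f) := by
  have h := congrArg (fun A => A f) (mulVar_sub_mul_divDiff hij)
  simp only [Module.End.mul_apply, LinearMap.sub_apply, mulVar, LinearMap.mulLeft_apply,
    Module.End.one_apply] at h
  simp only [heckeG, Module.End.mul_apply, LinearMap.sub_apply, LinearMap.add_apply, mulVar,
    LinearMap.mulLeft_apply, LinearMap.smul_apply, Module.End.one_apply]
  have h' : (zVar i - zVar j) * divDiff i j f = swapVar i j f - f := by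
    rw [sub_mul]; exact h
  rw [← h']
  change (zVar i - zVar j) * (q⁻¹ • (zVar i * _) - q • (zVar j * _) + q • f) = _
  simp only [Algebra.smul_def]
  ring

theorem heckeG_unique {q : ℂ} {N : ℕ} {i j : Fin N} (hij : i ≠ j) {f x : Laurent N}
    (h : (zVar i - zVar j) * x =
      (q⁻¹ • zVar i - q • zVar j) * (swapVar i j f - f) + q • ((zVar i - zVar j) * f)) :
    x = heckeG q i j f :=
  mul_left_cancel₀ (zVar_sub_ne hij) (h.trans (zVar_sub_mul_heckeG q hij f).symm)

theorem permOp_mul_swapVar {N : ℕ} (σ : Equiv.Perm (Fin N)) (i j : Fin N) :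
    permOp σ * swapVar i j = swapVar (σ i) (σ j) * permOp σ := by
  rw [swapVar_eq, swapVar_eq, ← permOp_mul, ← permOp_mul]
  congr 1
  exact Equiv.mul_swap_eq_swap_mul σ i j

theorem permOp_heckeG (q : ℂ) {N : ℕ} {i j : Fin N} (hij : i ≠ j) (σ : Equiv.Perm (Fin N)) :
    permOp σ * heckeG q i j = heckeG q (σ i) (σ j) * permOp σ := by
  refine LinearMap.ext fun f => ?_
  simp only [Module.End.mul_apply]
  refine heckeG_unique (fun h => hij (σ.injective h)) ?_
  have h := congrArg (permOp σ) (zVar_sub_mul_heckeG q hij f)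
  have hs := congrArg (fun A => A f) (permOp_mul_swapVar σ i j)
  simp only [Module.End.mul_apply] at hs
  simpa only [permOp_map_mul, map_add, map_sub, map_smul, permOp_zVar, hs] using h

theorem swapVar_heckeG (q : ℂ) {N : ℕ} {k l : Fin N} (hkl : k ≠ l) (i j : Fin N) :
    swapVar i j * heckeG q k l =
      heckeG q (Equiv.swap i j k) (Equiv.swap i j l) * swapVar i j := by
  rw [swapVar_eq]; exact permOp_heckeG q hkl _

theorem swapVar_mul_self {N : ℕ} (i j : Fin N) : swapVar i j * swapVar i j = 1 := by
  rw [swapVar_eq, ← permOp_mul, Equiv.swap_mul_self, permOp_one]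

theorem swapVar_comm {N : ℕ} (i j : Fin N) : (swapVar i j : Module.End ℂ (Laurent N)) =
    swapVar j i := by
  rw [swapVar_eq, swapVar_eq, Equiv.swap_comm]

/-- The embedding of the Laurent polynomials into the rational functions. -/
abbrev toFrac {N : ℕ} : Laurent N →+* FractionRing (Laurent N) := algebraMap _ _

/-- The constants as rational functions. -/
def cst (N : ℕ) : ℂ →+* FractionRing (Laurent N) := toFrac.comp (algebraMap ℂ (Laurent N))

theorem toFrac_injective {N : ℕ} : Function.Injective (toFrac : Laurent N →+* _) :=
  IsFractionRing.injective _ _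

theorem toFrac_smul {N : ℕ} (c : ℂ) (f : Laurent N) : toFrac (c • f) = cst N c * toFrac f := by
  rw [Algebra.smul_def, map_mul]; rfl

theorem toFrac_sub_ne {N : ℕ} {i j : Fin N} (hij : i ≠ j) :
    (toFrac (zVar i) - toFrac (zVar j) : FractionRing (Laurent N)) ≠ 0 := by
  rw [← map_sub]
  exact (map_ne_zero_iff _ toFrac_injective).2 (zVar_sub_ne hij)

theorem toFrac_heckeG (q : ℂ) {N : ℕ} {i j : Fin N} (hij : i ≠ j) (f : Laurent N) :
    toFrac (heckeG q i j f) =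
      (((cst N q)⁻¹ * toFrac (zVar i) - cst N q * toFrac (zVar j)) /
        (toFrac (zVar i) - toFrac (zVar j))) * (toFrac (swapVar i j f) - toFrac f) +
        cst N q * toFrac f := by
  have h := congrArg toFrac (zVar_sub_mul_heckeG q hij f)
  simp only [map_mul, map_sub, map_add, toFrac_smul, map_inv₀] at h
  have h0 := toFrac_sub_ne hij
  rw [div_mul_eq_mul_div, div_add' _ _ _ h0, eq_div_iff h0]
  linear_combination h

theorem cst_ne_zero {N : ℕ} {q : ℂ} (hq : q ≠ 0) : cst N q ≠ 0 := (map_ne_zero _).2 hq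

theorem heckeG_sq {q : ℂ} (hq : q ≠ 0) {N : ℕ} {i j : Fin N} (hij : i ≠ j) :
    heckeG q i j * heckeG q i j = (q - q⁻¹) • heckeG q i j + 1 := by
  refine LinearMap.ext fun f => toFrac_injective ?_
  have hK := congrArg (fun A => A f) (swapVar_heckeG q hij i j)
  have hKK := congrArg (fun A => A f) (swapVar_mul_self i j)
  simp only [Module.End.mul_apply, Equiv.swap_apply_left, Equiv.swap_apply_right,
    Module.End.one_apply] at hK hKK
  simp only [Module.End.mul_apply, LinearMap.add_apply, LinearMap.smul_apply, map_add,
    Module.End.one_apply, toFrac_smul, toFrac_heckeG q hij, hK, toFrac_heckeG q hij.symm,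
    swapVar_comm j i, hKK, map_sub, map_inv₀]
  generalize toFrac (swapVar i j f) = a
  generalize toFrac f = b
  have h0 := toFrac_sub_ne hij
  have h1 := toFrac_sub_ne hij.symm
  have hc := cst_ne_zero (N := N) hq
  generalize toFrac (zVar i) = x at *
  generalize toFrac (zVar j) = y at *
  generalize cst N q = t at *
  field_simp
  ring

theorem heckeG_comm (q : ℂ) {N : ℕ} {i j k l : Fin N} (hij : i ≠ j) (hkl : k ≠ l)
    (hik : i ≠ k) (hil : i ≠ l) (hjk : j ≠ k) (hjl : j ≠ l) :
    Commute (heckeG q i j) (heckeG q k l) := by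
  refine LinearMap.ext fun f => toFrac_injective ?_
  have hK := congrArg (fun A => A f) (swapVar_heckeG q hkl i j)
  have hK' := congrArg (fun A => A f) (swapVar_heckeG q hij k l)
  have hKK := congrArg (fun A => A f) (permOp_mul_swapVar (Equiv.swap i j) k l)
  rw [← swapVar_eq] at hKK
  simp only [Module.End.mul_apply, Equiv.swap_apply_of_ne_of_ne hik.symm hjk.symm,
    Equiv.swap_apply_of_ne_of_ne hil.symm hjl.symm, Equiv.swap_apply_of_ne_of_ne hik hil,
    Equiv.swap_apply_of_ne_of_ne hjk hjl] at hK hK' hKK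
  simp only [Module.End.mul_apply, toFrac_heckeG q hij, hK, hK', toFrac_heckeG q hkl, hKK]
  ring

theorem heckeG_braid {q : ℂ} (hq : q ≠ 0) {N : ℕ} {i j k : Fin N} (hij : i ≠ j) (hjk : j ≠ k)
    (hik : i ≠ k) :
    heckeG q i j * heckeG q j k * heckeG q i j = heckeG q j k * heckeG q i j * heckeG q j k := by
  have e1 : ∀ x : Laurent N, swapVar i j (heckeG q i j x) = heckeG q j i (swapVar i j x) := by
    intro x
    simpa using congrArg (fun A => A x) (swapVar_heckeG q hij i j)
  have e2 : ∀ x : Laurent N, swapVar i j (heckeG q j k x) = heckeG q i k (swapVar i j x) := by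
    intro x
    simpa [Equiv.swap_apply_of_ne_of_ne hik.symm hjk.symm] using
      congrArg (fun A => A x) (swapVar_heckeG q hjk i j)
  have e3 : ∀ x : Laurent N, swapVar j k (heckeG q j k x) = heckeG q k j (swapVar j k x) := by
    intro x
    simpa using congrArg (fun A => A x) (swapVar_heckeG q hjk j k)
  have e4 : ∀ x : Laurent N, swapVar j k (heckeG q i j x) = heckeG q i k (swapVar j k x) := by
    intro x
    simpa [Equiv.swap_apply_of_ne_of_ne hij hik] using
      congrArg (fun A => A x) (swapVar_heckeG q hij j k)
  have e5 : ∀ x : Laurent N, swapVar i k x = swapVar i j (swapVar j k (swapVar i j x)) := by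
    intro x
    have := congrArg (fun A => A (swapVar i j x)) (permOp_mul_swapVar (Equiv.swap i j) j k)
    rw [← swapVar_eq] at this
    simp only [Module.End.mul_apply, Equiv.swap_apply_right,
      Equiv.swap_apply_of_ne_of_ne hik.symm hjk.symm] at this
    rw [this, ← Module.End.mul_apply (swapVar i j) (swapVar i j), swapVar_mul_self,
      Module.End.one_apply]
  have e6 : ∀ x : Laurent N, swapVar i j (swapVar i j x) = x := fun x => by
    rw [← Module.End.mul_apply, swapVar_mul_self, Module.End.one_apply]
  have e7 : ∀ x : Laurent N, swapVar j k (swapVar j k x) = x := fun x => by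
    rw [← Module.End.mul_apply, swapVar_mul_self, Module.End.one_apply]
  have e8 : ∀ x : Laurent N, swapVar j k (swapVar i j (swapVar j k x)) =
      swapVar i j (swapVar j k (swapVar i j x)) := by
    intro x
    rw [← e5]
    have := congrArg (fun A => A (swapVar j k x)) (permOp_mul_swapVar (Equiv.swap j k) i j)
    rw [← swapVar_eq] at this
    simp only [Module.End.mul_apply, Equiv.swap_apply_left,
      Equiv.swap_apply_of_ne_of_ne hij hik] at this
    rw [this, e7]
  refine LinearMap.ext fun f => toFrac_injective ?_
  have g1 := toFrac_heckeG q hij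
  have g2 := toFrac_heckeG q hjk
  have g3 := toFrac_heckeG q hik
  have g4 := toFrac_heckeG q hij.symm
  have g5 := toFrac_heckeG q hjk.symm
  have g10 : ∀ x : Laurent N, swapVar i k (heckeG q j i x) = heckeG q j k (swapVar i k x) := by
    intro x
    simpa [Equiv.swap_apply_of_ne_of_ne hij.symm hjk] using
      congrArg (fun A => A x) (swapVar_heckeG q hij.symm i k)
  have g11 : ∀ x : Laurent N, swapVar i k (heckeG q k j x) = heckeG q i j (swapVar i k x) := by
    intro x
    simpa [Equiv.swap_apply_of_ne_of_ne hij.symm hjk] using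
      congrArg (fun A => A x) (swapVar_heckeG q hjk.symm i k)
  simp only [Module.End.mul_apply, g1, g2, g3, g4, g5, e1, e2, e3, e4, g10, g11,
    swapVar_comm j i, swapVar_comm k j]
  simp only [e5, e6, e7, e8]
  have h1 := toFrac_sub_ne hij
  have h2 := toFrac_sub_ne hjk
  have h3 := toFrac_sub_ne hik
  have h4 := toFrac_sub_ne hij.symm
  have h5 := toFrac_sub_ne hjk.symm
  have hc := cst_ne_zero (N := N) hq
  clear g1 g2 g3 g4 g5 e1 e2 e3 e4 e5 e6 e7 e8 g10 g11
  generalize toFrac (swapVar i j (swapVar j k (swapVar i j f))) = f1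
  generalize toFrac (swapVar i j (swapVar j k f)) = f2
  generalize toFrac (swapVar j k (swapVar i j f)) = f3
  generalize toFrac (swapVar i j f) = f4
  generalize toFrac (swapVar j k f) = f5
  generalize toFrac f = f6
  generalize toFrac (zVar i) = x at *
  generalize toFrac (zVar j) = y at *
  generalize toFrac (zVar k) = z at *
  generalize cst N q = t at *
  have r1 : (t⁻¹ * y - t * x) / (y - x) = t + t⁻¹ - (t⁻¹ * x - t * y) / (x - y) := by
    field_simp; ring
  have r2 : (t⁻¹ * z - t * y) / (z - y) = t + t⁻¹ - (t⁻¹ * y - t * z) / (y - z) := by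
    field_simp; ring
  rw [r1, r2]
  have r3 : (t⁻¹ * x - t * y) / (x - y) * ((t⁻¹ * y - t * z) / (y - z)) =
    (t⁻¹ * x - t * z) / (x - z) * ((t⁻¹ * x - t * y) / (x - y) + (t⁻¹ * y - t * z) / (y - z)
      - (t + t⁻¹)) + 1 := by
    field_simp; ring
  have r4 : t * t⁻¹ = 1 := mul_inv_cancel₀ hc
  generalize (t⁻¹ * x - t * y) / (x - y) = a at *
  generalize (t⁻¹ * y - t * z) / (y - z) = b at *
  generalize (t⁻¹ * x - t * z) / (x - z) = c at *
  generalize t⁻¹ = u at *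
  clear h1 h2 h3 h4 h5 hc r1 r2
  grind

/-! ### Inverses, shifts, and the commuting family `Y_i` -/

/-- The inverse of `heckeG`. -/
def heckeGInv (q : ℂ) {N : ℕ} (i j : Fin N) : Module.End ℂ (Laurent N) :=
  heckeG q i j - (q - q⁻¹) • 1

theorem heckeG_mul_inv {q : ℂ} (hq : q ≠ 0) {N : ℕ} {i j : Fin N} (hij : i ≠ j) :
    heckeG q i j * heckeGInv q i j = 1 := by
  rw [heckeGInv, mul_sub, heckeG_sq hq hij]; simp

theorem heckeGInv_mul {q : ℂ} (hq : q ≠ 0) {N : ℕ} {i j : Fin N} (hij : i ≠ j) :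
    heckeGInv q i j * heckeG q i j = 1 := by
  rw [heckeGInv, sub_mul, heckeG_sq hq hij]; simp

theorem isUnit_of_inv {R : Type*} [Monoid R] {a b : R} (h : a * b = 1) (h' : b * a = 1) :
    IsUnit a := ⟨⟨a, b, h, h'⟩, rfl⟩

theorem ringInverse_eq {R : Type*} [MonoidWithZero R] {a b : R} (h : a * b = 1)
    (h' : b * a = 1) : Ring.inverse a = b :=
  Ring.inverse_unit (⟨a, b, h, h'⟩ : Rˣ)

theorem SemiconjBy.ringInverse_right {R : Type*} [MonoidWithZero R] {k a b : R}
    (h : SemiconjBy k a b) (ha : IsUnit a) (hb : IsUnit b) :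
    SemiconjBy k (Ring.inverse a) (Ring.inverse b) := by
  obtain ⟨a, rfl⟩ := ha
  obtain ⟨b, rfl⟩ := hb
  rw [Ring.inverse_unit, Ring.inverse_unit]
  exact h.units_inv_right

theorem Commute.ringInverse_right' {R : Type*} [MonoidWithZero R] {k a : R}
    (h : Commute k a) : Commute k (Ring.inverse a) := by
  by_cases ha : IsUnit a
  · exact SemiconjBy.ringInverse_right h ha ha
  · rw [Ring.inverse_non_unit _ ha]; exact Commute.zero_right _

/-- The inverse of `xi`. -/
def xiInv (q : ℂ) {N : ℕ} (i j : Fin N) : Module.End ℂ (Laurent N) :=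
  heckeGInv q i j * swapVar i j

theorem xi_mul_inv {q : ℂ} (hq : q ≠ 0) {N : ℕ} {i j : Fin N} (hij : i ≠ j) :
    xi q i j * xiInv q i j = 1 := by
  rw [xi, xiInv, mul_assoc, ← mul_assoc (heckeG q i j), heckeG_mul_inv hq hij, one_mul,
    swapVar_mul_self]

theorem xiInv_mul {q : ℂ} (hq : q ≠ 0) {N : ℕ} {i j : Fin N} (hij : i ≠ j) :
    xiInv q i j * xi q i j = 1 := by
  rw [xi, xiInv, mul_assoc, ← mul_assoc (swapVar i j), swapVar_mul_self, one_mul,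
    heckeGInv_mul hq hij]

theorem isUnit_xi {q : ℂ} (hq : q ≠ 0) {N : ℕ} {i j : Fin N} (hij : i ≠ j) :
    IsUnit (xi q i j) := isUnit_of_inv (xi_mul_inv hq hij) (xiInv_mul hq hij)

theorem inverse_xi {q : ℂ} (hq : q ≠ 0) {N : ℕ} {i j : Fin N} (hij : i ≠ j) :
    Ring.inverse (xi q i j) = xiInv q i j := ringInverse_eq (xi_mul_inv hq hij) (xiInv_mul hq hij)

theorem isUnit_heckeG {q : ℂ} (hq : q ≠ 0) {N : ℕ} {i j : Fin N} (hij : i ≠ j) :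
    IsUnit (heckeG q i j) := isUnit_of_inv (heckeG_mul_inv hq hij) (heckeGInv_mul hq hij)

theorem pShift_mono (p : ℂ) {N : ℕ} (i : Fin N) (m : Fin N → ℤ) :
    pShift p i (mono m) = p ^ (m i) • mono m := opOnMono_mono _ _

theorem pShift_mul_inv {p : ℂ} (hp : p ≠ 0) {N : ℕ} (i : Fin N) :
    pShift p i * pShift p⁻¹ i = 1 := by
  refine ext_mono fun m => ?_
  simp [pShift_mono, smul_smul, inv_mul_cancel₀ (zpow_ne_zero (m i) hp)]

theorem pShift_inv_mul {p : ℂ} (hp : p ≠ 0) {N : ℕ} (i : Fin N) :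
    pShift p⁻¹ i * pShift p i = 1 := by
  simpa using pShift_mul_inv (inv_ne_zero hp) i

theorem isUnit_pShift {p : ℂ} (hp : p ≠ 0) {N : ℕ} (i : Fin N) : IsUnit (pShift p i) :=
  isUnit_of_inv (pShift_mul_inv hp i) (pShift_inv_mul hp i)

theorem pShift_map_mul {p : ℂ} (hp : p ≠ 0) {N : ℕ} (i : Fin N) (f g : Laurent N) :
    pShift p i (f * g) = pShift p i f * pShift p i g :=
  map_mul_of_mono (fun a b => by
    simp only [pShift_mono, mono_mul_mono, Pi.add_apply, zpow_add₀ hp, smul_mul_smul_comm]) f g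

theorem swapVar_pShift (p : ℂ) {N : ℕ} (i j k : Fin N) :
    SemiconjBy (swapVar i j) (pShift p k) (pShift p (Equiv.swap i j k)) := by
  refine ext_mono fun m => ?_
  simp [pShift_mono, swapVar_mono]

theorem pShift_comm (p : ℂ) {N : ℕ} (i j : Fin N) : Commute (pShift p i) (pShift p j) := by
  refine ext_mono fun m => ?_
  simp [pShift_mono, smul_smul, mul_comm]

theorem pShift_zVar_of_ne (p : ℂ) {N : ℕ} {i j : Fin N} (h : i ≠ j) :
    pShift p i (zVar j) = zVar j := by
  simp [zVar, pShift_mono, h]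

theorem pShift_zVar_self (p : ℂ) {N : ℕ} (i : Fin N) : pShift p i (zVar i) = p • zVar i := by
  simp [zVar, pShift_mono]

theorem pShift_heckeG_comm {p : ℂ} (hp : p ≠ 0) (q : ℂ) {N : ℕ} {i j k : Fin N} (hij : i ≠ j)
    (hki : k ≠ i) (hkj : k ≠ j) : Commute (heckeG q i j) (pShift p k) := by
  refine LinearMap.ext fun f => ?_
  change heckeG q i j (pShift p k f) = pShift p k (heckeG q i j f)
  refine (heckeG_unique hij ?_).symm
  have h := congrArg (pShift p k) (zVar_sub_mul_heckeG q hij f)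
  have hK := congrArg (fun A => A f) (swapVar_pShift p i j k)
  simp only [Equiv.swap_apply_of_ne_of_ne hki hkj, Module.End.mul_apply] at hK
  simpa only [pShift_map_mul hp, map_add, map_sub, map_smul, pShift_zVar_of_ne p hki,
    pShift_zVar_of_ne p hkj, ← hK, Module.End.mul_apply] using h

theorem pShift_pair_heckeG_comm {p : ℂ} (hp : p ≠ 0) (q : ℂ) {N : ℕ} {i j : Fin N} (hij : i ≠ j) :
    Commute (heckeG q i j) (pShift p j * pShift p i) := by
  refine LinearMap.ext fun f => ?_
  change heckeG q i j (pShift p j (pShift p i f)) = pShift p j (pShift p i (heckeG q i j f))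
  refine (heckeG_unique hij ?_).symm
  have h := congrArg (fun x => pShift p j (pShift p i x)) (zVar_sub_mul_heckeG q hij f)
  have hK := congrArg (fun A => A f)
    ((swapVar_pShift p i j j).mul_right (swapVar_pShift p i j i))
  simp only [Equiv.swap_apply_left, Equiv.swap_apply_right,
    (pShift_comm p i j).eq, Module.End.mul_apply] at hK
  simp only [pShift_map_mul hp, map_add, map_sub, map_smul, pShift_zVar_of_ne p hij,
    pShift_zVar_of_ne p hij.symm, pShift_zVar_self, ← hK] at h
  rw [← smul_sub, smul_comm q⁻¹, smul_comm q, ← smul_sub, smul_mul_assoc, smul_mul_assoc,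
    smul_mul_assoc, smul_comm q, ← smul_add] at h
  exact smul_right_injective _ hp h

theorem swapVar_xi (q : ℂ) {N : ℕ} {k l : Fin N} (hkl : k ≠ l) (i j : Fin N) :
    SemiconjBy (swapVar i j) (xi q k l) (xi q (Equiv.swap i j k) (Equiv.swap i j l)) := by
  refine SemiconjBy.mul_right ?_ (swapVar_heckeG q hkl i j)
  have := permOp_mul_swapVar (Equiv.swap i j) k l
  rwa [← swapVar_eq] at this

theorem heckeG_swapVar_comm (q : ℂ) {N : ℕ} {i j k l : Fin N} (hij : i ≠ j)
    (hik : i ≠ k) (hil : i ≠ l) (hjk : j ≠ k) (hjl : j ≠ l) :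
    Commute (heckeG q i j) (swapVar k l) := by
  have := swapVar_heckeG q hij k l
  rw [Equiv.swap_apply_of_ne_of_ne hik hil, Equiv.swap_apply_of_ne_of_ne hjk hjl] at this
  exact this.symm

theorem heckeG_xi_comm (q : ℂ) {N : ℕ} {i j k l : Fin N} (hij : i ≠ j) (hkl : k ≠ l)
    (hik : i ≠ k) (hil : i ≠ l) (hjk : j ≠ k) (hjl : j ≠ l) :
    Commute (heckeG q i j) (xi q k l) :=
  (heckeG_swapVar_comm q hij hik hil hjk hjl).mul_right (heckeG_comm q hij hkl hik hil hjk hjl)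

theorem xi_comm (q : ℂ) {N : ℕ} {i j k l : Fin N} (hij : i ≠ j) (hkl : k ≠ l)
    (hik : i ≠ k) (hil : i ≠ l) (hjk : j ≠ k) (hjl : j ≠ l) :
    Commute (xi q i j) (xi q k l) := by
  refine Commute.mul_left ?_ (heckeG_xi_comm q hij hkl hik hil hjk hjl)
  have := swapVar_xi q hkl i j
  rwa [Equiv.swap_apply_of_ne_of_ne hik.symm hjk.symm,
    Equiv.swap_apply_of_ne_of_ne hil.symm hjl.symm] at this

theorem heckeG_xi_mul_xi {q : ℂ} (hq : q ≠ 0) {N : ℕ} {i j k : Fin N} (hij : i ≠ j) (hjk : j ≠ k)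
    (hik : i ≠ k) : Commute (heckeG q i j) (xi q i k * xi q j k) := by
  have h1 : heckeG q i k * swapVar j k = swapVar j k * heckeG q i j := by
    have := swapVar_heckeG q hij j k
    rw [Equiv.swap_apply_of_ne_of_ne hij hik, Equiv.swap_apply_left] at this
    exact this.symm
  have h2 : heckeG q i j * swapVar i k = swapVar i k * heckeG q k j := by
    have := swapVar_heckeG q hjk.symm i k
    rw [Equiv.swap_apply_of_ne_of_ne hij.symm hjk, Equiv.swap_apply_right] at this
    exact this.symm
  have h3 : heckeG q k j * swapVar j k = swapVar j k * heckeG q j k := by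
    have := swapVar_heckeG q hjk j k
    rw [Equiv.swap_apply_right, Equiv.swap_apply_left] at this
    exact this.symm
  have h4 : xi q i k * xi q j k = swapVar i k * swapVar j k * (heckeG q i j * heckeG q j k) := by
    simp only [xi, mul_assoc]
    rw [← mul_assoc (heckeG q i k), h1]; simp only [mul_assoc]
  have h5 : SemiconjBy (heckeG q i j) (swapVar i k * swapVar j k * (heckeG q i j * heckeG q j k))
      (swapVar i k * swapVar j k * (heckeG q i j * heckeG q j k)) := by
    change _ * _ = _ * _
    simp only [← mul_assoc]
    rw [h2, mul_assoc (swapVar i k) _ (swapVar j k), h3]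
    have := heckeG_braid hq hij hjk hik
    simp only [mul_assoc] at this ⊢
    rw [← this]
  rw [h4]; exact h5

theorem heckeG_xi_mul_xi' {q : ℂ} (hq : q ≠ 0) {N : ℕ} {i j k : Fin N} (hij : i ≠ j) (hjk : j ≠ k)
    (hik : i ≠ k) : Commute (heckeG q i j) (xi q k j * xi q k i) := by
  have h1 : heckeG q k j * swapVar k i = swapVar k i * heckeG q i j := by
    have := swapVar_heckeG q hij k i
    rw [Equiv.swap_apply_of_ne_of_ne hjk hij.symm, Equiv.swap_apply_right] at this
    exact this.symm
  have h2 : heckeG q i j * swapVar k j = swapVar k j * heckeG q i k := by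
    have := swapVar_heckeG q hik k j
    rw [Equiv.swap_apply_of_ne_of_ne hik hij, Equiv.swap_apply_left] at this
    exact this.symm
  have h3 : heckeG q i k * swapVar k i = swapVar k i * heckeG q k i := by
    have := swapVar_heckeG q hik.symm k i
    rw [Equiv.swap_apply_right, Equiv.swap_apply_left] at this
    exact this.symm
  have h4 : xi q k j * xi q k i = swapVar k j * swapVar k i * (heckeG q i j * heckeG q k i) := by
    simp only [xi, mul_assoc]
    rw [← mul_assoc (heckeG q k j), h1]; simp only [mul_assoc]
  have h5 : SemiconjBy (heckeG q i j) (swapVar k j * swapVar k i * (heckeG q i j * heckeG q k i))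
      (swapVar k j * swapVar k i * (heckeG q i j * heckeG q k i)) := by
    change _ * _ = _ * _
    simp only [← mul_assoc]
    rw [h2, mul_assoc (swapVar k j) _ (swapVar k i), h3]
    have := heckeG_braid hq hik.symm hij hjk.symm
    simp only [mul_assoc] at this ⊢
    rw [← this]
  rw [h4]; exact h5

theorem semiconjBy_list_prod {R ι : Type*} [Monoid R] {k : R} (l : List ι) {f f' : ι → R}
    (h : ∀ x ∈ l, SemiconjBy k (f x) (f' x)) : SemiconjBy k (l.map f).prod (l.map f').prod := by
  induction l with
  | nil => simp
  | cons a l ih =>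
    simp only [List.map_cons, List.prod_cons]
    exact (h a (by simp)).mul_right (ih fun x hx => h x (by simp [hx]))

theorem filter_finRange_eq {N : ℕ} {P : Fin N → Bool} {l : List (Fin N)}
    (hl : l.Pairwise (· < ·)) (h : ∀ a, a ∈ l ↔ P a) : (List.finRange N).filter P = l :=
  List.Pairwise.eq_of_mem_iff ((List.pairwise_lt_finRange N).filter P) hl (by simp [h])

theorem up_eq {N : ℕ} {i j : Fin N} (hij : (i : ℕ) + 1 = j) :
    (List.finRange N).filter (fun l => i < l) = j :: (List.finRange N).filter (fun l => j < l) := by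
  refine filter_finRange_eq ?_ fun a => ?_
  · refine List.pairwise_cons.2 ⟨fun a ha => by simpa using ha, ?_⟩
    exact (List.pairwise_lt_finRange N).filter _
  · simp only [List.mem_cons, List.mem_filter, List.mem_finRange, true_and, decide_eq_true_eq,
      Fin.ext_iff, Fin.lt_def]
    omega

theorem down_eq {N : ℕ} {i j : Fin N} (hij : (i : ℕ) + 1 = j) :
    (List.finRange N).filter (fun l => l < j) = (List.finRange N).filter (fun l => l < i) ++ [i] := by
  refine filter_finRange_eq ?_ fun a => ?_
  · refine List.pairwise_append.2 ⟨(List.pairwise_lt_finRange N).filter _, by simp, ?_⟩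
    simp
  · simp only [List.mem_append, List.mem_singleton, List.mem_filter, List.mem_finRange, true_and,
      decide_eq_true_eq, Fin.ext_iff, Fin.lt_def]
    omega

theorem down_split {N : ℕ} {i j k : Fin N} (hij : (i : ℕ) + 1 = j) (hk : j < k) :
    (List.finRange N).filter (fun l => l < k) = (List.finRange N).filter (fun l => l < i) ++
      (i :: j :: (List.finRange N).filter (fun l => j < l ∧ l < k)) := by
  refine filter_finRange_eq ?_ fun a => ?_
  · refine List.pairwise_append.2 ⟨(List.pairwise_lt_finRange N).filter _, ?_, ?_⟩
    · refine List.pairwise_cons.2 ⟨fun a ha => ?_, List.pairwise_cons.2 ⟨fun a ha => ?_,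
        (List.pairwise_lt_finRange N).filter _⟩⟩
      · simp at ha; omega
      · simp at ha; omega
    · intro a ha b hb
      simp at ha hb; omega
  · simp only [List.mem_append, List.mem_cons, List.mem_filter, List.mem_finRange, true_and,
      decide_eq_true_eq, Fin.ext_iff, Fin.lt_def] at hk ⊢
    omega

theorem up_split {N : ℕ} {i j k : Fin N} (hij : (i : ℕ) + 1 = j) (hk : k < i) :
    (List.finRange N).filter (fun l => k < l) = (List.finRange N).filter (fun l => k < l ∧ l < i) ++
      (i :: j :: (List.finRange N).filter (fun l => j < l)) := by
  refine filter_finRange_eq ?_ fun a => ?_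
  · refine List.pairwise_append.2 ⟨(List.pairwise_lt_finRange N).filter _, ?_, ?_⟩
    · refine List.pairwise_cons.2 ⟨fun a ha => ?_, List.pairwise_cons.2 ⟨fun a ha => ?_,
        (List.pairwise_lt_finRange N).filter _⟩⟩
      · simp at ha; omega
      · simp at ha; omega
    · intro a ha b hb
      simp at ha hb; omega
  · simp only [List.mem_append, List.mem_cons, List.mem_filter, List.mem_finRange, true_and,
      decide_eq_true_eq, Fin.ext_iff, Fin.lt_def] at hk ⊢
    omega

section cherednik

variable {q p : ℂ} (hq : q ≠ 0) (hp : p ≠ 0) {N : ℕ}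

theorem isUnit_macY (hq : q ≠ 0) (hp : p ≠ 0) (i : Fin N) : IsUnit (macY q p i) := by
  refine ((List.prod_isUnit ?_).mul (isUnit_pShift hp i)).mul (List.prod_isUnit ?_)
  · simp only [List.mem_map, List.mem_filter, List.mem_finRange, true_and, decide_eq_true_eq]
    rintro _ ⟨j, hj, rfl⟩
    exact (isUnit_xi hq hj.ne).ringInverse
  · simp only [List.mem_map, List.mem_filter, List.mem_finRange, true_and, decide_eq_true_eq]
    rintro _ ⟨j, hj, rfl⟩
    exact isUnit_xi hq hj.ne

theorem macY_succ (hq : q ≠ 0) {i j : Fin N} (hij : (i : ℕ) + 1 = j) :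
    macY q p j = heckeG q i j * macY q p i * heckeG q i j := by
  have hne : i ≠ j := by rintro rfl; simp at hij
  have hA : SemiconjBy (swapVar i j)
      (((List.finRange N).filter (fun l => j < l)).map fun l => Ring.inverse (xi q j l)).prod
      (((List.finRange N).filter (fun l => j < l)).map fun l => Ring.inverse (xi q i l)).prod := by
    refine semiconjBy_list_prod _ fun l hl => ?_
    simp only [List.mem_filter, List.mem_finRange, true_and, decide_eq_true_eq] at hl
    have hil : i ≠ l := by rintro rfl; omega
    refine SemiconjBy.ringInverse_right ?_ (isUnit_xi hq hl.ne) (isUnit_xi hq hil)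
    have := swapVar_xi q hl.ne i j
    rwa [Equiv.swap_apply_right, Equiv.swap_apply_of_ne_of_ne hil.symm hl.ne'] at this
  have hB : SemiconjBy (swapVar i j)
      (((List.finRange N).filter (fun l => l < i)).map fun l => xi q l j).prod
      (((List.finRange N).filter (fun l => l < i)).map fun l => xi q l i).prod := by
    refine semiconjBy_list_prod _ fun l hl => ?_
    simp only [List.mem_filter, List.mem_finRange, true_and, decide_eq_true_eq] at hl
    have hlj : l ≠ j := by rintro rfl; omega
    have := swapVar_xi q hlj i j
    rwa [Equiv.swap_apply_right, Equiv.swap_apply_of_ne_of_ne hl.ne hlj] at this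
  have hC : SemiconjBy (swapVar i j) (pShift p j) (pShift p i) := by
    simpa using swapVar_pShift p i j j
  have key := ((hA.mul_right hC).mul_right hB).eq
  rw [macY, macY, down_eq hij, up_eq hij]
  simp only [List.map_append, List.map_cons, List.map_nil, List.prod_append, List.prod_cons,
    List.prod_nil, mul_one]
  generalize (((List.finRange N).filter (fun l => j < l)).map
    fun l => Ring.inverse (xi q j l)).prod = a at *
  generalize (((List.finRange N).filter (fun l => j < l)).map
    fun l => Ring.inverse (xi q i l)).prod = a' at *
  generalize (((List.finRange N).filter (fun l => l < i)).map fun l => xi q l j).prod = b at *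
  generalize (((List.finRange N).filter (fun l => l < i)).map fun l => xi q l i).prod = b' at *
  rw [inverse_xi hq hne, xiInv]
  calc a * pShift p j * (b * xi q i j)
      = (swapVar i j * swapVar i j) * (a * pShift p j * b) * xi q i j := by
        rw [swapVar_mul_self]; simp only [mul_assoc, one_mul]
    _ = swapVar i j * (a' * pShift p i * b') * (swapVar i j * swapVar i j) * heckeG q i j := by
        rw [mul_assoc (swapVar i j), key, xi]; simp only [mul_assoc]
    _ = (heckeG q i j * heckeGInv q i j) * swapVar i j * (a' * pShift p i * b') * heckeG q i j := by
        rw [swapVar_mul_self, heckeG_mul_inv hq hne]; simp only [mul_assoc, one_mul, mul_one]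
    _ = _ := by simp only [mul_assoc]

theorem inverse_mul_inverse_comm {R : Type*} [MonoidWithZero R] {k a b : R} (ha : IsUnit a)
    (hb : IsUnit b) (h : Commute k (a * b)) : Commute k (Ring.inverse b * Ring.inverse a) := by
  obtain ⟨a, rfl⟩ := ha
  obtain ⟨b, rfl⟩ := hb
  rw [Ring.inverse_unit, Ring.inverse_unit, ← Units.val_mul, ← mul_inv_rev]
  rw [← Units.val_mul] at h
  exact h.units_inv_right

theorem heckeG_macY_comm (hq : q ≠ 0) (hp : p ≠ 0) {i j k : Fin N} (hij : (i : ℕ) + 1 = j)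
    (hki : k ≠ i) (hkj : k ≠ j) : Commute (heckeG q i j) (macY q p k) := by
  have hne : i ≠ j := by rintro rfl; simp at hij
  have h1 : ∀ l, l ≠ i → l ≠ j → l ≠ k → Commute (heckeG q i j) (Ring.inverse (xi q k l)) :=
    fun l h1 h2 h3 => Commute.ringInverse_right' <|
      heckeG_xi_comm q hne h3.symm hki.symm h1.symm hkj.symm h2.symm
  have h2 : ∀ l, l ≠ i → l ≠ j → l ≠ k → Commute (heckeG q i j) (xi q l k) :=
    fun l h1 h2 h3 => heckeG_xi_comm q hne h3 h1.symm hki.symm h2.symm hkj.symm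
  rw [macY]
  refine Commute.mul_right (Commute.mul_right ?_ (pShift_heckeG_comm hp q hne hki hkj)) ?_
  · rcases lt_or_ge k i with h | h
    · rw [up_split hij h]
      simp only [List.map_append, List.map_cons, List.prod_append, List.prod_cons]
      refine Commute.mul_right (semiconjBy_list_prod _ fun l hl => h1 l ?_ ?_ ?_) ?_
      iterate 3 (rintro rfl; simp at hl; try omega)
      rw [← mul_assoc]
      refine Commute.mul_right (inverse_mul_inverse_comm (isUnit_xi hq hkj) (isUnit_xi hq hki)
        (heckeG_xi_mul_xi' hq hne hkj.symm hki.symm))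
        (semiconjBy_list_prod _ fun l hl => h1 l ?_ ?_ ?_)
      all_goals (rintro rfl; simp at hl; try omega)
    · refine semiconjBy_list_prod _ fun l hl => h1 l ?_ ?_ ?_
      all_goals
        rintro rfl
        simp at hl
        try omega
  · rcases lt_or_ge j k with h | h
    · rw [down_split hij h]
      simp only [List.map_append, List.map_cons, List.prod_append, List.prod_cons]
      refine Commute.mul_right (semiconjBy_list_prod _ fun l hl => h2 l ?_ ?_ ?_) ?_
      iterate 3 (rintro rfl; simp at hl; try omega)
      rw [← mul_assoc]
      refine Commute.mul_right (heckeG_xi_mul_xi hq hne hkj.symm hki.symm)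
        (semiconjBy_list_prod _ fun l hl => h2 l ?_ ?_ ?_)
      all_goals (rintro rfl; simp at hl; try omega)
    · refine semiconjBy_list_prod _ fun l hl => h2 l ?_ ?_ ?_
      all_goals
        rintro rfl
        simp at hl
        try omega

theorem commute_interleave {R ι : Type*} [Monoid R] {k : R} (l : List ι) (hl : l.Nodup)
    {a b : ι → R} (hab : ∀ x ∈ l, ∀ y ∈ l, x ≠ y → Commute (a x) (b y))
    (h : ∀ x ∈ l, Commute k (a x * b x)) : Commute k ((l.map a).prod * (l.map b).prod) := by
  induction l with
  | nil => simp
  | cons x l ih =>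
    simp only [List.map_cons, List.prod_cons]
    have hx : Commute (b x) (l.map a).prod := semiconjBy_list_prod _ fun y hy =>
      (hab y (by simp [hy]) x (by simp) (by rintro rfl; simp [hy] at hl)).symm
    have e : a x * (l.map a).prod * (b x * (l.map b).prod) =
        (a x * b x) * ((l.map a).prod * (l.map b).prod) := by
      rw [mul_assoc, ← mul_assoc _ (b x), ← hx.eq]; simp only [mul_assoc]
    rw [e]
    exact (h x (by simp)).mul_right (ih (List.nodup_cons.1 hl).2
      (fun y hy z hz => hab y (by simp [hy]) z (by simp [hz])) fun y hy => h y (by simp [hy]))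

theorem macY_comm_zero_one (hq : q ≠ 0) (hp : p ≠ 0) {i j : Fin N} (hi : (i : ℕ) = 0)
    (hij : (i : ℕ) + 1 = j) : Commute (macY q p i) (macY q p j) := by
  have hne : i ≠ j := by rintro rfl; simp at hij
  have hY0 : ∀ a : Fin N, i < a ↔ a ≠ i := by
    intro a; simp only [Fin.lt_def, ne_eq, Fin.ext_iff]; omega
  have hdown : (List.finRange N).filter (fun l => l < i) = [] :=
    filter_finRange_eq (by simp) fun a => by simp [Fin.le_def, hi]
  have hji : macY q p j * macY q p i =
      ((((List.finRange N).filter (fun l => j < l)).map fun l => Ring.inverse (xi q j l)).prod *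
       (((List.finRange N).filter (fun l => j < l)).map fun l => Ring.inverse (xi q i l)).prod) *
      (pShift p j * pShift p i) := by
    have hc : Commute (pShift p j)
        (((List.finRange N).filter (fun l => j < l)).map fun l => Ring.inverse (xi q i l)).prod := by
      refine semiconjBy_list_prod _ fun l hl => Commute.ringInverse_right' ?_
      simp only [List.mem_filter, List.mem_finRange, true_and, decide_eq_true_eq] at hl
      have hil : i ≠ l := by rintro rfl; omega
      refine Commute.mul_right ?_ (pShift_heckeG_comm hp q hil hne.symm hl.ne).symm
      have := swapVar_pShift p i l j
      rw [Equiv.swap_apply_of_ne_of_ne hne.symm hl.ne] at this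
      exact this.symm
    rw [macY, macY, down_eq hij, up_eq hij, hdown]
    simp only [List.nil_append, List.map_cons, List.map_nil, List.prod_cons, List.prod_nil,
      mul_one]
    simp only [mul_assoc]
    rw [← mul_assoc (xi q i j), Ring.mul_inverse_cancel _ (isUnit_xi hq hne), one_mul,
      ← mul_assoc (pShift p j), hc.eq]
    simp only [mul_assoc]
  have hcomm : Commute (heckeG q i j) (macY q p j * macY q p i) := by
    rw [hji]
    refine Commute.mul_right (commute_interleave _ ((List.nodup_finRange N).filter _) ?_ ?_)
      (pShift_pair_heckeG_comm hp q hne)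
    · intro a ha b hb hab
      simp only [List.mem_filter, List.mem_finRange, true_and, decide_eq_true_eq] at ha hb
      have hia : i ≠ a := by rintro rfl; omega
      have hib : i ≠ b := by rintro rfl; omega
      exact (xi_comm q ha.ne hib hne.symm hb.ne hia.symm hab).ringInverse_ringInverse
    · intro a ha
      simp only [List.mem_filter, List.mem_finRange, true_and, decide_eq_true_eq] at ha
      have hia : i ≠ a := by rintro rfl; omega
      exact inverse_mul_inverse_comm (isUnit_xi hq hia) (isUnit_xi hq ha.ne)
        (heckeG_xi_mul_xi hq hne ha.ne hia)
  have h2 := hcomm.eq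
  rw [macY_succ hq hij] at h2 ⊢
  change _ * _ = _ * _
  refine (isUnit_heckeG hq hne).mul_left_cancel ?_
  simp only [mul_assoc] at h2 ⊢
  rw [← h2]

theorem macY_comm_zero (hq : q ≠ 0) (hp : p ≠ 0) {i : Fin N} (hi : (i : ℕ) = 0) :
    ∀ (d : ℕ) (j : Fin N), (j : ℕ) = d + 1 → Commute (macY q p i) (macY q p j)
  | 0, j, hj => macY_comm_zero_one hq hp hi (by omega)
  | d + 1, j, hj => by
    have hj' : d + 1 < N := by omega
    have ih := macY_comm_zero hq hp hi d ⟨d + 1, hj'⟩ rfl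
    have hs : ((⟨d + 1, hj'⟩ : Fin N) : ℕ) + 1 = j := by simp [hj]
    rw [macY_succ hq hs]
    have hg : Commute (heckeG q (⟨d + 1, hj'⟩ : Fin N) j) (macY q p i) :=
      heckeG_macY_comm hq hp hs (by simp [Fin.ext_iff]; omega) (by simp [Fin.ext_iff]; omega)
    exact (hg.symm.mul_right ih).mul_right hg.symm

theorem macY_comm_lt (hq : q ≠ 0) (hp : p ≠ 0) :
    ∀ (d : ℕ) (i j : Fin N), (i : ℕ) = d → i < j → Commute (macY q p i) (macY q p j)
  | 0, i, j, hi, hij => macY_comm_zero hq hp hi (j - 1) j (by omega)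
  | d + 1, i, j, hi, hij => by
    have hd : d < N := by omega
    rw [Fin.lt_def] at hij
    have ih := macY_comm_lt hq hp d ⟨d, hd⟩ j rfl (by simp [Fin.lt_def]; omega)
    have hs : ((⟨d, hd⟩ : Fin N) : ℕ) + 1 = i := by simp [hi]
    rw [macY_succ hq hs]
    have hg : Commute (heckeG q (⟨d, hd⟩ : Fin N) i) (macY q p j) :=
      heckeG_macY_comm hq hp hs (by simp [Fin.ext_iff]; omega) (by simp [Fin.ext_iff]; omega)
    exact (hg.mul_left ih).mul_left hg

theorem macY_comm (hq : q ≠ 0) (hp : p ≠ 0) (i j : Fin N) :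
    Commute (macY q p i) (macY q p j) := by
  rcases lt_trichotomy i j with h | rfl | h
  · exact macY_comm_lt hq hp _ i j rfl h
  · exact Commute.refl _
  · exact (macY_comm_lt hq hp _ j i rfl h).symm

end cherednik

/-! ### The operators `y_i` -/

section yOp

variable {q p : ℂ} {N : ℕ}

theorem isUnit_yOp (hq : q ≠ 0) (hp : p ≠ 0) (i : Fin N) : IsUnit (yOp q p i) := by
  obtain ⟨u, hu⟩ := isUnit_macY hq hp i
  refine isUnit_of_inv (b := (q ^ (1 - (N : ℤ)))⁻¹ • (↑u⁻¹ : Module.End ℂ (Laurent N))) ?_ ?_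
  all_goals rw [yOp, ← hu]; simp [smul_smul, zpow_ne_zero _ hq]

theorem yOp_comm (hq : q ≠ 0) (hp : p ≠ 0) (i j : Fin N) : Commute (yOp q p i) (yOp q p j) :=
  ((macY_comm hq hp i j).smul_left _).smul_right _

theorem heckeG_yOp_comm (hq : q ≠ 0) (hp : p ≠ 0) {i j k : Fin N} (hij : (i : ℕ) + 1 = j)
    (hki : k ≠ i) (hkj : k ≠ j) : Commute (heckeG q i j) (yOp q p k) :=
  (heckeG_macY_comm hq hp hij hki hkj).smul_right _

theorem ne_of_succ {i j : Fin N} (hij : (i : ℕ) + 1 = j) : i ≠ j := by rintro rfl; simp at hij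

theorem yOp_succ (hq : q ≠ 0) {i j : Fin N} (hij : (i : ℕ) + 1 = j) :
    yOp q p j = heckeG q i j * yOp q p i * heckeG q i j := by
  rw [yOp, yOp, macY_succ hq hij, mul_smul_comm, smul_mul_assoc]

theorem inverse_yOp_pred (hq : q ≠ 0) (hp : p ≠ 0) {i j : Fin N} (hij : (i : ℕ) + 1 = j) :
    Ring.inverse (yOp q p i) = heckeG q i j * Ring.inverse (yOp q p j) * heckeG q i j := by
  have hg := isUnit_heckeG hq (ne_of_succ hij)
  rw [yOp_succ (p := p) hq hij]
  obtain ⟨u, hu⟩ := isUnit_yOp (p := p) hq hp i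
  obtain ⟨g, hg⟩ := hg
  rw [← hu, ← hg, ← Units.val_mul, ← Units.val_mul, Ring.inverse_unit, Ring.inverse_unit,
    ← Units.val_mul, ← Units.val_mul]
  congr 1
  group

theorem commute_powerSum {R : Type*} [Ring R] [Algebra ℂ R] {g X Y : R} (hXY : Commute X Y)
    {c : ℂ} (hg : g * g = c • g + 1) (hY : Y = g * X * g) : ∀ l : ℕ, Commute g (X ^ l + Y ^ l) := by
  have e1 : g * Y = X * g + c • Y := by
    calc g * Y = (g * g) * X * g := by rw [hY]; simp only [mul_assoc]
      _ = X * g + c • Y := by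
        rw [hg, hY, add_mul, add_mul, one_mul, add_comm, smul_mul_assoc, smul_mul_assoc]
  have e2 : Y * g = g * X + c • Y := by
    calc Y * g = g * X * (g * g) := by rw [hY]; simp only [mul_assoc]
      _ = _ := by rw [hg, mul_add, mul_one, mul_smul_comm, ← hY, add_comm]
  have h1 : Commute g (X + Y) := by
    change _ * _ = _ * _
    rw [mul_add, add_mul, e1, e2]; abel
  have h2 : Commute g (X * Y) := by
    change _ * _ = _ * _
    conv_rhs => rw [hXY.eq]
    rw [hY]; simp only [mul_assoc]
  have key : ∀ l : ℕ, Commute g (X ^ l + Y ^ l) ∧ Commute g (X ^ (l + 1) + Y ^ (l + 1)) := by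
    intro l
    induction l with
    | zero => exact ⟨by simp [Commute.one_right, Commute.add_right], by simpa using h1⟩
    | succ l ih =>
      refine ⟨ih.2, ?_⟩
      have e : X ^ (l + 1 + 1) + Y ^ (l + 1 + 1) =
          (X + Y) * (X ^ (l + 1) + Y ^ (l + 1)) - X * Y * (X ^ l + Y ^ l) := by
        have e3 : X * Y * X ^ l = Y * X ^ (l + 1) := by
          rw [hXY.eq, mul_assoc, ← pow_succ']
        have e4 : X * Y * Y ^ l = X * Y ^ (l + 1) := by rw [mul_assoc, ← pow_succ']
        rw [mul_add (X * Y), e3, e4, add_mul, mul_add, mul_add, ← pow_succ', ← pow_succ']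
        abel
      rw [e]
      exact (h1.mul_right ih.2).sub_right (h2.mul_right ih.1)
  exact fun l => (key l).1

theorem commute_endZPow {W : Type} [AddCommGroup W] [Module ℂ W] {A B : Module.End ℂ W}
    (h : Commute A B) (l : ℤ) : Commute A (endZPow B l) := by
  cases l with
  | ofNat a => exact h.pow_right a
  | negSucc a => exact (Commute.ringInverse_right' h).pow_right _

theorem heckeG_ham_comm (hq : q ≠ 0) (hp : p ≠ 0) {i j : Fin N} (hij : (i : ℕ) + 1 = j) (l : ℤ) :
    Commute (heckeG q i j) (∑ k : Fin N, endZPow (yOp q p k) l) := by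
  have hne := ne_of_succ hij
  have h2 : Commute (heckeG q i j) (endZPow (yOp q p i) l + endZPow (yOp q p j) l) := by
    cases l with
    | ofNat a => exact commute_powerSum (yOp_comm hq hp i j) (heckeG_sq hq hne) (yOp_succ hq hij) a
    | negSucc a =>
      rw [add_comm]
      exact commute_powerSum (yOp_comm hq hp j i).ringInverse_ringInverse (heckeG_sq hq hne)
        (inverse_yOp_pred hq hp hij) _
  have e : ∑ k : Fin N, endZPow (yOp q p k) l =
      (endZPow (yOp q p i) l + endZPow (yOp q p j) l) +
        ∑ k ∈ (Finset.univ.erase i).erase j, endZPow (yOp q p k) l := by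
    rw [add_assoc, Finset.add_sum_erase _ (fun k => endZPow (yOp q p k) l) (by simp [hne.symm]),
      Finset.add_sum_erase _ (fun k => endZPow (yOp q p k) l) (by simp)]
  rw [e]
  refine h2.add_right (Commute.sum_right _ _ _ fun k hk => ?_)
  simp only [Finset.mem_erase, Finset.mem_univ, and_true] at hk
  exact commute_endZPow (heckeG_yOp_comm hq hp hij hk.2 hk.1) l

end yOp

/-! ### The action on monomials -/

/-- `ν` is obtained from `μ` by moving `μ_i` and `μ_j` strictly towards each other. -/
def Inner {N : ℕ} (i j : Fin N) (μ ν : Fin N → ℤ) : Prop :=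
  (∀ l, l ≠ i → l ≠ j → ν l = μ l) ∧ ν i + ν j = μ i + μ j ∧
    min (μ i) (μ j) < ν i ∧ ν i < max (μ i) (μ j)

/-- The span of the monomials with exponents in `P`. -/
def monoSpan {N : ℕ} (P : Set (Fin N → ℤ)) : Submodule ℂ (Laurent N) :=
  Submodule.span ℂ (mono '' P)

theorem mono_mem {N : ℕ} {P : Set (Fin N → ℤ)} {m : Fin N → ℤ} (h : m ∈ P) :
    mono m ∈ monoSpan P := Submodule.subset_span ⟨m, h, rfl⟩

theorem monoSpan_mono {N : ℕ} {P P' : Set (Fin N → ℤ)} (h : P ⊆ P') :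
    monoSpan P ≤ monoSpan P' := Submodule.span_mono (Set.image_mono h)

theorem monoSpan_induction {N : ℕ} {P : Set (Fin N → ℤ)} {W : Type*} [AddCommGroup W]
    [Module ℂ W] {A : Laurent N →ₗ[ℂ] W} {V : Submodule ℂ W} (h : ∀ m ∈ P, A (mono m) ∈ V) :
    ∀ f ∈ monoSpan P, A f ∈ V := by
  intro f hf
  have : monoSpan P ≤ V.comap A := by
    rw [monoSpan, Submodule.span_le]
    rintro _ ⟨m, hm, rfl⟩
    exact h m hm
  exact this hf

theorem update_pair_mem {N : ℕ} {i j : Fin N} (hij : i ≠ j) (m : Fin N → ℤ) {a b : ℤ}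
    (hab : a + b = m i + m j) (h1 : min (m i) (m j) < a) (h2 : a < max (m i) (m j)) :
    mono (Function.update (Function.update m i a) j b) ∈ monoSpan {ν | Inner i j m ν} := by
  refine mono_mem ⟨fun l h1 h2 => by simp [h1, h2], ?_, ?_, ?_⟩ <;>
  rw [Function.update_of_ne hij, Function.update_self] <;> try assumption
  rw [Function.update_self]; exact hab

theorem comp_swap_eq {N : ℕ} (i j : Fin N) (m : Fin N → ℤ) :
    m ∘ Equiv.swap i j = Function.update (Function.update m i (m j)) j (m i) := by
  funext l
  by_cases h1 : l = j
  · subst h1; simp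
  · by_cases h2 : l = i
    · subst h2; simp [h1]
    · simp [h1, h2, Equiv.swap_apply_of_ne_of_ne]

theorem mulVar_update_left {N : ℕ} {i j : Fin N} (hij : i ≠ j) (m : Fin N → ℤ) (a b : ℤ) :
    mulVar i (mono (Function.update (Function.update m i a) j b)) =
      mono (Function.update (Function.update m i (a + 1)) j b) := by
  rw [mulVar_mono]
  congr 1
  funext l
  by_cases h1 : l = j
  · subst h1; simp [hij.symm]
  · by_cases h2 : l = i
    · subst h2; simp [h1, add_comm]
    · simp [h1, h2]

theorem mulVar_update_right {N : ℕ} (i j : Fin N) (m : Fin N → ℤ) (a b : ℤ) :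
    mulVar j (mono (Function.update (Function.update m i a) j b)) =
      mono (Function.update (Function.update m i a) j (b + 1)) := by
  rw [mulVar_mono]
  congr 1
  funext l
  by_cases h1 : l = j
  · subst h1; simp [add_comm]
  · simp [h1]

theorem heckeG_mono_eq (q : ℂ) {N : ℕ} {i j : Fin N} {m : Fin N → ℤ} (h : m i = m j) :
    heckeG q i j (mono m) = q • mono m := by
  simp [heckeG, divDiff, opOnMono_mono, h]

theorem heckeG_mono_lt (q : ℂ) {N : ℕ} {i j : Fin N} (hij : i ≠ j) {m : Fin N → ℤ}
    (h : m i < m j) : heckeG q i j (mono m) - q⁻¹ • mono (m ∘ Equiv.swap i j) ∈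
      monoSpan {ν | Inner i j m ν} := by
  obtain ⟨L, hL⟩ : ∃ L : ℕ, m j - m i = L + 1 := ⟨(m j - m i - 1).toNat, by omega⟩
  have e1 : (m j - m i).toNat = L + 1 := by omega
  have e2 : (m i - m j).toNat = 0 := by omega
  have e3 : mono m = mono (Function.update (Function.update m i (m i)) j (m j)) := by simp
  have e : heckeG q i j (mono m) - q⁻¹ • mono (m ∘ Equiv.swap i j) =
      q⁻¹ • (∑ t ∈ Finset.range L, mono (Function.update (Function.update m i
        (m j - 1 - ((t + 1 : ℕ) : ℤ) + 1)) j (m i + ((t + 1 : ℕ) : ℤ)))) -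
      q • ∑ t ∈ Finset.range L, mono (Function.update (Function.update m i
        (m j - 1 - (t : ℤ))) j (m i + (t : ℤ) + 1)) := by
    rw [heckeG, LinearMap.add_apply, Module.End.mul_apply, divDiff, opOnMono_mono, e1, e2]
    simp only [Finset.range_zero, Finset.sum_empty, sub_zero, map_sum, LinearMap.sub_apply,
      LinearMap.smul_apply, mulVar_update_left hij, mulVar_update_right, Module.End.one_apply]
    rw [Finset.sum_sub_distrib, ← Finset.smul_sum, ← Finset.smul_sum, Finset.sum_range_succ',
      Finset.sum_range_succ (fun t : ℕ => mono (Function.update (Function.update m i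
        (m j - 1 - (t : ℤ))) j (m i + (t : ℤ) + 1)))]
    have e4 : m j - 1 - (L : ℤ) = m i := by omega
    have e5 : m i + (L : ℤ) + 1 = m j := by omega
    have e6 : m j - 1 - ((0 : ℕ) : ℤ) + 1 = m j := by simp
    have e7 : m i + ((0 : ℕ) : ℤ) = m i := by simp
    rw [e4, e5, e6, e7, ← comp_swap_eq, ← e3]
    module
  rw [e]
  refine Submodule.sub_mem _ (Submodule.smul_mem _ _ (Submodule.sum_mem _ fun t ht => ?_))
    (Submodule.smul_mem _ _ (Submodule.sum_mem _ fun t ht => ?_))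
  all_goals
    have := Finset.mem_range.1 ht
    refine update_pair_mem hij m ?_ ?_ ?_ <;> push_cast <;> omega

theorem heckeG_mono_gt (q : ℂ) {N : ℕ} {i j : Fin N} (hij : i ≠ j) {m : Fin N → ℤ}
    (h : m j < m i) : heckeG q i j (mono m) -
      (q • mono (m ∘ Equiv.swap i j) + (q - q⁻¹) • mono m) ∈ monoSpan {ν | Inner i j m ν} := by
  obtain ⟨L, hL⟩ : ∃ L : ℕ, m i - m j = L + 1 := ⟨(m i - m j - 1).toNat, by omega⟩
  have e1 : (m i - m j).toNat = L + 1 := by omega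
  have e2 : (m j - m i).toNat = 0 := by omega
  have e3 : mono m = mono (Function.update (Function.update m i (m i)) j (m j)) := by simp
  have e : heckeG q i j (mono m) - (q • mono (m ∘ Equiv.swap i j) + (q - q⁻¹) • mono m) =
      q • (∑ t ∈ Finset.range L, mono (Function.update (Function.update m i
        (m i - 1 - (t : ℤ))) j (m j + (t : ℤ) + 1))) -
      q⁻¹ • ∑ t ∈ Finset.range L, mono (Function.update (Function.update m i
        (m i - 1 - ((t + 1 : ℕ) : ℤ) + 1)) j (m j + ((t + 1 : ℕ) : ℤ))) := by
    rw [heckeG, LinearMap.add_apply, Module.End.mul_apply, divDiff, opOnMono_mono, e1, e2]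
    simp only [Finset.range_zero, Finset.sum_empty, zero_sub, map_sum, LinearMap.sub_apply,
      LinearMap.smul_apply, mulVar_update_left hij, mulVar_update_right, Module.End.one_apply,
      map_neg]
    rw [Finset.sum_sub_distrib, ← Finset.smul_sum, ← Finset.smul_sum, Finset.sum_range_succ',
      Finset.sum_range_succ (fun t : ℕ => mono (Function.update (Function.update m i
        (m i - 1 - (t : ℤ))) j (m j + (t : ℤ) + 1)))]
    have e4 : m i - 1 - (L : ℤ) = m j := by omega
    have e5 : m j + (L : ℤ) + 1 = m i := by omega
    have e6 : m i - 1 - ((0 : ℕ) : ℤ) + 1 = m i := by simp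
    have e7 : m j + ((0 : ℕ) : ℤ) = m j := by simp
    rw [e4, e5, e6, e7, ← comp_swap_eq, ← e3]
    module
  rw [e]
  refine Submodule.sub_mem _ (Submodule.smul_mem _ _ (Submodule.sum_mem _ fun t ht => ?_))
    (Submodule.smul_mem _ _ (Submodule.sum_mem _ fun t ht => ?_))
  all_goals
    have := Finset.mem_range.1 ht
    refine update_pair_mem hij m ?_ ?_ ?_ <;> push_cast <;> omega

/-- The set `P` of exponents is stable under exchanging two entries and under moving two entries
strictly towards each other. -/
def ClosedExp {N : ℕ} (P : Set (Fin N → ℤ)) : Prop :=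
  ∀ m ∈ P, ∀ i j, i ≠ j → m ∘ Equiv.swap i j ∈ P ∧ ∀ ν, Inner i j m ν → ν ∈ P

/-- `A` is invertible, and `A` and its inverse preserve `V`. -/
def BiPres {W : Type*} [AddCommGroup W] [Module ℂ W] (V : Submodule ℂ W)
    (A : Module.End ℂ W) : Prop :=
  ∃ B, A * B = 1 ∧ B * A = 1 ∧ (∀ f ∈ V, A f ∈ V) ∧ ∀ f ∈ V, B f ∈ V

section BiPres

variable {W : Type*} [AddCommGroup W] [Module ℂ W] {V : Submodule ℂ W}

theorem BiPres.mem {A : Module.End ℂ W} (h : BiPres V A) {f : W} (hf : f ∈ V) : A f ∈ V := by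
  obtain ⟨B, -, -, h, -⟩ := h; exact h f hf

theorem BiPres.one : BiPres V (1 : Module.End ℂ W) :=
  ⟨1, by simp, by simp, by simp, by simp⟩

theorem BiPres.mul {A A' : Module.End ℂ W} (h : BiPres V A) (h' : BiPres V A') :
    BiPres V (A * A') := by
  obtain ⟨B, h1, h2, h3, h4⟩ := h
  obtain ⟨B', h1', h2', h3', h4'⟩ := h'
  refine ⟨B' * B, ?_, ?_, fun f hf => h3 _ (h3' _ hf), fun f hf => h4' _ (h4 _ hf)⟩
  · rw [mul_assoc, ← mul_assoc A', h1', one_mul, h1]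
  · rw [mul_assoc, ← mul_assoc B, h2, one_mul, h2']

theorem BiPres.list_prod {ι : Type*} {l : List ι} {f : ι → Module.End ℂ W}
    (h : ∀ x ∈ l, BiPres V (f x)) : BiPres V (l.map f).prod := by
  induction l with
  | nil => exact BiPres.one
  | cons a l ih =>
    simp only [List.map_cons, List.prod_cons]
    exact (h a (by simp)).mul (ih fun x hx => h x (by simp [hx]))

theorem BiPres.inverse {A : Module.End ℂ W} (h : BiPres V A) : BiPres V (Ring.inverse A) := by
  obtain ⟨B, h1, h2, h3, h4⟩ := h
  rw [ringInverse_eq h1 h2]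
  exact ⟨A, h2, h1, h4, h3⟩

theorem BiPres.smul {A : Module.End ℂ W} (h : BiPres V A) {c : ℂ} (hc : c ≠ 0) :
    BiPres V (c • A) := by
  obtain ⟨B, h1, h2, h3, h4⟩ := h
  exact ⟨c⁻¹ • B, by simp [h1, hc], by simp [h2, hc],
    fun f hf => V.smul_mem _ (h3 f hf), fun f hf => V.smul_mem _ (h4 f hf)⟩

theorem BiPres.endZPow_mem {W : Type} [AddCommGroup W] [Module ℂ W] {V : Submodule ℂ W}
    {A : Module.End ℂ W} (h : BiPres V A) (l : ℤ) {f : W} (hf : f ∈ V) :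
    endZPow A l f ∈ V := by
  have key : ∀ {B : Module.End ℂ W}, BiPres V B → ∀ a : ℕ, (B ^ a) f ∈ V := by
    intro B hB a
    induction a with
    | zero => simpa
    | succ a ih => rw [pow_succ']; exact hB.mem ih
  cases l with
  | ofNat a => exact key h a
  | negSucc a => exact key h.inverse _

end BiPres

section closed

variable {q p : ℂ} {N : ℕ} {P : Set (Fin N → ℤ)}

theorem ClosedExp.heckeG_mem (hP : ClosedExp P) {i j : Fin N} (hij : i ≠ j) :
    ∀ f ∈ monoSpan P, heckeG q i j f ∈ monoSpan P := by
  refine monoSpan_induction fun m hm => ?_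
  have hin : monoSpan {ν | Inner i j m ν} ≤ monoSpan P := monoSpan_mono (hP m hm i j hij).2
  have hsw := mono_mem (hP m hm i j hij).1
  rcases lt_trichotomy (m i) (m j) with h | h | h
  · have := Submodule.add_mem _ (hin (heckeG_mono_lt q hij h)) (Submodule.smul_mem _ q⁻¹ hsw)
    rwa [sub_add_cancel] at this
  · rw [heckeG_mono_eq q h]; exact Submodule.smul_mem _ _ (mono_mem hm)
  · have := Submodule.add_mem _ (hin (heckeG_mono_gt q hij h)) (Submodule.add_mem _
      (Submodule.smul_mem _ q hsw) (Submodule.smul_mem _ (q - q⁻¹) (mono_mem hm)))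
    rwa [sub_add_cancel] at this

theorem ClosedExp.biPres_heckeG (hq : q ≠ 0) (hP : ClosedExp P) {i j : Fin N} (hij : i ≠ j) :
    BiPres (monoSpan P) (heckeG q i j) :=
  ⟨heckeGInv q i j, heckeG_mul_inv hq hij, heckeGInv_mul hq hij, hP.heckeG_mem hij, fun f hf =>
    Submodule.sub_mem _ (hP.heckeG_mem hij f hf) (Submodule.smul_mem _ _ hf)⟩

theorem ClosedExp.biPres_swapVar (hP : ClosedExp P) {i j : Fin N} (hij : i ≠ j) :
    BiPres (monoSpan P) (swapVar i j) := by
  have : ∀ f ∈ monoSpan P, swapVar i j f ∈ monoSpan P := monoSpan_induction fun m hm => by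
    rw [swapVar_mono]; exact mono_mem (hP m hm i j hij).1
  exact ⟨swapVar i j, swapVar_mul_self i j, swapVar_mul_self i j, this, this⟩

theorem ClosedExp.biPres_xi (hq : q ≠ 0) (hP : ClosedExp P) {i j : Fin N} (hij : i ≠ j) :
    BiPres (monoSpan P) (xi q i j) := (hP.biPres_swapVar hij).mul (hP.biPres_heckeG hq hij)

theorem biPres_pShift (hp : p ≠ 0) (i : Fin N) : BiPres (monoSpan P) (pShift p i) := by
  have : ∀ p : ℂ, ∀ f ∈ monoSpan P, pShift p i f ∈ monoSpan P := fun p =>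
    monoSpan_induction fun m hm => by
      rw [pShift_mono]; exact Submodule.smul_mem _ _ (mono_mem hm)
  exact ⟨pShift p⁻¹ i, pShift_mul_inv hp i, pShift_inv_mul hp i, this p, this p⁻¹⟩

theorem ClosedExp.biPres_macY (hq : q ≠ 0) (hp : p ≠ 0) (hP : ClosedExp P) (i : Fin N) :
    BiPres (monoSpan P) (macY q p i) := by
  refine ((BiPres.list_prod fun j hj => ?_).mul (biPres_pShift hp i)).mul
    (BiPres.list_prod fun j hj => ?_)
  all_goals simp only [List.mem_filter, List.mem_finRange, true_and, decide_eq_true_eq] at hj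
  · exact (hP.biPres_xi hq hj.ne).inverse
  · exact hP.biPres_xi hq hj.ne

theorem ClosedExp.biPres_yOp (hq : q ≠ 0) (hp : p ≠ 0) (hP : ClosedExp P) (i : Fin N) :
    BiPres (monoSpan P) (yOp q p i) := (hP.biPres_macY hq hp i).smul (zpow_ne_zero _ hq)

end closed

/-! ### The Hecke operators on spins -/

theorem spin_sub {n N : ℕ} (a b : Spin n N) : a - b = a + (-1 : ℂ) • b := by
  have h : ∀ {G : Type} [AddCommGroup G] [Module ℂ G] (x y : G), x - y = x + (-1 : ℂ) • y := by
    intro G _ _ x y; rw [neg_one_smul, sub_eq_add_neg]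
  exact h a b

theorem spin_neg {n N : ℕ} (b : Spin n N) : -b = (-1 : ℂ) • b := by
  have h : ∀ {G : Type} [AddCommGroup G] [Module ℂ G] (y : G), -y = (-1 : ℂ) • y := by
    intro G _ _ y; rw [neg_one_smul]
  exact h b

/-- The basis `v_e` of the spin space. -/
def spinBasis (n N : ℕ) : Module.Basis (Fin N → Fin n) ℂ (Spin n N) :=
  Basis.piTensorProduct fun _ : Fin N => Pi.basisFun ℂ (Fin n)

theorem spinBasis_apply {n N : ℕ} (e : Fin N → Fin n) : spinBasis n N e = spinVec e := by
  simp [spinBasis, spinVec]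

theorem ext_spin {n N : ℕ} {W : Type*} [AddCommMonoid W] [Module ℂ W] {A B : Spin n N →ₗ[ℂ] W}
    (h : ∀ e, A (spinVec e) = B (spinVec e)) : A = B :=
  (spinBasis n N).ext fun e => by rw [spinBasis_apply]; exact h e

theorem siteOp_spinVec {n N : ℕ} {A : Fin N → Module.End ℂ (Fin n → ℂ)} {e e' : Fin N → Fin n}
    {c : Fin N → ℂ} (h : ∀ l, A l (Pi.single (e l) 1) = c l • Pi.single (e' l) 1) :
    siteOp A (spinVec e) = (∏ l, c l) • spinVec e' := by
  rw [siteOp, spinVec, PiTensorProduct.map_tprod]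
  simp only [h]
  rw [MultilinearMap.map_smul_univ]
  rfl

theorem eUnit_single {n : ℕ} (a b c : Fin n) :
    eUnit a b (Pi.single c 1) = (if c = b then (1 : ℂ) else 0) • Pi.single a 1 := by
  ext x
  simp [eUnit, Matrix.single_apply, Pi.single_apply, ite_and, eq_comm]

theorem twoSite_spinVec {n N : ℕ} {i j : Fin N} (hij : i ≠ j) (a b c d : Fin n)
    (e : Fin N → Fin n) : twoSite i j (eUnit a b) (eUnit c d) (spinVec e) =
      if e i = b ∧ e j = d then spinVec (Function.update (Function.update e i a) j c) else 0 := by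
  rw [twoSite, siteOp_spinVec (e' := Function.update (Function.update e i a) j c)
    (c := fun l => if l = i then (if e i = b then 1 else 0) else
      if l = j then (if e j = d then 1 else 0) else 1)]
  · have : (∏ l, if l = i then (if e i = b then (1 : ℂ) else 0) else
      if l = j then (if e j = d then 1 else 0) else 1) = if e i = b ∧ e j = d then 1 else 0 := by
      rw [Fintype.prod_eq_mul i j hij (fun l hl => by simp [hl.1, hl.2])]
      simp only [if_true, if_neg hij.symm]
      split_ifs <;> simp_all
    rw [this]
    split_ifs <;> simp
  · intro l
    by_cases h1 : l = i
    · subst h1; simp [eUnit_single, hij]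
    · by_cases h2 : l = j
      · subst h2; simp [eUnit_single, h1]
      · simp [h1, h2]

/-- The diagonal coefficient of the Hecke operator on spins, normalised so that the other
coefficient is `-1`. -/
def sDiag (q : ℂ) {n : ℕ} (x y : Fin n) : ℂ :=
  if x = y then 1 - q⁻¹ else if x < y then q - q⁻¹ else 0

theorem update_pair_eq_swap {α : Type*} {N : ℕ} (i j : Fin N) (e : Fin N → α) :
    Function.update (Function.update e i (e j)) j (e i) = e ∘ Equiv.swap i j := by
  funext l
  by_cases h1 : l = j
  · subst h1; simp
  · by_cases h2 : l = i
    · subst h2; simp [h1]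
    · simp [h1, h2, Equiv.swap_apply_of_ne_of_ne]

theorem comp_swap_of_eq {α : Type*} {N : ℕ} {i j : Fin N} {e : Fin N → α} (h : e i = e j) :
    e ∘ Equiv.swap i j = e := by
  rw [← update_pair_eq_swap, ← h, Function.update_eq_self, h, Function.update_eq_self]

theorem spinS_spinVec (q : ℂ) {n N : ℕ} {i j : Fin N} (hij : i ≠ j) (e : Fin N → Fin n) :
    spinS q i j (spinVec e) =
      sDiag q (e i) (e j) • spinVec e + (-1 : ℂ) • spinVec (e ∘ Equiv.swap i j) := by
  have e0 : Function.update (Function.update e i (e i)) j (e j) = e := by simp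
  have h1 : ∑ a : Fin n, (if e i = a ∧ e j = a then
      (spinVec (Function.update (Function.update e i a) j a) : Spin n N) else 0) =
      if e i = e j then spinVec e else 0 := by
    rw [Finset.sum_eq_single (e i)]
    · by_cases h : e i = e j
      · rw [if_pos ⟨rfl, h.symm⟩, if_pos h]; congr 1; nth_rewrite 2 [h]; exact e0
      · simp [h, Ne.symm h]
    · intro b _ hb; simp [Ne.symm hb]
    · simp
  have h2 : ∑ a : Fin n, ∑ b ∈ Finset.univ.filter (fun b => a < b), (if e i = a ∧ e j = b then
      (spinVec (Function.update (Function.update e i a) j b) : Spin n N) else 0) =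
      if e i < e j then spinVec e else 0 := by
    rw [Finset.sum_eq_single (e i)]
    · by_cases h : e i < e j
      · rw [Finset.sum_eq_single (e j)]
        · simp [h]
        · intro b _ hb; simp [Ne.symm hb]
        · simp [h]
      · rw [if_neg h, Finset.sum_eq_zero]
        intro b hb
        have : e j ≠ b := by rintro rfl; simp at hb; exact h hb
        simp [this]
    · intro b _ hb; simp [Ne.symm hb]
    · simp
  have h3 : ∑ a : Fin n, ∑ b ∈ Finset.univ.filter (fun b => a ≠ b), (if e i = b ∧ e j = a then
      (spinVec (Function.update (Function.update e i a) j b) : Spin n N) else 0) =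
      if e i ≠ e j then spinVec (e ∘ Equiv.swap i j) else 0 := by
    rw [Finset.sum_eq_single (e j)]
    · by_cases h : e i ≠ e j
      · rw [Finset.sum_eq_single (e i)]
        · simp [h, update_pair_eq_swap]
        · intro b _ hb; simp [Ne.symm hb]
        · simp [Ne.symm h]
      · rw [if_neg h, Finset.sum_eq_zero]
        intro b hb
        simp only [Finset.mem_filter, Finset.mem_univ, true_and] at hb
        simp only [ne_eq, not_not] at h
        rw [if_neg]; rintro ⟨rfl, -⟩; exact hb h.symm
    · intro b _ hb; simp [Ne.symm hb]
    · simp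
  simp only [spinS, LinearMap.sub_apply, LinearMap.add_apply, LinearMap.neg_apply,
    LinearMap.smul_apply, LinearMap.sum_apply, twoSite_spinVec hij, h1, h2, h3, sDiag, spin_sub,
    spin_neg]
  rcases lt_trichotomy (e i) (e j) with h | h | h
  · simp [h, h.ne]
  · simp only [h, lt_irrefl, if_true, if_false, comp_swap_of_eq h, ne_eq, not_true]
    module
  · simp [h.ne', h.not_gt]

/-- The relations of the finite Hecke algebra. -/
structure HeckeFamily (q : ℂ) {N : ℕ} {X : Type*} [AddCommGroup X] [Module ℂ X]
    (T : Fin N → Fin N → Module.End ℂ X) : Prop where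
  sq : ∀ i j : Fin N, (i : ℕ) + 1 = j → T i j * T i j = (q - q⁻¹) • T i j + 1
  comm : ∀ i j k l : Fin N, (i : ℕ) + 1 = j → (k : ℕ) + 1 = l → j < k →
    Commute (T i j) (T k l)
  braid : ∀ i j k : Fin N, (i : ℕ) + 1 = j → (j : ℕ) + 1 = k →
    T i j * T j k * T i j = T j k * T i j * T j k

theorem heckeFamily_heckeG {q : ℂ} (hq : q ≠ 0) (N : ℕ) :
    HeckeFamily q (heckeG q : Fin N → Fin N → _) where
  sq i j h := heckeG_sq hq (ne_of_succ h)
  comm i j k l h h' hjk := by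
    rw [Fin.lt_def] at hjk
    refine heckeG_comm q (ne_of_succ h) (ne_of_succ h') ?_ ?_ ?_ ?_ <;> rw [ne_eq, Fin.ext_iff] <;>
    omega
  braid i j k h h' := heckeG_braid hq (ne_of_succ h) (ne_of_succ h')
    (by rw [ne_eq, Fin.ext_iff]; omega)

theorem spinS_sq {q : ℂ} (hq : q ≠ 0) {n N : ℕ} {i j : Fin N} (hij : i ≠ j) :
    (spinS q i j * spinS q i j : Module.End ℂ (Spin n N)) = (q - q⁻¹) • spinS q i j + 1 := by
  refine ext_spin fun e => ?_
  have hs : (e ∘ Equiv.swap i j) ∘ Equiv.swap i j = e := by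
    rw [Function.comp_assoc, ← Equiv.coe_trans]; simp
  simp only [Module.End.mul_apply, LinearMap.add_apply, LinearMap.smul_apply,
    Module.End.one_apply, spinS_spinVec q hij, map_add, map_smul, Function.comp_apply,
    Equiv.swap_apply_left, Equiv.swap_apply_right, hs, sDiag]
  rcases lt_trichotomy (e i) (e j) with h | h | h
  · simp only [h, h.ne, h.ne', h.not_gt, if_true, if_false]; module
  · rw [comp_swap_of_eq h]
    simp only [h, if_true]
    match_scalars
    field_simp
    ring
  · simp only [h, h.ne, h.ne', h.not_gt, if_true, if_false]; module

theorem swap_swap_comm {α : Type*} {N : ℕ} {i j k l : Fin N} (hik : i ≠ k) (hil : i ≠ l)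
    (hjk : j ≠ k) (hjl : j ≠ l) (e : Fin N → α) :
    (e ∘ Equiv.swap i j) ∘ Equiv.swap k l = (e ∘ Equiv.swap k l) ∘ Equiv.swap i j := by
  have h := Equiv.mul_swap_eq_swap_mul (Equiv.swap i j) k l
  rw [Equiv.swap_apply_of_ne_of_ne hik.symm hjk.symm,
    Equiv.swap_apply_of_ne_of_ne hil.symm hjl.symm] at h
  rw [Function.comp_assoc, Function.comp_assoc, ← Equiv.Perm.coe_mul, h, Equiv.Perm.coe_mul]

theorem swap_braid {α : Type*} {N : ℕ} {i j k : Fin N} (hij : i ≠ j) (hjk : j ≠ k) (hik : i ≠ k)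
    (e : Fin N → α) :
    ((e ∘ Equiv.swap i j) ∘ Equiv.swap j k) ∘ Equiv.swap i j =
      ((e ∘ Equiv.swap j k) ∘ Equiv.swap i j) ∘ Equiv.swap j k := by
  simp only [Function.comp_assoc]
  congr 1
  have h := Equiv.mul_swap_eq_swap_mul (Equiv.swap i j) j k
  rw [Equiv.swap_apply_right, Equiv.swap_apply_of_ne_of_ne hik.symm hjk.symm] at h
  have h' := Equiv.mul_swap_eq_swap_mul (Equiv.swap j k) i j
  rw [Equiv.swap_apply_of_ne_of_ne hij hik, Equiv.swap_apply_left] at h'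
  rw [← Equiv.Perm.coe_mul, ← Equiv.Perm.coe_mul, ← Equiv.Perm.coe_mul, ← Equiv.Perm.coe_mul,
    ← mul_assoc, ← mul_assoc, h, h', mul_assoc, mul_assoc, Equiv.swap_mul_self,
    Equiv.swap_mul_self]

theorem spinS_comm (q : ℂ) {n N : ℕ} {i j k l : Fin N} (hij : i ≠ j) (hkl : k ≠ l)
    (hik : i ≠ k) (hil : i ≠ l) (hjk : j ≠ k) (hjl : j ≠ l) :
    Commute (spinS q i j : Module.End ℂ (Spin n N)) (spinS q k l) := by
  refine ext_spin fun e => ?_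
  simp only [Module.End.mul_apply, spinS_spinVec q hij, spinS_spinVec q hkl, map_add, map_smul,
    Function.comp_apply, Equiv.swap_apply_of_ne_of_ne hik hil,
    Equiv.swap_apply_of_ne_of_ne hjk hjl, Equiv.swap_apply_of_ne_of_ne hik.symm hjk.symm,
    Equiv.swap_apply_of_ne_of_ne hil.symm hjl.symm, swap_swap_comm hik hil hjk hjl]
  module

theorem spinS_braid {q : ℂ} (hq : q ≠ 0) {n N : ℕ} {i j k : Fin N} (hij : i ≠ j) (hjk : j ≠ k)
    (hik : i ≠ k) : (spinS q i j * spinS q j k * spinS q i j : Module.End ℂ (Spin n N)) =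
      spinS q j k * spinS q i j * spinS q j k := by
  refine ext_spin fun e => ?_
  have a1 := Equiv.swap_apply_of_ne_of_ne hik.symm hjk.symm
  have a2 := Equiv.swap_apply_of_ne_of_ne hij hik
  have b1 : (e ∘ Equiv.swap i j) ∘ Equiv.swap i j = e := by
    rw [Function.comp_assoc, ← Equiv.coe_trans]; simp
  have b2 : (e ∘ Equiv.swap j k) ∘ Equiv.swap j k = e := by
    rw [Function.comp_assoc, ← Equiv.coe_trans]; simp
  simp only [Module.End.mul_apply, spinS_spinVec q hij, spinS_spinVec q hjk, map_add, map_smul,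
    Function.comp_apply, Equiv.swap_apply_left, Equiv.swap_apply_right, a1, a2,
    swap_braid hij hjk hik, b1, b2]
  generalize hx : e i = x
  generalize hy : e j = y
  generalize hz : e k = z
  have c1 : x = y → e ∘ Equiv.swap i j = e := fun h => comp_swap_of_eq (by rw [hx, hy, h])
  have c2 : y = z → e ∘ Equiv.swap j k = e := fun h => comp_swap_of_eq (by rw [hy, hz, h])
  have c3 : x = z → (e ∘ Equiv.swap j k) ∘ Equiv.swap i j = e ∘ Equiv.swap j k := fun h =>
    comp_swap_of_eq (by simp [a2, hx, hz, h])
  have c4 : x = z → (e ∘ Equiv.swap i j) ∘ Equiv.swap j k = e ∘ Equiv.swap i j := fun h =>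
    comp_swap_of_eq (by simp [a1, hx, hz, h])
  clear hx hy hz
  simp only [sDiag]
  rcases lt_trichotomy x y with h1 | h1 | h1 <;> rcases lt_trichotomy y z with h2 | h2 | h2
  · have h3 := h1.trans h2
    simp only [h1, h2, h3, h1.ne, h1.ne', h2.ne, h2.ne', h3.ne, h1.not_gt, h2.not_gt,
      if_true, if_false]
    module
  · rw [c2 h2]; subst h2
    simp only [h1, h1.ne, h1.ne', h1.not_gt, if_true, if_false]
    match_scalars <;> field_simp <;> ring
  · rcases lt_trichotomy x z with h3 | h3 | h3
    · simp only [h1, h2, h3, h1.ne, h1.ne', h2.ne, h2.ne', h3.ne, h1.not_gt, h2.not_gt,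
        if_true, if_false]
      module
    · rw [c3 h3, c4 h3, b2]; subst h3
      simp only [h1, h1.ne, h1.ne', h1.not_gt, if_true, if_false]
      match_scalars <;> field_simp <;> ring
    · simp only [h1, h2, h1.ne, h1.ne', h2.ne, h2.ne', h3.ne', h1.not_gt, h2.not_gt,
        h3.not_gt, if_true, if_false]
      module
  · rw [c1 h1]; subst h1
    simp only [h2, h2.ne, h2.ne', h2.not_gt, if_true, if_false]
    match_scalars <;> field_simp <;> ring
  · rw [c1 h1, c2 h2]; subst h1; subst h2
    rw [c1 rfl]
  · rw [c1 h1]; subst h1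
    simp only [h2, h2.ne, h2.ne', h2.not_gt, if_true, if_false]
    match_scalars <;> field_simp <;> ring
  · rcases lt_trichotomy x z with h3 | h3 | h3
    · simp only [h1, h2, h3, h1.ne, h1.ne', h2.ne, h2.ne', h3.ne, h1.not_gt, h2.not_gt,
        if_true, if_false]
      module
    · rw [c3 h3, c4 h3, b2]; subst h3
      simp only [h1, h1.ne, h1.ne', h1.not_gt, if_true, if_false]
      match_scalars <;> field_simp <;> ring
    · simp only [h1, h2, h1.ne, h1.ne', h2.ne, h2.ne', h3.ne', h1.not_gt, h2.not_gt,
        h3.not_gt, if_true, if_false]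
      module
  · rw [c2 h2]; subst h2
    simp only [h1, h1.ne, h1.ne', h1.not_gt, if_true, if_false]
    match_scalars <;> field_simp <;> ring
  · have h3 := h2.trans h1
    simp only [h1, h2, h1.ne, h1.ne', h2.ne, h2.ne', h3.ne', h1.not_gt, h2.not_gt,
      h3.not_gt, if_true, if_false]
    module

theorem spinS_inv {q : ℂ} (hq : q ≠ 0) {n N : ℕ} {i j : Fin N} (hij : i ≠ j) :
    Ring.inverse (spinS q i j : Module.End ℂ (Spin n N)) = spinS q i j + (-(q - q⁻¹)) • 1 := by
  have h := spinS_sq hq (n := n) hij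
  have h' : ∀ e : Spin n N, spinS q i j (spinS q i j e) = (q - q⁻¹) • spinS q i j e + e :=
    fun e => congrArg (fun A => A e) h
  refine ringInverse_eq (LinearMap.ext fun e => ?_) (LinearMap.ext fun e => ?_) <;>
  simp only [Module.End.mul_apply, LinearMap.add_apply, LinearMap.smul_apply, map_add, map_smul,
    Module.End.one_apply, h'] <;> module

/-! ### The wedge relations -/

section tens

variable {n N : ℕ}

theorem polyOp_mul (A B : Module.End ℂ (Laurent N)) :
    (polyOp (A * B) : Module.End ℂ (Tens n N)) = polyOp A * polyOp B :=
  LinearMap.rTensor_mul _ _ _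

theorem spinOp_mul (A B : Module.End ℂ (Spin n N)) :
    (spinOp (A * B) : Module.End ℂ (Tens n N)) = spinOp A * spinOp B :=
  LinearMap.lTensor_mul _ _ _

theorem polyOp_tmul (A : Module.End ℂ (Laurent N)) (f : Laurent N) (v : Spin n N) :
    polyOp A (f ⊗ₜ[ℂ] v) = A f ⊗ₜ[ℂ] v := rfl

theorem spinOp_tmul (A : Module.End ℂ (Spin n N)) (f : Laurent N) (v : Spin n N) :
    spinOp A (f ⊗ₜ[ℂ] v) = f ⊗ₜ[ℂ] A v := rfl

theorem polyOp_one : (polyOp 1 : Module.End ℂ (Tens n N)) = 1 := LinearMap.rTensor_id _ _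

theorem spinOp_one : (spinOp 1 : Module.End ℂ (Tens n N)) = 1 := LinearMap.lTensor_id _ _

theorem polyOp_add (A B : Module.End ℂ (Laurent N)) :
    (polyOp (A + B) : Module.End ℂ (Tens n N)) = polyOp A + polyOp B :=
  LinearMap.rTensor_add _ _ _

theorem spinOp_add (A B : Module.End ℂ (Spin n N)) :
    (spinOp (A + B) : Module.End ℂ (Tens n N)) = spinOp A + spinOp B :=
  LinearMap.lTensor_add _ _ _

theorem polyOp_smul (c : ℂ) (A : Module.End ℂ (Laurent N)) :
    (polyOp (c • A) : Module.End ℂ (Tens n N)) = c • polyOp A :=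
  LinearMap.rTensor_smul _ _ _

theorem spinOp_smul (c : ℂ) (A : Module.End ℂ (Spin n N)) :
    (spinOp (c • A) : Module.End ℂ (Tens n N)) = c • spinOp A :=
  LinearMap.lTensor_smul _ _ _

theorem polyOp_spinOp_comm (A : Module.End ℂ (Laurent N)) (B : Module.End ℂ (Spin n N)) :
    Commute (polyOp A) (spinOp B : Module.End ℂ (Tens n N)) :=
  TensorProduct.ext' fun _ _ => rfl

theorem polyOp_comm {A B : Module.End ℂ (Laurent N)} (h : Commute A B) :
    Commute (polyOp A : Module.End ℂ (Tens n N)) (polyOp B) := by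
  change _ * _ = _ * _
  rw [← polyOp_mul, ← polyOp_mul, h.eq]

theorem spinOp_comm {A B : Module.End ℂ (Spin n N)} (h : Commute A B) :
    Commute (spinOp A : Module.End ℂ (Tens n N)) (spinOp B) := by
  change _ * _ = _ * _
  rw [← spinOp_mul, ← spinOp_mul, h.eq]

theorem ext_tens {W : Type*} [AddCommMonoid W] [Module ℂ W] {A B : Tens n N →ₗ[ℂ] W}
    (h : ∀ m e, A (mono m ⊗ₜ[ℂ] spinVec e) = B (mono m ⊗ₜ[ℂ] spinVec e)) : A = B :=
  (tensBasis n N).ext fun me => by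
    rw [← Prod.mk.eta (p := me), tensBasis_apply]; exact h _ _

variable {q : ℂ}

theorem polyOp_heckeG_sq (hq : q ≠ 0) {i j : Fin N} (hij : i ≠ j) :
    (polyOp (heckeG q i j) * polyOp (heckeG q i j) : Module.End ℂ (Tens n N)) =
      (q - q⁻¹) • polyOp (heckeG q i j) + 1 := by
  rw [← polyOp_mul, heckeG_sq hq hij, polyOp_add, polyOp_smul, polyOp_one]

theorem spinOp_spinS_sq (hq : q ≠ 0) {i j : Fin N} (hij : i ≠ j) :
    (spinOp (spinS q i j) * spinOp (spinS q i j) : Module.End ℂ (Tens n N)) =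
      (q - q⁻¹) • spinOp (spinS q i j) + 1 := by
  rw [← spinOp_mul, spinS_sq hq hij, spinOp_add, spinOp_smul, spinOp_one]

theorem wedgeMk_heckeG (hq : q ≠ 0) {i j : Fin N} (hij : (i : ℕ) + 1 = j) (t : Tens n N) :
    wedgeMk q n N (polyOp (heckeG q i j) t) = wedgeMk q n N (spinOp (spinS q i j) t) := by
  have hne := ne_of_succ hij
  rw [← sub_eq_zero, ← map_sub, wedgeMk, Submodule.mkQ_apply, Submodule.Quotient.mk_eq_zero, omega]
  refine Submodule.mem_iSup_of_mem i (Submodule.mem_iSup_of_mem j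
    (Submodule.mem_iSup_of_mem hij ?_))
  rw [LinearMap.mem_ker, spinS_inv hq hne, spinOp_add, spinOp_smul, spinOp_one]
  have h1 := congrArg (fun A => A t) (polyOp_heckeG_sq (n := n) hq hne)
  have h2 := congrArg (fun A => A t) (spinOp_spinS_sq (n := n) hq hne)
  have h3 := congrArg (fun A => A t) (polyOp_spinOp_comm (heckeG q i j) (spinS (n := n) q i j)).eq
  simp only [Module.End.mul_apply, LinearMap.add_apply, LinearMap.smul_apply,
    Module.End.one_apply] at h1 h2 h3
  simp only [LinearMap.add_apply, LinearMap.smul_apply, map_sub,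
    Module.End.one_apply, h1, h2, h3]
  module

theorem omega_le_ker (hq : q ≠ 0) (hq2 : q + q⁻¹ ≠ 0) {W : Type*} [AddCommGroup W] [Module ℂ W]
    (L : Tens n N →ₗ[ℂ] W) (h : ∀ i j : Fin N, (i : ℕ) + 1 = j → ∀ t,
      L (polyOp (heckeG q i j) t) = L (spinOp (spinS q i j) t)) : omega q n N ≤ LinearMap.ker L := by
  refine iSup_le fun i => iSup_le fun j => iSup_le fun hij => ?_
  have hne := ne_of_succ hij
  intro t ht
  rw [LinearMap.mem_ker, spinS_inv hq hne, spinOp_add, spinOp_smul, spinOp_one] at ht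
  simp only [LinearMap.add_apply, LinearMap.smul_apply,
    Module.End.one_apply] at ht
  have h1 := h i j hij t
  have h2 := h i j hij (spinOp (spinS q i j) t)
  have h3 := congrArg (fun A => A t) (polyOp_spinOp_comm (heckeG q i j) (spinS (n := n) q i j)).eq
  have h4 := congrArg (fun A => A t) (spinOp_spinS_sq (n := n) hq hne)
  simp only [Module.End.mul_apply, LinearMap.add_apply, LinearMap.smul_apply,
    Module.End.one_apply] at h3 h4
  have h5 : polyOp (heckeG q i j) t = (q - q⁻¹) • t - spinOp (spinS q i j) t := by
    rw [eq_sub_iff_add_eq, ← sub_eq_zero, ← ht]; module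
  rw [h3, h5, map_sub, map_smul, h4, map_sub, map_add, map_smul] at h2
  rw [h5, map_sub, map_smul] at h1
  rw [LinearMap.mem_ker]
  have key : ((q + q⁻¹) ^ 2) • L t = 0 := by
    have e1 : (2 : ℂ) • L (spinOp (spinS q i j) t) = (q - q⁻¹) • L t := by
      rw [two_smul]; nth_rewrite 1 [← h1]; abel
    have e2 : (2 : ℂ) • L t + (q - q⁻¹) • L (spinOp (spinS q i j) t) = 0 := by
      have : (2 : ℂ) • L t + (q - q⁻¹) • L (spinOp (spinS q i j) t) =
        ((q - q⁻¹) • L (spinOp (spinS q i j) t) + L t) - ((q - q⁻¹) • L (spinOp (spinS q i j) t) -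
          ((q - q⁻¹) • L (spinOp (spinS q i j) t) + L t)) := by module
      rw [this, h2, sub_self]
    have e3 : ((q + q⁻¹) ^ 2) = (q - q⁻¹) * (q - q⁻¹) + 2 * 2 := by field_simp; ring
    rw [e3, add_smul, mul_smul, mul_smul, ← e1, smul_comm _ (2 : ℂ), ← smul_add, add_comm, e2,
      smul_zero]
  exact (smul_eq_zero.1 key).resolve_left (pow_ne_zero _ hq2)

end tens

/-! ### Straightening -/

section wedge

variable {n N : ℕ} {q : ℂ}

theorem wedgeMk_smul_left (c : ℂ) (f : Laurent N) (v : Spin n N) :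
    wedgeMk q n N ((c • f) ⊗ₜ[ℂ] v) = c • wedgeMk q n N (f ⊗ₜ[ℂ] v) := by
  rw [← TensorProduct.smul_tmul', map_smul]

theorem wedgeMk_smul_right (c : ℂ) (f : Laurent N) (v : Spin n N) :
    wedgeMk q n N (f ⊗ₜ[ℂ] (c • v)) = c • wedgeMk q n N (f ⊗ₜ[ℂ] v) := by
  rw [TensorProduct.tmul_smul, map_smul]

theorem wedgeMk_spinS (hq : q ≠ 0) {i j : Fin N} (hij : (i : ℕ) + 1 = j) (f : Laurent N)
    (e : Fin N → Fin n) : wedgeMk q n N (heckeG q i j f ⊗ₜ[ℂ] spinVec e) =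
      sDiag q (e i) (e j) • wedgeMk q n N (f ⊗ₜ[ℂ] spinVec e) -
        wedgeMk q n N (f ⊗ₜ[ℂ] spinVec (e ∘ Equiv.swap i j)) := by
  have h := wedgeMk_heckeG hq hij (f ⊗ₜ[ℂ] spinVec e)
  rw [polyOp_tmul, spinOp_tmul, spinS_spinVec q (ne_of_succ hij), TensorProduct.tmul_add, map_add,
    wedgeMk_smul_right, wedgeMk_smul_right] at h
  rw [h]; module

theorem wedgeMk_eigen_eq (hq : q ≠ 0) (hq2 : q + q⁻¹ ≠ 0) {i j : Fin N} (hij : (i : ℕ) + 1 = j)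
    {f : Laurent N} {e : Fin N → Fin n} (hf : heckeG q i j f = q • f) (he : e i = e j) :
    wedgeMk q n N (f ⊗ₜ[ℂ] spinVec e) = 0 := by
  have h := wedgeMk_spinS hq hij f e
  rw [hf, wedgeMk_smul_left, comp_swap_of_eq he] at h
  simp only [sDiag, he, if_true] at h
  have : (q + q⁻¹) • wedgeMk q n N (f ⊗ₜ[ℂ] spinVec e) = 0 := by
    have h' := sub_eq_zero.2 h
    rw [← h']; module
  exact (smul_eq_zero.1 this).resolve_left hq2

theorem wedgeMk_eigen_lt (hq : q ≠ 0) {i j : Fin N} (hij : (i : ℕ) + 1 = j)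
    {f : Laurent N} {e : Fin N → Fin n} (hf : heckeG q i j f = q • f) (he : e i < e j) :
    wedgeMk q n N (f ⊗ₜ[ℂ] spinVec e) =
      (-q) • wedgeMk q n N (f ⊗ₜ[ℂ] spinVec (e ∘ Equiv.swap i j)) := by
  have h := wedgeMk_spinS hq hij f e
  rw [hf, wedgeMk_smul_left] at h
  simp only [sDiag, he.ne, he, if_true, if_false] at h
  have h' : q⁻¹ • wedgeMk q n N (f ⊗ₜ[ℂ] spinVec e) =
      -wedgeMk q n N (f ⊗ₜ[ℂ] spinVec (e ∘ Equiv.swap i j)) := by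
    rw [← sub_eq_zero] at h ⊢
    rw [← h]; module
  rw [neg_smul, ← smul_neg, ← h', smul_smul, mul_inv_cancel₀ hq, one_smul]

theorem wedgeMon_eq_eq (hq : q ≠ 0) (hq2 : q + q⁻¹ ≠ 0) {i j : Fin N} (hij : (i : ℕ) + 1 = j)
    {m : Fin N → ℤ} {e : Fin N → Fin n} (hm : m i = m j) (he : e i = e j) :
    wedgeMon q m e = 0 := wedgeMk_eigen_eq hq hq2 hij (heckeG_mono_eq q hm) he

theorem wedgeMon_eq_lt (hq : q ≠ 0) {i j : Fin N} (hij : (i : ℕ) + 1 = j)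
    {m : Fin N → ℤ} {e : Fin N → Fin n} (hm : m i = m j) (he : e i < e j) :
    wedgeMon q m e = (-q) • wedgeMon q m (e ∘ Equiv.swap i j) :=
  wedgeMk_eigen_lt hq hij (heckeG_mono_eq q hm) he

/-- The wedges that can occur after exchanging two factors in the wrong order. -/
theorem wedgeMon_gt (hq : q ≠ 0) {i j : Fin N} (hij : (i : ℕ) + 1 = j)
    {m : Fin N → ℤ} (e : Fin N → Fin n) (hm : m j < m i) {V : Submodule ℂ (Wedge q n N)}
    (h1 : e i ≤ e j → wedgeMon q (m ∘ Equiv.swap i j) e ∈ V)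
    (h2 : wedgeMon q (m ∘ Equiv.swap i j) (e ∘ Equiv.swap i j) ∈ V)
    (h3 : ∀ ν, Inner i j m ν → wedgeMon q ν e ∈ V) : wedgeMon q m e ∈ V := by
  have hne := ne_of_succ hij
  have hs : (m ∘ Equiv.swap i j) ∘ Equiv.swap i j = m := by
    rw [Function.comp_assoc, ← Equiv.coe_trans]; simp
  have h := wedgeMk_spinS hq hij (mono (m ∘ Equiv.swap i j)) e
  have hR := heckeG_mono_lt q hne (m := m ∘ Equiv.swap i j) (by simpa using hm)
  rw [hs] at hR
  have hin : ∀ ν, Inner i j (m ∘ Equiv.swap i j) ν → Inner i j m ν := by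
    rintro ν ⟨h1, h2, h3, h4⟩
    refine ⟨fun l hi hj => ?_, ?_, ?_, ?_⟩
    · rw [h1 l hi hj, Function.comp_apply, Equiv.swap_apply_of_ne_of_ne hi hj]
    · simpa [add_comm] using h2
    · simpa [or_comm] using h3
    · simpa [or_comm] using h4
  have hR' : wedgeMk q n N ((heckeG q i j (mono (m ∘ Equiv.swap i j)) - q⁻¹ • mono m) ⊗ₜ[ℂ]
      spinVec e) ∈ V := by
    have := monoSpan_induction (P := {ν | Inner i j (m ∘ Equiv.swap i j) ν}) (V := V)
      (A := (wedgeMk q n N).comp ((TensorProduct.mk ℂ _ _).flip (spinVec e)))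
      (fun ν hν => h3 ν (hin ν hν)) _ hR
    exact this
  have e1 : wedgeMon q m e = q • (wedgeMk q n N (heckeG q i j (mono (m ∘ Equiv.swap i j)) ⊗ₜ[ℂ]
      spinVec e) - wedgeMk q n N ((heckeG q i j (mono (m ∘ Equiv.swap i j)) - q⁻¹ • mono m) ⊗ₜ[ℂ]
      spinVec e)) := by
    rw [← map_sub, ← TensorProduct.sub_tmul, sub_sub_cancel, wedgeMk_smul_left, smul_smul,
      mul_inv_cancel₀ hq, one_smul]
    rfl
  rw [e1, h]
  refine V.smul_mem _ (V.sub_mem (V.sub_mem ?_ h2) hR')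
  rcases le_or_gt (e i) (e j) with h | h
  · exact V.smul_mem _ (h1 h)
  · simp [sDiag, h.ne', h.not_gt]

end wedge

/-! ### Labelling by the indices `k` -/

section labels

variable {n : ℕ}

/-- The index `ε - 1` in `u_k = z^m v_ε`. -/
def aOf (n : ℕ) [NeZero n] (k : ℤ) : Fin n :=
  ⟨((k - 1) % n).toNat, by
    have hn : (0 : ℤ) < n := by exact_mod_cast Nat.pos_of_ne_zero (NeZero.ne n)
    have := Int.emod_lt_of_pos (k - 1) hn
    have := Int.emod_nonneg (k - 1) hn.ne'
    omega⟩

theorem aOf_val [NeZero n] (k : ℤ) : ((aOf n k : ℕ) : ℤ) = (k - 1) % n := by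
  have hn : (0 : ℤ) < n := by exact_mod_cast Nat.pos_of_ne_zero (NeZero.ne n)
  exact Int.toNat_of_nonneg (Int.emod_nonneg _ hn.ne')

theorem uIndex_mOf_aOf [NeZero n] (k : ℤ) : uIndex (mOf n k) (aOf n k) = k := by
  rw [uIndex, aOf_val, mOf]
  have := Int.emod_add_mul_ediv (k - 1) n
  linarith

theorem uIndex_injective {m m' : ℤ} {a a' : Fin n} (h : uIndex m a = uIndex m' a') :
    m = m' ∧ a = a' := by
  have hm : m = m' := by rw [← mOf_uIndex m a, h, mOf_uIndex]
  subst hm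
  simp only [uIndex] at h
  exact ⟨rfl, Fin.ext (by omega)⟩

theorem aOf_uIndex [NeZero n] (m : ℤ) (a : Fin n) : aOf n (uIndex m a) = a :=
  (uIndex_injective (uIndex_mOf_aOf (n := n) (uIndex m a))).2

theorem uIndex_lt_iff {m m' : ℤ} {a a' : Fin n} :
    uIndex m a < uIndex m' a' ↔ m' < m ∨ m = m' ∧ a < a' := by
  have ha := a.2
  have ha' := a'.2
  simp only [uIndex, Fin.lt_def]
  constructor
  · intro h
    rcases lt_trichotomy m m' with h1 | h1 | h1
    · have : (n : ℤ) * (m + 1) ≤ n * m' := Int.mul_le_mul_of_nonneg_left (by omega) (by omega)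
      rw [mul_add] at this
      omega
    · subst h1; right; exact ⟨rfl, by omega⟩
    · exact Or.inl h1
  · rintro (h1 | ⟨rfl, h1⟩)
    · have : (n : ℤ) * (m' + 1) ≤ n * m := Int.mul_le_mul_of_nonneg_left (by omega) (by omega)
      rw [mul_add] at this
      omega
    · omega

theorem uIndex_le_iff {m m' : ℤ} {a a' : Fin n} :
    uIndex m a ≤ uIndex m' a' ↔ m' < m ∨ m = m' ∧ a ≤ a' := by
  rw [← not_lt, uIndex_lt_iff]
  constructor
  · intro h
    push Not at h
    rcases h.1.lt_or_eq with h1 | h1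
    · exact Or.inl h1
    · exact Or.inr ⟨h1.symm, h.2 h1⟩
  · rintro (h | ⟨rfl, h⟩) (h' | ⟨h1, h'⟩)
    · omega
    · omega
    · omega
    · exact absurd h' h.not_gt

/-- The label `k` of `z^m v_e`. -/
def kIdx {N : ℕ} (m : Fin N → ℤ) (e : Fin N → Fin n) : Fin N → ℤ := fun i => uIndex (m i) (e i)

/-- `u_{k_1} ∧ ⋯ ∧ u_{k_N}`. -/
def wk (q : ℂ) (n : ℕ) [NeZero n] {N : ℕ} (k : Fin N → ℤ) : Wedge q n N :=
  wedgeMon q (fun i => mOf n (k i)) (fun i => aOf n (k i))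

theorem wk_kIdx (q : ℂ) [NeZero n] {N : ℕ} (m : Fin N → ℤ) (e : Fin N → Fin n) :
    wk q n (kIdx m e) = wedgeMon q m e := by
  simp only [wk, kIdx, mOf_uIndex, aOf_uIndex]

theorem kIdx_of [NeZero n] {N : ℕ} (k : Fin N → ℤ) :
    kIdx (fun i => mOf n (k i)) (fun i => aOf n (k i)) = k := by
  funext i; exact uIndex_mOf_aOf _

/-- A straightening step at the positions `i, j`. -/
def Move (n : ℕ) {N : ℕ} (i j : Fin N) (k k' : Fin N → ℤ) : Prop :=
  (∀ l, l ≠ i → l ≠ j → k' l = k l) ∧ k' i + k' j = k i + k j ∧ k i ≤ k' j ∧ k' j < k j ∧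
    mOf n (k' i) + mOf n (k' j) = mOf n (k i) + mOf n (k j)

variable {q : ℂ} {N : ℕ} [NeZero n]

theorem wk_mem_of_move (hq : q ≠ 0) (hq2 : q + q⁻¹ ≠ 0) {i j : Fin N} (hij : (i : ℕ) + 1 = j)
    {k : Fin N → ℤ} (hk : k i ≤ k j) {V : Submodule ℂ (Wedge q n N)}
    (h : ∀ k', Move n i j k k' → wk q n k' ∈ V) : wk q n k ∈ V := by
  have hne := ne_of_succ hij
  obtain ⟨m, e, rfl⟩ : ∃ m e, k = kIdx (n := n) m e := ⟨_, _, (kIdx_of k).symm⟩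
  have h' : ∀ m' e', Move n i j (kIdx (n := n) m e) (kIdx m' e') → wedgeMon q m' e' ∈ V :=
    fun m' e' hm => by rw [← wk_kIdx]; exact h _ hm
  rw [wk_kIdx]
  have hk' : uIndex (m i) (e i) ≤ uIndex (m j) (e j) := hk
  rw [uIndex_le_iff] at hk'
  rcases hk' with hm | ⟨hm, he⟩
  · refine wedgeMon_gt hq hij e hm (fun he => h' _ _ ?_) (h' _ _ ?_) (fun ν hν => h' _ _ ?_)
    · refine ⟨fun l hi hj => ?_, ?_, ?_, ?_, ?_⟩
      · simp [kIdx, Equiv.swap_apply_of_ne_of_ne hi hj]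
      · simp [kIdx, uIndex]; ring
      · simp only [kIdx, Function.comp_apply, Equiv.swap_apply_right]
        exact uIndex_le_iff.2 (Or.inr ⟨rfl, he⟩)
      · simp only [kIdx, Function.comp_apply, Equiv.swap_apply_right]
        exact uIndex_lt_iff.2 (Or.inl hm)
      · simp [kIdx, mOf_uIndex, add_comm]
    · refine ⟨fun l hi hj => ?_, ?_, ?_, ?_, ?_⟩
      · simp [kIdx, Equiv.swap_apply_of_ne_of_ne hi hj]
      · simp [kIdx, add_comm]
      · simp [kIdx]
      · simp only [kIdx, Function.comp_apply, Equiv.swap_apply_right]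
        exact uIndex_lt_iff.2 (Or.inl hm)
      · simp [kIdx, mOf_uIndex, add_comm]
    · obtain ⟨h1, h2, h3, h4⟩ := hν
      rw [min_eq_right hm.le] at h3
      rw [max_eq_left hm.le] at h4
      refine ⟨fun l hi hj => ?_, ?_, ?_, ?_, ?_⟩
      · simp [kIdx, h1 l hi hj]
      · simp only [kIdx, uIndex]; linear_combination (-(n : ℤ)) * h2
      · simp only [kIdx]; exact uIndex_le_iff.2 (Or.inl (by omega))
      · simp only [kIdx]; exact uIndex_lt_iff.2 (Or.inl (by omega))
      · simpa [kIdx, mOf_uIndex] using h2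
  · rcases he.lt_or_eq with he | he
    · rw [wedgeMon_eq_lt hq hij hm he]
      refine V.smul_mem _ (h' _ _ ⟨fun l hi hj => ?_, ?_, ?_, ?_, ?_⟩)
      · simp [kIdx, Equiv.swap_apply_of_ne_of_ne hi hj]
      · simp [kIdx, uIndex]; ring
      · simp [kIdx, hm]
      · simp only [kIdx, Function.comp_apply, Equiv.swap_apply_right]
        exact uIndex_lt_iff.2 (Or.inr ⟨rfl, he⟩)
      · simp [kIdx, mOf_uIndex]
    · rw [wedgeMon_eq_eq hq hq2 hij hm he]; exact V.zero_mem

theorem sum_pair_lt {N : ℕ} {i j : Fin N} (hij : (i : ℕ) + 1 = j) {k k' : Fin N → ℤ}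
    (h1 : ∀ l, l ≠ i → l ≠ j → k' l = k l) (h2 : k' i + k' j = k i + k j) (h3 : k' j < k j) :
    ∑ l : Fin N, ((l : ℕ) : ℤ) * k' l < ∑ l : Fin N, ((l : ℕ) : ℤ) * k l := by
  have hne := ne_of_succ hij
  have e : ∀ f : Fin N → ℤ, ∑ l, f l = f i + f j + ∑ l ∈ (Finset.univ.erase i).erase j, f l := by
    intro f
    rw [add_assoc, Finset.add_sum_erase _ f (by simp [hne.symm]),
      Finset.add_sum_erase _ f (by simp)]
  rw [e (fun l => ((l : ℕ) : ℤ) * k' l), e (fun l => ((l : ℕ) : ℤ) * k l)]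
  have e2 : ∑ l ∈ (Finset.univ.erase i).erase j, ((l : ℕ) : ℤ) * k' l =
      ∑ l ∈ (Finset.univ.erase i).erase j, ((l : ℕ) : ℤ) * k l := by
    refine Finset.sum_congr rfl fun l hl => ?_
    simp only [Finset.mem_erase, Finset.mem_univ, and_true] at hl
    rw [h1 l hl.2 hl.1]
  have hj : ((j : ℕ) : ℤ) = (i : ℕ) + 1 := by omega
  simp only [e2, hj]
  have e3 : k' i = k i + k j - k' j := by omega
  rw [e3]
  nlinarith

theorem straighten (hq : q ≠ 0) (hq2 : q + q⁻¹ ≠ 0) (a : ℕ) (P : (Fin N → ℤ) → Prop)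
    (hP : ∀ (i j : Fin N) (k k' : Fin N → ℤ), (i : ℕ) + 1 = j → a ≤ i → P k → Move n i j k k' → P k')
    (k : Fin N → ℤ) (hk : P k) :
    wk q n k ∈ Submodule.span ℂ {w | ∃ K, P K ∧
      (∀ i j : Fin N, (i : ℕ) + 1 = j → a ≤ i → K j < K i) ∧ w = wk q n K} := by
  obtain ⟨b, hb⟩ : ∃ b : ℤ, ∀ l, b ≤ k l := by
    obtain ⟨b, hb⟩ := (Set.finite_range k).bddBelow
    exact ⟨b, fun l => hb ⟨l, rfl⟩⟩
  have key : ∀ (d : ℕ) (k : Fin N → ℤ), P k → (∀ l, b ≤ k l) →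
      ∑ l : Fin N, ((l : ℕ) : ℤ) * (k l - b) ≤ d →
      wk q n k ∈ Submodule.span ℂ {w | ∃ K, P K ∧
        (∀ i j : Fin N, (i : ℕ) + 1 = j → a ≤ i → K j < K i) ∧ w = wk q n K} := by
    intro d
    induction d with
    | zero =>
      intro k hk hb hd
      by_cases hs : ∀ i j : Fin N, (i : ℕ) + 1 = j → a ≤ i → k j < k i
      · exact Submodule.subset_span ⟨k, hk, hs, rfl⟩
      · push Not at hs
        obtain ⟨i, j, hij, hai, hs⟩ := hs
        refine wk_mem_of_move hq hq2 hij hs fun k' hk' => ?_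
        exfalso
        obtain ⟨h1, h2, h3, h4, -⟩ := hk'
        have hlt := sum_pair_lt (k := fun l => k l - b) (k' := fun l => k' l - b) hij
          (fun l hi hj => by simp [h1 l hi hj]) (by omega) (by omega)
        have hnn : 0 ≤ ∑ l : Fin N, ((l : ℕ) : ℤ) * (k' l - b) := by
          refine Finset.sum_nonneg fun l _ => mul_nonneg (by positivity) ?_
          by_cases hli : l = i
          · subst hli; have := hb l; omega
          · by_cases hlj : l = j
            · subst hlj; have := hb i; omega
            · rw [h1 l hli hlj]; have := hb l; omega
        simp only [Nat.cast_zero] at hd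
        omega
    | succ d ih =>
      intro k hk hb hd
      by_cases hs : ∀ i j : Fin N, (i : ℕ) + 1 = j → a ≤ i → k j < k i
      · exact Submodule.subset_span ⟨k, hk, hs, rfl⟩
      · push Not at hs
        obtain ⟨i, j, hij, hai, hs⟩ := hs
        refine wk_mem_of_move hq hq2 hij hs fun k' hk' => ?_
        have hP' := hP i j k k' hij hai hk hk'
        obtain ⟨h1, h2, h3, h4, -⟩ := hk'
        have hlt := sum_pair_lt (k := fun l => k l - b) (k' := fun l => k' l - b) hij
          (fun l hi hj => by simp [h1 l hi hj]) (by omega) (by omega)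
        refine ih k' hP' (fun l => ?_) ?_
        · by_cases hli : l = i
          · subst hli; have := hb l; omega
          · by_cases hlj : l = j
            · subst hlj; have := hb i; omega
            · rw [h1 l hli hlj]; exact hb l
        · push_cast at hd
          omega
  have h0 : 0 ≤ ∑ l : Fin N, ((l : ℕ) : ℤ) * (k l - b) :=
    Finset.sum_nonneg fun l _ => mul_nonneg (by positivity) (sub_nonneg.2 (hb l))
  exact key (∑ l : Fin N, ((l : ℕ) : ℤ) * (k l - b)).toNat k hk hb (Int.toNat_of_nonneg h0).ge

theorem strictAnti_of_succ {N : ℕ} {k : Fin N → ℤ}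
    (h : ∀ i j : Fin N, (i : ℕ) + 1 = j → k j < k i) : StrictAnti k := by
  cases N with
  | zero => exact fun i => i.elim0
  | succ N => exact Fin.strictAnti_iff_succ_lt.2 fun i => h _ _ (by simp)

end labels

/-! ### Extending a family from the monotone sequences along a Hecke module -/

section bfam

variable {N : ℕ}

theorem comp_swap_swap {α : Type*} (i j : Fin N) (m : Fin N → α) :
    (m ∘ Equiv.swap i j) ∘ Equiv.swap i j = m := by
  rw [Function.comp_assoc, ← Equiv.coe_trans]; simp

/-- A natural number that drops when a descent is sorted. -/
def sortWeight (μ : Fin N → ℤ) : ℕ :=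
  (∑ i : Fin N, ((N : ℤ) * |μ i| - ((i : ℕ) : ℤ) * μ i)).toNat

theorem sortWeight_lt {i j : Fin N} (hij : (i : ℕ) + 1 = j) {μ : Fin N → ℤ} (h : μ j < μ i) :
    sortWeight (μ ∘ Equiv.swap i j) < sortWeight μ := by
  have h1 := sum_pair_lt (k := μ ∘ Equiv.swap i j) (k' := μ) hij
    (fun l hi hj => by simp [Equiv.swap_apply_of_ne_of_ne hi hj]) (by simp [add_comm])
    (by simpa using h)
  have h2 : ∑ l : Fin N, (N : ℤ) * |(μ ∘ Equiv.swap i j) l| = ∑ l : Fin N, (N : ℤ) * |μ l| :=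
    Equiv.sum_comp (Equiv.swap i j) fun l => (N : ℤ) * |μ l|
  have h3 : ∀ ν : Fin N → ℤ, 0 ≤ ∑ l : Fin N, ((N : ℤ) * |ν l| - ((l : ℕ) : ℤ) * ν l) := by
    intro ν
    refine Finset.sum_nonneg fun l _ => sub_nonneg.2 ?_
    have h4 : ((l : ℕ) : ℤ) ≤ N := by exact_mod_cast l.2.le
    exact (mul_le_mul_of_nonneg_left (le_abs_self (ν l)) (by positivity)).trans
      (mul_le_mul_of_nonneg_right h4 (abs_nonneg _))
  have h5 := h3 μ
  have h6 := h3 (μ ∘ Equiv.swap i j)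
  rw [sortWeight, sortWeight]
  rw [Finset.sum_sub_distrib] at h5 h6 ⊢
  rw [Finset.sum_sub_distrib]
  omega

variable {X : Type*} [AddCommGroup X] [Module ℂ X]

open Classical in
/-- The family `b` with `b_μ = T_i b_{s_i μ}` at the descents of `μ`, equal to `b0` on the monotone
sequences. -/
def bfam (T : Fin N → Fin N → Module.End ℂ X) (b0 : (Fin N → ℤ) → X) (μ : Fin N → ℤ) : X :=
  if h : ∃ x : Fin N × Fin N, (x.1 : ℕ) + 1 = x.2 ∧ μ x.2 < μ x.1 then
    T h.choose.1 h.choose.2 (bfam T b0 (μ ∘ Equiv.swap h.choose.1 h.choose.2))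
  else b0 μ
termination_by sortWeight μ
decreasing_by exact sortWeight_lt h.choose_spec.1 h.choose_spec.2

theorem bfam_cases (T : Fin N → Fin N → Module.End ℂ X) (b0 : (Fin N → ℤ) → X) (μ : Fin N → ℤ) :
    (Monotone μ ∧ bfam T b0 μ = b0 μ) ∨ ∃ i j : Fin N, (i : ℕ) + 1 = j ∧ μ j < μ i ∧
      bfam T b0 μ = T i j (bfam T b0 (μ ∘ Equiv.swap i j)) := by
  by_cases h : ∃ x : Fin N × Fin N, (x.1 : ℕ) + 1 = x.2 ∧ μ x.2 < μ x.1
  · refine Or.inr ⟨_, _, h.choose_spec.1, h.choose_spec.2, ?_⟩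
    rw [bfam, dif_pos h]
  · refine Or.inl ⟨?_, by rw [bfam, dif_neg h]⟩
    push Not at h
    cases N with
    | zero => exact fun i => i.elim0
    | succ N => exact Fin.monotone_iff_le_succ.2 fun i => h (i.castSucc, i.succ) (by simp)

theorem bfam_of_monotone {T : Fin N → Fin N → Module.End ℂ X} {b0 : (Fin N → ℤ) → X}
    {μ : Fin N → ℤ} (hμ : Monotone μ) : bfam T b0 μ = b0 μ := by
  rcases bfam_cases T b0 μ with h | ⟨i, j, hij, h, -⟩
  · exact h.2
  · have hle : i ≤ j := by rw [Fin.le_def]; omega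
    exact absurd (hμ hle) (not_le.2 h)

variable {q : ℂ} {T : Fin N → Fin N → Module.End ℂ X} (hT : HeckeFamily q T)

theorem swap_apply_far {i j k l : Fin N} (hij : (i : ℕ) + 1 = j) (hkl : (k : ℕ) + 1 = l)
    (h : j < k ∨ l < i) : i ≠ k ∧ i ≠ l ∧ j ≠ k ∧ j ≠ l := by
  simp only [ne_eq, Fin.ext_iff, Fin.lt_def] at *
  omega

include hT in
theorem HeckeFamily.comm' {i j k l : Fin N} (hij : (i : ℕ) + 1 = j) (hkl : (k : ℕ) + 1 = l)
    (h : j < k ∨ l < i) : Commute (T i j) (T k l) := by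
  rcases h with h | h
  · exact hT.comm i j k l hij hkl h
  · exact (hT.comm k l i j hkl hij h).symm

theorem swap_pair_cases {i j k l : Fin N} (hij : (i : ℕ) + 1 = j) (hkl : (k : ℕ) + 1 = l) :
    (i = k ∧ j = l) ∨ (j < k ∨ l < i) ∨ j = k ∨ l = i := by
  simp only [Fin.ext_iff, Fin.lt_def]
  omega

include hT in
theorem bfam_braid_step {b0 : (Fin N → ℤ) → X} {μ : Fin N → ℤ} {i j k : Fin N}
    (hij : (i : ℕ) + 1 = j) (hjk : (j : ℕ) + 1 = k) (h1 : μ j < μ i) (h2 : μ k < μ j)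
    (ih : ∀ ν, sortWeight ν < sortWeight μ → ∀ i j : Fin N, (i : ℕ) + 1 = j → ν j < ν i →
      bfam T b0 ν = T i j (bfam T b0 (ν ∘ Equiv.swap i j))) :
    T i j (bfam T b0 (μ ∘ Equiv.swap i j)) = T j k (bfam T b0 (μ ∘ Equiv.swap j k)) := by
  have hij' := ne_of_succ hij
  have hjk' := ne_of_succ hjk
  have hik : i ≠ k := by rw [ne_eq, Fin.ext_iff]; omega
  have a1 := Equiv.swap_apply_of_ne_of_ne hik.symm hjk'.symm
  have a2 := Equiv.swap_apply_of_ne_of_ne hij' hik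
  have w1 := sortWeight_lt hij h1
  have w2 := sortWeight_lt hjk h2
  have d1 : (μ ∘ Equiv.swap i j) k < (μ ∘ Equiv.swap i j) j := by simpa [a1] using h2.trans h1
  have d2 : (μ ∘ Equiv.swap j k) j < (μ ∘ Equiv.swap j k) i := by simpa [a2] using h2.trans h1
  have w3 := sortWeight_lt hjk d1
  have w4 := sortWeight_lt hij d2
  rw [ih _ w1 j k hjk d1, ih _ (w3.trans w1) i j hij (by simpa [a1, a2] using h2),
    ih _ w2 i j hij d2, ih _ (w4.trans w2) j k hjk (by simpa [a1, a2] using h1),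
    swap_braid hij' hjk' hik]
  have := congrArg (fun A => A (bfam T b0 (((μ ∘ Equiv.swap j k) ∘ Equiv.swap i j) ∘
    Equiv.swap j k))) (hT.braid i j k hij hjk)
  simpa only [Module.End.mul_apply] using this

include hT in
theorem bfam_desc (b0 : (Fin N → ℤ) → X) : ∀ (d : ℕ) (μ : Fin N → ℤ), sortWeight μ < d →
    ∀ i j : Fin N, (i : ℕ) + 1 = j → μ j < μ i →
      bfam T b0 μ = T i j (bfam T b0 (μ ∘ Equiv.swap i j))
  | 0, _, h => fun _ _ _ _ => absurd h (Nat.not_lt_zero _)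
  | d + 1, μ, hd => by
    intro i j hij h
    have ih : ∀ ν, sortWeight ν < sortWeight μ → ∀ i j : Fin N, (i : ℕ) + 1 = j → ν j < ν i →
      bfam T b0 ν = T i j (bfam T b0 (ν ∘ Equiv.swap i j)) :=
      fun ν hν => bfam_desc b0 d ν (by omega)
    rcases bfam_cases T b0 μ with h' | ⟨k, l, hkl, h', e⟩
    · have hle : i ≤ j := by rw [Fin.le_def]; omega
      exact absurd (h'.1 hle) (not_le.2 h)
    rw [e]
    rcases swap_pair_cases hij hkl with ⟨rfl, rfl⟩ | hfar | rfl | rfl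
    · rfl
    · obtain ⟨hik, hil, hjk, hjl⟩ := swap_apply_far hij hkl hfar
      have a1 := Equiv.swap_apply_of_ne_of_ne hik hil
      have a2 := Equiv.swap_apply_of_ne_of_ne hjk hjl
      have a3 := Equiv.swap_apply_of_ne_of_ne hik.symm hjk.symm
      have a4 := Equiv.swap_apply_of_ne_of_ne hil.symm hjl.symm
      rw [ih _ (sortWeight_lt hkl h') i j hij (by simpa [a1, a2] using h),
        ih _ (sortWeight_lt hij h) k l hkl (by simpa [a3, a4] using h'),
        swap_swap_comm hik hil hjk hjl]
      exact (congrArg (fun A => A (bfam T b0 ((μ ∘ Equiv.swap k l) ∘ Equiv.swap i j)))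
        (hT.comm' hij hkl hfar).eq).symm
    · exact (bfam_braid_step hT hij hkl h h' ih).symm
    · exact bfam_braid_step hT hkl hij h' h ih

include hT in
theorem bfam_gt (b0 : (Fin N → ℤ) → X) {μ : Fin N → ℤ} {i j : Fin N} (hij : (i : ℕ) + 1 = j)
    (h : μ j < μ i) : T i j (bfam T b0 (μ ∘ Equiv.swap i j)) = bfam T b0 μ :=
  (bfam_desc hT b0 _ μ (Nat.lt_succ_self _) i j hij h).symm

include hT in
theorem bfam_act_lt (b0 : (Fin N → ℤ) → X) {μ : Fin N → ℤ} {i j : Fin N} (hij : (i : ℕ) + 1 = j)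
    (h : μ i < μ j) : T i j (bfam T b0 μ) = bfam T b0 (μ ∘ Equiv.swap i j) := by
  have := bfam_gt hT b0 (μ := μ ∘ Equiv.swap i j) hij (by simpa using h)
  rwa [comp_swap_swap] at this

include hT in
theorem bfam_act_gt (b0 : (Fin N → ℤ) → X) {μ : Fin N → ℤ} {i j : Fin N} (hij : (i : ℕ) + 1 = j)
    (h : μ j < μ i) : T i j (bfam T b0 μ) =
      bfam T b0 (μ ∘ Equiv.swap i j) + (q - q⁻¹) • bfam T b0 μ := by
  rw [← bfam_gt hT b0 hij h, ← Module.End.mul_apply, hT.sq i j hij]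
  simp [add_comm]

include hT in
theorem bfam_act_eq {b0 : (Fin N → ℤ) → X} (hb : ∀ m, Monotone m → ∀ i j : Fin N,
    (i : ℕ) + 1 = j → m i = m j → T i j (b0 m) = q • b0 m) :
    ∀ (d : ℕ) (μ : Fin N → ℤ), sortWeight μ < d → ∀ i j : Fin N, (i : ℕ) + 1 = j → μ i = μ j →
      T i j (bfam T b0 μ) = q • bfam T b0 μ
  | 0, _, h => fun _ _ _ _ => absurd h (Nat.not_lt_zero _)
  | d + 1, μ, hd => by
    intro i j hij h
    rcases bfam_cases T b0 μ with h' | ⟨k, l, hkl, h', e⟩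
    · rw [h'.2]; exact hb μ h'.1 i j hij h
    have w1 := sortWeight_lt hkl h'
    rcases swap_pair_cases hij hkl with ⟨rfl, rfl⟩ | hfar | rfl | rfl
    · omega
    · obtain ⟨hik, hil, hjk, hjl⟩ := swap_apply_far hij hkl hfar
      have a1 := Equiv.swap_apply_of_ne_of_ne hik hil
      have a2 := Equiv.swap_apply_of_ne_of_ne hjk hjl
      have := bfam_act_eq hb d (μ ∘ Equiv.swap k l) (by omega) i j hij (by simpa [a1, a2] using h)
      rw [e, ← map_smul, ← this]
      exact congrArg (fun A => A (bfam T b0 (μ ∘ Equiv.swap k l))) (hT.comm' hij hkl hfar).eq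
    · have hij' := ne_of_succ hij
      have hjl := ne_of_succ hkl
      have hil : i ≠ l := by rw [ne_eq, Fin.ext_iff]; omega
      have a1 := Equiv.swap_apply_of_ne_of_ne hil.symm hjl.symm
      have a2 := Equiv.swap_apply_of_ne_of_ne hij' hil
      have d2 : (μ ∘ Equiv.swap j l) j < (μ ∘ Equiv.swap j l) i := by simpa [a2, h] using h'
      have w2 := sortWeight_lt hij d2
      have := bfam_act_eq hb d ((μ ∘ Equiv.swap j l) ∘ Equiv.swap i j) (by omega) j l hkl
        (by simp [a1, a2, h])
      rw [e, ← bfam_gt hT b0 hij d2, ← map_smul, ← map_smul, ← this]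
      exact congrArg (fun A => A (bfam T b0 ((μ ∘ Equiv.swap j l) ∘ Equiv.swap i j)))
        (hT.braid i j l hij hkl)
    · have hlj := ne_of_succ hij
      have hkl' := ne_of_succ hkl
      have hkj : k ≠ j := by rw [ne_eq, Fin.ext_iff]; omega
      have a1 := Equiv.swap_apply_of_ne_of_ne hkj.symm hlj.symm
      have a2 := Equiv.swap_apply_of_ne_of_ne hkl' hkj
      have d2 : (μ ∘ Equiv.swap k l) j < (μ ∘ Equiv.swap k l) l := by simpa [a1, ← h] using h'
      have w2 := sortWeight_lt hij d2
      have := bfam_act_eq hb d ((μ ∘ Equiv.swap k l) ∘ Equiv.swap l j) (by omega) k l hkl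
        (by simp [a1, a2, h])
      rw [e, ← bfam_gt hT b0 hij d2, ← map_smul, ← map_smul, ← this]
      exact (congrArg (fun A => A (bfam T b0 ((μ ∘ Equiv.swap k l) ∘ Equiv.swap l j)))
        (hT.braid k l j hkl hij)).symm

/-- The sum of the squares of the entries. -/
def sqSum (μ : Fin N → ℤ) : ℤ := ∑ l, μ l ^ 2

theorem sqSum_swap (i j : Fin N) (μ : Fin N → ℤ) : sqSum (μ ∘ Equiv.swap i j) = sqSum μ :=
  Equiv.sum_comp (Equiv.swap i j) fun l => μ l ^ 2

theorem bfam_eq_zero {T : Fin N → Fin N → Module.End ℂ X} {b0 : (Fin N → ℤ) → X} {c : ℤ}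
    (hb : ∀ m, sqSum m ≠ c → b0 m = 0) : ∀ (d : ℕ) (μ : Fin N → ℤ), sortWeight μ < d →
      sqSum μ ≠ c → bfam T b0 μ = 0
  | 0, _, h => absurd h (Nat.not_lt_zero _)
  | d + 1, μ, hd => by
    intro hc
    rcases bfam_cases T b0 μ with h' | ⟨k, l, hkl, h', e⟩
    · rw [h'.2, hb μ hc]
    · have w1 := sortWeight_lt hkl h'
      rw [e, bfam_eq_zero hb d _ (by omega) (by rwa [sqSum_swap]), map_zero]

end bfam

/-! ### A basis of the Laurent polynomials adapted to the Hecke action -/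

section laurentBasis

variable {N : ℕ}

theorem sum_pair_split {M : Type*} [AddCommMonoid M] {i j : Fin N} (hij : i ≠ j)
    (f : Fin N → M) :
    ∑ l, f l = f i + f j + ∑ l ∈ (Finset.univ.erase i).erase j, f l := by
  rw [add_assoc, Finset.add_sum_erase _ f (by simp [hij.symm]), Finset.add_sum_erase _ f (by simp)]

theorem Inner.sum_eq {i j : Fin N} (hij : i ≠ j) {μ ν : Fin N → ℤ} (h : Inner i j μ ν)
    {M : Type*} [AddCommMonoid M] (φ : ℤ → M) :
    ∑ l, φ (ν l) = φ (ν i) + φ (ν j) + ∑ l ∈ (Finset.univ.erase i).erase j, φ (μ l) := by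
  rw [sum_pair_split hij]
  congr 1
  refine Finset.sum_congr rfl fun l hl => ?_
  simp only [Finset.mem_erase, Finset.mem_univ, and_true] at hl
  rw [h.1 l hl.2 hl.1]

theorem Inner.sqSum_lt {i j : Fin N} (hij : i ≠ j) {μ ν : Fin N → ℤ} (h : Inner i j μ ν) :
    sqSum ν < sqSum μ := by
  rw [sqSum, sqSum, h.sum_eq hij (· ^ 2), sum_pair_split hij]
  obtain ⟨-, h2, h3, h4⟩ := h
  have h5 : ν j = μ i + μ j - ν i := by omega
  rw [h5]
  rcases le_total (μ i) (μ j) with h | h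
  · rw [min_eq_left h] at h3; rw [max_eq_right h] at h4; nlinarith
  · rw [min_eq_right h] at h3; rw [max_eq_left h] at h4; nlinarith

theorem closedExp_sqSum_lt (c : ℤ) : ClosedExp {μ : Fin N → ℤ | sqSum μ < c} :=
  fun m hm i j hij => ⟨by simpa [sqSum_swap] using hm, fun _ hν => (hν.sqSum_lt hij).trans hm⟩

variable {q : ℂ}

/-- The Hecke-adapted basis vectors. -/
def heckeVec (q : ℂ) (μ : Fin N → ℤ) : Laurent N := bfam (heckeG q) mono μ

theorem heckeVec_triangular (hq : q ≠ 0) : ∀ (d : ℕ) (μ : Fin N → ℤ), sortWeight μ < d →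
    ∃ c : ℂ, c ≠ 0 ∧ heckeVec q μ - c • mono μ ∈ monoSpan {ν | sqSum ν < sqSum μ}
  | 0, _, h => absurd h (Nat.not_lt_zero _)
  | d + 1, μ, hd => by
    rcases bfam_cases (heckeG q) mono μ with h' | ⟨i, j, hij, h, e⟩
    · exact ⟨1, one_ne_zero, by rw [heckeVec, h'.2]; simp⟩
    · have hne := ne_of_succ hij
      have w1 := sortWeight_lt hij h
      obtain ⟨c, hc, hm⟩ := heckeVec_triangular hq d (μ ∘ Equiv.swap i j) (by omega)
      rw [sqSum_swap] at hm
      refine ⟨c * q⁻¹, mul_ne_zero hc (inv_ne_zero hq), ?_⟩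
      have h1 := (closedExp_sqSum_lt (sqSum μ)).heckeG_mem (q := q) hne _ hm
      have h2 := heckeG_mono_lt q hne (m := μ ∘ Equiv.swap i j) (by simpa using h)
      rw [comp_swap_swap] at h2
      have h3 : monoSpan {ν | Inner i j (μ ∘ Equiv.swap i j) ν} ≤
          monoSpan {ν | sqSum ν < sqSum μ} := monoSpan_mono fun ν hν => by
        have := Inner.sqSum_lt hne hν
        rwa [sqSum_swap] at this
      have h4 := Submodule.add_mem _ h1 (Submodule.smul_mem _ c (h3 h2))
      rw [map_sub, map_smul] at h4
      rw [heckeVec, e]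
      have e2 : ∀ x y z : Laurent N, x - c • y + c • (y - q⁻¹ • z) = x - (c * q⁻¹) • z := by
        intro x y z; module
      rw [e2] at h4
      exact h4

/-- The coefficient of `z^μ`. -/
def coeffAt (μ : Fin N → ℤ) : Laurent N →ₗ[ℂ] ℂ where
  toFun f := f.coeff μ
  map_add' f g := by simp
  map_smul' c f := by simp

theorem coeffAt_mono (μ ν : Fin N → ℤ) : coeffAt μ (mono ν) = if ν = μ then 1 else 0 := by
  change (mono ν : Laurent N).coeff μ = _
  simp [mono, Finsupp.single_apply]

theorem coeffAt_eq_zero {P : Set (Fin N → ℤ)} {f : Laurent N} (hf : f ∈ monoSpan P)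
    {μ : Fin N → ℤ} (hμ : μ ∉ P) : coeffAt μ f = 0 := by
  have := monoSpan_induction (P := P) (A := coeffAt μ) (V := ⊥) (fun m hm => by
    rw [coeffAt_mono, if_neg (by rintro rfl; exact hμ hm)]; simp) f hf
  simpa using this

theorem eq_sum_mono (f : Laurent N) : f = ∑ μ ∈ f.coeff.support, coeffAt μ f • mono μ := by
  have := (AddMonoidAlgebra.basis (Fin N → ℤ) ℂ).linearCombination_repr f
  rw [Finsupp.linearCombination_apply, Finsupp.sum] at this
  conv_lhs => rw [← this]
  refine Finset.sum_congr rfl fun μ _ => ?_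
  rw [basis_eq_mono]; rfl

/-- The change of basis from the monomials to the Hecke-adapted basis. -/
def heckeChange (q : ℂ) (N : ℕ) : Module.End ℂ (Laurent N) := opOnMono (heckeVec q)

theorem heckeChange_mono (μ : Fin N → ℤ) : heckeChange q N (mono μ) = heckeVec q μ :=
  opOnMono_mono _ _

theorem sqSum_nonneg (μ : Fin N → ℤ) : 0 ≤ sqSum μ := Finset.sum_nonneg fun _ _ => sq_nonneg _

theorem heckeChange_surj (hq : q ≠ 0) : ∀ (d : ℕ), monoSpan {μ : Fin N → ℤ | sqSum μ < d} ≤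
    (monoSpan {μ : Fin N → ℤ | sqSum μ < d}).map (heckeChange q N)
  | 0 => by
    rw [monoSpan, Submodule.span_le]
    rintro _ ⟨μ, hμ, rfl⟩
    exact absurd hμ (not_lt.2 (by simpa using sqSum_nonneg μ))
  | d + 1 => by
    refine Submodule.span_le.2 ?_
    rintro _ ⟨μ, hμ, rfl⟩
    obtain ⟨c, hc, h⟩ := heckeVec_triangular hq _ μ (Nat.lt_succ_self _)
    have hsub : {ν : Fin N → ℤ | sqSum ν < sqSum μ} ⊆ {ν | sqSum ν < d} := fun ν hν => by
      simp only [Set.mem_ofPred_eq, Nat.cast_add, Nat.cast_one] at hμ hν ⊢; omega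
    have hsub2 : monoSpan {μ : Fin N → ℤ | sqSum μ < d} ≤
        monoSpan {μ : Fin N → ℤ | sqSum μ < ((d + 1 : ℕ) : ℤ)} := monoSpan_mono fun ν hν => by
      simp only [Set.mem_ofPred_eq, Nat.cast_add, Nat.cast_one] at hν ⊢; omega
    have h' := Submodule.map_mono hsub2 (heckeChange_surj hq d (monoSpan_mono hsub h))
    have e : mono μ = c⁻¹ • (heckeChange q N (mono μ) - (heckeVec q μ - c • mono μ)) := by
      rw [heckeChange_mono, sub_sub_cancel, smul_smul, inv_mul_cancel₀ hc, one_smul]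
    rw [e]
    exact Submodule.smul_mem _ _ (Submodule.sub_mem _ (Submodule.mem_map_of_mem (mono_mem hμ)) h')

theorem heckeChange_bijective (hq : q ≠ 0) : Function.Bijective (heckeChange q N) := by
  constructor
  · rw [injective_iff_map_eq_zero]
    intro f hf
    by_contra hne
    have hs : f.coeff.support.Nonempty := by
      rw [Finset.nonempty_iff_ne_empty, ne_eq, Finsupp.support_eq_empty,
        AddMonoidAlgebra.coeff_eq_zero]
      exact hne
    obtain ⟨μ, hμ, hmax⟩ := Finset.exists_max_image _ sqSum hs
    obtain ⟨c, hc, h⟩ := heckeVec_triangular hq _ μ (Nat.lt_succ_self _)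
    have h1 := congrArg (coeffAt μ) hf
    rw [eq_sum_mono f, map_sum, map_sum, Finset.sum_eq_single μ] at h1
    · rw [map_smul, heckeChange_mono, map_smul, map_zero, smul_eq_mul] at h1
      have h2 : coeffAt μ (heckeVec q μ) = c := by
        have := coeffAt_eq_zero h (μ := μ) (by simp)
        rw [map_sub, map_smul, coeffAt_mono, if_pos rfl, smul_eq_mul, mul_one] at this
        exact sub_eq_zero.1 this
      rw [h2] at h1
      exact (Finsupp.mem_support_iff.1 hμ) ((mul_eq_zero.1 h1).resolve_right hc)
    · intro ν hν hνμ
      obtain ⟨c', -, h'⟩ := heckeVec_triangular hq _ ν (Nat.lt_succ_self _)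
      have := coeffAt_eq_zero h' (μ := μ) (by simpa using hmax ν hν)
      rw [map_sub, map_smul, coeffAt_mono, if_neg hνμ, smul_zero, sub_zero] at this
      rw [map_smul, heckeChange_mono, map_smul, this, smul_zero]
    · exact fun h => absurd hμ h
  · rw [← LinearMap.range_eq_top, eq_top_iff]
    rintro f -
    rw [eq_sum_mono f]
    refine Submodule.sum_mem _ fun μ _ => Submodule.smul_mem _ _ ?_
    have := heckeChange_surj hq ((sqSum μ).toNat + 1) (mono_mem (m := μ) (by
      have := sqSum_nonneg μ
      simp only [Set.mem_ofPred_eq, Nat.cast_add, Nat.cast_one]; omega))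
    exact LinearMap.map_le_range this

/-- The inverse change of basis. -/
def heckeEquiv (hq : q ≠ 0) (N : ℕ) : Laurent N ≃ₗ[ℂ] Laurent N :=
  LinearEquiv.ofBijective (heckeChange q N) (heckeChange_bijective hq)

theorem heckeEquiv_symm_heckeVec (hq : q ≠ 0) (μ : Fin N → ℤ) :
    (heckeEquiv hq N).symm (heckeVec q μ) = mono μ := by
  rw [LinearEquiv.symm_apply_eq]
  exact (heckeChange_mono μ).symm

theorem heckeEquiv_symm_mem (hq : q ≠ 0) {d : ℕ} {f : Laurent N}
    (hf : f ∈ monoSpan {μ : Fin N → ℤ | sqSum μ < d}) :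
    (heckeEquiv hq N).symm f ∈ monoSpan {μ : Fin N → ℤ | sqSum μ < d} := by
  obtain ⟨g, hg, hgf⟩ := heckeChange_surj hq d hf
  have : (heckeEquiv hq N).symm f = g := by
    rw [LinearEquiv.symm_apply_eq]; exact hgf.symm
  rwa [this]

theorem ext_heckeVec (hq : q ≠ 0) {W : Type*} [AddCommMonoid W] [Module ℂ W]
    {A B : Laurent N →ₗ[ℂ] W} (h : ∀ μ, A (heckeVec q μ) = B (heckeVec q μ)) : A = B := by
  have : A ∘ₗ heckeChange q N = B ∘ₗ heckeChange q N := ext_mono fun μ => by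
    simpa [heckeChange_mono] using h μ
  refine LinearMap.ext fun f => ?_
  obtain ⟨g, rfl⟩ := (heckeChange_bijective (N := N) hq).2 f
  exact congrArg (fun A => A g) this

end laurentBasis

/-! ### Linear forms on the wedge product -/

section heckeLift

variable {N : ℕ} {q : ℂ} {X : Type*} [AddCommGroup X] [Module ℂ X]

/-- The linear map to a Hecke module with prescribed values on the monotone monomials. -/
def heckeLift (hq : q ≠ 0) (T : Fin N → Fin N → Module.End ℂ X) (b0 : (Fin N → ℤ) → X) :
    Laurent N →ₗ[ℂ] X :=
  (AddMonoidAlgebra.basis (Fin N → ℤ) ℂ).constr ℂ (bfam T b0) ∘ₗ (heckeEquiv hq N).symm.toLinearMap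

theorem constr_mono (b : (Fin N → ℤ) → X) (μ : Fin N → ℤ) :
    (AddMonoidAlgebra.basis (Fin N → ℤ) ℂ).constr ℂ b (mono μ) = b μ := by
  rw [← basis_eq_mono, Module.Basis.constr_basis]

theorem heckeLift_heckeVec (hq : q ≠ 0) (T : Fin N → Fin N → Module.End ℂ X)
    (b0 : (Fin N → ℤ) → X) (μ : Fin N → ℤ) : heckeLift hq T b0 (heckeVec q μ) = bfam T b0 μ := by
  rw [heckeLift, LinearMap.comp_apply, LinearEquiv.coe_coe, heckeEquiv_symm_heckeVec, constr_mono]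

theorem heckeLift_mono (hq : q ≠ 0) (T : Fin N → Fin N → Module.End ℂ X)
    (b0 : (Fin N → ℤ) → X) {μ : Fin N → ℤ} (hμ : Monotone μ) :
    heckeLift hq T b0 (mono μ) = b0 μ := by
  rw [← bfam_of_monotone (T := T) (b0 := b0) hμ, ← heckeLift_heckeVec hq]
  rw [heckeVec, bfam_of_monotone hμ]

theorem heckeLift_heckeG (hq : q ≠ 0) {T : Fin N → Fin N → Module.End ℂ X} (hT : HeckeFamily q T)
    {b0 : (Fin N → ℤ) → X} (hb : ∀ m, Monotone m → ∀ i j : Fin N,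
    (i : ℕ) + 1 = j → m i = m j → T i j (b0 m) = q • b0 m) {i j : Fin N} (hij : (i : ℕ) + 1 = j)
    (f : Laurent N) : heckeLift hq T b0 (heckeG q i j f) = T i j (heckeLift hq T b0 f) := by
  have hL := heckeFamily_heckeG hq N
  have hbL : ∀ m, Monotone m → ∀ i j : Fin N, (i : ℕ) + 1 = j → m i = m j →
      heckeG q i j (mono m) = q • mono m := fun m _ i j _ h => heckeG_mono_eq q h
  suffices h : heckeLift hq T b0 ∘ₗ heckeG q i j = T i j ∘ₗ heckeLift hq T b0 from
    congrArg (fun A => A f) h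
  refine ext_heckeVec hq fun μ => ?_
  simp only [LinearMap.comp_apply, heckeLift_heckeVec]
  rcases lt_trichotomy (μ i) (μ j) with h | h | h
  · rw [bfam_act_lt hT b0 hij h, heckeVec, bfam_act_lt hL mono hij h, ← heckeVec,
      heckeLift_heckeVec]
  · rw [bfam_act_eq hT hb _ μ (Nat.lt_succ_self _) i j hij h, heckeVec,
      bfam_act_eq hL hbL _ μ (Nat.lt_succ_self _) i j hij h, map_smul, ← heckeVec,
      heckeLift_heckeVec]
  · rw [bfam_act_gt hT b0 hij h, heckeVec, bfam_act_gt hL mono hij h, map_add, map_smul,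
      ← heckeVec, ← heckeVec, heckeLift_heckeVec, heckeLift_heckeVec]

theorem heckeLift_eq_zero (hq : q ≠ 0) {T : Fin N → Fin N → Module.End ℂ X}
    {b0 : (Fin N → ℤ) → X} {c : ℤ} (hb : ∀ m, sqSum m ≠ c → b0 m = 0) {f : Laurent N}
    (hf : f ∈ monoSpan {μ : Fin N → ℤ | sqSum μ < c}) : heckeLift hq T b0 f = 0 := by
  have hc : {μ : Fin N → ℤ | sqSum μ < c} ⊆ {μ | sqSum μ < (c.toNat : ℕ)} := fun μ hμ =>
    lt_of_lt_of_le hμ (Int.self_le_toNat c)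
  have hc' : {μ : Fin N → ℤ | sqSum μ < (c.toNat : ℕ)} ⊆ {μ | sqSum μ < c} := fun μ hμ => by
    have h1 : sqSum μ < (c.toNat : ℕ) := hμ
    have h2 := sqSum_nonneg μ
    change sqSum μ < c
    omega
  have h := monoSpan_mono hc' (heckeEquiv_symm_mem hq (monoSpan_mono hc hf))
  have := monoSpan_induction (P := {μ : Fin N → ℤ | sqSum μ < c})
    (A := (AddMonoidAlgebra.basis (Fin N → ℤ) ℂ).constr ℂ (bfam T b0)) (V := ⊥) (fun m hm => by
      rw [constr_mono, Submodule.mem_bot]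
      exact bfam_eq_zero hb _ m (Nat.lt_succ_self _) (ne_of_lt hm)) _ h
  exact this

end heckeLift

section inversions

variable {N : ℕ}

/-- The number of pairs `a < b` with `k a < k b`. -/
def ascents (k : Fin N → ℤ) : ℕ :=
  (Finset.univ.filter fun x : Fin N × Fin N => x.1 < x.2 ∧ k x.1 < k x.2).card

theorem swap_lt_swap {i j a b : Fin N} (hij : (i : ℕ) + 1 = j) (hab : a < b)
    (h : ¬ (a = i ∧ b = j)) : Equiv.swap i j a < Equiv.swap i j b := by
  simp only [Equiv.swap_apply_def]
  split_ifs <;> simp only [Fin.lt_def, Fin.ext_iff] at * <;> omega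

theorem ascents_swap {i j : Fin N} (hij : (i : ℕ) + 1 = j) {k : Fin N → ℤ} (h : k i < k j) :
    ascents (k ∘ Equiv.swap i j) + 1 = ascents k := by
  have hmem : (i, j) ∈ Finset.univ.filter
      fun x : Fin N × Fin N => x.1 < x.2 ∧ k x.1 < k x.2 := by
    simp only [Finset.mem_filter, Finset.mem_univ, true_and, Fin.lt_def]; exact ⟨by omega, h⟩
  rw [ascents, ascents, ← Finset.card_erase_add_one hmem]
  congr 1
  refine Finset.card_nbij' (fun x => (Equiv.swap i j x.1, Equiv.swap i j x.2))
    (fun x => (Equiv.swap i j x.1, Equiv.swap i j x.2)) ?_ ?_ ?_ ?_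
  · rintro ⟨a, b⟩ hx
    simp only [Finset.coe_filter, Finset.mem_univ, true_and, Set.mem_ofPred_eq,
      Function.comp_apply] at hx
    have hne : ¬ (a = i ∧ b = j) := by
      rintro ⟨rfl, rfl⟩
      simp only [Equiv.swap_apply_left, Equiv.swap_apply_right] at hx
      omega
    simp only [Finset.coe_erase, Finset.coe_filter, Finset.mem_univ, true_and, Set.mem_sdiff,
      Set.mem_ofPred_eq, Set.mem_singleton_iff, Prod.mk.injEq]
    refine ⟨⟨swap_lt_swap hij hx.1 hne, hx.2⟩, ?_⟩
    rintro ⟨h1, h2⟩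
    rw [Equiv.swap_apply_eq_iff, Equiv.swap_apply_left] at h1
    rw [Equiv.swap_apply_eq_iff, Equiv.swap_apply_right] at h2
    have := hx.1
    rw [h1, h2, Fin.lt_def] at this
    omega
  · rintro ⟨a, b⟩ hx
    simp only [Finset.coe_erase, Finset.coe_filter, Finset.mem_univ, true_and, Set.mem_sdiff,
      Set.mem_ofPred_eq, Set.mem_singleton_iff, Prod.mk.injEq] at hx
    simp only [Finset.coe_filter, Finset.mem_univ, true_and, Set.mem_ofPred_eq,
      Function.comp_apply, Equiv.swap_apply_self]
    exact ⟨swap_lt_swap hij hx.1.1 hx.2, hx.1.2⟩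
  · rintro ⟨a, b⟩ -; simp
  · rintro ⟨a, b⟩ -; simp

end inversions

section wedgeForm

variable {n N : ℕ} {q : ℂ}

theorem kIdx_swap {m : Fin N → ℤ} {i j : Fin N} (h : m i = m j) (e : Fin N → Fin n) :
    kIdx m (e ∘ Equiv.swap i j) = kIdx m e ∘ Equiv.swap i j := by
  conv_lhs => rw [← comp_swap_of_eq h]
  rfl

open Classical in
/-- The linear form on spins attached to the block structure of `m`. -/
def spinForm (q : ℂ) (m : Fin N → ℤ) (e : Fin N → Fin n) : Module.Dual ℂ (Spin n N) :=
  (spinBasis n N).constr ℂ fun e' =>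
    if ∃ σ : Equiv.Perm (Fin N), kIdx m e' = kIdx m e ∘ σ then (-q) ^ ascents (kIdx m e') else 0

open Classical in
theorem spinForm_spinVec (m : Fin N → ℤ) (e e' : Fin N → Fin n) :
    spinForm q m e (spinVec e') =
      if ∃ σ : Equiv.Perm (Fin N), kIdx m e' = kIdx m e ∘ σ then (-q) ^ ascents (kIdx m e')
      else 0 := by
  rw [spinForm, ← spinBasis_apply, Module.Basis.constr_basis]

theorem kIdx_lt_iff {m : Fin N → ℤ} {i j : Fin N} (h : m i = m j) (e : Fin N → Fin n) :
    kIdx m e i < kIdx m e j ↔ e i < e j := by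
  simp [kIdx, uIndex_lt_iff, h]

theorem strictAnti_kIdx {m : Fin N → ℤ} {e : Fin N → Fin n} (hm : Monotone m) (he : InE m e) :
    StrictAnti (kIdx m e) := by
  refine strictAnti_of_succ fun i j hij => ?_
  rw [kIdx, kIdx, uIndex_lt_iff]
  have hle : i ≤ j := by rw [Fin.le_def]; omega
  rcases (hm hle).lt_or_eq with h | h
  · exact Or.inl h
  · exact Or.inr ⟨h.symm, he i j hij h⟩

/-- The transposed Hecke operators on linear forms. -/
def dualS (q : ℂ) (n : ℕ) {N : ℕ} (i j : Fin N) : Module.End ℂ (Module.Dual ℂ (Spin n N)) :=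
  (spinS q i j).dualMap

theorem dualS_apply (i j : Fin N) (φ : Module.Dual ℂ (Spin n N)) (v : Spin n N) :
    dualS q n i j φ v = φ (spinS q i j v) := rfl

theorem heckeFamily_dualS (hq : q ≠ 0) (n N : ℕ) :
    HeckeFamily q (dualS q n : Fin N → Fin N → _) where
  sq i j h := by
    refine LinearMap.ext fun φ => LinearMap.ext fun v => ?_
    have := congrArg (fun A => φ (A v)) (spinS_sq (n := n) hq (ne_of_succ h))
    simpa [dualS_apply] using this
  comm i j k l h h' hjk := by
    refine LinearMap.ext fun φ => LinearMap.ext fun v => ?_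
    have hc := spinS_comm q (n := n) (ne_of_succ h) (ne_of_succ h') (swap_apply_far h h' (.inl hjk)).1
      (swap_apply_far h h' (.inl hjk)).2.1 (swap_apply_far h h' (.inl hjk)).2.2.1
      (swap_apply_far h h' (.inl hjk)).2.2.2
    exact (congrArg (fun A => φ (A v)) hc.eq).symm
  braid i j k h h' := by
    refine LinearMap.ext fun φ => LinearMap.ext fun v => ?_
    exact congrArg (fun A => φ (A v)) (spinS_braid (n := n) hq (ne_of_succ h) (ne_of_succ h')
      (by rw [ne_eq, Fin.ext_iff]; omega))

theorem dualS_spinForm (hq : q ≠ 0) {m : Fin N → ℤ} {e : Fin N → Fin n} (hm : Monotone m)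
    (he : InE m e) {i j : Fin N} (hij : (i : ℕ) + 1 = j) (h : m i = m j) :
    dualS q n i j (spinForm q m e) = q • spinForm q m e := by
  have hinj := (strictAnti_kIdx hm he).injective
  refine ext_spin fun e' => ?_
  have hne := ne_of_succ hij
  rw [dualS_apply, spinS_spinVec q hne, map_add, map_smul, map_smul, LinearMap.smul_apply]
  simp only [spinForm_spinVec]
  have hex : (∃ σ : Equiv.Perm (Fin N), kIdx m (e' ∘ Equiv.swap i j) = kIdx m e ∘ σ) ↔
      ∃ σ : Equiv.Perm (Fin N), kIdx m e' = kIdx m e ∘ σ := by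
    rw [kIdx_swap h]
    constructor
    · rintro ⟨σ, hσ⟩
      refine ⟨(Equiv.swap i j).trans σ, ?_⟩
      rw [← comp_swap_swap i j (kIdx m e'), hσ]; rfl
    · rintro ⟨σ, hσ⟩
      exact ⟨(Equiv.swap i j).trans σ, by rw [hσ]; rfl⟩
  simp only [hex]
  by_cases hσ : ∃ σ : Equiv.Perm (Fin N), kIdx m e' = kIdx m e ∘ σ
  swap
  · simp [hσ]
  simp only [if_pos hσ]
  rw [kIdx_swap h]
  rcases lt_trichotomy (e' i) (e' j) with h1 | h1 | h1
  · have ha := ascents_swap hij ((kIdx_lt_iff h e').2 h1)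
    rw [← ha, sDiag, if_neg h1.ne, if_pos h1, pow_succ, smul_eq_mul, smul_eq_mul, smul_eq_mul]
    field_simp
    ring
  · exfalso
    obtain ⟨σ, hσ⟩ := hσ
    have h2 : kIdx m e' i = kIdx m e' j := by simp [kIdx, h, h1]
    rw [hσ] at h2
    exact hne (σ.injective (hinj h2))
  · have ha := ascents_swap (k := kIdx m e' ∘ Equiv.swap i j) hij
      (by simpa using (kIdx_lt_iff h.symm e').2 h1)
    rw [comp_swap_swap] at ha
    rw [← ha, sDiag, if_neg h1.ne', if_neg h1.not_gt, pow_succ, smul_eq_mul, smul_eq_mul,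
      smul_eq_mul]
    ring

theorem ascents_eq_zero {k : Fin N → ℤ} (hk : StrictAnti k) : ascents k = 0 := by
  rw [ascents, Finset.card_eq_zero, Finset.filter_eq_empty_iff]
  rintro ⟨a, b⟩ - ⟨h1, h2⟩
  exact absurd (hk h1) h2.not_gt

theorem strictAnti_eq_of_perm {k k' : Fin N → ℤ} (hk : StrictAnti k) (hk' : StrictAnti k')
    {σ : Equiv.Perm (Fin N)} (h : k' = k ∘ σ) : k' = k := by
  have hσ : StrictMono σ := fun a b hab => by
    have := hk' hab
    rw [h] at this
    exact hk.lt_iff_gt.1 this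
  have : (σ : Fin N → Fin N) = id := by
    have := (Subsingleton.elim (hσ.orderIsoOfSurjective σ σ.surjective) (OrderIso.refl _))
    exact congrArg (fun f : Fin N ≃o Fin N => (f : Fin N → Fin N)) this
  rw [h, this]; rfl

theorem kIdx_injective {m m' : Fin N → ℤ} {e e' : Fin N → Fin n} (h : kIdx m e = kIdx m' e') :
    m = m' ∧ e = e' :=
  ⟨funext fun i => (uIndex_injective (congrFun h i)).1,
    funext fun i => (uIndex_injective (congrFun h i)).2⟩

/-- Separation of the normally ordered wedges by linear forms. -/
theorem exists_wedgeForm (hq : q ≠ 0) (hq2 : q + q⁻¹ ≠ 0) {m : Fin N → ℤ} {e : Fin N → Fin n}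
    (hm : Monotone m) (he : InE m e) : ∃ F : Wedge q n N →ₗ[ℂ] ℂ, F (wedgeMon q m e) = 1 ∧
      (∀ m' e', Monotone m' → InE m' e' → (m' ≠ m ∨ e' ≠ e) → F (wedgeMon q m' e') = 0) ∧
      ∀ f ∈ monoSpan {μ : Fin N → ℤ | sqSum μ < sqSum m}, ∀ v,
        F (wedgeMk q n N (f ⊗ₜ[ℂ] v)) = 0 := by
  classical
  let b0 : (Fin N → ℤ) → Module.Dual ℂ (Spin n N) :=
    fun μ => if μ = m then spinForm q m e else 0
  have hb : ∀ μ, Monotone μ → ∀ i j : Fin N, (i : ℕ) + 1 = j → μ i = μ j →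
      dualS q n i j (b0 μ) = q • b0 μ := by
    intro μ _ i j hij h
    by_cases hμ : μ = m
    · subst hμ; simp only [b0, if_true]; exact dualS_spinForm hq hm he hij h
    · simp [b0, hμ]
  let L : Laurent N →ₗ[ℂ] Spin n N →ₗ[ℂ] ℂ := heckeLift hq (dualS q n) b0
  have hker : omega q n N ≤ LinearMap.ker (TensorProduct.lift L) := by
    refine omega_le_ker hq hq2 _ fun i j hij t => ?_
    suffices h : TensorProduct.lift L ∘ₗ polyOp (heckeG q i j) =
      TensorProduct.lift L ∘ₗ spinOp (spinS q i j) from congrArg (fun A => A t) h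
    refine TensorProduct.ext' fun f v => ?_
    rw [LinearMap.comp_apply, LinearMap.comp_apply, polyOp_tmul, spinOp_tmul,
      TensorProduct.lift.tmul, TensorProduct.lift.tmul]
    exact congrArg (fun φ => φ v) (heckeLift_heckeG hq (heckeFamily_dualS hq n N) hb hij f)
  have hval : ∀ f v, (omega q n N).liftQ (TensorProduct.lift L) hker (wedgeMk q n N (f ⊗ₜ[ℂ] v)) =
      L f v := fun f v => by
    rw [wedgeMk, Submodule.mkQ_apply, Submodule.liftQ_apply, TensorProduct.lift.tmul]
  have hmon : ∀ m' e', Monotone m' →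
      (omega q n N).liftQ (TensorProduct.lift L) hker (wedgeMon q m' e') = b0 m' (spinVec e') := by
    intro m' e' hm'
    rw [wedgeMon, hval]
    exact congrArg (fun φ => φ (spinVec e')) (heckeLift_mono hq (dualS q n) b0 hm')
  refine ⟨(omega q n N).liftQ (TensorProduct.lift L) hker, ?_, ?_, ?_⟩
  · rw [hmon m e hm]
    simp only [b0, if_true]
    rw [spinForm_spinVec, if_pos ⟨1, rfl⟩, ascents_eq_zero (strictAnti_kIdx hm he), pow_zero]
  · intro m' e' hm' he' hne
    rw [hmon m' e' hm']
    by_cases hmm : m' = m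
    · subst hmm
      have hne' : e' ≠ e := hne.resolve_left (fun h => h rfl)
      simp only [b0, if_true]
      rw [spinForm_spinVec, if_neg]
      rintro ⟨σ, hσ⟩
      exact hne' (kIdx_injective (strictAnti_eq_of_perm (strictAnti_kIdx hm he)
        (strictAnti_kIdx hm he') hσ)).2
    · simp [b0, hmm]
  · intro f hf v
    rw [hval]
    have : heckeLift hq (dualS q n) b0 f = 0 := by
      refine heckeLift_eq_zero (c := sqSum m) hq (fun μ hμ => ?_) hf
      have : μ ≠ m := by rintro rfl; exact hμ rfl
      simp [b0, this]
    exact congrArg (fun φ => φ v) this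

end wedgeForm

/-! ### The basis of normally ordered wedges -/

section wedgeBasis

variable {n N : ℕ} [NeZero n] {q : ℂ}

/-- The strictly decreasing labels. -/
abbrev SLabel (N : ℕ) : Type := {k : Fin N → ℤ // StrictAnti k}

theorem mOf_monotone {k : Fin N → ℤ} (hk : StrictAnti k) : Monotone fun i => mOf n (k i) := by
  have hn : (0 : ℤ) < n := by exact_mod_cast Nat.pos_of_ne_zero (NeZero.ne n)
  intro i j hij
  have := Int.ediv_le_ediv hn (sub_le_sub_right (hk.antitone hij) 1)
  simp only [mOf]
  omega

theorem inE_aOf {k : Fin N → ℤ} (hk : StrictAnti k) :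
    InE (fun i => mOf n (k i)) (fun i => aOf n (k i)) := by
  intro i j hij h
  have hlt : i < j := by rw [Fin.lt_def]; omega
  have h1 := hk hlt
  rw [← uIndex_mOf_aOf (n := n) (k i), ← uIndex_mOf_aOf (n := n) (k j), uIndex_lt_iff] at h1
  rcases h1 with h1 | h1
  · exact absurd h1 (by simp only at h; omega)
  · exact h1.2

theorem span_wk (hq : q ≠ 0) (hq2 : q + q⁻¹ ≠ 0) :
    Submodule.span ℂ (Set.range fun k : SLabel N => wk q n k.1) = ⊤ := by
  rw [eq_top_iff]
  rintro w -
  obtain ⟨t, rfl⟩ := (omega q n N).mkQ_surjective w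
  suffices h : (⊤ : Submodule ℂ (Tens n N)) ≤ (Submodule.span ℂ
      (Set.range fun k : SLabel N => wk q n k.1)).comap (wedgeMk q n N) from h trivial
  rw [← (tensBasis n N).span_eq, Submodule.span_le]
  rintro _ ⟨⟨m, e⟩, rfl⟩
  rw [tensBasis_apply]
  change wedgeMon q m e ∈ Submodule.span ℂ (Set.range fun k : SLabel N => wk q n k.1)
  rw [← wk_kIdx]
  refine Submodule.span_mono ?_ (straighten hq hq2 0 (fun _ => True) (fun _ _ _ _ _ _ _ _ => trivial)
    (kIdx m e) trivial)
  rintro _ ⟨K, -, hK, rfl⟩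
  exact ⟨⟨K, strictAnti_of_succ fun i j hij => hK i j hij (Nat.zero_le _)⟩, rfl⟩

theorem linearIndependent_wk (hq : q ≠ 0) (hq2 : q + q⁻¹ ≠ 0) :
    LinearIndependent ℂ (fun k : SLabel N => wk q n k.1) := by
  have h := fun k : SLabel N => exists_wedgeForm (q := q) hq hq2 (mOf_monotone (n := n) k.2)
    (inE_aOf (n := n) k.2)
  choose F hF1 hF2 hF3 using h
  rw [linearIndependent_iff']
  intro s g hg k hk
  have h1 := congrArg (F k) hg
  rw [map_sum, Finset.sum_eq_single k, map_smul, map_zero, smul_eq_mul] at h1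
  · change g k * F k (wedgeMon q _ _) = 0 at h1
    rwa [hF1, mul_one] at h1
  · intro k' _ hne
    rw [map_smul]
    change g k' • F k (wedgeMon q _ _) = 0
    rw [hF2 k _ _ (mOf_monotone k'.2) (inE_aOf k'.2), smul_zero]
    by_contra hcon
    push Not at hcon
    refine hne (Subtype.ext ?_)
    rw [← kIdx_of (n := n) k'.1, ← kIdx_of (n := n) k.1, hcon.1, hcon.2]
  · exact fun h => absurd hk h

/-- The basis of normally ordered wedges. -/
def wBasis (hq : q ≠ 0) (hq2 : q + q⁻¹ ≠ 0) (n N : ℕ) [NeZero n] :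
    Module.Basis (SLabel N) ℂ (Wedge q n N) :=
  Module.Basis.mk (linearIndependent_wk hq hq2) (span_wk hq hq2).ge

theorem wBasis_apply (hq : q ≠ 0) (hq2 : q + q⁻¹ ≠ 0) (k : SLabel N) :
    wBasis hq hq2 n N k = wk q n k.1 := by
  rw [wBasis, Module.Basis.mk_apply]

end wedgeBasis

/-! ### Representations of the quantum affine algebra: the coproduct -/

section serre

variable {A : Type} [Ring A] [Algebra ℂ A] {q : ℂ}

theorem qBinom_one (q : ℂ) : qBinom q 1 0 = 1 ∧ qBinom q 1 1 = 1 := by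
  simp [qBinom, qFact, qInt]

theorem qBinom_two (hq : q ≠ 0) (hq2 : q + q⁻¹ ≠ 0) :
    qBinom q 2 0 = 1 ∧ qBinom q 2 1 = q + q⁻¹ ∧ qBinom q 2 2 = 1 := by
  have h : qInt q 2 = q + q⁻¹ := by
    simp [qInt, Finset.sum_range_succ]
  have h1 : qInt q 1 = 1 := by simp [qInt]
  refine ⟨?_, ?_, ?_⟩ <;> simp [qBinom, qFact, Finset.prod_range_succ, h, h1, hq2]

theorem qInt_three (hq : q ≠ 0) (hq' : ∀ a : ℕ, 0 < a → q ^ a = 1 → q = 1) :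
    qInt q 3 = q ^ 2 + 1 + q⁻¹ ^ 2 ∧ qInt q 3 ≠ 0 := by
  have h : qInt q 3 = q ^ 2 + 1 + q⁻¹ ^ 2 := by
    simp [qInt, Finset.sum_range_succ]
  refine ⟨h, fun h0 => ?_⟩
  rw [h] at h0
  field_simp at h0
  have h6 : q ^ 6 = 1 := by linear_combination (q ^ 2 - 1) * h0
  have := hq' 6 (by norm_num) h6
  rw [this] at h0
  norm_num at h0

theorem add_inv_ne_zero (hq : q ≠ 0) (hq' : ∀ a : ℕ, 0 < a → q ^ a = 1 → q = 1) :
    q + q⁻¹ ≠ 0 := by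
  intro h0
  field_simp at h0
  have h4 : q ^ 4 = 1 := by linear_combination (q ^ 2 - 1) * h0
  have := hq' 4 (by norm_num) h4
  rw [this] at h0
  norm_num at h0

theorem qBinom_three (hq : q ≠ 0) (hq' : ∀ a : ℕ, 0 < a → q ^ a = 1 → q = 1) :
    qBinom q 3 0 = 1 ∧ qBinom q 3 1 = q ^ 2 + 1 + q⁻¹ ^ 2 ∧ qBinom q 3 2 = q ^ 2 + 1 + q⁻¹ ^ 2 ∧
      qBinom q 3 3 = 1 := by
  have h : qInt q 2 = q + q⁻¹ := by
    simp [qInt, Finset.sum_range_succ]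
  have h1 : qInt q 1 = 1 := by simp [qInt]
  have h3 := qInt_three hq hq'
  have h2 := add_inv_ne_zero hq hq'
  rw [← h3.1]
  have h3' := h3.2
  refine ⟨?_, ?_, ?_, ?_⟩ <;> simp [qBinom, qFact, Finset.prod_range_succ, h, h1, h2, h3']

theorem serre_one (X Y : A) : serre q 1 X Y = Y * X - X * Y := by
  simp [serre, Finset.sum_range_succ, qBinom_one, sub_eq_add_neg]

theorem serre_two (hq : q ≠ 0) (hq2 : q + q⁻¹ ≠ 0) (X Y : A) :
    serre q 2 X Y = Y * X * X - (q + q⁻¹) • (X * Y * X) + X * X * Y := by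
  simp only [serre, Finset.sum_range_succ, Finset.sum_range_zero, qBinom_two hq hq2]
  simp [pow_two, mul_assoc, sub_eq_add_neg]
  module

theorem serre_three (hq : q ≠ 0) (hq' : ∀ a : ℕ, 0 < a → q ^ a = 1 → q = 1) (X Y : A) :
    serre q 3 X Y = Y * X * X * X - (q ^ 2 + 1 + q⁻¹ ^ 2) • (X * Y * X * X) +
      (q ^ 2 + 1 + q⁻¹ ^ 2) • (X * X * Y * X) - X * X * X * Y := by
  simp only [serre, Finset.sum_range_succ, Finset.sum_range_zero, qBinom_three hq hq']
  simp [pow_succ, mul_assoc]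
  module

theorem serre_add_right (b : ℕ) (X Y Y' : A) :
    serre q b X (Y + Y') = serre q b X Y + serre q b X Y' := by
  simp only [serre, mul_add, add_mul, smul_add, Finset.sum_add_distrib]

theorem serre_mul_comm (b : ℕ) {X Y k l : A} (hkX : Commute k X) (hkY : Commute k Y)
    (hlX : Commute l X) (hkl : Commute k l) :
    serre q b (X * k) (Y * l) = serre q b X Y * (k ^ b * l) := by
  rw [serre, serre, Finset.sum_mul]
  refine Finset.sum_congr rfl fun r hr => ?_
  have hrb : r + (b - r) = b := by have := Finset.mem_range.1 hr; omega
  rw [smul_mul_assoc]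
  congr 1
  rw [hkX.symm.mul_pow, hkX.symm.mul_pow]
  conv_rhs => rw [← hrb, pow_add]
  have h1 : l * X ^ (b - r) = X ^ (b - r) * l := (hlX.pow_right _).eq
  have h2 : k ^ r * Y = Y * k ^ r := (hkY.pow_left _).eq
  have h3 : k ^ r * X ^ (b - r) = X ^ (b - r) * k ^ r := (hkX.pow_pow _ _).eq
  have h4 : l * k ^ (b - r) = k ^ (b - r) * l := (hkl.symm.pow_right _).eq
  calc X ^ r * k ^ r * (Y * l) * (X ^ (b - r) * k ^ (b - r))
      = X ^ r * (k ^ r * Y) * (l * X ^ (b - r)) * k ^ (b - r) := by simp only [mul_assoc]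
    _ = X ^ r * Y * (k ^ r * X ^ (b - r)) * (l * k ^ (b - r)) := by
        rw [h1, h2]; simp only [mul_assoc]
    _ = _ := by
        rw [h3, h4]
        simp only [hrb, mul_assoc]

theorem serre_mul_comm_left (b : ℕ) {X Y k l : A} (hkX : Commute k X) (hkY : Commute k Y)
    (hlX : Commute l X) (hlY : Commute l Y) (hkl : Commute k l) :
    serre q b (k * X) (l * Y) = serre q b X Y * (k ^ b * l) := by
  rw [hkX.eq, hlY.eq, serre_mul_comm b hkX hkY hlX hkl]

theorem serre_add_left (hq : q ≠ 0) (hq' : ∀ a : ℕ, 0 < a → q ^ a = 1 → q = 1) {b : ℕ}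
    (hb : b = 1 ∨ b = 2 ∨ b = 3) {u : ℂ} (hu : u = q ∨ u = q⁻¹) {X X' Y : A}
    (h1 : X' * X = (u⁻¹ ^ 2) • (X * X')) (h2 : X' * Y = u ^ (b - 1) • (Y * X')) :
    serre q b (X + X') Y = serre q b X Y := by
  have h1' : ∀ Z, X' * (X * Z) = (u⁻¹ ^ 2) • (X * (X' * Z)) := fun Z => by
    rw [← mul_assoc, h1, smul_mul_assoc, mul_assoc]
  have h2' : ∀ Z, X' * (Y * Z) = u ^ (b - 1) • (Y * (X' * Z)) := fun Z => by
    rw [← mul_assoc, h2, smul_mul_assoc, mul_assoc]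
  have e2 : q + q⁻¹ = u + u⁻¹ := by rcases hu with rfl | rfl <;> simp [add_comm]
  have e3 : q ^ 2 + 1 + q⁻¹ ^ 2 = u ^ 2 + 1 + u⁻¹ ^ 2 := by
    rcases hu with rfl | rfl <;> simp <;> ring
  have hu0 : u ≠ 0 := by rcases hu with rfl | rfl <;> simp [hq]
  rcases hb with rfl | rfl | rfl
  · rw [serre_one, serre_one]
    simp only [add_mul, mul_add, h2]
    match_scalars <;> simp
  · rw [serre_two hq (add_inv_ne_zero hq hq'), serre_two hq (add_inv_ne_zero hq hq'), e2]
    simp only [add_mul, mul_add, mul_assoc, h1, h2, h2', smul_mul_assoc, mul_smul_comm]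
    match_scalars <;> field_simp <;> ring
  · rw [serre_three hq hq', serre_three hq hq', e3]
    simp only [add_mul, mul_add, mul_assoc, h1, h2, h1', h2', smul_mul_assoc, mul_smul_comm]
    match_scalars <;> field_simp <;> ring

end serre

section coproduct

variable {q : ℂ} {n : ℕ} [NeZero n] {A : Type} [Ring A] [Algebra ℂ A]

/-- The defining relations of the quantum affine algebra except the one on the central element. -/
structure UqRep (q : ℂ) (g : QGen n → A) : Prop where
  K_Kinv : ∀ i, g (.K i) * g (.Kinv i) = 1
  Kinv_K : ∀ i, g (.Kinv i) * g (.K i) = 1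
  K_K : ∀ i j, g (.K i) * g (.K j) = g (.K j) * g (.K i)
  K_E : ∀ i j, g (.K i) * g (.E j) = q ^ cartan i j • (g (.E j) * g (.K i))
  K_F : ∀ i j, g (.K i) * g (.F j) = q ^ (-cartan i j) • (g (.F j) * g (.K i))
  EF_ne : ∀ i j, i ≠ j → g (.E i) * g (.F j) = g (.F j) * g (.E i)
  EF_eq : ∀ i, (q - q⁻¹) • (g (.E i) * g (.F i) - g (.F i) * g (.E i)) = g (.K i) - g (.Kinv i)
  serre_E : ∀ i j, i ≠ j → serre q (1 - cartan i j).toNat (g (.E i)) (g (.E j)) = 0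
  serre_F : ∀ i j, i ≠ j → serre q (1 - cartan i j).toNat (g (.F i)) (g (.F j)) = 0

theorem cartan_symm (i j : Fin n) : cartan i j = cartan j i := by
  simp only [cartan, eq_comm (a := i) (b := j)]
  ring

theorem cartan_self (hn : 2 ≤ n) (i : Fin n) : cartan i i = 2 := by
  have h1 : (1 : Fin n) ≠ 0 := by
    intro h
    have := congrArg Fin.val h
    rw [Fin.val_one', Fin.val_zero, Nat.mod_eq_of_lt (by omega)] at this
    omega
  have : i ≠ i + 1 := by simpa using h1
  simp [cartan, this]

theorem cartan_cases {i j : Fin n} (h : i ≠ j) :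
    (1 - cartan i j).toNat = 1 ∨ (1 - cartan i j).toNat = 2 ∨ (1 - cartan i j).toNat = 3 := by
  simp only [cartan, if_neg h]
  split_ifs <;> simp

theorem cartan_eq {i j : Fin n} (h : i ≠ j) :
    -cartan i j = (((1 - cartan i j).toNat - 1 : ℕ) : ℤ) := by
  simp only [cartan, if_neg h]
  split_ifs <;> simp

variable {g g' : QGen n → A}

theorem UqRep.Kinv_E (h : UqRep q g) (i j : Fin n) :
    g (.E j) * g (.Kinv i) = q ^ cartan i j • (g (.Kinv i) * g (.E j)) := by
  have := congrArg (fun x => g (.Kinv i) * x * g (.Kinv i)) (h.K_E i j)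
  simp only [mul_smul_comm, smul_mul_assoc, mul_assoc, h.K_Kinv, mul_one] at this
  rw [← mul_assoc, h.Kinv_K, one_mul] at this
  exact this

theorem UqRep.Kinv_F (h : UqRep q g) (i j : Fin n) :
    g (.F j) * g (.Kinv i) = q ^ (-cartan i j) • (g (.Kinv i) * g (.F j)) := by
  have := congrArg (fun x => g (.Kinv i) * x * g (.Kinv i)) (h.K_F i j)
  simp only [mul_smul_comm, smul_mul_assoc, mul_assoc, h.K_Kinv, mul_one] at this
  rw [← mul_assoc, h.Kinv_K, one_mul] at this
  exact this

theorem UqRep.Kinv_Kinv (h : UqRep q g) (i j : Fin n) :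
    Commute (g (.Kinv i)) (g (.Kinv j)) := by
  have hu : ∀ i, g (.Kinv i) = Ring.inverse (g (.K i)) := fun i =>
    (ringInverse_eq (h.K_Kinv i) (h.Kinv_K i)).symm
  have hc : Commute (g (.K i)) (g (.K j)) := h.K_K i j
  rw [hu, hu]
  exact Commute.ringInverse_ringInverse hc

/-- The coproduct. -/
def coprod (g g' : QGen n → A) : QGen n → A
  | .K i => g (.K i) * g' (.K i)
  | .Kinv i => g (.Kinv i) * g' (.Kinv i)
  | .E i => g (.E i) * g' (.K i) + g' (.E i)
  | .F i => g (.F i) + g (.Kinv i) * g' (.F i)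

theorem UqRep.coprod (hn : 2 ≤ n) (hq : q ≠ 0) (hq' : ∀ a : ℕ, 0 < a → q ^ a = 1 → q = 1)
    (h : UqRep q g) (h' : UqRep q g') (hc : ∀ x y, Commute (g x) (g' y)) :
    UqRep q (coprod g g') := by
  have hcc : ∀ x y z, g' y * (g x * z) = g x * (g' y * z) := fun x y z => by
    rw [← mul_assoc, ← (hc x y).eq, mul_assoc]
  have hc0 : ∀ x y, g' y * g x = g x * g' y := fun x y => (hc x y).eq.symm
  have assoc_smul : ∀ {x y z : A} {c : ℂ}, x * y = c • (y * x) → x * (y * z) = c • (y * (x * z)) :=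
    fun {x y z c} hxy => by rw [← mul_assoc, hxy, smul_mul_assoc, mul_assoc]
  have hz : ∀ a b : ℤ, q ^ (a + b) = q ^ a * q ^ b := fun a b => zpow_add₀ hq a b
  refine ⟨fun i => ?_, fun i => ?_, fun i j => ?_, fun i j => ?_, fun i j => ?_, fun i j hij => ?_,
    fun i => ?_, fun i j hij => ?_, fun i j hij => ?_⟩
  · simp only [LevelZero.coprod, mul_assoc, hcc, h'.K_Kinv, h.K_Kinv, mul_one]
  · simp only [LevelZero.coprod, mul_assoc, hcc, h'.Kinv_K, h.Kinv_K, mul_one]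
  · simp only [LevelZero.coprod, mul_assoc, hcc, h'.K_K i j]
    rw [← mul_assoc, h.K_K i j, mul_assoc]
  · simp only [LevelZero.coprod, mul_assoc, hcc, mul_add, add_mul, h'.K_E i j, h'.K_K i j,
      assoc_smul (h.K_E i j), smul_add, mul_smul_comm]
  · have hKK : ∀ z, g (.K i) * (g (.Kinv j) * z) = g (.Kinv j) * (g (.K i) * z) := fun z => by
      have hu : Commute (g (.K i)) (g (.K j)) := h.K_K i j
      have e : g (.Kinv j) = Ring.inverse (g (.K j)) :=
        (ringInverse_eq (h.K_Kinv j) (h.Kinv_K j)).symm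
      rw [← mul_assoc, e, (Commute.ringInverse_right' hu).eq, mul_assoc]
    simp only [LevelZero.coprod, mul_assoc, hcc, mul_add, add_mul, h'.K_F i j, hKK,
      assoc_smul (h.K_F i j), hc0, smul_add, mul_smul_comm]
  · simp only [LevelZero.coprod, mul_assoc, hcc, mul_add, add_mul, hc0, h'.EF_ne i j hij,
      h'.K_F i j, assoc_smul (h.Kinv_E j i), mul_smul_comm, smul_smul, ← hz, cartan_symm j i,
      neg_add_cancel, zpow_zero, one_smul]
    have e : ∀ z, g (.E i) * (g (.F j) * z) = g (.F j) * (g (.E i) * z) := fun z => by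
      rw [← mul_assoc, h.EF_ne i j hij, mul_assoc]
    simp only [e]
    abel
  · have k1 := congrArg (fun x => x * g' (.K i)) (h.EF_eq i)
    have k2 := congrArg (fun x => g (.Kinv i) * x) (h'.EF_eq i)
    simp only [smul_mul_assoc, mul_smul_comm, sub_mul, mul_sub, mul_assoc] at k1 k2
    simp only [LevelZero.coprod, mul_assoc, hcc, mul_add, add_mul, hc0,
      h'.K_F i i, assoc_smul (h.Kinv_E i i), mul_smul_comm, smul_smul, ← hz,
      neg_add_cancel, zpow_zero, one_smul]
    rw [← sub_add_sub_cancel (g (.K i) * g' (.K i)) (g (.Kinv i) * g' (.K i)), ← k1, ← k2]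
    module
  · obtain ⟨b, hb⟩ : ∃ b, b = (1 - cartan i j).toNat := ⟨_, rfl⟩
    have hb3 := cartan_cases hij
    have hcar := cartan_eq hij
    have s1 := h.serre_E i j hij
    have s2 := h'.serre_E i j hij
    rw [← hb] at *
    have hcar' : cartan i j = -((b - 1 : ℕ) : ℤ) := by omega
    simp only [LevelZero.coprod]
    rw [serre_add_right, serre_add_left hq hq' hb3 (.inl rfl), add_comm (g (.E i) * g' (.K i)),
      serre_add_left hq hq' hb3 (.inr rfl), s2,
      serre_mul_comm b (hc _ _).symm (hc _ _).symm (hc _ _).symm (h'.K_K i j), s1]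
    · simp
    · simp only [mul_assoc, h'.K_E i i, hcc, mul_smul_comm,
        cartan_self hn, inv_inv]
      norm_cast
    · simp only [mul_assoc, h'.K_E i j, hcc, mul_smul_comm, hcar', inv_pow, zpow_neg,
        zpow_natCast]
    · simp only [mul_assoc, h'.K_E i i, hcc, mul_smul_comm, smul_smul, cartan_self hn]
      match_scalars
      field_simp
    · simp only [mul_assoc, h'.K_E j i, cartan_symm j i, hcar', hcc, mul_smul_comm, smul_smul,
        zpow_neg, zpow_natCast]
      rw [mul_inv_cancel₀ (pow_ne_zero _ hq), one_smul]
  · obtain ⟨b, hb⟩ : ∃ b, b = (1 - cartan i j).toNat := ⟨_, rfl⟩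
    have hb3 := cartan_cases hij
    have hcar := cartan_eq hij
    have s1 := h.serre_F i j hij
    have s2 := h'.serre_F i j hij
    rw [← hb] at *
    have hcar' : cartan i j = -((b - 1 : ℕ) : ℤ) := by omega
    simp only [LevelZero.coprod]
    rw [serre_add_right, serre_add_left hq hq' hb3 (.inr rfl), add_comm (g (.F i)),
      serre_add_left hq hq' hb3 (.inl rfl), s1,
      serre_mul_comm_left b (hc _ _) (hc _ _) (hc _ _) (hc _ _) (h.Kinv_Kinv i j), s2]
    · simp
    · simp only [mul_assoc, assoc_smul (h.Kinv_F i i), hc0,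
        cartan_self hn]
      match_scalars
      field_simp
    · simp only [mul_assoc, assoc_smul (h.Kinv_F j i), hc0,
        cartan_symm j i, hcar]
      rw [zpow_natCast]
    · simp only [mul_assoc, assoc_smul (h.Kinv_F i i), hc0,
        smul_smul, cartan_self hn]
      match_scalars
      field_simp
    · simp only [mul_assoc, assoc_smul (h.Kinv_F i j), hc0,
        smul_smul, hcar]
      rw [zpow_natCast, inv_pow, inv_mul_cancel₀ (pow_ne_zero _ hq), one_smul]

end coproduct

/-! ### The evaluation representation of the quantum affine algebra at one site -/

section eval

variable {q : ℂ} {n : ℕ}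

theorem eUnit_mul (a b c d : Fin n) : eUnit a b * eUnit c d = if b = c then eUnit a d else 0 := by
  have h : eUnit a b * eUnit c d = Matrix.toLin' (Matrix.single a b 1 * Matrix.single c d 1) := by
    rw [Matrix.toLin'_mul]; rfl
  rw [h]
  split_ifs with hbc
  · subst hbc
    rw [Matrix.single_mul_single_same, mul_one]; rfl
  · rw [Matrix.single_mul_single_of_ne _ _ _ _ hbc, map_zero]

variable [NeZero n]

/-- The eigenvalues of `kSite`. -/
def kEig (q : ℂ) {n : ℕ} [NeZero n] (t : ℤ) (ε a : Fin n) : ℂ :=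
  q ^ (t * ((if a = ε - 1 then 1 else 0) - (if a = ε then 1 else 0)))

theorem kSite_single (t : ℤ) (ε a : Fin n) :
    kSite q t ε (Pi.single a 1) = kEig q t ε a • Pi.single a 1 := by
  rw [kSite, Matrix.toLin'_apply, Matrix.mulVec_single_one, Matrix.col_diagonal]
  rw [← Pi.single_smul, smul_eq_mul, mul_one]
  rfl

theorem ext_single {W : Type*} [AddCommMonoid W] [Module ℂ W] {A B : (Fin n → ℂ) →ₗ[ℂ] W}
    (h : ∀ a, A (Pi.single a 1) = B (Pi.single a 1)) : A = B :=
  (Pi.basisFun ℂ (Fin n)).ext fun a => by simpa using h a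

theorem kSite_mul (hq : q ≠ 0) (t t' : ℤ) (ε : Fin n) :
    kSite q t ε * kSite q t' ε = kSite q (t + t') ε := by
  refine ext_single fun a => ?_
  rw [Module.End.mul_apply, kSite_single, map_smul, kSite_single, kSite_single, smul_smul,
    kEig, kEig, kEig, ← zpow_add₀ hq]
  congr 2
  ring

theorem kSite_zero (ε : Fin n) : kSite q 0 ε = 1 := by
  refine ext_single fun a => ?_
  rw [kSite_single]
  simp [kEig]

theorem kSite_comm (t t' : ℤ) (ε ε' : Fin n) : kSite q t ε * kSite q t' ε' =
    kSite q t' ε' * kSite q t ε := by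
  refine ext_single fun a => ?_
  simp only [Module.End.mul_apply, kSite_single, map_smul, smul_smul]
  rw [mul_comm]

theorem kSite_mul_eUnit (t : ℤ) (ε a b : Fin n) :
    kSite q t ε * eUnit a b = kEig q t ε a • eUnit a b := by
  refine ext_single fun c => ?_
  rw [Module.End.mul_apply, LinearMap.smul_apply, eUnit_single]
  split_ifs
  · rw [one_smul, kSite_single]
  · simp

theorem eUnit_mul_kSite (t : ℤ) (ε a b : Fin n) :
    eUnit a b * kSite q t ε = kEig q t ε b • eUnit a b := by
  refine ext_single fun c => ?_
  rw [Module.End.mul_apply, LinearMap.smul_apply, kSite_single, map_smul, eUnit_single]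
  split_ifs with h
  · rw [h]
  · simp

theorem kEig_sub_one (hq : q ≠ 0) (i j : Fin n) :
    kEig q 1 i (j - 1) = q ^ cartan i j * kEig q 1 i j := by
  have e1 : (j - 1 = i - 1) = (i = j) := by simp [eq_comm]
  have e2 : (j - 1 = i) = (j = i + 1) := by rw [sub_eq_iff_eq_add]
  have e3 : (j = i - 1) = (i = j + 1) := by rw [eq_sub_iff_add_eq, eq_comm (a := i)]
  have e4 : (j = i) = (i = j) := by rw [eq_comm (a := i)]
  rw [kEig, kEig, ← zpow_add₀ hq]
  congr 1
  simp only [cartan, e1, e2, e3, e4]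
  split_ifs <;> ring

theorem sub_one_ne (hn : 2 ≤ n) (ε : Fin n) : ε - 1 ≠ ε := by
  have h1 : (1 : Fin n) ≠ 0 := by
    intro h
    have := congrArg Fin.val h
    rw [Fin.val_one', Fin.val_zero, Nat.mod_eq_of_lt (by omega)] at this
    omega
  simpa using h1

theorem kSite_sub_kSite (hn : 2 ≤ n) (ε : Fin n) : kSite q 1 ε - kSite q (-1) ε =
    (q - q⁻¹) • (eUnit (ε - 1) (ε - 1) - eUnit ε ε) := by
  refine ext_single fun c => ?_
  have h := sub_one_ne hn ε
  simp only [LinearMap.sub_apply, LinearMap.smul_apply, eUnit_single, kSite_single, kEig]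
  by_cases h1 : c = ε
  · subst h1
    simp [h.symm]
    module
  · by_cases h2 : c = ε - 1
    · subst h2; simp [h]; module
    · simp [h1, h2]

variable {A : Type} [Ring A] [Algebra ℂ A]

/-- The generators in the evaluation representation. -/
def evalGen (q : ℂ) (ψ : Module.End ℂ (Fin n → ℂ) →ₗ[ℂ] A) (X Y : Fin n → A) : QGen n → A
  | .K ε => ψ (kSite q 1 ε)
  | .Kinv ε => ψ (kSite q (-1) ε)
  | .E ε => X ε * ψ (eUnit (ε - 1) ε)
  | .F ε => Y ε * ψ (eUnit ε (ε - 1))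

theorem serre_eq_zero (hq : q ≠ 0) (hq' : ∀ a : ℕ, 0 < a → q ^ a = 1 → q = 1) {i j : Fin n}
    (hij : i ≠ j) {X Y : A} (h2 : X * X = 0)
    (h1 : i ≠ j + 1 ∨ j ≠ i + 1 → X * (Y * X) = 0)
    (h0 : i ≠ j + 1 → j ≠ i + 1 → X * Y = 0 ∧ Y * X = 0) :
    serre q (1 - cartan i j).toNat X Y = 0 := by
  have h2' : ∀ Z, X * (X * Z) = 0 := fun Z => by rw [← mul_assoc, h2, zero_mul]
  by_cases h3 : i = j + 1 <;> by_cases h4 : j = i + 1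
  · have : (1 - cartan i j).toNat = 3 := by
      simp only [cartan, if_neg hij, if_pos h3, if_pos h4]; rfl
    rw [this, serre_three hq hq']
    simp [mul_assoc, h2]
  · have : (1 - cartan i j).toNat = 2 := by
      simp only [cartan, if_neg hij, if_pos h3, if_neg h4]; rfl
    rw [this, serre_two hq (add_inv_ne_zero hq hq')]
    simp [mul_assoc, h2, h1 (.inr h4)]
  · have : (1 - cartan i j).toNat = 2 := by
      simp only [cartan, if_neg hij, if_neg h3, if_pos h4]; rfl
    rw [this, serre_two hq (add_inv_ne_zero hq hq')]
    simp [mul_assoc, h2, h1 (.inl h3)]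
  · have : (1 - cartan i j).toNat = 1 := by
      simp only [cartan, if_neg hij, if_neg h3, if_neg h4]; rfl
    rw [this, serre_one, (h0 h3 h4).1, (h0 h3 h4).2, sub_zero]

theorem uqRep_evalGen (hn : 2 ≤ n) (hq : q ≠ 0) (hq' : ∀ a : ℕ, 0 < a → q ^ a = 1 → q = 1)
    {ψ : Module.End ℂ (Fin n → ℂ) →ₗ[ℂ] A} (h1 : ψ 1 = 1) (hψ : ∀ a b, ψ (a * b) = ψ a * ψ b)
    {X Y : Fin n → A} (hX : ∀ ε a, Commute (ψ a) (X ε)) (hY : ∀ ε a, Commute (ψ a) (Y ε))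
    (hXY : ∀ ε, X ε * Y ε = 1) (hYX : ∀ ε, Y ε * X ε = 1) : UqRep q (evalGen q ψ X Y) := by
  have hXm : ∀ ε a Z, ψ a * (X ε * Z) = X ε * (ψ a * Z) := fun ε a Z => by
    rw [← mul_assoc, (hX ε a).eq, mul_assoc]
  have hYm : ∀ ε a Z, ψ a * (Y ε * Z) = Y ε * (ψ a * Z) := fun ε a Z => by
    rw [← mul_assoc, (hY ε a).eq, mul_assoc]
  have hψm : ∀ a b Z, ψ a * (ψ b * Z) = ψ (a * b) * Z := fun a b Z => by
    rw [hψ, mul_assoc]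
  have hXYm : ∀ ε Z, X ε * (Y ε * Z) = Z := fun ε Z => by rw [← mul_assoc, hXY, one_mul]
  have hYXm : ∀ ε Z, Y ε * (X ε * Z) = Z := fun ε Z => by rw [← mul_assoc, hYX, one_mul]
  have hne := sub_one_ne hn
  refine ⟨fun i => ?_, fun i => ?_, fun i j => ?_, fun i j => ?_, fun i j => ?_, fun i j hij => ?_,
    fun i => ?_, fun i j hij => ?_, fun i j hij => ?_⟩
  · simp only [evalGen]
    rw [← hψ, kSite_mul hq, add_neg_cancel, kSite_zero, h1]
  · simp only [evalGen]
    rw [← hψ, kSite_mul hq, neg_add_cancel, kSite_zero, h1]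
  · simp only [evalGen]
    rw [← hψ, ← hψ, kSite_comm]
  · simp only [evalGen]
    rw [hXm, mul_assoc, ← hψ, ← hψ, kSite_mul_eUnit, eUnit_mul_kSite, map_smul, map_smul,
      mul_smul_comm, mul_smul_comm, smul_smul, kEig_sub_one hq]
  · simp only [evalGen]
    rw [hYm, mul_assoc, ← hψ, ← hψ, kSite_mul_eUnit, eUnit_mul_kSite, map_smul, map_smul,
      mul_smul_comm, mul_smul_comm, smul_smul, kEig_sub_one hq, ← mul_assoc, ← zpow_add₀ hq,
      neg_add_cancel, zpow_zero, one_mul]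
  · simp only [evalGen, mul_assoc, hXm, hYm]
    rw [← hψ, ← hψ, eUnit_mul, eUnit_mul, if_neg hij, if_neg (by simpa using hij.symm)]
    simp
  · simp only [evalGen, mul_assoc, hXm, hYm, hXYm, hYXm]
    rw [← hψ, ← hψ, eUnit_mul, eUnit_mul, if_pos rfl, if_pos rfl, ← map_sub, ← map_smul,
      ← kSite_sub_kSite hn, map_sub]
  · have e1 : ∀ x : Fin n, x - 1 + 1 = x := fun x => by abel
    refine serre_eq_zero hq hq' hij ?_ (fun h => ?_) (fun h3 h4 => ?_)
    · simp only [evalGen, mul_assoc, hXm]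
      rw [← hψ, eUnit_mul, if_neg (hne i).symm]; simp
    · simp only [evalGen, mul_assoc, hXm]
      rw [← hψ, ← hψ, eUnit_mul, mul_ite, eUnit_mul, mul_zero]
      split_ifs with h5 h6
      · exfalso; rcases h with h | h
        · exact h (by rw [h5]; exact (e1 i).symm)
        · exact h (by rw [h6]; exact (e1 j).symm)
      all_goals simp
    · simp only [evalGen, mul_assoc, hXm]
      rw [← hψ, ← hψ, eUnit_mul, eUnit_mul, if_neg (by rintro rfl; exact h4 (e1 j).symm),
        if_neg (by rintro rfl; exact h3 (e1 i).symm)]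
      simp
  · have e1 : ∀ x : Fin n, x - 1 + 1 = x := fun x => by abel
    refine serre_eq_zero hq hq' hij ?_ (fun h => ?_) (fun h3 h4 => ?_)
    · simp only [evalGen, mul_assoc, hYm]
      rw [← hψ, eUnit_mul, if_neg (hne i)]; simp
    · simp only [evalGen, mul_assoc, hYm]
      rw [← hψ, ← hψ, eUnit_mul, mul_ite, eUnit_mul, mul_zero]
      split_ifs with h5 h6
      · exfalso; rcases h with h | h
        · exact h (by rw [← h6]; exact (e1 i).symm)
        · exact h (by rw [← h5]; exact (e1 j).symm)
      all_goals simp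
    · simp only [evalGen, mul_assoc, hYm]
      rw [← hψ, ← hψ, eUnit_mul, eUnit_mul, if_neg (by rintro rfl; exact h3 (e1 i).symm),
        if_neg (by rintro rfl; exact h4 (e1 j).symm)]
      simp

end eval

/-! ### The representation on the tensor product -/

section tensorRep

variable {q p : ℂ} {n N : ℕ}

theorem siteOp_mul (A B : Fin N → Module.End ℂ (Fin n → ℂ)) :
    siteOp A * siteOp B = siteOp fun l => A l * B l :=
  (PiTensorProduct.map_mul A B).symm

theorem siteOp_one : siteOp (fun _ : Fin N => (1 : Module.End ℂ (Fin n → ℂ))) = 1 :=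
  PiTensorProduct.map_one

/-- An operator at the site `i`, acting on `⊗^N V(z)`. -/
def siteLin (n : ℕ) {N : ℕ} (i : Fin N) : Module.End ℂ (Fin n → ℂ) →ₗ[ℂ] Module.End ℂ (Tens n N) where
  toFun D := spinOp (siteOp (Function.update 1 i D))
  map_add' D D' := by
    rw [siteOp, PiTensorProduct.map_update_add]
    exact spinOp_add _ _
  map_smul' c D := by
    rw [siteOp, PiTensorProduct.map_update_smul]
    exact spinOp_smul _ _

theorem siteLin_apply (i : Fin N) (D : Module.End ℂ (Fin n → ℂ)) :
    siteLin n i D = spinOp (siteOp (Function.update 1 i D)) := rfl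

theorem siteLin_one (i : Fin N) : siteLin n i 1 = 1 := by
  rw [siteLin_apply]
  have : Function.update (1 : Fin N → Module.End ℂ (Fin n → ℂ)) i 1 = fun _ => 1 := by
    funext l
    by_cases h : l = i
    · subst h; simp
    · simp [h]
  rw [this, siteOp_one, spinOp_one]

theorem siteLin_mul (i : Fin N) (D D' : Module.End ℂ (Fin n → ℂ)) :
    siteLin n i (D * D') = siteLin n i D * siteLin n i D' := by
  rw [siteLin_apply, siteLin_apply, siteLin_apply, ← spinOp_mul, siteOp_mul]
  congr 2
  funext l
  by_cases h : l = i
  · subst h; simp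
  · simp [h]

theorem siteLin_comm {i j : Fin N} (hij : i ≠ j) (D D' : Module.End ℂ (Fin n → ℂ)) :
    Commute (siteLin n i D) (siteLin n j D') := by
  rw [siteLin_apply, siteLin_apply]
  refine spinOp_comm ?_
  rw [Commute, SemiconjBy, siteOp_mul, siteOp_mul]
  congr 1
  funext l
  by_cases h : l = i
  · subst h; simp [hij]
  · simp [h]

variable [NeZero n]

/-- The generators acting at the site `i`. -/
def siteGen (q p : ℂ) (n : ℕ) {N : ℕ} [NeZero n] (i : Fin N) : QGen n → Module.End ℂ (Tens n N) :=
  evalGen q (siteLin n i) (fun ε => if ε = 0 then polyOp (Ring.inverse (yOp q p i)) else 1)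
    (fun ε => if ε = 0 then polyOp (yOp q p i) else 1)

theorem siteLin_polyOp_comm (i : Fin N) (D : Module.End ℂ (Fin n → ℂ))
    (B : Module.End ℂ (Laurent N)) : Commute (siteLin n i D) (polyOp B) :=
  (polyOp_spinOp_comm _ _).symm

theorem commute_ite_one {A : Type*} [Monoid A] {x y : A} {P : Prop} [Decidable P]
    (h : Commute x y) : Commute x (if P then y else 1) := by
  split_ifs
  · exact h
  · exact Commute.one_right x

theorem uqRep_siteGen (hn : 2 ≤ n) (hq : q ≠ 0) (hq' : ∀ a : ℕ, 0 < a → q ^ a = 1 → q = 1)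
    (hp : p ≠ 0) (i : Fin N) : UqRep q (siteGen q p n i) := by
  have hu := isUnit_yOp hq hp i
  refine uqRep_evalGen hn hq hq' (siteLin_one i) (siteLin_mul i)
    (fun ε a => commute_ite_one (siteLin_polyOp_comm _ _ _))
    (fun ε a => commute_ite_one (siteLin_polyOp_comm _ _ _)) (fun ε => ?_) (fun ε => ?_)
  · split_ifs
    · rw [← polyOp_mul, Ring.inverse_mul_cancel _ hu, polyOp_one]
    · simp
  · split_ifs
    · rw [← polyOp_mul, Ring.mul_inverse_cancel _ hu, polyOp_one]
    · simp

theorem siteGen_comm (hq : q ≠ 0) (hp : p ≠ 0) {i j : Fin N} (hij : i ≠ j) (x y : QGen n) :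
    Commute (siteGen q p n i x) (siteGen q p n j y) := by
  have c0 := yOp_comm hq hp i j
  have c1 := siteLin_comm (n := n) hij
  have c2 := fun D B => siteLin_polyOp_comm (n := n) i D B
  have c3 := fun D B => siteLin_polyOp_comm (n := n) j D B
  have hX : ∀ k : Fin N, ∀ ε, ∃ B, (B = Ring.inverse (yOp q p k) ∨ B = 1) ∧
      (if ε = (0 : Fin n) then (polyOp (Ring.inverse (yOp q p k)) : Module.End ℂ (Tens n N)) else 1) =
        polyOp B := by
    intro k ε
    split_ifs
    · exact ⟨_, .inl rfl, rfl⟩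
    · exact ⟨1, .inr rfl, polyOp_one.symm⟩
  have hY : ∀ k : Fin N, ∀ ε, ∃ B, (B = yOp q p k ∨ B = 1) ∧
      (if ε = (0 : Fin n) then (polyOp (yOp q p k) : Module.End ℂ (Tens n N)) else 1) =
        polyOp B := by
    intro k ε
    split_ifs
    · exact ⟨_, .inl rfl, rfl⟩
    · exact ⟨1, .inr rfl, polyOp_one.symm⟩
  have form : ∀ k : Fin N, ∀ x : QGen n, ∃ B D, (B = Ring.inverse (yOp q p k) ∨ B = yOp q p k ∨ B = 1) ∧
      siteGen q p n k x = polyOp B * siteLin n k D := by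
    intro k x
    cases x with
    | K ε => exact ⟨1, kSite q 1 ε, .inr (.inr rfl), by rw [polyOp_one, one_mul]; rfl⟩
    | Kinv ε => exact ⟨1, kSite q (-1) ε, .inr (.inr rfl), by rw [polyOp_one, one_mul]; rfl⟩
    | E ε =>
      obtain ⟨B, hB, e⟩ := hX k ε
      exact ⟨B, eUnit (ε - 1) ε, by tauto, by rw [← e]; rfl⟩
    | F ε =>
      obtain ⟨B, hB, e⟩ := hY k ε
      exact ⟨B, eUnit ε (ε - 1), by tauto, by rw [← e]; rfl⟩
  obtain ⟨B, D, hB, e⟩ := form i x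
  obtain ⟨B', D', hB', e'⟩ := form j y
  have hc' : Commute (yOp q p i) B' := by
    rcases hB' with rfl | rfl | rfl
    exacts [Commute.ringInverse_right' c0, c0, Commute.one_right _]
  have hc : Commute B B' := by
    rcases hB with rfl | rfl | rfl
    exacts [(Commute.ringInverse_right' hc'.symm).symm, hc', Commute.one_left _]
  rw [e, e']
  exact Commute.mul_left (Commute.mul_right (polyOp_comm hc) (c3 D' B).symm)
    (Commute.mul_right (c2 D B') (c1 D D'))

/-- The action on the first `t` factors. -/
def headGen (q p : ℂ) (n N : ℕ) [NeZero n] (t : ℕ) : QGen n → Module.End ℂ (Tens n N)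
  | .K ε => spinOp (siteOp fun j => if (j : ℕ) < t then kSite q 1 ε else 1)
  | .Kinv ε => spinOp (siteOp fun j => if (j : ℕ) < t then kSite q (-1) ε else 1)
  | .E ε => ∑ i ∈ Finset.univ.filter (fun i : Fin N => (i : ℕ) < t),
      (if ε = 0 then polyOp (Ring.inverse (yOp q p i)) else 1) *
      spinOp (siteOp fun j => if j < i then 1 else if j = i then eUnit (ε - 1) ε else
        if (j : ℕ) < t then kSite q 1 ε else 1)
  | .F ε => ∑ i ∈ Finset.univ.filter (fun i : Fin N => (i : ℕ) < t),
      (if ε = 0 then polyOp (yOp q p i) else 1) *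
      spinOp (siteOp fun j => if j < i then kSite q (-1) ε else
        if j = i then eUnit ε (ε - 1) else 1)

theorem headGen_full : headGen q p n N N = genTens q p n N := by
  funext x
  cases x <;> simp [headGen, genTens]

theorem filter_lt_succ (i : Fin N) : Finset.univ.filter (fun k : Fin N => (k : ℕ) < (i : ℕ) + 1) =
    insert i (Finset.univ.filter fun k : Fin N => (k : ℕ) < i) := by
  ext k
  simp only [Finset.mem_filter, Finset.mem_univ, true_and, Finset.mem_insert, Fin.ext_iff]
  omega

theorem headGen_succ (i : Fin N) : headGen q p n N ((i : ℕ) + 1) =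
    coprod (headGen q p n N i) (siteGen q p n i) := by
  funext x
  cases x with
  | K ε =>
    simp only [headGen, coprod, siteGen, evalGen, siteLin_apply]
    rw [← spinOp_mul, siteOp_mul]
    congr 2
    funext l
    by_cases h : l = i
    · subst h; simp
    · have : ((l : ℕ) < i + 1) = ((l : ℕ) < i) := by rw [Fin.ext_iff] at h; simp; omega
      simp [h, this]
  | Kinv ε =>
    simp only [headGen, coprod, siteGen, evalGen, siteLin_apply]
    rw [← spinOp_mul, siteOp_mul]
    congr 2
    funext l
    by_cases h : l = i
    · subst h; simp
    · have : ((l : ℕ) < i + 1) = ((l : ℕ) < i) := by rw [Fin.ext_iff] at h; simp; omega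
      simp [h, this]
  | E ε =>
    simp only [headGen, coprod, siteGen, evalGen, siteLin_apply]
    rw [filter_lt_succ, Finset.sum_insert (by simp), add_comm, Finset.sum_mul]
    congr 1
    · refine Finset.sum_congr rfl fun k hk => ?_
      have hk' : (k : ℕ) < i := (Finset.mem_filter.1 hk).2
      rw [mul_assoc, ← spinOp_mul, siteOp_mul]
      congr 3
      funext l
      by_cases h : l = i
      · subst h
        have h1 : ¬ l < k := by rw [Fin.lt_def]; omega
        have h2 : l ≠ k := by rw [ne_eq, Fin.ext_iff]; omega
        simp [h1, h2]
      · have : ((l : ℕ) < i + 1) = ((l : ℕ) < i) := by rw [Fin.ext_iff] at h; simp; omega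
        simp [h, this]
    · congr 3
      funext l
      by_cases h : l = i
      · subst h; simp
      · have : ((l : ℕ) < i + 1) = (l < i) := by
          rw [Fin.ext_iff] at h; rw [Fin.lt_def]; simp; omega
        simp only [h, this, if_false]
        split_ifs <;> simp [h]
  | F ε =>
    simp only [headGen, coprod, siteGen, evalGen, siteLin_apply]
    rw [filter_lt_succ, Finset.sum_insert (by simp), add_comm]
    congr 1
    rw [← mul_assoc]
    have hc : Commute (spinOp (siteOp fun j : Fin N => if (j : ℕ) < i then kSite q (-1) ε else 1) :
        Module.End ℂ (Tens n N)) (if ε = 0 then polyOp (yOp q p i) else 1) :=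
      commute_ite_one (polyOp_spinOp_comm _ _).symm
    rw [hc.eq, mul_assoc, ← spinOp_mul, siteOp_mul]
    congr 3
    funext l
    by_cases h : l = i
    · subst h; simp
    · have : ((l : ℕ) < i) = (l < i) := by rw [Fin.lt_def]
      simp only [h, this, if_false]
      split_ifs <;> simp [h]

theorem uqRep_headGen (hn : 2 ≤ n) (hq : q ≠ 0) (hq' : ∀ a : ℕ, 0 < a → q ^ a = 1 → q = 1)
    (hp : p ≠ 0) : ∀ t ≤ N, UqRep q (headGen q p n N t) ∧ ∀ i : Fin N, t ≤ i → ∀ x y,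
      Commute (headGen q p n N t x) (siteGen q p n i y)
  | 0, _ => by
    have e : headGen q p n N 0 = fun x => match x with
      | .K _ => 1
      | .Kinv _ => 1
      | .E _ => 0
      | .F _ => 0 := by
      funext x
      cases x <;> simp [headGen, siteOp_one, spinOp_one]
    rw [e]
    refine ⟨⟨by simp, by simp, by simp, by simp, by simp, by simp, by simp, fun i j hij => ?_,
      fun i j hij => ?_⟩, fun i _ x y => ?_⟩
    · exact serre_eq_zero hq hq' hij (by simp) (by simp) (by simp)
    · exact serre_eq_zero hq hq' hij (by simp) (by simp) (by simp)
    · cases x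
      · exact Commute.zero_left _
      · exact Commute.zero_left _
      · exact Commute.one_left _
      · exact Commute.one_left _
  | t + 1, ht => by
    obtain ⟨h1, h2⟩ := uqRep_headGen hn hq hq' hp t (by omega)
    have hs := headGen_succ (q := q) (p := p) (n := n) (⟨t, by omega⟩ : Fin N)
    simp only at hs
    rw [hs]
    refine ⟨h1.coprod hn hq hq' (uqRep_siteGen hn hq hq' hp _) (h2 _ le_rfl), fun i hi x y => ?_⟩
    have c1 := fun x => h2 i (by omega) x y
    have c2 := fun x => siteGen_comm (n := n) hq hp (i := ⟨t, by omega⟩) (j := i)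
      (by rw [ne_eq, Fin.ext_iff]; simp; omega) x y
    cases x with
    | K ε => exact (c1 _).mul_left (c2 _)
    | Kinv ε => exact (c1 _).mul_left (c2 _)
    | E ε => exact ((c1 _).mul_left (c2 _)).add_left (c2 _)
    | F ε => exact (c1 _).add_left ((c1 _).mul_left (c2 _))

theorem uqRep_genTens (hn : 2 ≤ n) (hq : q ≠ 0) (hq' : ∀ a : ℕ, 0 < a → q ^ a = 1 → q = 1)
    (hp : p ≠ 0) : UqRep q (genTens q p n N) := by
  rw [← headGen_full]
  exact (uqRep_headGen hn hq hq' hp N le_rfl).1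

end tensorRep

section central

variable {q p : ℂ} {n N : ℕ} [NeZero n]

theorem list_ofFn_prod_apply {W : Type*} [AddCommGroup W] [Module ℂ W] : ∀ {m : ℕ}
    (F : Fin m → Module.End ℂ W) (c : Fin m → ℂ) (t : W), (∀ i, F i t = c i • t) →
      (List.ofFn F).prod t = (∏ i, c i) • t
  | 0, F, c, t, _ => by simp
  | m + 1, F, c, t, h => by
    rw [List.ofFn_succ, List.prod_cons, Module.End.mul_apply,
      list_ofFn_prod_apply _ (fun i => c i.succ) t fun i => h i.succ, map_smul, h, smul_smul,
      Fin.prod_univ_succ, mul_comm]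

theorem prod_kEig (hq : q ≠ 0) (a : Fin n) : ∏ ε, kEig q 1 ε a = 1 := by
  have h : ∀ ε, kEig q 1 ε a = (if a + 1 = ε then q else 1) * (if a = ε then q⁻¹ else 1) := by
    intro ε
    rw [kEig]
    simp only [eq_sub_iff_add_eq]
    rw [one_mul, sub_eq_add_neg, zpow_add₀ hq]
    congr 1 <;> split_ifs <;> simp
  simp only [h, Finset.prod_mul_distrib, Finset.prod_ite_eq, Finset.mem_univ, if_true]
  exact mul_inv_cancel₀ hq

theorem siteOp_kSite_spinVec (t : ℤ) (ε : Fin n) (e : Fin N → Fin n) :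
    siteOp (fun _ => kSite q t ε) (spinVec e) = (∏ l, kEig q t ε (e l)) • spinVec e :=
  siteOp_spinVec fun _ => kSite_single _ _ _

theorem prod_genTens_K (hq : q ≠ 0) :
    (List.ofFn fun ε : Fin n => genTens q p n N (.K ε)).prod = 1 := by
  refine ext_tens fun m e => ?_
  rw [list_ofFn_prod_apply _ (fun ε => ∏ l, kEig q 1 ε (e l))]
  · rw [Finset.prod_comm]
    simp [prod_kEig hq]
  · intro ε
    rw [genTens, spinOp_tmul, siteOp_kSite_spinVec, TensorProduct.tmul_smul]

end central

/-! ### Descent to the wedge product -/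

section descent

variable {q p : ℂ} {n N : ℕ}

/-- Two spins at the sites `i` and `j`, the others given by `e`. -/
def pairVec (e : Fin N → Fin n) (i j : Fin N) (x y : Fin n) : Spin n N :=
  spinVec (Function.update (Function.update e i x) j y)

theorem spinS_pairVec {i j : Fin N} (hij : i ≠ j) (e : Fin N → Fin n) (x y : Fin n) :
    spinS q i j (pairVec e i j x y) =
      sDiag q x y • pairVec e i j x y + (-1 : ℂ) • pairVec e i j y x := by
  simp only [pairVec]
  rw [spinS_spinVec q hij, ← update_pair_eq_swap]
  simp only [Function.update_self, Function.update_of_ne hij]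
  congr 3
  funext l
  by_cases h1 : l = j
  · subst h1; simp
  · by_cases h2 : l = i
    · subst h2; simp [h1]
    · simp [h1, h2]

theorem ext_pairVec {i j : Fin N} (hij : i ≠ j) {W : Type*} [AddCommMonoid W] [Module ℂ W]
    {A B : Spin n N →ₗ[ℂ] W} (h : ∀ e x y, A (pairVec e i j x y) = B (pairVec e i j x y)) :
    A = B := by
  refine ext_spin fun e => ?_
  have := h e (e i) (e j)
  rwa [pairVec, Function.update_eq_self, Function.update_eq_self] at this

theorem siteOp_comm_spinS {i j : Fin N} (hij : i ≠ j) {C : Fin N → Module.End ℂ (Fin n → ℂ)}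
    {c : Fin N → Fin n → ℂ} {t : Fin N → Fin n → Fin n}
    (hC : ∀ l a, C l (Pi.single a 1) = c l a • Pi.single (t l a) 1) (hc : c i = c j)
    (hi : t i = id) (hj : t j = id) : Commute (siteOp C) (spinS q i j) := by
  have hv : ∀ e, siteOp C (spinVec e) = (∏ l, c l (e l)) • spinVec fun l => t l (e l) :=
    fun e => siteOp_spinVec fun l => hC l _
  have hp : ∀ e : Fin N → Fin n, ∏ l, c l ((e ∘ Equiv.swap i j) l) = ∏ l, c l (e l) := by
    intro e
    rw [← Equiv.prod_comp (Equiv.swap i j) fun l => c l (e l)]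
    refine Finset.prod_congr rfl fun l _ => ?_
    have : c (Equiv.swap i j l) = c l := by
      rw [Equiv.swap_apply_def]
      split_ifs with h1 h2
      · rw [h1, hc]
      · rw [h2, hc]
      · rfl
    rw [Function.comp_apply, this]
  have ht : ∀ e : Fin N → Fin n, (fun l => t l ((e ∘ Equiv.swap i j) l)) =
      (fun l => t l (e l)) ∘ Equiv.swap i j := by
    intro e
    funext l
    have : t (Equiv.swap i j l) = t l := by
      rw [Equiv.swap_apply_def]
      split_ifs with h1 h2
      · rw [h1, hi, hj]
      · rw [h2, hi, hj]
      · rfl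
    simp only [Function.comp_apply, this]
  refine ext_spin fun e => ?_
  rw [Module.End.mul_apply, Module.End.mul_apply, spinS_spinVec q hij, map_add, map_smul, map_smul,
    hv, hv, hp, ht, map_smul, spinS_spinVec q hij, hi, hj]
  simp only [id]
  module

theorem siteOp_pairVec {i j : Fin N} (hij : i ≠ j) {C : Fin N → Module.End ℂ (Fin n → ℂ)}
    {c : Fin N → Fin n → ℂ} {t : Fin N → Fin n → Fin n}
    (hC : ∀ l a, C l (Pi.single a 1) = c l a • Pi.single (t l a) 1)
    (ht : ∀ l, l ≠ i → l ≠ j → t l = id) (e : Fin N → Fin n) (x y : Fin n) :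
    siteOp C (pairVec e i j x y) = (c i x * c j y *
      ∏ l ∈ (Finset.univ.erase i).erase j, c l (e l)) • pairVec e i j (t i x) (t j y) := by
  rw [pairVec, siteOp_spinVec (c := fun l => c l ((Function.update (Function.update e i x) j y) l))
    (e' := Function.update (Function.update e i (t i x)) j (t j y)), pairVec]
  · congr 1
    rw [← Finset.mul_prod_erase Finset.univ _ (Finset.mem_univ i),
      ← Finset.mul_prod_erase (Finset.univ.erase i) _ (Finset.mem_erase.2 ⟨hij.symm, Finset.mem_univ j⟩)]
    rw [Function.update_self, Function.update_of_ne hij, Function.update_self, mul_assoc]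
    congr 2
    refine Finset.prod_congr rfl fun l hl => ?_
    simp only [Finset.mem_erase, Finset.mem_univ, and_true] at hl
    rw [Function.update_of_ne hl.1, Function.update_of_ne hl.2]
  · intro l
    by_cases h1 : l = j
    · subst h1; simp [hC]
    · by_cases h2 : l = i
      · subst h2; simp [h1, hC]
      · simp [h1, h2, hC, ht l h2 h1]

variable (q n) in
/-- `X` maps `Im (g - S)` into `Ω`. -/
def DescendsAt (i j : Fin N) (X : Module.End ℂ (Tens n N)) : Prop :=
  ∀ t, wedgeMk q n N (X (polyOp (heckeG q i j) t)) = wedgeMk q n N (X (spinOp (spinS q i j) t))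

theorem DescendsAt.add {i j : Fin N} {X Y : Module.End ℂ (Tens n N)} (hX : DescendsAt q n i j X)
    (hY : DescendsAt q n i j Y) : DescendsAt q n i j (X + Y) := fun t => by
  rw [LinearMap.add_apply, LinearMap.add_apply, map_add, map_add, hX t, hY t]

theorem DescendsAt.sum {i j : Fin N} {ι : Type*} {s : Finset ι} {X : ι → Module.End ℂ (Tens n N)}
    (hX : ∀ k ∈ s, DescendsAt q n i j (X k)) : DescendsAt q n i j (∑ k ∈ s, X k) := fun t => by
  rw [LinearMap.sum_apply, LinearMap.sum_apply, map_sum, map_sum]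
  exact Finset.sum_congr rfl fun k hk => hX k hk t

theorem descendsAt_of_commute (hq : q ≠ 0) {i j : Fin N} (hij : (i : ℕ) + 1 = j)
    {X : Module.End ℂ (Tens n N)}
    (h1 : Commute X (polyOp (heckeG q i j))) (h2 : Commute X (spinOp (spinS q i j))) :
    DescendsAt q n i j X := fun t => by
  have e1 := congrArg (fun A => A t) h1.eq
  have e2 := congrArg (fun A => A t) h2.eq
  simp only [Module.End.mul_apply] at e1 e2
  rw [e1, e2, wedgeMk_heckeG hq hij]

theorem descendsAt_pair (hq : q ≠ 0) {i j : Fin N} (hij : (i : ℕ) + 1 = j)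
    {X X' : Module.End ℂ (Laurent N)} (hX : X = heckeG q i j * X' * heckeG q i j)
    {A B : Module.End ℂ (Spin n N)} (hS : spinS q i j * A = B * spinS q i j) :
    DescendsAt q n i j (polyOp X * spinOp A + polyOp X' * spinOp B) := fun t => by
  have hne := ne_of_succ hij
  have hSA : spinOp (spinS q i j) * spinOp A = (spinOp B * spinOp (spinS q i j) :
      Module.End ℂ (Tens n N)) := by rw [← spinOp_mul, hS, spinOp_mul]
  have hXp : (polyOp X : Module.End ℂ (Tens n N)) =
      polyOp (heckeG q i j) * polyOp X' * polyOp (heckeG q i j) := by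
    rw [hX, polyOp_mul, polyOp_mul]
  have hg := polyOp_heckeG_sq (n := n) hq hne
  have hs := spinOp_spinS_sq (n := n) hq hne
  have c1 := (polyOp_spinOp_comm (n := n) X' (spinS q i j)).eq
  have c2 := (polyOp_spinOp_comm (n := n) (heckeG q i j) A).eq
  have c3 := (polyOp_spinOp_comm (n := n) (heckeG q i j) (spinS q i j)).eq
  have c4 := (polyOp_spinOp_comm (n := n) X' B).eq
  have c5 := (polyOp_spinOp_comm (n := n) (heckeG q i j) B).eq
  have hL : ∀ u, wedgeMk q n N ((polyOp X * spinOp A : Module.End ℂ (Tens n N)) u) =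
      wedgeMk q n N ((polyOp X' * spinOp B * polyOp (heckeG q i j) * spinOp (spinS q i j) :
        Module.End ℂ (Tens n N)) u) := by
    intro u
    rw [hXp]
    have e : spinOp (spinS q i j) * (polyOp X' * polyOp (heckeG q i j) * spinOp A) =
        (polyOp X' * spinOp B * polyOp (heckeG q i j) * spinOp (spinS q i j) :
          Module.End ℂ (Tens n N)) := by
      calc spinOp (spinS q i j) * (polyOp X' * polyOp (heckeG q i j) * spinOp A)
          = polyOp X' * (spinOp (spinS q i j) * spinOp A) * polyOp (heckeG q i j) := by
            rw [mul_assoc, c2, ← mul_assoc, ← c1]; simp only [mul_assoc]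
        _ = _ := by rw [hSA, mul_assoc, mul_assoc, ← c3]; simp only [mul_assoc]
    rw [← e]
    simp only [Module.End.mul_apply]
    rw [wedgeMk_heckeG hq hij]
  set g : Module.End ℂ (Tens n N) := polyOp (heckeG q i j)
  set S : Module.End ℂ (Tens n N) := spinOp (spinS q i j)
  rw [LinearMap.add_apply, LinearMap.add_apply, map_add, map_add, hL, hL]
  have e1 : polyOp X' * spinOp B * g * S * g =
      (q - q⁻¹) • (polyOp X' * spinOp B * g * S) + polyOp X' * spinOp B * S := by
    rw [mul_assoc _ S, ← c3, ← mul_assoc, mul_assoc _ g g, hg, mul_add, add_mul, mul_one,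
      mul_smul_comm, smul_mul_assoc]
  have e2 : polyOp X' * spinOp B * g * S * S =
      (q - q⁻¹) • (polyOp X' * spinOp B * g * S) + polyOp X' * spinOp B * g := by
    rw [mul_assoc _ S S, hs, mul_add, mul_one, mul_smul_comm]
  have e1' := congrArg (fun A => wedgeMk q n N (A t)) e1
  have e2' := congrArg (fun A => wedgeMk q n N (A t)) e2
  simp only [LinearMap.add_apply, map_add] at e1' e2'
  set P : Module.End ℂ (Tens n N) := polyOp X' * spinOp B
  change wedgeMk q n N ((P * g * S * g) t) + wedgeMk q n N ((P * g) t)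
    = wedgeMk q n N ((P * g * S * S) t) + wedgeMk q n N ((P * S) t)
  rw [e1', e2']
  abel

variable [NeZero n]

theorem val_sub_one {ε : Fin n} (h : ε ≠ 0) : ((ε - 1 : Fin n) : ℕ) + 1 = ε := by
  have hpos : 0 < (ε : ℕ) := Fin.pos_iff_ne_zero.2 h
  have h1 : (1 : Fin n) ≤ ε := by
    rw [Fin.le_def, Fin.val_one']
    exact (Nat.mod_le _ _).trans hpos
  rw [Fin.val_sub_one_of_ne_zero h]
  omega

theorem val_zero_sub_one : (((0 : Fin n) - 1 : Fin n) : ℕ) + 1 = n := by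
  have hn := Nat.pos_of_ne_zero (NeZero.ne n)
  by_cases h : n = 1
  · subst h; simp
  · have h1 : ((1 : Fin n) : ℕ) = 1 := by rw [Fin.val_one', Nat.mod_eq_of_lt (by omega)]
    rw [Fin.sub_def]
    simp only [h1, Fin.val_zero, add_zero]
    rw [Nat.mod_eq_of_lt (by omega)]
    omega

/-- The spin part of the `i`-th term of `E_ε`. -/
def eSite (q : ℂ) (ε : Fin n) (i : Fin N) : Module.End ℂ (Spin n N) :=
  siteOp fun j => if j < i then 1 else if j = i then eUnit (ε - 1) ε else kSite q 1 ε

/-- The spin part of the `i`-th term of `F_ε`. -/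
def fSite (q : ℂ) (ε : Fin n) (i : Fin N) : Module.End ℂ (Spin n N) :=
  siteOp fun j => if j < i then kSite q (-1) ε else if j = i then eUnit ε (ε - 1) else 1

theorem eSite_single (ε : Fin n) (i l : Fin N) (a : Fin n) :
    (if l < i then (1 : Module.End ℂ (Fin n → ℂ)) else if l = i then eUnit (ε - 1) ε
      else kSite q 1 ε) (Pi.single a 1) =
    (if l < i then 1 else if l = i then (if a = ε then 1 else 0) else kEig q 1 ε a : ℂ) •
      Pi.single (if l = i then ε - 1 else a) 1 := by
  by_cases h : l < i
  · have : l ≠ i := h.ne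
    simp [h, this]
  · by_cases h2 : l = i
    · subst h2; simp [eUnit_single]
    · simp [h, h2, kSite_single]

theorem fSite_single (ε : Fin n) (i l : Fin N) (a : Fin n) :
    (if l < i then kSite q (-1) ε else if l = i then eUnit ε (ε - 1)
      else (1 : Module.End ℂ (Fin n → ℂ))) (Pi.single a 1) =
    (if l < i then kEig q (-1) ε a else if l = i then (if a = ε - 1 then 1 else 0) else 1 : ℂ) •
      Pi.single (if l = i then ε else a) 1 := by
  by_cases h : l < i
  · have : l ≠ i := h.ne
    simp [h, this, kSite_single]
  · by_cases h2 : l = i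
    · subst h2; simp [eUnit_single]
    · simp [h, h2]

theorem eSite_comm_spinS {i j k : Fin N} (hij : (i : ℕ) + 1 = j) (hki : k ≠ i) (hkj : k ≠ j)
    (ε : Fin n) : Commute (eSite q ε k) (spinS q i j) := by
  refine siteOp_comm_spinS (ne_of_succ hij) (eSite_single ε k) ?_ ?_ ?_
  · funext a
    have h : (i < k) = (j < k) := by
      rw [ne_eq, Fin.ext_iff] at hki hkj; rw [Fin.lt_def, Fin.lt_def]; simp; omega
    simp [hki.symm, hkj.symm, h]
  · funext a; simp [hki.symm]
  · funext a; simp [hkj.symm]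

theorem fSite_comm_spinS {i j k : Fin N} (hij : (i : ℕ) + 1 = j) (hki : k ≠ i) (hkj : k ≠ j)
    (ε : Fin n) : Commute (fSite q ε k) (spinS q i j) := by
  refine siteOp_comm_spinS (ne_of_succ hij) (fSite_single ε k) ?_ ?_ ?_
  · funext a
    have h : (i < k) = (j < k) := by
      rw [ne_eq, Fin.ext_iff] at hki hkj; rw [Fin.lt_def, Fin.lt_def]; simp; omega
    simp [hki.symm, hkj.symm, h]
  · funext a; simp [hki.symm]
  · funext a; simp [hkj.symm]

theorem exists_eSite_pairVec {i j : Fin N} (hij : (i : ℕ) + 1 = j) (ε : Fin n) (e : Fin N → Fin n) :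
    ∃ R : ℂ, (∀ x y, eSite q ε i (pairVec e i j x y) =
        (if x = ε then kEig q 1 ε y * R else 0) • pairVec e i j (ε - 1) y) ∧
      ∀ x y, eSite q ε j (pairVec e i j x y) =
        (if y = ε then R else 0) • pairVec e i j x (ε - 1) := by
  have hne := ne_of_succ hij
  have hlt : i < j := by rw [Fin.lt_def]; omega
  refine ⟨∏ l ∈ (Finset.univ.erase i).erase j, (if l < i then 1 else kEig q 1 ε (e l)),
    fun x y => ?_, fun x y => ?_⟩
  · rw [eSite, siteOp_pairVec hne (eSite_single ε i) (fun l hi _ => by funext a; simp [hi])]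
    simp only [lt_irrefl, if_false, if_true, if_neg hne.symm, if_neg hlt.not_gt]
    have : ∏ l ∈ (Finset.univ.erase i).erase j, (if l < i then 1 else if l = i then
        (if e l = ε then 1 else 0) else kEig q 1 ε (e l)) =
        ∏ l ∈ (Finset.univ.erase i).erase j, (if l < i then 1 else kEig q 1 ε (e l)) :=
      Finset.prod_congr rfl fun l hl => by
        simp only [Finset.mem_erase, Finset.mem_univ, and_true] at hl
        rw [if_neg hl.2]
    rw [this]
    split_ifs <;> simp
  · rw [eSite, siteOp_pairVec hne (eSite_single ε j) (fun l _ hj => by funext a; simp [hj])]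
    simp only [lt_irrefl, if_false, if_true, if_pos hlt, if_neg hne]
    have : ∏ l ∈ (Finset.univ.erase i).erase j, (if l < j then 1 else if l = j then
        (if e l = ε then 1 else 0) else kEig q 1 ε (e l)) =
        ∏ l ∈ (Finset.univ.erase i).erase j, (if l < i then 1 else kEig q 1 ε (e l)) :=
      Finset.prod_congr rfl fun l hl => by
        simp only [Finset.mem_erase, Finset.mem_univ, and_true, ne_eq, Fin.ext_iff] at hl
        have h : (l < j) = (l < i) := by rw [Fin.lt_def, Fin.lt_def]; simp; omega
        rw [if_neg (Fin.ne_of_val_ne hl.1)]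
        simp only [h]
    rw [this]
    split_ifs <;> simp

theorem exists_fSite_pairVec {i j : Fin N} (hij : (i : ℕ) + 1 = j) (ε : Fin n) (e : Fin N → Fin n) :
    ∃ R : ℂ, (∀ x y, fSite q ε i (pairVec e i j x y) =
        (if x = ε - 1 then R else 0) • pairVec e i j ε y) ∧
      ∀ x y, fSite q ε j (pairVec e i j x y) =
        (if y = ε - 1 then kEig q (-1) ε x * R else 0) • pairVec e i j x ε := by
  have hne := ne_of_succ hij
  have hlt : i < j := by rw [Fin.lt_def]; omega
  refine ⟨∏ l ∈ (Finset.univ.erase i).erase j, (if l < i then kEig q (-1) ε (e l) else 1),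
    fun x y => ?_, fun x y => ?_⟩
  · rw [fSite, siteOp_pairVec hne (fSite_single ε i) (fun l hi _ => by funext a; simp [hi])]
    simp only [lt_irrefl, if_false, if_true, if_neg hne.symm, if_neg hlt.not_gt]
    have : ∏ l ∈ (Finset.univ.erase i).erase j, (if l < i then kEig q (-1) ε (e l) else if l = i then
        (if e l = ε - 1 then 1 else 0) else 1) =
        ∏ l ∈ (Finset.univ.erase i).erase j, (if l < i then kEig q (-1) ε (e l) else 1) :=
      Finset.prod_congr rfl fun l hl => by
        simp only [Finset.mem_erase, Finset.mem_univ, and_true] at hl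
        rw [if_neg hl.2]
    rw [this]
    split_ifs <;> simp
  · rw [fSite, siteOp_pairVec hne (fSite_single ε j) (fun l _ hj => by funext a; simp [hj])]
    simp only [lt_irrefl, if_false, if_true, if_pos hlt, if_neg hne]
    have : ∏ l ∈ (Finset.univ.erase i).erase j, (if l < j then kEig q (-1) ε (e l) else if l = j then
        (if e l = ε - 1 then 1 else 0) else 1) =
        ∏ l ∈ (Finset.univ.erase i).erase j, (if l < i then kEig q (-1) ε (e l) else 1) :=
      Finset.prod_congr rfl fun l hl => by
        simp only [Finset.mem_erase, Finset.mem_univ, and_true, ne_eq, Fin.ext_iff] at hl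
        have h : (l < j) = (l < i) := by rw [Fin.lt_def, Fin.lt_def]; simp; omega
        rw [if_neg (Fin.ne_of_val_ne hl.1)]
        simp only [h]
    rw [this]
    split_ifs <;> simp

theorem sDiag_lt {x y : Fin n} (h : x < y) : sDiag q x y = q - q⁻¹ := by
  rw [sDiag, if_neg h.ne, if_pos h]

theorem sDiag_gt {x y : Fin n} (h : y < x) : sDiag q x y = 0 := by
  rw [sDiag, if_neg h.ne', if_neg h.not_gt]

theorem sDiag_self (x : Fin n) : sDiag q x x = 1 - q⁻¹ := by
  rw [sDiag, if_pos rfl]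

theorem kEig_of_ne {t : ℤ} {ε a : Fin n} (h1 : a ≠ ε) (h2 : a ≠ ε - 1) : kEig q t ε a = 1 := by
  simp [kEig, h1, h2]

theorem kEig_self (hn : 2 ≤ n) (t : ℤ) (ε : Fin n) : kEig q t ε ε = q ^ (-t) := by
  simp [kEig, (sub_one_ne hn ε).symm]

theorem kEig_pred (hn : 2 ≤ n) (t : ℤ) (ε : Fin n) : kEig q t ε (ε - 1) = q ^ t := by
  simp [kEig, sub_one_ne hn ε]

theorem sDiag_pred {ε y : Fin n} (hε : ε ≠ 0) (h1 : y ≠ ε) (h2 : y ≠ ε - 1) :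
    sDiag q (ε - 1) y = sDiag q ε y ∧ sDiag q y (ε - 1) = sDiag q y ε := by
  have hv := val_sub_one hε
  have e1 : (ε - 1 < y) = (ε < y) := by
    rw [ne_eq, Fin.ext_iff] at h1 h2; rw [Fin.lt_def, Fin.lt_def]; simp only [eq_iff_iff]; omega
  have e2 : (y < ε - 1) = (y < ε) := by
    rw [ne_eq, Fin.ext_iff] at h1 h2; rw [Fin.lt_def, Fin.lt_def]; simp only [eq_iff_iff]; omega
  simp only [sDiag, e1, e2, h1, h2, h1.symm, h2.symm, if_false, and_self]

theorem eSite_add_comm_spinS (hn : 2 ≤ n) (hq : q ≠ 0) {i j : Fin N} (hij : (i : ℕ) + 1 = j)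
    {ε : Fin n} (hε : ε ≠ 0) : Commute (eSite q ε i + eSite q ε j) (spinS q i j) := by
  have hne := ne_of_succ hij
  refine ext_pairVec hne fun e x y => ?_
  obtain ⟨R, h1, h2⟩ := exists_eSite_pairVec (q := q) hij ε e
  have hp := sub_one_ne hn ε
  have hlt : ε - 1 < ε := by have := val_sub_one hε; rw [Fin.lt_def]; omega
  simp only [Module.End.mul_apply, LinearMap.add_apply, spinS_pairVec hne, map_add, map_smul, h1, h2]
  by_cases hx : x = ε
  · subst hx
    by_cases hy : y = x
    · subst hy
      simp only [if_true, sDiag_self, sDiag_lt hlt, sDiag_gt hlt, kEig_self hn, zpow_neg, zpow_one]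
      match_scalars <;> field_simp <;> ring
    · by_cases hy' : y = x - 1
      · subst hy'
        simp only [if_true, hp, if_false, sDiag_self, sDiag_gt hlt, kEig_pred hn, zpow_one]
        match_scalars <;> field_simp <;> ring
      · have := sDiag_pred (q := q) hε hy hy'
        simp only [if_true, hy, if_false, this, kEig_of_ne hy hy']
        match_scalars <;> ring
  · by_cases hy : y = ε
    · subst hy
      by_cases hx' : x = y - 1
      · subst hx'
        simp only [if_true, hp, if_false, sDiag_self, sDiag_lt hlt, kEig_pred hn, zpow_one]
        match_scalars <;> field_simp <;> ring
      · have := sDiag_pred (q := q) hε hx hx'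
        simp only [if_true, hx, if_false, this, kEig_of_ne hx hx']
        match_scalars <;> ring
    · simp only [hx, hy, if_false]; module

theorem fSite_add_comm_spinS (hn : 2 ≤ n) (hq : q ≠ 0) {i j : Fin N} (hij : (i : ℕ) + 1 = j)
    {ε : Fin n} (hε : ε ≠ 0) : Commute (fSite q ε i + fSite q ε j) (spinS q i j) := by
  have hne := ne_of_succ hij
  refine ext_pairVec hne fun e x y => ?_
  obtain ⟨R, h1, h2⟩ := exists_fSite_pairVec (q := q) hij ε e
  have hp := sub_one_ne hn ε
  have hlt : ε - 1 < ε := by have := val_sub_one hε; rw [Fin.lt_def]; omega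
  simp only [Module.End.mul_apply, LinearMap.add_apply, spinS_pairVec hne, map_add, map_smul, h1, h2]
  by_cases hx : x = ε - 1
  · subst hx
    by_cases hy : y = ε - 1
    · subst hy
      simp only [if_true, sDiag_self, sDiag_lt hlt, sDiag_gt hlt, kEig_pred hn, zpow_neg, zpow_one]
      match_scalars <;> field_simp <;> ring
    · by_cases hy' : y = ε
      · subst hy'
        simp only [if_true, hp.symm, if_false, sDiag_self, sDiag_lt hlt, kEig_self hn, neg_neg, zpow_one]
        match_scalars <;> field_simp <;> ring
      · have := sDiag_pred (q := q) hε hy' hy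
        simp only [if_true, hy, if_false, this, kEig_of_ne hy' hy]
        match_scalars <;> ring
  · by_cases hy : y = ε - 1
    · subst hy
      by_cases hx' : x = ε
      · subst hx'
        simp only [if_true, hp.symm, if_false, sDiag_self, sDiag_gt hlt, kEig_self hn, neg_neg, zpow_one]
        match_scalars <;> field_simp <;> ring
      · have := sDiag_pred (q := q) hε hx' hx
        simp only [if_true, hx, if_false, this, kEig_of_ne hx' hx]
        match_scalars <;> ring
    · simp only [hx, hy, if_false]; module

theorem spinS_eSite_zero (hn : 2 ≤ n) (hq : q ≠ 0) {i j : Fin N} (hij : (i : ℕ) + 1 = j) :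
    spinS q i j * eSite q (0 : Fin n) i = eSite q 0 j * spinS q i j := by
  have hne := ne_of_succ hij
  refine ext_pairVec hne fun e x y => ?_
  obtain ⟨R, h1, h2⟩ := exists_eSite_pairVec (q := q) hij (0 : Fin n) e
  have hp := sub_one_ne hn (0 : Fin n)
  have hv := val_zero_sub_one (n := n)
  simp only [Module.End.mul_apply, spinS_pairVec hne, map_add, map_smul, h1, h2]
  by_cases hx : x = 0
  · subst hx
    have hlt : (0 : Fin n) < 0 - 1 := by
      rw [Fin.lt_def, Fin.val_zero]; omega
    by_cases hy : y = 0
    · subst hy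
      simp only [if_true, sDiag_self, sDiag_gt hlt, kEig_self hn, zpow_neg, zpow_one]
      match_scalars <;> field_simp <;> ring
    · by_cases hy' : y = 0 - 1
      · subst hy'
        simp only [if_true, hp, if_false, sDiag_self, kEig_pred hn, zpow_one]
        match_scalars <;> field_simp <;> ring
      · have : y < 0 - 1 := by
          rw [Fin.ext_iff] at hy'; rw [Fin.lt_def]; have := y.2; omega
        simp only [if_true, hy, if_false, sDiag_gt this, kEig_of_ne hy hy']
        match_scalars <;> ring
  · by_cases hy : y = 0
    · subst hy
      have : (0 : Fin n) < x := Fin.pos_iff_ne_zero.2 hx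
      simp only [if_true, hx, if_false, sDiag_gt this]
      match_scalars <;> ring
    · simp only [hx, hy, if_false]; module

theorem spinS_fSite_zero (hn : 2 ≤ n) (hq : q ≠ 0) {i j : Fin N} (hij : (i : ℕ) + 1 = j) :
    spinS q i j * fSite q (0 : Fin n) j = fSite q 0 i * spinS q i j := by
  have hne := ne_of_succ hij
  refine ext_pairVec hne fun e x y => ?_
  obtain ⟨R, h1, h2⟩ := exists_fSite_pairVec (q := q) hij (0 : Fin n) e
  have hp := sub_one_ne hn (0 : Fin n)
  have hv := val_zero_sub_one (n := n)
  simp only [Module.End.mul_apply, spinS_pairVec hne, map_add, map_smul, h1, h2]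
  have hlt : (0 : Fin n) < 0 - 1 := by
    rw [Fin.lt_def, Fin.val_zero]; omega
  by_cases hy : y = 0 - 1
  · subst hy
    by_cases hx : x = 0 - 1
    · subst hx
      simp only [if_true, sDiag_self, sDiag_gt hlt, kEig_pred hn, zpow_neg, zpow_one]
      match_scalars <;> field_simp <;> ring
    · by_cases hx' : x = 0
      · subst hx'
        simp only [if_true, hp.symm, if_false, sDiag_self, kEig_self hn, neg_neg, zpow_one]
        match_scalars <;> field_simp <;> ring
      · have : (0 : Fin n) < x := Fin.pos_iff_ne_zero.2 hx'
        simp only [if_true, hx, if_false, sDiag_gt this, kEig_of_ne hx' hx]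
        match_scalars <;> ring
  · by_cases hx : x = 0 - 1
    · subst hx
      have : y < 0 - 1 := by
        rw [Fin.ext_iff] at hy; rw [Fin.lt_def]; have := y.2; omega
      simp only [if_true, hy, if_false, sDiag_gt this]
      match_scalars <;> ring
    · simp only [hx, hy, if_false]; module

end descent

section finiteAction

variable {q p : ℂ} {n N : ℕ}

theorem omega_le_comap (hq : q ≠ 0) (hq2 : q + q⁻¹ ≠ 0) {X : Module.End ℂ (Tens n N)}
    (h : ∀ i j : Fin N, (i : ℕ) + 1 = j → DescendsAt q n i j X) :
    omega q n N ≤ (omega q n N).comap X := by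
  have := omega_le_ker hq hq2 (wedgeMk q n N ∘ₗ X) fun i j hij t => h i j hij t
  rw [LinearMap.ker_comp] at this
  rwa [wedgeMk, Submodule.ker_mkQ] at this

theorem descendsAt_ham (hq : q ≠ 0) (hp : p ≠ 0) {i j : Fin N} (hij : (i : ℕ) + 1 = j) (l : ℤ) :
    DescendsAt q n i j (hamTens q p n N l) :=
  descendsAt_of_commute hq hij (polyOp_comm (heckeG_ham_comm hq hp hij l).symm)
    (polyOp_spinOp_comm _ _)

variable [NeZero n]

theorem genTens_E (ε : Fin n) : genTens q p n N (.E ε) =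
    ∑ i : Fin N, polyOp (if ε = 0 then Ring.inverse (yOp q p i) else 1) * spinOp (eSite q ε i) := by
  simp only [genTens, eSite]
  refine Finset.sum_congr rfl fun i _ => ?_
  split_ifs <;> simp [polyOp_one]

theorem genTens_F (ε : Fin n) : genTens q p n N (.F ε) =
    ∑ i : Fin N, polyOp (if ε = 0 then yOp q p i else 1) * spinOp (fSite q ε i) := by
  simp only [genTens, fSite]
  refine Finset.sum_congr rfl fun i _ => ?_
  split_ifs <;> simp [polyOp_one]

theorem descendsAt_kSite (hq : q ≠ 0) {i j : Fin N} (hij : (i : ℕ) + 1 = j) (t : ℤ) (ε : Fin n) :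
    DescendsAt q n i j (spinOp (siteOp fun _ => kSite q t ε)) :=
  descendsAt_of_commute hq hij (polyOp_spinOp_comm _ _).symm (spinOp_comm
    (siteOp_comm_spinS (ne_of_succ hij) (c := fun _ => kEig q t ε) (t := fun _ => id)
      (fun _ => kSite_single _ _) rfl rfl rfl))

theorem commute_one_ite {A : Type*} [Monoid A] {x y : A} {P : Prop} [Decidable P]
    (h : P → Commute x y) : Commute (if P then x else 1) y := by
  split_ifs with hP
  · exact h hP
  · exact Commute.one_left y

theorem descendsAt_genTens (hn : 2 ≤ n) (hq : q ≠ 0) (hp : p ≠ 0) {i j : Fin N}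
    (hij : (i : ℕ) + 1 = j) (x : QGen n) : DescendsAt q n i j (genTens q p n N x) := by
  have hne := ne_of_succ hij
  cases x with
  | K ε => exact descendsAt_kSite hq hij _ _
  | Kinv ε => exact descendsAt_kSite hq hij _ _
  | E ε =>
    rw [genTens_E, sum_pair_split hne]
    refine DescendsAt.add ?_ (DescendsAt.sum fun k hk => ?_)
    · by_cases hε : ε = 0
      · subst hε
        simp only [if_true]
        exact descendsAt_pair hq hij (inverse_yOp_pred hq hp hij) (spinS_eSite_zero hn hq hij)
      · simp only [if_neg hε, polyOp_one, one_mul]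
        rw [← spinOp_add]
        exact descendsAt_of_commute hq hij (polyOp_spinOp_comm _ _).symm
          (spinOp_comm (eSite_add_comm_spinS hn hq hij hε))
    · simp only [Finset.mem_erase, Finset.mem_univ, and_true] at hk
      refine descendsAt_of_commute hq hij (Commute.mul_left (polyOp_comm (commute_one_ite fun _ => ?_))
        (polyOp_spinOp_comm _ _).symm) (Commute.mul_left (polyOp_spinOp_comm _ _)
          (spinOp_comm (eSite_comm_spinS hij hk.2 hk.1 ε)))
      exact (Commute.ringInverse_right' (heckeG_yOp_comm hq hp hij hk.2 hk.1)).symm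
  | F ε =>
    rw [genTens_F, sum_pair_split hne]
    refine DescendsAt.add ?_ (DescendsAt.sum fun k hk => ?_)
    · by_cases hε : ε = 0
      · subst hε
        simp only [if_true]
        have : DescendsAt q n i j (polyOp (yOp q p j) * spinOp (fSite q 0 j) +
            polyOp (yOp q p i) * spinOp (fSite q (0 : Fin n) i)) :=
          descendsAt_pair hq hij (yOp_succ hq hij) (spinS_fSite_zero hn hq hij)
        rwa [add_comm] at this
      · simp only [if_neg hε, polyOp_one, one_mul]
        rw [← spinOp_add]
        exact descendsAt_of_commute hq hij (polyOp_spinOp_comm _ _).symm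
          (spinOp_comm (fSite_add_comm_spinS hn hq hij hε))
    · simp only [Finset.mem_erase, Finset.mem_univ, and_true] at hk
      refine descendsAt_of_commute hq hij (Commute.mul_left (polyOp_comm (commute_one_ite fun _ => ?_))
        (polyOp_spinOp_comm _ _).symm) (Commute.mul_left (polyOp_spinOp_comm _ _)
          (spinOp_comm (fSite_comm_spinS hij hk.2 hk.1 ε)))
      exact (heckeG_yOp_comm hq hp hij hk.2 hk.1).symm

theorem UqRep.rel {A : Type} [Ring A] [Algebra ℂ A] {g : QGen n → A} (h : UqRep q g)
    (hc : (List.ofFn fun i => g (.K i)).prod = 1) {x y : FreeAlgebra ℂ (QGen n)}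
    (hxy : UqRel q n x y) : FreeAlgebra.lift ℂ g x = FreeAlgebra.lift ℂ g y := by
  have hs : ∀ b X Y, FreeAlgebra.lift ℂ g (serre q b X Y) =
      serre q b (FreeAlgebra.lift ℂ g X) (FreeAlgebra.lift ℂ g Y) := by
    intro b X Y
    simp only [serre, map_sum, map_smul, map_mul, map_pow]
  cases hxy with
  | K_Kinv i => simpa using h.K_Kinv i
  | Kinv_K i => simpa using h.Kinv_K i
  | K_K i j => simpa using h.K_K i j
  | K_E i j =>
    simp only [map_mul, map_smul, FreeAlgebra.lift_ι_apply]
    rw [h.K_E, smul_mul_assoc, mul_assoc, h.K_Kinv, mul_one]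
  | K_F i j =>
    simp only [map_mul, map_smul, FreeAlgebra.lift_ι_apply]
    rw [h.K_F, smul_mul_assoc, mul_assoc, h.K_Kinv, mul_one]
  | EF_ne i j hij => simpa using h.EF_ne i j hij
  | EF_eq i => simpa using h.EF_eq i
  | serre_E i j hij => rw [hs]; simpa using h.serre_E i j hij
  | serre_F i j hij => rw [hs]; simpa using h.serre_F i j hij
  | central =>
    rw [map_list_prod, List.map_ofFn, map_one, ← hc]
    congr 2
    funext i
    simp

/-- The algebra homomorphism attached to a representation of the relations. -/
def UqRep.hom {A : Type} [Ring A] [Algebra ℂ A] {g : QGen n → A} (h : UqRep q g)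
    (hc : (List.ofFn fun i => g (.K i)).prod = 1) : Uq q n →ₐ[ℂ] A :=
  RingQuot.liftAlgHom ℂ ⟨FreeAlgebra.lift ℂ g, fun _ _ hxy => h.rel hc hxy⟩

theorem UqRep.hom_gen {A : Type} [Ring A] [Algebra ℂ A] {g : QGen n → A} (h : UqRep q g)
    (hc : (List.ofFn fun i => g (.K i)).prod = 1) (x : QGen n) : h.hom hc (Uq.gen q x) = g x := by
  rw [UqRep.hom, Uq.gen, RingQuot.liftAlgHom_mkAlgHom_apply, FreeAlgebra.lift_ι_apply]

theorem uq_hom_ext {A : Type} [Ring A] [Algebra ℂ A] {φ ψ : Uq q n →ₐ[ℂ] A}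
    (h : ∀ x, φ (Uq.gen q x) = ψ (Uq.gen q x)) : φ = ψ := by
  refine RingQuot.ringQuot_ext' ℂ _ _ ?_
  refine FreeAlgebra.hom_ext ?_
  funext x
  exact h x

theorem uq_induction {P : Uq q n → Prop} (hgen : ∀ x, P (Uq.gen q x)) (h1 : ∀ c : ℂ, P (algebraMap ℂ _ c))
    (hadd : ∀ x y, P x → P y → P (x + y)) (hmul : ∀ x y, P x → P y → P (x * y)) (x : Uq q n) :
    P x := by
  obtain ⟨y, rfl⟩ := RingQuot.mkAlgHom_surjective ℂ (UqRel q n) x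
  induction y using FreeAlgebra.induction with
  | grade0 c => rw [AlgHom.commutes]; exact h1 c
  | grade1 x => exact hgen x
  | mul a b ha hb => rw [map_mul]; exact hmul _ _ ha hb
  | add a b ha hb => rw [map_add]; exact hadd _ _ ha hb

theorem wedge_end_ext {W : Type*} [AddCommGroup W] [Module ℂ W] {A B : Wedge q n N →ₗ[ℂ] W}
    (h : ∀ t, A (wedgeMk q n N t) = B (wedgeMk q n N t)) : A = B :=
  Submodule.linearMap_qext _ (LinearMap.ext h)

theorem existsUnique_levelZero (hn : 2 ≤ n) (hq : q ≠ 0)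
    (hq' : ∀ a : ℕ, 0 < a → q ^ a = 1 → q = 1) (hp : p ≠ 0) (N : ℕ) :
    ∃! φ : Uq q n →ₐ[ℂ] Module.End ℂ (Wedge q n N), IsLevelZeroAction q p n N φ := by
  have hq2 := add_inv_ne_zero hq hq'
  let T : Uq q n →ₐ[ℂ] Module.End ℂ (Tens n N) :=
    (uqRep_genTens hn hq hq' hp).hom (prod_genTens_K hq)
  have hT : ∀ x, omega q n N ≤ (omega q n N).comap (T x) := by
    refine uq_induction (fun x => ?_) (fun c => ?_) (fun x y hx hy => ?_) (fun x y hx hy => ?_)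
    · rw [UqRep.hom_gen]
      exact omega_le_comap hq hq2 fun i j hij => descendsAt_genTens hn hq hp hij x
    · intro t ht
      rw [AlgHom.commutes, Submodule.mem_comap, Module.algebraMap_end_apply]
      exact Submodule.smul_mem _ _ ht
    · intro t ht
      rw [map_add, Submodule.mem_comap, LinearMap.add_apply]
      exact Submodule.add_mem _ (hx ht) (hy ht)
    · intro t ht
      rw [map_mul, Submodule.mem_comap, Module.End.mul_apply]
      exact hx (hy ht)
  let φ : Uq q n →ₐ[ℂ] Module.End ℂ (Wedge q n N) :=
    { toFun := fun x => (omega q n N).mapQ (omega q n N) (T x) (hT x)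
      map_one' := wedge_end_ext fun t => by
        simp [wedgeMk]
      map_mul' := fun x y => wedge_end_ext fun t => by
        simp [wedgeMk]
      map_zero' := wedge_end_ext fun t => by
        simp [wedgeMk]
      map_add' := fun x y => wedge_end_ext fun t => by
        simp [wedgeMk]
      commutes' := fun c => wedge_end_ext fun t => by
        simp [wedgeMk, Module.algebraMap_end_apply] }
  have hφ : ∀ x t, φ x (wedgeMk q n N t) = wedgeMk q n N (T x t) := fun x t => rfl
  refine ⟨φ, fun x t => ?_, fun ψ hψ => uq_hom_ext fun x => wedge_end_ext fun t => ?_⟩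
  · rw [hφ, UqRep.hom_gen]
  · rw [hψ, hφ, UqRep.hom_gen]

theorem existsUnique_hamiltonian (hq : q ≠ 0)
    (hq' : ∀ a : ℕ, 0 < a → q ^ a = 1 → q = 1) (hp : p ≠ 0) (N : ℕ) :
    ∃! h : NZ → Module.End ℂ (Wedge q n N), IsHamiltonian q p n N h := by
  have hq2 := add_inv_ne_zero hq hq'
  refine ⟨fun l => (omega q n N).mapQ (omega q n N) (hamTens q p n N l)
    (omega_le_comap hq hq2 fun i j hij => descendsAt_ham hq hp hij l), fun l t => rfl,
    fun h hh => funext fun l => wedge_end_ext fun t => ?_⟩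
  rw [hh]; rfl

end finiteAction

/-! ### Vacuum labels -/

section vacuum

variable {n : ℕ}

theorem mVac_eq {M : ℤ} {s : ℕ} (hs : s < n) (hMs : M ≡ s [ZMOD n]) (i : ℕ) :
    mVac n M s i = mOf n (M - i) := by
  have hn : (0 : ℤ) < n := by exact_mod_cast (Nat.zero_le s).trans_lt hs
  obtain ⟨t, ht⟩ := hMs.dvd
  have hM : M = s - n * t := by omega
  subst hM
  rw [mVac, mOf]
  have e1 : ((s : ℤ) - (s - n * t)) / n = t := by
    rw [sub_sub_cancel, Int.mul_ediv_cancel_left _ hn.ne']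
  rw [e1]
  have e2 : ((s : ℤ) - n * t - i - 1) = (s - 1 - i) + n * (-t) := by ring
  rw [e2, Int.add_mul_ediv_left _ _ hn.ne']
  split_ifs with h
  · rw [Int.ediv_eq_zero_of_lt (by omega) (by omega)]; ring
  · push Not at h
    have h1 := Int.emod_add_mul_ediv ((s : ℤ) - 1 - i) n
    have h2 := Int.emod_nonneg ((s : ℤ) - 1 - i) hn.ne'
    have h3 := Int.emod_lt_of_pos ((s : ℤ) - 1 - i) hn
    have h4 : (((i - s) / n : ℕ) : ℤ) = ((i : ℤ) - s) / n := by
      rw [Int.natCast_ediv, Nat.cast_sub h]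
    rw [h4]
    have h5 := Int.emod_add_mul_ediv ((i : ℤ) - s) n
    have h6 := Int.emod_nonneg ((i : ℤ) - s) hn.ne'
    have h7 := Int.emod_lt_of_pos ((i : ℤ) - s) hn
    set a := ((s : ℤ) - 1 - i) / n
    set b := ((i : ℤ) - s) / n
    have h8 : (n : ℤ) * (a + b + 1) = (n : ℤ) - 1 - ((s : ℤ) - 1 - i) % n - ((i : ℤ) - s) % n := by
      linarith [mul_add (n : ℤ) (a + b) 1, mul_add (n : ℤ) a b]
    have h9 : a + b + 1 = 0 := by
      have h10 : (n : ℤ) * (a + b + 1) < n * 1 := by omega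
      have h11 : (n : ℤ) * (-1) < n * (a + b + 1) := by omega
      have := lt_of_mul_lt_mul_left h10 hn.le
      have := lt_of_mul_lt_mul_left h11 hn.le
      omega
    linarith

theorem mOf_antitone (hn : 0 < n) : Antitone (mOf n) := by
  intro a b hab
  have := Int.ediv_le_ediv (by exact_mod_cast hn : (0 : ℤ) < n) (sub_le_sub_right hab 1)
  simp only [mOf]
  omega

theorem mOf_le_iff (hn : 0 < n) {k C : ℤ} : mOf n k ≤ C ↔ -(n * C) < k := by
  have hn' : (0 : ℤ) < n := by exact_mod_cast hn
  rw [mOf, neg_le, Int.le_ediv_iff_mul_le hn']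
  rw [neg_mul, mul_comm]
  omega

end vacuum

/-! ### Appending the vacuum -/

section extension

variable {n N N' : ℕ} {q p : ℂ}

/-- Append the entries of `c` to a tuple. -/
def extTuple {α : Type*} (c : ℕ → α) (N' : ℕ) (m : Fin N → α) : Fin N' → α :=
  fun i => if h : (i : ℕ) < N then m ⟨i, h⟩ else c i

variable {α : Type*} {c : ℕ → α}

theorem extTuple_castLE (h : N ≤ N') (m : Fin N → α) (i : Fin N) :
    extTuple c N' m (Fin.castLE h i) = m i := by
  simp [extTuple]

theorem extTuple_of_ge (m : Fin N → α) {i : Fin N'} (h : N ≤ (i : ℕ)) :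
    extTuple c N' m i = c i := by
  simp [extTuple, Nat.not_lt.2 h]

theorem extTuple_comp_castLE (h : N ≤ N') (m : Fin N → α) :
    extTuple c N' m ∘ Fin.castLE h = m := funext fun i => extTuple_castLE h m i

theorem extTuple_of_comp (h : N ≤ N') {m : Fin N' → α} (hm : ∀ i : Fin N', N ≤ (i : ℕ) → m i = c i) :
    extTuple c N' (m ∘ Fin.castLE h) = m := by
  funext i
  by_cases hi : (i : ℕ) < N
  · simp only [extTuple, hi, dif_pos, Function.comp_apply]; rfl
  · rw [extTuple_of_ge _ (not_lt.1 hi), hm i (not_lt.1 hi)]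

theorem extTuple_update (h : N ≤ N') (m : Fin N → α) (i : Fin N) (a : α) :
    extTuple c N' (Function.update m i a) = Function.update (extTuple c N' m) (Fin.castLE h i) a := by
  funext l
  by_cases hl : (l : ℕ) < N
  · by_cases hli : l = Fin.castLE h i
    · subst hli; simp [extTuple]
    · have : (⟨l, hl⟩ : Fin N) ≠ i := by rintro rfl; exact hli rfl
      simp [extTuple, hl, hli, this]
  · have : l ≠ Fin.castLE h i := by rintro rfl; exact hl (by simp)
    simp [extTuple, hl, this]

theorem extTuple_swap (h : N ≤ N') (m : Fin N → α) (i j : Fin N) :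
    extTuple c N' (m ∘ Equiv.swap i j) =
      extTuple c N' m ∘ Equiv.swap (Fin.castLE h i) (Fin.castLE h j) := by
  rw [← update_pair_eq_swap, ← update_pair_eq_swap, extTuple_update h, extTuple_update h,
    extTuple_castLE, extTuple_castLE]

/-- Multiplication by a monomial in new variables. -/
def extL (N' : ℕ) (c : ℕ → ℤ) : Laurent N →ₗ[ℂ] Laurent N' :=
  (AddMonoidAlgebra.basis (Fin N → ℤ) ℂ).constr ℂ fun m => mono (extTuple c N' m)

theorem extL_mono (c : ℕ → ℤ) (m : Fin N → ℤ) : extL N' c (mono m) = mono (extTuple c N' m) :=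
  constr_mono _ _

theorem castLE_ne (h : N ≤ N') {i j : Fin N} (hij : i ≠ j) : Fin.castLE h i ≠ Fin.castLE h j :=
  fun h' => hij (Fin.castLE_injective h h')

theorem extL_mulVar (h : N ≤ N') (c : ℕ → ℤ) (i : Fin N) :
    mulVar (Fin.castLE h i) ∘ₗ extL N' c = extL N' c ∘ₗ mulVar i := by
  refine ext_mono fun m => ?_
  rw [LinearMap.comp_apply, LinearMap.comp_apply, extL_mono, mulVar_mono, mulVar_mono, extL_mono]
  congr 1
  have : ∀ {K : ℕ} (l : Fin K) (ν : Fin K → ℤ), Pi.single l 1 + ν = Function.update ν l (1 + ν l) := by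
    intro K l ν
    funext t
    by_cases ht : t = l
    · subst ht; simp
    · simp [ht]
  rw [this, this, extTuple_update h, extTuple_castLE]

theorem extL_heckeG (h : N ≤ N') (c : ℕ → ℤ) (i j : Fin N) (f : Laurent N) :
    heckeG q (Fin.castLE h i) (Fin.castLE h j) (extL N' c f) = extL N' c (heckeG q i j f) := by
  have hd : divDiff (Fin.castLE h i) (Fin.castLE h j) ∘ₗ extL N' c = extL N' c ∘ₗ divDiff i j := by
    refine ext_mono fun m => ?_
    rw [LinearMap.comp_apply, LinearMap.comp_apply, extL_mono, divDiff, divDiff, opOnMono_mono,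
      opOnMono_mono, map_sub, map_sum, map_sum]
    simp only [extL_mono, extTuple_update h, extTuple_castLE]
  have h1 := congrArg (fun A => A f) hd
  have h2 := congrArg (fun A => A (divDiff i j f)) (extL_mulVar h c i)
  have h3 := congrArg (fun A => A (divDiff i j f)) (extL_mulVar h c j)
  simp only [LinearMap.comp_apply] at h1 h2 h3
  simp only [heckeG, LinearMap.add_apply, Module.End.mul_apply, LinearMap.sub_apply,
    LinearMap.smul_apply, Module.End.one_apply, map_add, map_sub, map_smul, h1, h2, h3]

theorem extL_swapVar (h : N ≤ N') (c : ℕ → ℤ) (i j : Fin N) (f : Laurent N) :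
    swapVar (Fin.castLE h i) (Fin.castLE h j) (extL N' c f) = extL N' c (swapVar i j f) := by
  suffices h' : swapVar (Fin.castLE h i) (Fin.castLE h j) ∘ₗ extL N' c = extL N' c ∘ₗ swapVar i j from
    congrArg (fun A => A f) h'
  refine ext_mono fun m => ?_
  rw [LinearMap.comp_apply, LinearMap.comp_apply, extL_mono, swapVar_mono, swapVar_mono, extL_mono,
    extTuple_swap h]

theorem extL_pShift (h : N ≤ N') (c : ℕ → ℤ) (i : Fin N) (f : Laurent N) :
    pShift p (Fin.castLE h i) (extL N' c f) = extL N' c (pShift p i f) := by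
  suffices h' : pShift p (Fin.castLE h i) ∘ₗ extL N' c = extL N' c ∘ₗ pShift p i from
    congrArg (fun A => A f) h'
  refine ext_mono fun m => ?_
  rw [LinearMap.comp_apply, LinearMap.comp_apply, extL_mono, pShift_mono, pShift_mono, map_smul,
    extL_mono, extTuple_castLE]

theorem extL_xi (h : N ≤ N') (c : ℕ → ℤ) (i j : Fin N) (f : Laurent N) :
    xi q (Fin.castLE h i) (Fin.castLE h j) (extL N' c f) = extL N' c (xi q i j f) := by
  rw [xi, xi, Module.End.mul_apply, Module.End.mul_apply, extL_heckeG, extL_swapVar]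

/-- Tensoring with fixed spins. -/
def extS (N' : ℕ) (c : ℕ → Fin n) : Spin n N →ₗ[ℂ] Spin n N' :=
  (spinBasis n N).constr ℂ fun e => spinVec (extTuple c N' e)

theorem extS_spinVec (c : ℕ → Fin n) (e : Fin N → Fin n) :
    extS N' c (spinVec e) = spinVec (extTuple c N' e) := by
  rw [extS, ← spinBasis_apply, Module.Basis.constr_basis]

theorem extS_spinS (h : N ≤ N') (c : ℕ → Fin n) {i j : Fin N} (hij : i ≠ j) (v : Spin n N) :
    spinS q (Fin.castLE h i) (Fin.castLE h j) (extS N' c v) = extS N' c (spinS q i j v) := by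
  suffices h' : spinS q (Fin.castLE h i) (Fin.castLE h j) ∘ₗ extS N' c = extS N' c ∘ₗ spinS q i j from
    congrArg (fun A => A v) h'
  refine ext_spin fun e => ?_
  rw [LinearMap.comp_apply, LinearMap.comp_apply, extS_spinVec, spinS_spinVec q hij,
    spinS_spinVec q (castLE_ne h hij), map_add, map_smul, map_smul, extS_spinVec, extS_spinVec,
    extTuple_swap h, extTuple_castLE, extTuple_castLE]

/-- Tensoring with fixed vectors `z^{c_i} v_{d_i}`. -/
def extT (N' : ℕ) (c : ℕ → ℤ) (d : ℕ → Fin n) : Tens n N →ₗ[ℂ] Tens n N' :=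
  TensorProduct.map (extL N' c) (extS N' d)

theorem extT_tmul (c : ℕ → ℤ) (d : ℕ → Fin n) (f : Laurent N) (v : Spin n N) :
    extT N' c d (f ⊗ₜ[ℂ] v) = extL N' c f ⊗ₜ[ℂ] extS N' d v :=
  TensorProduct.map_tmul _ _ _ _

variable (hq : q ≠ 0) (hq2 : q + q⁻¹ ≠ 0)

include hq hq2 in
theorem omega_le_comap_extT (h : N ≤ N') (c : ℕ → ℤ) (d : ℕ → Fin n) :
    omega q n N ≤ (omega q n N').comap (extT N' c d) := by
  have := omega_le_ker hq hq2 (wedgeMk q n N' ∘ₗ extT N' c d) fun i j hij t => by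
    have hg : extT N' c d ∘ₗ polyOp (heckeG q i j) =
        polyOp (heckeG q (Fin.castLE h i) (Fin.castLE h j)) ∘ₗ extT N' c d :=
      TensorProduct.ext' fun f v => by
        rw [LinearMap.comp_apply, LinearMap.comp_apply, polyOp_tmul, extT_tmul, extT_tmul,
          polyOp_tmul, extL_heckeG]
    have hS : extT N' c d ∘ₗ spinOp (spinS q i j) =
        spinOp (spinS q (Fin.castLE h i) (Fin.castLE h j)) ∘ₗ extT N' c d :=
      TensorProduct.ext' fun f v => by
        rw [LinearMap.comp_apply, LinearMap.comp_apply, spinOp_tmul, extT_tmul, extT_tmul,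
          spinOp_tmul, extS_spinS _ _ (ne_of_succ hij)]
    have h1 := congrArg (fun A => A t) hg
    have h2 := congrArg (fun A => A t) hS
    simp only [LinearMap.comp_apply] at h1 h2
    rw [LinearMap.comp_apply, LinearMap.comp_apply, h1, h2,
      wedgeMk_heckeG (i := Fin.castLE h i) (j := Fin.castLE h j) hq (by simpa using hij)]
  rw [LinearMap.ker_comp] at this
  rwa [wedgeMk, Submodule.ker_mkQ] at this

variable [NeZero n]

/-- `f ↦ f ∧ u_{M-N} ∧ ⋯ ∧ u_{M-N'+1}`. -/
def extW (hq : q ≠ 0) (hq2 : q + q⁻¹ ≠ 0) (n : ℕ) [NeZero n] (M : ℤ) (h : N ≤ N') :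
    Wedge q n N →ₗ[ℂ] Wedge q n N' :=
  (omega q n N).mapQ (omega q n N')
    (extT N' (fun i => mOf n (M - i)) fun i => aOf n (M - i)) (omega_le_comap_extT hq hq2 h _ _)

theorem extW_wedgeMk (M : ℤ) (h : N ≤ N') (t : Tens n N) :
    extW hq hq2 n M h (wedgeMk q n N t) =
      wedgeMk q n N' (extT N' (fun i => mOf n (M - i)) (fun i => aOf n (M - i)) t) := rfl

/-- Append the vacuum labels. -/
def extK (M : ℤ) (N' : ℕ) (k : Fin N → ℤ) : Fin N' → ℤ := extTuple (fun i => M - i) N' k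

theorem extW_wk (M : ℤ) (h : N ≤ N') (k : Fin N → ℤ) :
    extW hq hq2 n M h (wk q n k) = wk q n (extK M N' k) := by
  rw [wk, wedgeMon, extW_wedgeMk, extT_tmul, extL_mono, extS_spinVec]
  rw [wk, wedgeMon]
  congr 3
  · funext i; simp only [extK, extTuple]; split_ifs <;> rfl
  · congr 1
    funext i; simp only [extK, extTuple]; split_ifs <;> rfl

theorem tensVac_tmul (M : ℤ) (m : Fin N → ℤ) (e : Fin N → Fin n) :
    tensVac n M N (mono m ⊗ₜ[ℂ] spinVec e) = Finsupp.single (appendVac M (kIdx m e)) 1 := by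
  rw [tensVac, ← tensBasis_apply, Module.Basis.constr_basis]
  rfl

theorem appendVac_extK (M : ℤ) (h : N ≤ N') (k : Fin N → ℤ) :
    appendVac M (extK M N' k) = appendVac M k := by
  refine Subtype.ext (funext fun i => ?_)
  simp only [appendVac, extK, extTuple]
  split_ifs with h1 h2 h2
  · rfl
  · rfl
  · omega
  · rfl

theorem tensVac_extT (M : ℤ) (h : N ≤ N') (t : Tens n N) :
    tensVac n M N' (extT N' (fun i => mOf n (M - i)) (fun i => aOf n (M - i)) t) =
      tensVac n M N t := by
  suffices h' : tensVac n M N' ∘ₗ extT N' (fun i => mOf n (M - i)) (fun i => aOf n (M - i)) =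
      tensVac n M N from congrArg (fun A => A t) h'
  refine ext_tens fun m e => ?_
  rw [LinearMap.comp_apply, extT_tmul, extL_mono, extS_spinVec, tensVac_tmul, tensVac_tmul,
    ← appendVac_extK M h]
  congr 2
  funext i
  simp only [kIdx, extK, extTuple]
  split_ifs
  · rfl
  · exact uIndex_mOf_aOf _

theorem wedgeVac_wedgeMk (M : ℤ) (t : Tens n N) :
    wedgeVac q n M N (wedgeMk q n N t) = Submodule.Quotient.mk (tensVac n M N t) := rfl

theorem wedgeVac_wk (M : ℤ) (k : Fin N → ℤ) :
    wedgeVac q n M N (wk q n k) = siWedge q n (appendVac M k) := by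
  rw [wk, wedgeMon, wedgeVac_wedgeMk, tensVac_tmul, kIdx_of]
  rfl

theorem wedgeVac_extW (M : ℤ) (h : N ≤ N') (w : Wedge q n N) :
    wedgeVac q n M N' (extW hq hq2 n M h w) = wedgeVac q n M N w := by
  obtain ⟨t, rfl⟩ := (omega q n N).mkQ_surjective w
  change wedgeVac q n M N' (extW hq hq2 n M h (wedgeMk q n N t)) = wedgeVac q n M N (wedgeMk q n N t)
  rw [extW_wedgeMk, wedgeVac_wedgeMk, wedgeVac_wedgeMk, tensVac_extT M h]

theorem strictAnti_extK {M : ℤ} (h : N ≤ N') {k : Fin N → ℤ} (hk : StrictAnti k)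
    (hkM : ∀ i, M - N < k i) : StrictAnti (extK M N' k) := by
  intro i j hij
  rw [Fin.lt_def] at hij
  simp only [extK, extTuple]
  split_ifs with h1 h2 h2
  · exact hk (by rwa [Fin.lt_def])
  · omega
  · have := hkM ⟨i, h2⟩; omega
  · omega

end extension

/-! ### Subspaces of the wedge product spanned by normally ordered wedges -/

section wSpan

variable {n N : ℕ} {q : ℂ}

/-- The span of the wedges with exponents in `P`. -/
def wSpan (q : ℂ) (n : ℕ) {N : ℕ} (P : Set (Fin N → ℤ)) : Submodule ℂ (Wedge q n N) :=
  Submodule.span ℂ {w | ∃ m e, m ∈ P ∧ w = wedgeMon q m e}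

theorem wedgeMk_mem_wSpan {P : Set (Fin N → ℤ)} {f : Laurent N} (hf : f ∈ monoSpan P)
    (v : Spin n N) : wedgeMk q n N (f ⊗ₜ[ℂ] v) ∈ wSpan q n P := by
  have h1 : ∀ m ∈ P, ∀ v : Spin n N, wedgeMk q n N (mono m ⊗ₜ[ℂ] v) ∈ wSpan q n P := by
    intro m hm v
    have : (⊤ : Submodule ℂ (Spin n N)) ≤ (wSpan q n P).comap
        ((wedgeMk q n N) ∘ₗ (TensorProduct.mk ℂ (Laurent N) (Spin n N) (mono m))) := by
      rw [← (spinBasis n N).span_eq, Submodule.span_le]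
      rintro _ ⟨e, rfl⟩
      rw [spinBasis_apply]
      exact Submodule.subset_span ⟨m, e, hm, rfl⟩
    exact this (Submodule.mem_top (x := v))
  have := monoSpan_induction (P := P)
    (A := (wedgeMk q n N) ∘ₗ ((TensorProduct.mk ℂ (Laurent N) (Spin n N)).flip v))
    (V := wSpan q n P) (fun m hm => h1 m hm v) f hf
  exact this

theorem wSpan_induction {P : Set (Fin N → ℤ)} {W : Type*} [AddCommGroup W] [Module ℂ W]
    {A : Wedge q n N →ₗ[ℂ] W} {V : Submodule ℂ W} (h : ∀ m ∈ P, ∀ e, A (wedgeMon q m e) ∈ V)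
    {w : Wedge q n N} (hw : w ∈ wSpan q n P) : A w ∈ V := by
  have : wSpan q n P ≤ V.comap A := by
    refine Submodule.span_le.2 ?_
    rintro _ ⟨m, e, hm, rfl⟩
    exact h m hm e
  exact this hw

variable [NeZero n]

theorem ClosedExp.move {P : Set (Fin N → ℤ)} (hP : ClosedExp P) {i j : Fin N} (hij : i ≠ j)
    {k k' : Fin N → ℤ} (hk : (fun l => mOf n (k l)) ∈ P) (h : Move n i j k k') :
    (fun l => mOf n (k' l)) ∈ P := by
  obtain ⟨h1, h2, h3, h4, h5⟩ := h
  have hn := Nat.pos_of_ne_zero (NeZero.ne n)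
  have a1 := mOf_antitone hn h3
  have a2 := mOf_antitone hn h4.le
  have key : ∀ l, l ≠ i → l ≠ j → mOf n (k' l) = mOf n (k l) := fun l hi hj => by rw [h1 l hi hj]
  rcases a2.eq_or_lt with e | e
  · have : (fun l => mOf n (k' l)) = fun l => mOf n (k l) := by
      funext l
      by_cases hj : l = j
      · rw [hj, e]
      · by_cases hi : l = i
        · rw [hi]; omega
        · exact key l hi hj
    rwa [this]
  · rcases a1.eq_or_lt with e' | e'
    · have : (fun l => mOf n (k' l)) = (fun l => mOf n (k l)) ∘ Equiv.swap i j := by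
        funext l
        by_cases hj : l = j
        · subst hj; simp [e']
        · by_cases hi : l = i
          · subst hi; simp; omega
          · simp [Equiv.swap_apply_of_ne_of_ne hi hj, key l hi hj]
      rw [this]
      exact (hP _ hk i j hij).1
    · refine (hP _ hk i j hij).2 _ ⟨key, ?_, ?_, ?_⟩
      · exact h5
      · exact (min_le_right _ _).trans_lt (by dsimp only; omega)
      · exact lt_of_lt_of_le (by dsimp only; omega) (le_max_left _ _)

theorem wSpan_eq (hq : q ≠ 0) (hq2 : q + q⁻¹ ≠ 0) {P : Set (Fin N → ℤ)} (hP : ClosedExp P) :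
    wSpan q n P = Submodule.span ℂ {w | ∃ k : Fin N → ℤ, StrictAnti k ∧
      (fun l => mOf n (k l)) ∈ P ∧ w = wk q n k} := by
  refine le_antisymm ?_ ?_
  · refine Submodule.span_le.2 ?_
    rintro _ ⟨m, e, hm, rfl⟩
    rw [← wk_kIdx]
    refine Submodule.span_mono ?_ (straighten hq hq2 0 (fun k => (fun l => mOf n (k l)) ∈ P)
      (fun i j k k' hij _ hk hk' => hP.move (ne_of_succ hij) hk hk') (kIdx m e) ?_)
    · rintro _ ⟨K, hK, hK', rfl⟩
      exact ⟨K, strictAnti_of_succ fun i j hij => hK' i j hij (Nat.zero_le _), hK, rfl⟩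
    · simpa only [kIdx, mOf_uIndex] using hm
  · refine Submodule.span_le.2 ?_
    rintro _ ⟨k, -, hk, rfl⟩
    exact Submodule.subset_span ⟨_, _, hk, rfl⟩

theorem wSpan_inf (hq : q ≠ 0) (hq2 : q + q⁻¹ ≠ 0) {P P' : Set (Fin N → ℤ)} (hP : ClosedExp P)
    (hP' : ClosedExp P') {w : Wedge q n N} (h : w ∈ wSpan q n P) (h' : w ∈ wSpan q n P') :
    w ∈ wSpan q n (P ∩ P') := by
  have key : ∀ {P : Set (Fin N → ℤ)}, ClosedExp P → wSpan q n P =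
      Submodule.span ℂ (wBasis hq hq2 n N '' {k : SLabel N | (fun l => mOf n (k.1 l)) ∈ P}) := by
    intro P hP
    rw [wSpan_eq hq hq2 hP]
    congr 1
    ext w
    constructor
    · rintro ⟨k, hk, hkP, rfl⟩
      exact ⟨⟨k, hk⟩, hkP, wBasis_apply hq hq2 _⟩
    · rintro ⟨k, hkP, rfl⟩
      exact ⟨k.1, k.2, hkP, wBasis_apply hq hq2 _⟩
  have hPP : ClosedExp (P ∩ P') := fun m hm i j hij =>
    ⟨⟨(hP m hm.1 i j hij).1, (hP' m hm.2 i j hij).1⟩,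
      fun ν hν => ⟨(hP m hm.1 i j hij).2 ν hν, (hP' m hm.2 i j hij).2 ν hν⟩⟩
  rw [key hP, Module.Basis.mem_span_image] at h
  rw [key hP', Module.Basis.mem_span_image] at h'
  rw [key hPP, Module.Basis.mem_span_image]
  exact fun k hk => ⟨h hk, h' hk⟩

end wSpan

/-! ### Operators compatible with an extension modulo a subspace -/

section extRel

variable {W W' : Type} [AddCommGroup W] [Module ℂ W] [AddCommGroup W'] [Module ℂ W']
  {ι : W →ₗ[ℂ] W'} {B : Submodule ℂ W} {L : Submodule ℂ W'}

/-- `X'` acts on the image of `B` as `X`, modulo `L`. -/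
structure ExtRel (ι : W →ₗ[ℂ] W') (B : Submodule ℂ W) (L : Submodule ℂ W')
    (X' : Module.End ℂ W') (X : Module.End ℂ W) : Prop where
  presL : ∀ f ∈ L, X' f ∈ L
  presB : ∀ f ∈ B, X f ∈ B
  rel : ∀ f ∈ B, X' (ι f) - ι (X f) ∈ L

namespace ExtRel

variable {X' Y' : Module.End ℂ W'} {X Y : Module.End ℂ W}

theorem algebraMap (c : ℂ) : ExtRel ι B L (c • 1) (c • 1) :=
  ⟨fun f hf => L.smul_mem c hf, fun f hf => B.smul_mem c hf, fun f _ => by simp⟩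

theorem one : ExtRel ι B L 1 1 := by
  simpa using ExtRel.algebraMap (ι := ι) (B := B) (L := L) 1

theorem mul (h : ExtRel ι B L X' X) (h' : ExtRel ι B L Y' Y) : ExtRel ι B L (X' * Y') (X * Y) := by
  refine ⟨fun f hf => h.presL _ (h'.presL _ hf), fun f hf => h.presB _ (h'.presB _ hf),
    fun f hf => ?_⟩
  have h1 := h.presL _ (h'.rel f hf)
  have h2 := h.rel _ (h'.presB f hf)
  rw [map_sub] at h1
  simpa using L.add_mem h1 h2

theorem add (h : ExtRel ι B L X' X) (h' : ExtRel ι B L Y' Y) : ExtRel ι B L (X' + Y') (X + Y) := by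
  refine ⟨fun f hf => L.add_mem (h.presL _ hf) (h'.presL _ hf),
    fun f hf => B.add_mem (h.presB _ hf) (h'.presB _ hf), fun f hf => ?_⟩
  have := L.add_mem (h.rel f hf) (h'.rel f hf)
  rw [LinearMap.add_apply, LinearMap.add_apply, map_add]
  convert this using 1
  abel

theorem smul (h : ExtRel ι B L X' X) (c : ℂ) : ExtRel ι B L (c • X') (c • X) := by
  have := (ExtRel.algebraMap (ι := ι) (B := B) (L := L) c).mul h
  simpa using this

theorem pow (h : ExtRel ι B L X' X) : ∀ a : ℕ, ExtRel ι B L (X' ^ a) (X ^ a)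
  | 0 => by simpa using ExtRel.one
  | a + 1 => by rw [pow_succ, pow_succ]; exact (h.pow a).mul h

theorem list_prod {κ : Type*} {l : List κ} {f' : κ → Module.End ℂ W'} {f : κ → Module.End ℂ W}
    (h : ∀ x ∈ l, ExtRel ι B L (f' x) (f x)) : ExtRel ι B L (l.map f').prod (l.map f).prod := by
  induction l with
  | nil => simpa using ExtRel.one
  | cons a l ih =>
    simp only [List.map_cons, List.prod_cons]
    exact (h a (by simp)).mul (ih fun x hx => h x (by simp [hx]))

theorem list_prod_const {κ : Type*} {l : List κ} {f' : κ → Module.End ℂ W'} {c : ℂ}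
    (h : ∀ x ∈ l, ExtRel ι B L (f' x) (c • 1)) :
    ExtRel ι B L (l.map f').prod (c ^ l.length • 1) := by
  have := ExtRel.list_prod (f := fun _ => c • (1 : Module.End ℂ W)) h
  simpa [smul_pow] using this

theorem inverse (h : ExtRel ι B L X' X) (hL : BiPres L X') (hB : BiPres B X) :
    ExtRel ι B L (Ring.inverse X') (Ring.inverse X) := by
  refine ⟨fun f hf => hL.inverse.mem hf, fun f hf => hB.inverse.mem hf, fun f hf => ?_⟩
  have h1 : IsUnit X' := by
    obtain ⟨B, h1, h2, -⟩ := hL; exact isUnit_of_inv h1 h2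
  have h2 : IsUnit X := by
    obtain ⟨B, h1, h2, -⟩ := hB; exact isUnit_of_inv h1 h2
  have h3 := hL.inverse.mem (h.rel _ (hB.inverse.mem hf))
  rw [map_sub] at h3
  have e1 : Ring.inverse X' (X' (ι (Ring.inverse X f))) = ι (Ring.inverse X f) := by
    rw [← Module.End.mul_apply, Ring.inverse_mul_cancel _ h1, Module.End.one_apply]
  have e2 : X (Ring.inverse X f) = f := by
    rw [← Module.End.mul_apply, Ring.mul_inverse_cancel _ h2, Module.End.one_apply]
  rw [e1, e2] at h3
  rw [← neg_sub]
  exact L.neg_mem h3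

theorem endZPow (h : ExtRel ι B L X' X) (hL : BiPres L X') (hB : BiPres B X) (l : ℤ) :
    ExtRel ι B L (endZPow X' l) (endZPow X l) := by
  cases l with
  | ofNat a => exact h.pow a
  | negSucc a => exact (h.inverse hL hB).pow _

end ExtRel

theorem biPres_smul_one {c : ℂ} (hc : c ≠ 0) : BiPres B (c • (1 : Module.End ℂ W)) :=
  BiPres.one.smul hc

theorem inverse_smul_one {c : ℂ} (hc : c ≠ 0) :
    Ring.inverse (c • (1 : Module.End ℂ W)) = c⁻¹ • 1 :=
  ringInverse_eq (by simp [smul_smul, hc]) (by simp [smul_smul, hc])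

theorem endZPow_smul_one {c : ℂ} (hc : c ≠ 0) (l : ℤ) :
    endZPow (c • (1 : Module.End ℂ W)) l = (c ^ l) • 1 := by
  cases l with
  | ofNat a => simp [endZPow, smul_pow]
  | negSucc a => rw [endZPow, inverse_smul_one hc, smul_pow, one_pow, zpow_negSucc, inv_pow]

end extRel

/-! ### The operators `y_i` and the extension by vacuum variables -/

section yExt

variable {N N' t : ℕ} {q p : ℂ} {c : ℕ → ℤ} {C : ℤ}

theorem prod_univ_split {M : Type*} [CommMonoid M] (hN : N' = N + t) (f : Fin N' → M) :
    ∏ i, f i = (∏ i : Fin N, f (Fin.castLE (by omega) i)) *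
      ∏ j : Fin t, f ⟨N + j, by have := j.2; omega⟩ := by
  subst hN
  exact Fin.prod_univ_add f

theorem sum_univ_split {M : Type*} [AddCommMonoid M] (hN : N' = N + t) (f : Fin N' → M) :
    ∑ i, f i = (∑ i : Fin N, f (Fin.castLE (by omega) i)) +
      ∑ j : Fin t, f ⟨N + j, by have := j.2; omega⟩ := by
  subst hN
  exact Fin.sum_univ_add f

/-- The number of entries equal to `C`. -/
def cnt (C : ℤ) (m : Fin N → ℤ) : ℕ := ∑ i, if m i = C then 1 else 0

/-- The exponents bounded by `C`. -/
def belowSet (N : ℕ) (C : ℤ) : Set (Fin N → ℤ) := {m | ∀ i, m i ≤ C}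

/-- The exponents bounded by `C`, with less than `t` entries equal to `C`. -/
def lowSet (N : ℕ) (C : ℤ) (t : ℕ) : Set (Fin N → ℤ) := {m | (∀ i, m i ≤ C) ∧ cnt C m < t}

theorem Inner.lt_of_le {i j : Fin N} {m ν : Fin N → ℤ} (h : Inner i j m ν)
    (hi : m i ≤ C) (hj : m j ≤ C) : ν i < C ∧ ν j < C := by
  obtain ⟨-, h2, h3, h4⟩ := h
  omega

theorem Inner.le_of_le {i j : Fin N} {m ν : Fin N → ℤ} (h : Inner i j m ν)
    (hm : ∀ l, m l ≤ C) (l : Fin N) : ν l ≤ C := by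
  have h1 := h.lt_of_le (hm i) (hm j)
  by_cases hi : l = i
  · subst hi; exact h1.1.le
  · by_cases hj : l = j
    · subst hj; exact h1.2.le
    · rw [h.1 l hi hj]; exact hm l

theorem closedExp_belowSet (N : ℕ) (C : ℤ) : ClosedExp (belowSet N C) :=
  fun _ hm _ _ _ => ⟨fun _ => hm _, fun _ hν => hν.le_of_le hm⟩

theorem cnt_inner {i j : Fin N} (hij : i ≠ j) {m ν : Fin N → ℤ} (h : Inner i j m ν)
    (hm : ∀ l, m l ≤ C) : (if m i = C then 1 else 0) + (if m j = C then 1 else 0) + cnt C ν =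
      cnt C m := by
  have h1 := h.lt_of_le (hm i) (hm j)
  rw [cnt, cnt, h.sum_eq hij fun x => if x = C then 1 else 0, if_neg h1.1.ne, if_neg h1.2.ne,
    sum_pair_split hij]
  simp

theorem closedExp_lowSet (N : ℕ) (C : ℤ) (t : ℕ) : ClosedExp (lowSet N C t) := by
  intro m hm i j hij
  refine ⟨⟨fun _ => hm.1 _, ?_⟩, fun ν hν => ⟨hν.le_of_le hm.1, ?_⟩⟩
  · have : cnt C (m ∘ Equiv.swap i j) = cnt C m :=
      Equiv.sum_comp (Equiv.swap i j) fun l => if m l = C then 1 else 0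
    rw [this]; exact hm.2
  · have := cnt_inner hij hν hm.1
    have := hm.2
    omega

theorem cnt_ext (hN : N' = N + t) (hc : ∀ i, N ≤ i → i < N' → c i = C) {m : Fin N → ℤ}
    (hm : m ∈ belowSet N (C - 1)) : cnt C (extTuple c N' m) = t := by
  rw [cnt, sum_univ_split hN]
  have h1 : ∀ i : Fin N, (if extTuple c N' m (Fin.castLE (by omega) i) = C then 1 else 0) = 0 := by
    intro i
    rw [extTuple_castLE, if_neg]
    have := hm i
    omega
  have h2 : ∀ j : Fin t, (if extTuple c N' m ⟨N + j, by have := j.2; omega⟩ = C then 1 else 0) = 1 := by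
    intro j
    rw [extTuple_of_ge _ (by simp), if_pos]
    exact hc _ (by simp) (by have := j.2; simp; omega)
  simp only [h1, h2]
  simp

theorem ext_mem_belowSet (hc : ∀ i, N ≤ i → i < N' → c i = C) {m : Fin N → ℤ}
    (hm : m ∈ belowSet N (C - 1)) : extTuple c N' m ∈ belowSet N' C := by
  intro i
  rw [extTuple]
  split_ifs with h
  · have := hm ⟨i, h⟩; omega
  · exact (hc i (not_lt.1 h) i.2).le

theorem swapVar_swap_mono (i j : Fin N) (m : Fin N → ℤ) :
    swapVar i j (mono (m ∘ Equiv.swap i j)) = mono m := by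
  rw [swapVar_mono, comp_swap_swap]

variable (hN : N' = N + t) (hc : ∀ i, N ≤ i → i < N' → c i = C) (hq : q ≠ 0) (hp : p ≠ 0)

variable (N N' t c C) in
/-- The relation for the vacuum extension of Laurent polynomials. -/
abbrev LRel : Module.End ℂ (Laurent N') → Module.End ℂ (Laurent N) → Prop :=
  ExtRel (extL N' c) (monoSpan (belowSet N (C - 1))) (monoSpan (lowSet N' C t))

theorem LRel.of_eq {X' : Module.End ℂ (Laurent N')} {X : Module.End ℂ (Laurent N)}
    (h1 : ∀ f ∈ monoSpan (lowSet N' C t), X' f ∈ monoSpan (lowSet N' C t))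
    (h2 : ∀ f ∈ monoSpan (belowSet N (C - 1)), X f ∈ monoSpan (belowSet N (C - 1)))
    (h : ∀ f, X' (extL N' c f) = extL N' c (X f)) : LRel N N' t c C X' X :=
  ⟨h1, h2, fun f _ => by rw [h, sub_self]; exact Submodule.zero_mem _⟩

theorem LRel.of_scalar {X' : Module.End ℂ (Laurent N')} {a : ℂ}
    (h1 : ∀ f ∈ monoSpan (lowSet N' C t), X' f ∈ monoSpan (lowSet N' C t))
    (h : ∀ m ∈ belowSet N (C - 1), X' (mono (extTuple c N' m)) - a • mono (extTuple c N' m) ∈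
      monoSpan (lowSet N' C t)) : LRel N N' t c C X' (a • 1) := by
  refine ⟨h1, fun f hf => Submodule.smul_mem _ _ hf, fun f hf => ?_⟩
  have := monoSpan_induction (P := belowSet N (C - 1))
    (A := X' ∘ₗ extL N' c - extL N' c ∘ₗ (a • (1 : Module.End ℂ (Laurent N))))
    (V := monoSpan (lowSet N' C t)) (fun m hm => by
      simpa [extL_mono] using h m hm) f hf
  exact this

include hq in
theorem lrel_xi (h : N ≤ N') {i j : Fin N} (hij : i ≠ j) :
    LRel N N' t c C (xi q (Fin.castLE h i) (Fin.castLE h j)) (xi q i j) :=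
  LRel.of_eq
    (fun _ hf => ((closedExp_lowSet N' C t).biPres_xi hq (castLE_ne h hij)).mem hf)
    (fun _ hf => ((closedExp_belowSet N (C - 1)).biPres_xi hq hij).mem hf)
    (fun _ => extL_xi h c i j _)

include hN hc hq in
theorem lrel_xi_mixed {i l : Fin N'} (hi : (i : ℕ) < N) (hl : N ≤ (l : ℕ)) :
    LRel N N' t c C (xi q i l) (q⁻¹ • 1) := by
  have hne : i ≠ l := by rw [ne_eq, Fin.ext_iff]; omega
  have hcl := closedExp_lowSet N' C t
  refine LRel.of_scalar (fun _ hf => (hcl.biPres_xi hq hne).mem hf) fun m hm => ?_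
  have hb := ext_mem_belowSet (N' := N') hc hm
  have hmi : extTuple c N' m i < C := by
    simp only [extTuple, hi, dif_pos]
    have := hm ⟨i, hi⟩
    omega
  have hml : extTuple c N' m l = C := by rw [extTuple_of_ge _ hl]; exact hc _ hl l.2
  have h1 := heckeG_mono_lt q hne (m := extTuple c N' m) (by rw [hml]; exact hmi)
  have h2 : monoSpan {ν | Inner i l (extTuple c N' m) ν} ≤ monoSpan (lowSet N' C t) :=
    monoSpan_mono fun ν hν => by
      refine ⟨hν.le_of_le hb, ?_⟩
      have := cnt_inner hne hν hb
      rw [cnt_ext hN hc hm, if_pos hml] at this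
      omega
  have h3 := (hcl.biPres_swapVar hne).mem (h2 h1)
  rw [map_sub, map_smul, swapVar_swap_mono] at h3
  exact h3

include hc hq in
theorem lrel_xi_tail {i l : Fin N'} (hil : i ≠ l) (hi : N ≤ (i : ℕ)) (hl : N ≤ (l : ℕ)) :
    LRel N N' t c C (xi q i l) (q • 1) := by
  have hcl := closedExp_lowSet N' C t
  refine LRel.of_scalar (fun _ hf => (hcl.biPres_xi hq hil).mem hf) fun m hm => ?_
  have hml : extTuple c N' m l = C := by rw [extTuple_of_ge _ hl]; exact hc _ hl l.2
  have hmi : extTuple c N' m i = C := by rw [extTuple_of_ge _ hi]; exact hc _ hi i.2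
  have e : extTuple c N' m i = extTuple c N' m l := by rw [hml, hmi]
  rw [xi, Module.End.mul_apply, heckeG_mono_eq q e, map_smul, swapVar_mono, comp_swap_of_eq e,
    sub_self]
  exact Submodule.zero_mem _

include hp in
theorem lrel_pShift (h : N ≤ N') (i : Fin N) :
    LRel N N' t c C (pShift p (Fin.castLE h i)) (pShift p i) :=
  LRel.of_eq (fun _ hf => (biPres_pShift hp _).mem hf) (fun _ hf => (biPres_pShift hp _).mem hf)
    (fun _ => extL_pShift h c i _)

include hc hp in
theorem lrel_pShift_tail {i : Fin N'} (hi : N ≤ (i : ℕ)) :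
    LRel N N' t c C (pShift p i) (p ^ C • 1) := by
  refine LRel.of_scalar (fun _ hf => (biPres_pShift hp _).mem hf) fun m hm => ?_
  have hmi : extTuple c N' m i = C := by rw [extTuple_of_ge _ hi]; exact hc _ hi i.2
  rw [pShift_mono, hmi, sub_self]
  exact Submodule.zero_mem _

theorem length_filter_finRange {a b : ℕ} (hb : b ≤ N) :
    ((List.finRange N).filter fun j : Fin N => a ≤ (j : ℕ) ∧ (j : ℕ) < b).length = b - a := by
  have h1 : (((List.finRange N).filter fun j : Fin N => a ≤ (j : ℕ) ∧ (j : ℕ) < b).map Fin.val).toFinset =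
      Finset.Ico a b := by
    ext x
    simp only [List.mem_toFinset, List.mem_map, List.mem_filter, List.mem_finRange, true_and,
      decide_eq_true_eq, Finset.mem_Ico]
    constructor
    · rintro ⟨j, hj, rfl⟩; exact hj
    · intro hx; exact ⟨⟨x, by omega⟩, hx, rfl⟩
  have h2 : (((List.finRange N).filter fun j : Fin N => a ≤ (j : ℕ) ∧ (j : ℕ) < b).map Fin.val).Nodup :=
    ((List.nodup_finRange N).filter _).map Fin.val_injective
  rw [← List.length_map (f := Fin.val), ← List.toFinset_card_of_nodup h2, h1, Nat.card_Ico]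

theorem up_castLE (h : N ≤ N') (i : Fin N) :
    (List.finRange N').filter (fun j : Fin N' => Fin.castLE h i < j) =
      ((List.finRange N).filter (fun j : Fin N => i < j)).map (Fin.castLE h) ++
        (List.finRange N').filter (fun j : Fin N' => N ≤ (j : ℕ) ∧ (j : ℕ) < N') := by
  refine filter_finRange_eq ?_ fun a => ?_
  · refine List.pairwise_append.2 ⟨?_, (List.pairwise_lt_finRange N').filter _, ?_⟩
    · rw [List.pairwise_map]
      exact ((List.pairwise_lt_finRange N).filter _).imp fun hab => by
        rw [Fin.lt_def] at hab ⊢; simpa using hab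
    · intro a ha b hb
      simp only [List.mem_map, List.mem_filter, List.mem_finRange, true_and, decide_eq_true_eq] at ha hb
      obtain ⟨x, -, rfl⟩ := ha
      rw [Fin.lt_def]
      have := x.2
      simp only [Fin.val_castLE]
      omega
  · simp only [List.mem_append, List.mem_map, List.mem_filter, List.mem_finRange, true_and,
      decide_eq_true_eq, Fin.lt_def, Fin.val_castLE]
    refine Iff.symm ⟨fun ha => ?_, ?_⟩
    · by_cases haN : (a : ℕ) < N
      · exact .inl ⟨⟨a, haN⟩, ha, rfl⟩
      · exact .inr ⟨by omega, a.2⟩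
    · rintro (⟨x, hx, rfl⟩ | ha)
      · exact hx
      · have := i.2; omega

theorem down_castLE (h : N ≤ N') (i : Fin N) :
    (List.finRange N').filter (fun j : Fin N' => j < Fin.castLE h i) =
      ((List.finRange N).filter (fun j : Fin N => j < i)).map (Fin.castLE h) := by
  refine filter_finRange_eq ?_ fun a => ?_
  · rw [List.pairwise_map]
    exact ((List.pairwise_lt_finRange N).filter _).imp fun hab => by
      rw [Fin.lt_def] at hab ⊢; simpa using hab
  · simp only [List.mem_map, List.mem_filter, List.mem_finRange, true_and,
      decide_eq_true_eq, Fin.lt_def, Fin.val_castLE]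
    refine Iff.symm ⟨fun ha => ?_, ?_⟩
    · exact ⟨⟨a, ha.trans i.2⟩, ha, rfl⟩
    · rintro ⟨x, hx, rfl⟩
      exact hx

theorem down_tail {i : Fin N'} (hi : N ≤ (i : ℕ)) :
    (List.finRange N').filter (fun j : Fin N' => j < i) =
      (List.finRange N').filter (fun j : Fin N' => 0 ≤ (j : ℕ) ∧ (j : ℕ) < N) ++
        (List.finRange N').filter (fun j : Fin N' => N ≤ (j : ℕ) ∧ (j : ℕ) < i) := by
  refine filter_finRange_eq ?_ fun a => ?_
  · refine List.pairwise_append.2 ⟨(List.pairwise_lt_finRange N').filter _,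
      (List.pairwise_lt_finRange N').filter _, ?_⟩
    intro a ha b hb
    simp only [List.mem_filter, List.mem_finRange, true_and, decide_eq_true_eq] at ha hb
    rw [Fin.lt_def]; omega
  · simp only [List.mem_append, List.mem_filter, List.mem_finRange, true_and, decide_eq_true_eq,
      Fin.lt_def]
    omega

theorem up_tail (i : Fin N') : (List.finRange N').filter (fun j : Fin N' => i < j) =
    (List.finRange N').filter (fun j : Fin N' => (i : ℕ) + 1 ≤ (j : ℕ) ∧ (j : ℕ) < N') := by
  refine List.filter_congr fun j _ => ?_
  have := j.2
  simp only [Fin.lt_def, decide_eq_decide]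
  omega

include hN hc hq hp in
theorem lrel_yOp (h : N ≤ N') (i : Fin N) :
    LRel N N' t c C (yOp q p (Fin.castLE h i)) (yOp q p i) := by
  have hL := closedExp_lowSet N' C t
  have hB := closedExp_belowSet N (C - 1)
  rw [yOp, macY, up_castLE, down_castLE, List.map_append, List.prod_append, List.map_map,
    List.map_map]
  have h1 : LRel N N' t c C
      ((((List.finRange N).filter (fun j : Fin N => i < j)).map
        ((fun j => Ring.inverse (xi q (Fin.castLE h i) j)) ∘ Fin.castLE h)).prod)
      ((((List.finRange N).filter (fun j : Fin N => i < j)).map fun j => Ring.inverse (xi q i j)).prod) := by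
    refine ExtRel.list_prod fun j hj => ?_
    simp only [List.mem_filter, List.mem_finRange, true_and, decide_eq_true_eq] at hj
    exact (lrel_xi hq h hj.ne).inverse (hL.biPres_xi hq (castLE_ne h hj.ne)) (hB.biPres_xi hq hj.ne)
  have h2 : LRel N N' t c C
      ((((List.finRange N').filter (fun j : Fin N' => N ≤ (j : ℕ) ∧ (j : ℕ) < N')).map
        fun j => Ring.inverse (xi q (Fin.castLE h i) j)).prod) (q ^ t • 1) := by
    have hlen : ((List.finRange N').filter fun j : Fin N' => N ≤ (j : ℕ) ∧ (j : ℕ) < N').length = t := by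
      rw [length_filter_finRange le_rfl]; omega
    have key : ∀ j ∈ (List.finRange N').filter (fun j : Fin N' => N ≤ (j : ℕ) ∧ (j : ℕ) < N'),
        LRel N N' t c C (Ring.inverse (xi q (Fin.castLE h i) j)) (q • 1) := by
      intro j hj
      simp only [List.mem_filter, List.mem_finRange, true_and, decide_eq_true_eq] at hj
      have hne : Fin.castLE h i ≠ j := by
        rw [ne_eq, Fin.ext_iff, Fin.val_castLE]; have := i.2; omega
      have := (lrel_xi_mixed hN hc hq (i := Fin.castLE h i) (l := j) (by simp) hj.1).inverse
        (hL.biPres_xi hq hne) (biPres_smul_one (inv_ne_zero hq))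
      rwa [inverse_smul_one (inv_ne_zero hq), inv_inv] at this
    have := ExtRel.list_prod_const key
    rwa [hlen] at this
  have h3 : LRel N N' t c C
      ((((List.finRange N).filter (fun j : Fin N => j < i)).map
        ((fun j => xi q j (Fin.castLE h i)) ∘ Fin.castLE h)).prod)
      ((((List.finRange N).filter (fun j : Fin N => j < i)).map fun j => xi q j i).prod) := by
    refine ExtRel.list_prod fun j hj => ?_
    simp only [List.mem_filter, List.mem_finRange, true_and, decide_eq_true_eq] at hj
    exact lrel_xi hq h hj.ne
  have h4 := (((h1.mul h2).mul (lrel_pShift hp h i)).mul h3).smul (q ^ (1 - (N' : ℤ)))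
  have e : yOp q p i = q ^ (1 - (N' : ℤ)) •
      ((((((List.finRange N).filter (fun j : Fin N => i < j)).map fun j => Ring.inverse (xi q i j)).prod) *
        (q ^ t • 1)) * pShift p i *
        ((((List.finRange N).filter (fun j : Fin N => j < i)).map fun j => xi q j i).prod)) := by
    rw [yOp, macY, mul_smul_comm, mul_one, smul_mul_assoc, smul_mul_assoc, smul_smul,
      ← zpow_natCast, ← zpow_add₀ hq]
    congr 2
    omega
  rw [e]
  exact h4

include hN hc hq hp in
theorem lrel_yOp_tail {i : Fin N'} (hi : N ≤ (i : ℕ)) :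
    LRel N N' t c C (yOp q p i)
      ((p ^ C * q ^ (-2 * ((N : ℤ) + N' - 1 - (i : ℕ)))) • 1) := by
  have hL := closedExp_lowSet N' C t
  have hi2 := i.2
  rw [yOp, macY, up_tail, down_tail hi, List.map_append, List.prod_append]
  have h1 : LRel N N' t c C
      ((((List.finRange N').filter (fun j : Fin N' => (i : ℕ) + 1 ≤ (j : ℕ) ∧ (j : ℕ) < N')).map
        fun j => Ring.inverse (xi q i j)).prod) (q⁻¹ ^ (N' - (i + 1)) • 1) := by
    rw [← length_filter_finRange (N := N') le_rfl]
    refine ExtRel.list_prod_const fun j hj => ?_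
    simp only [List.mem_filter, List.mem_finRange, true_and, decide_eq_true_eq] at hj
    have hne : i ≠ j := by rw [ne_eq, Fin.ext_iff]; omega
    have := (lrel_xi_tail (N := N) (t := t) hc hq hne hi (by omega)).inverse
      (hL.biPres_xi hq hne) (biPres_smul_one hq)
    rwa [inverse_smul_one hq] at this
  have h2 : LRel N N' t c C
      ((((List.finRange N').filter (fun j : Fin N' => 0 ≤ (j : ℕ) ∧ (j : ℕ) < N)).map
        fun j => xi q j i).prod) (q⁻¹ ^ (N - 0) • 1) := by
    rw [← length_filter_finRange (N := N') (by omega)]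
    refine ExtRel.list_prod_const fun j hj => ?_
    simp only [List.mem_filter, List.mem_finRange, true_and, decide_eq_true_eq] at hj
    exact lrel_xi_mixed hN hc hq hj.2 hi
  have h3 : LRel N N' t c C
      ((((List.finRange N').filter (fun j : Fin N' => N ≤ (j : ℕ) ∧ (j : ℕ) < i)).map
        fun j => xi q j i).prod) (q ^ ((i : ℕ) - N) • 1) := by
    rw [← length_filter_finRange (N := N') hi2.le]
    refine ExtRel.list_prod_const fun j hj => ?_
    simp only [List.mem_filter, List.mem_finRange, true_and, decide_eq_true_eq] at hj
    exact lrel_xi_tail hc hq (by rw [ne_eq, Fin.ext_iff]; omega) hj.1 hi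
  have h4 := ((h1.mul (lrel_pShift_tail hc hp hi)).mul (h2.mul h3)).smul (q ^ (1 - (N' : ℤ)))
  have e : ((p ^ C * q ^ (-2 * ((N : ℤ) + N' - 1 - (i : ℕ)))) • (1 : Module.End ℂ (Laurent N))) =
      q ^ (1 - (N' : ℤ)) • ((q⁻¹ ^ (N' - (i + 1)) • 1) * (p ^ C • 1) *
        ((q⁻¹ ^ (N - 0) • 1) * (q ^ ((i : ℕ) - N) • 1))) := by
    simp only [mul_smul_comm, mul_one, smul_smul]
    congr 1
    have e1 : q⁻¹ ^ (N' - ((i : ℕ) + 1)) = q ^ (-((N' : ℤ) - (i + 1))) := by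
      rw [inv_pow, ← zpow_natCast, ← zpow_neg]; congr 2; omega
    have e2 : q⁻¹ ^ (N - 0) = q ^ (-(N : ℤ)) := by
      rw [inv_pow, ← zpow_natCast, ← zpow_neg]; congr 2
    have e3 : q ^ ((i : ℕ) - N) = q ^ ((i : ℤ) - N) := by
      rw [← zpow_natCast]; congr 1; omega
    rw [e1, e2, e3]
    have e4 : -2 * ((N : ℤ) + N' - 1 - (i : ℕ)) =
        (1 - (N' : ℤ)) + (-((N' : ℤ) - (i + 1))) + (-(N : ℤ)) + ((i : ℤ) - N) := by ring
    rw [e4, zpow_add₀ hq, zpow_add₀ hq, zpow_add₀ hq]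
    ring
  rw [e]
  exact h4

end yExt

theorem wedgeMon_repeat {n N : ℕ} {q : ℂ} (hq : q ≠ 0) (hq2 : q + q⁻¹ ≠ 0) {C : ℤ} {m : Fin N → ℤ}
    {a : Fin N} (d : ℕ) : ∀ {b : Fin N} {e : Fin N → Fin n}, (b : ℕ) = a + (d + 1) →
      (∀ i, a ≤ i → i ≤ b → m i = C) → e a = e b → wedgeMon q m e = 0 := by
  induction d with
  | zero =>
    intro b e hb hm he
    have hab : a ≤ b := by rw [Fin.le_def]; omega
    exact wedgeMon_eq_eq hq hq2 (i := a) (j := b) (by omega)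
      ((hm a le_rfl hab).trans (hm b hab le_rfl).symm) he
  | succ d ih =>
    intro b e hb hm he
    let j : Fin N := ⟨b - 1, by omega⟩
    have hj : (j : ℕ) + 1 = b := by dsimp only [j]; omega
    have haj : a ≤ j := by rw [Fin.le_def]; omega
    have hjb : j ≤ b := by rw [Fin.le_def]; omega
    have hmj : m j = m b := (hm j haj hjb).trans (hm b (haj.trans hjb) le_rfl).symm
    have h0 : wedgeMon q m (e ∘ Equiv.swap j b) = 0 := by
      refine ih (b := j) (by omega) (fun i h1 h2 => hm i h1 (h2.trans hjb)) ?_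
      have h1 : a ≠ j := by rw [ne_eq, Fin.ext_iff]; omega
      have h2 : a ≠ b := by rw [ne_eq, Fin.ext_iff]; omega
      simp [Equiv.swap_apply_of_ne_of_ne h1 h2, he]
    rcases lt_trichotomy (e j) (e b) with h | h | h
    · rw [wedgeMon_eq_lt hq hj hmj h, h0, smul_zero]
    · exact wedgeMon_eq_eq hq hq2 hj hmj h
    · have := wedgeMon_eq_lt hq hj hmj (e := e ∘ Equiv.swap j b) (by simpa using h)
      rw [h0, comp_swap_swap] at this
      exact (smul_eq_zero.1 this.symm).resolve_left (neg_ne_zero.2 hq)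

section wedgeExt

variable {n N N' t : ℕ} [NeZero n] {q p : ℂ} {M C : ℤ}

/-- The operator on the wedge product induced by `∑ i, A i ⊗ s i`. -/
def SumOp (A : Fin N → Module.End ℂ (Laurent N)) (S : Fin N → Module.End ℂ (Spin n N))
    (X : Module.End ℂ (Wedge q n N)) : Prop :=
  ∀ f v, X (wedgeMk q n N (f ⊗ₜ[ℂ] v)) = ∑ i, wedgeMk q n N (A i f ⊗ₜ[ℂ] S i v)

theorem SumOp.mem {A : Fin N → Module.End ℂ (Laurent N)} {S : Fin N → Module.End ℂ (Spin n N)}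
    {X : Module.End ℂ (Wedge q n N)} (hX : SumOp A S X) {P : Set (Fin N → ℤ)}
    (hA : ∀ i, ∀ f ∈ monoSpan P, A i f ∈ monoSpan P) {w : Wedge q n N} (hw : w ∈ wSpan q n P) :
    X w ∈ wSpan q n P :=
  wSpan_induction (fun m hm e => by
    rw [wedgeMon, hX]
    exact Submodule.sum_mem _ fun i _ => wedgeMk_mem_wSpan (hA i _ (mono_mem hm)) _) hw

variable (hq : q ≠ 0) (hq2 : q + q⁻¹ ≠ 0) (hN : N' = N + t) (h : N ≤ N')

variable (q n M C N N' t) in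
/-- The relation for the vacuum extension of wedges. -/
abbrev WRel (h : N ≤ N') : Module.End ℂ (Wedge q n N') → Module.End ℂ (Wedge q n N) → Prop :=
  ExtRel (extW hq hq2 n M h) (wSpan q n (belowSet N (C - 1))) (wSpan q n (lowSet N' C t))

include hN in
theorem SumOp.extRel {A' : Fin N' → Module.End ℂ (Laurent N')}
    {S' : Fin N' → Module.End ℂ (Spin n N')} {X' : Module.End ℂ (Wedge q n N')}
    {A : Fin N → Module.End ℂ (Laurent N)} {S : Fin N → Module.End ℂ (Spin n N)}
    {X : Module.End ℂ (Wedge q n N)} {κ τ : Fin t → ℂ} (hX' : SumOp A' S' X') (hX : SumOp A S X)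
    (hA : ∀ i, LRel N N' t (fun i => mOf n (M - i)) C (A' (Fin.castLE h i)) (A i))
    (hA' : ∀ j : Fin t, LRel N N' t (fun i => mOf n (M - i)) C
      (A' ⟨N + j, by have := j.2; omega⟩) (κ j • 1))
    (hS : ∀ i e, S' (Fin.castLE h i) (spinVec (extTuple (fun i => aOf n (M - i)) N' e)) =
      extS N' (fun i => aOf n (M - i)) (S i (spinVec e)))
    (hS' : ∀ j : Fin t, ∀ m ∈ belowSet N (C - 1), ∀ e : Fin N → Fin n,
      wedgeMk q n N' (mono (extTuple (fun i => mOf n (M - i)) N' m) ⊗ₜ[ℂ]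
        S' ⟨N + j, by have := j.2; omega⟩ (spinVec (extTuple (fun i => aOf n (M - i)) N' e))) =
      τ j • wedgeMon q (extTuple (fun i => mOf n (M - i)) N' m)
        (extTuple (fun i => aOf n (M - i)) N' e)) :
    WRel n N N' t q M C hq hq2 h X' (X + (∑ j, κ j * τ j) • 1) := by
  have hL : ∀ i, ∀ f ∈ monoSpan (lowSet N' C t), A' i f ∈ monoSpan (lowSet N' C t) := by
    intro i
    by_cases hi : (i : ℕ) < N
    · exact (hA ⟨i, hi⟩).presL
    · have := (hA' ⟨i - N, by have := i.2; omega⟩).presL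
      have e : (⟨N + (i - N), by have := i.2; omega⟩ : Fin N') = i := Fin.ext (by dsimp only; omega)
      rwa [e] at this
  have hB : ∀ f ∈ wSpan q n (belowSet N (C - 1)), X f ∈ wSpan q n (belowSet N (C - 1)) :=
    fun f hf => hX.mem (fun i => (hA i).presB) hf
  refine ⟨fun f hf => hX'.mem hL hf, fun f hf => ?_, fun f hf => ?_⟩
  · rw [LinearMap.add_apply]
    exact Submodule.add_mem _ (hB f hf) (Submodule.smul_mem _ _ hf)
  have := wSpan_induction (P := belowSet N (C - 1)) (V := wSpan q n (lowSet N' C t))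
    (A := X' ∘ₗ extW hq hq2 n M h - extW hq hq2 n M h ∘ₗ (X + (∑ j, κ j * τ j) • 1))
    (fun m hm e => ?_) hf
  · exact this
  set d : ℕ → Fin n := fun i => aOf n (M - i) with hd
  set c : ℕ → ℤ := fun i => mOf n (M - i) with hc
  have e1 : extW hq hq2 n M h (wedgeMon q m e) =
      wedgeMon q (extTuple c N' m) (extTuple d N' e) := by
    rw [wedgeMon, extW_wedgeMk, extT_tmul, extL_mono, extS_spinVec]; rfl
  rw [LinearMap.sub_apply, LinearMap.comp_apply, LinearMap.comp_apply, LinearMap.add_apply, map_add,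
    LinearMap.smul_apply, Module.End.one_apply, map_smul, e1, wedgeMon, hX', sum_univ_split hN,
    wedgeMon, hX, map_sum, add_sub_add_comm, ← Finset.sum_sub_distrib, Finset.sum_smul,
    ← Finset.sum_sub_distrib]
  refine Submodule.add_mem _ (Submodule.sum_mem _ fun i _ => ?_) (Submodule.sum_mem _ fun j _ => ?_)
  · rw [extW_wedgeMk, extT_tmul, hS, ← map_sub, ← TensorProduct.sub_tmul, ← extL_mono]
    exact wedgeMk_mem_wSpan ((hA i).rel _ (mono_mem hm)) _
  · have e2 : wedgeMk q n N' (A' ⟨N + j, by have := j.2; omega⟩ (mono (extTuple c N' m)) ⊗ₜ[ℂ]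
        S' ⟨N + j, by have := j.2; omega⟩ (spinVec (extTuple d N' e))) -
        (κ j * τ j) • wedgeMk q n N' (mono (extTuple c N' m) ⊗ₜ[ℂ] spinVec (extTuple d N' e)) =
        wedgeMk q n N' ((A' ⟨N + j, by have := j.2; omega⟩ (mono (extTuple c N' m)) -
          κ j • mono (extTuple c N' m)) ⊗ₜ[ℂ]
        S' ⟨N + j, by have := j.2; omega⟩ (spinVec (extTuple d N' e))) := by
      rw [TensorProduct.sub_tmul, map_sub, wedgeMk_smul_left, hS' j m hm e, smul_smul]
      rfl
    rw [e2]
    refine wedgeMk_mem_wSpan ?_ _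
    have := (hA' j).rel _ (mono_mem hm)
    rwa [extL_mono, LinearMap.smul_apply, Module.End.one_apply, map_smul, extL_mono] at this

/-! #### The generators -/

section finite

variable {π : ∀ N, Uq q n →ₐ[ℂ] Module.End ℂ (Wedge q n N)}
  (hπ : ∀ N, IsLevelZeroAction q p n N (π N))
  {H : ∀ N, NZ → Module.End ℂ (Wedge q n N)} (hH : ∀ N, IsHamiltonian q p n N (H N))

include hπ in
theorem sumOp_E (N : ℕ) (ε : Fin n) :
    SumOp (fun i => if ε = 0 then Ring.inverse (yOp q p i) else 1) (eSite q ε)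
      (π N (Uq.gen q (.E ε))) := fun f v => by
  rw [hπ N, genTens_E, LinearMap.sum_apply, map_sum]
  rfl

include hπ in
theorem sumOp_F (N : ℕ) (ε : Fin n) :
    SumOp (fun i => if ε = 0 then yOp q p i else 1) (fSite q ε) (π N (Uq.gen q (.F ε))) :=
  fun f v => by
    rw [hπ N, genTens_F, LinearMap.sum_apply, map_sum]
    rfl

include hH in
theorem sumOp_ham (N : ℕ) (l : NZ) :
    SumOp (fun i => endZPow (yOp q p i) l) (fun _ => 1) (H N l) := fun f v => by
  rw [hH N, hamTens, polyOp_tmul, LinearMap.sum_apply, TensorProduct.sum_tmul, map_sum]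
  rfl

include hπ in
theorem levelZero_K (N : ℕ) (ε : Fin n) (f : Laurent N) (v : Spin n N) :
    π N (Uq.gen q (.K ε)) (wedgeMk q n N (f ⊗ₜ[ℂ] v)) =
      wedgeMk q n N (f ⊗ₜ[ℂ] siteOp (fun _ => kSite q 1 ε) v) := by
  rw [hπ N]; rfl

include hπ in
theorem levelZero_Kinv (N : ℕ) (ε : Fin n) (f : Laurent N) (v : Spin n N) :
    π N (Uq.gen q (.Kinv ε)) (wedgeMk q n N (f ⊗ₜ[ℂ] v)) =
      wedgeMk q n N (f ⊗ₜ[ℂ] siteOp (fun _ => kSite q (-1) ε) v) := by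
  rw [hπ N]; rfl

include hq hπ in
theorem levelZero_mem (hp : p ≠ 0) {P : Set (Fin N → ℤ)} (hP : ClosedExp P) (x : Uq q n) :
    ∀ w ∈ wSpan q n P, π N x w ∈ wSpan q n P := by
  have hy := fun i : Fin N => hP.biPres_yOp hq hp i
  refine uq_induction (P := fun x => ∀ w ∈ wSpan q n P, π N x w ∈ wSpan q n P)
    (fun x => ?_) (fun c => ?_) (fun x y hx hy => ?_) (fun x y hx hy => ?_) x
  · intro w hw
    cases x with
    | E ε =>
      refine (sumOp_E hπ N ε).mem (fun i f hf => ?_) hw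
      split_ifs
      · exact (hy i).inverse.mem hf
      · exact hf
    | F ε =>
      refine (sumOp_F hπ N ε).mem (fun i f hf => ?_) hw
      split_ifs
      · exact (hy i).mem hf
      · exact hf
    | K ε =>
      refine wSpan_induction (fun m hm e => ?_) hw
      rw [wedgeMon, levelZero_K hπ]
      exact wedgeMk_mem_wSpan (mono_mem hm) _
    | Kinv ε =>
      refine wSpan_induction (fun m hm e => ?_) hw
      rw [wedgeMon, levelZero_Kinv hπ]
      exact wedgeMk_mem_wSpan (mono_mem hm) _
  · intro w hw
    rw [AlgHom.commutes, Module.algebraMap_end_apply]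
    exact Submodule.smul_mem _ _ hw
  · intro w hw
    rw [map_add]
    exact Submodule.add_mem _ (hx w hw) (hy w hw)
  · intro w hw
    rw [map_mul]
    exact hx _ (hy w hw)

include hq hH in
theorem ham_mem (hp : p ≠ 0) {P : Set (Fin N → ℤ)} (hP : ClosedExp P) (l : NZ) :
    ∀ w ∈ wSpan q n P, H N l w ∈ wSpan q n P := fun _ hw =>
  (sumOp_ham hH N l).mem (fun i _ hf => (hP.biPres_yOp hq hp i).endZPow_mem _ hf) hw

end finite

end wedgeExt

/-! ### The vacuum tail -/

section tail

variable {n N N' : ℕ} [NeZero n] {q p : ℂ} {M C : ℤ}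

theorem bijective_tail (hc : ∀ i, N ≤ i → i < N + n → mOf n (M - i) = C) :
    Function.Bijective fun j : Fin n => aOf n (M - ((N + j : ℕ) : ℤ)) := by
  refine Finite.injective_iff_bijective.1 fun j j' h => ?_
  have h1 := uIndex_mOf_aOf (n := n) (M - ((N + j : ℕ) : ℤ))
  have h2 := uIndex_mOf_aOf (n := n) (M - ((N + j' : ℕ) : ℤ))
  rw [hc _ (by omega) (by have := j.2; omega), h] at h1
  rw [hc _ (by omega) (by have := j'.2; omega), h1] at h2
  exact Fin.ext (by omega)

theorem prod_kEig_site (hq : q ≠ 0) (t : ℤ) (ε : Fin n) : ∏ a, kEig q t ε a = 1 := by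
  have h : ∀ a, kEig q t ε a = (if a = ε - 1 then q ^ t else 1) * (if a = ε then q ^ (-t) else 1) := by
    intro a
    rw [kEig, mul_sub, sub_eq_add_neg, zpow_add₀ hq]
    congr 1 <;> split_ifs <;> simp
  simp only [h, Finset.prod_mul_distrib, Finset.prod_ite_eq', Finset.mem_univ, if_true]
  rw [← zpow_add₀ hq, add_neg_cancel, zpow_zero]

theorem prod_kEig_tail (hq : q ≠ 0) (hc : ∀ i, N ≤ i → i < N + n → mOf n (M - i) = C) (t : ℤ)
    (ε : Fin n) : ∏ j : Fin n, kEig q t ε (aOf n (M - ((N + j : ℕ) : ℤ))) = 1 :=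
  ((bijective_tail hc).prod_comp fun a => kEig q t ε a).trans (prod_kEig_site hq t ε)

variable (hn : 2 ≤ n) (hq : q ≠ 0) (hq2 : q + q⁻¹ ≠ 0) (hp : p ≠ 0) (hN : N' = N + n) (h : N ≤ N')
  (hc : ∀ i, N ≤ i → i < N + n → mOf n (M - i) = C)

include hN in
theorem siteOp_ext {c' : Fin N' → ℂ} {c : Fin N → ℂ} {A' : Fin N' → Module.End ℂ (Fin n → ℂ)}
    {A : Fin N → Module.End ℂ (Fin n → ℂ)} {d : ℕ → Fin n} {e e' : Fin N → Fin n}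
    (hA' : ∀ l, A' l (Pi.single (extTuple d N' e l) 1) =
      c' l • Pi.single (extTuple d N' e' l) (1 : ℂ))
    (hA : ∀ l, A l (Pi.single (e l) 1) = c l • Pi.single (e' l) (1 : ℂ))
    (h1 : ∀ l, c' (Fin.castLE h l) = c l)
    (h2 : ∏ j : Fin n, c' ⟨N + j, by have := j.2; omega⟩ = 1) :
    siteOp A' (spinVec (extTuple d N' e)) = extS N' d (siteOp A (spinVec e)) := by
  rw [siteOp_spinVec hA', siteOp_spinVec hA, map_smul, extS_spinVec, prod_univ_split hN, h2, mul_one]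
  simp only [h1]

theorem val_castLE_ne {i : Fin N} {l : ℕ} (hl : N ≤ l) (h' : l < N') (h : N ≤ N') :
    ¬ (⟨l, h'⟩ : Fin N') < Fin.castLE h i ∧ (⟨l, h'⟩ : Fin N') ≠ Fin.castLE h i ∧
      Fin.castLE h i < (⟨l, h'⟩ : Fin N') := by
  have := i.2
  rw [ne_eq, Fin.lt_def, Fin.ext_iff, Fin.lt_def, Fin.val_castLE]
  dsimp only
  omega

include hN hq hc in
theorem kSite_ext (t : ℤ) (ε : Fin n) (e : Fin N → Fin n) :
    siteOp (fun _ => kSite q t ε) (spinVec (extTuple (fun i => aOf n (M - i)) N' e)) =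
      extS N' (fun i => aOf n (M - i)) (siteOp (fun _ => kSite q t ε) (spinVec e)) := by
  refine siteOp_ext hN (hN ▸ Nat.le_add_right N n) (fun l => kSite_single t ε _) (fun l => kSite_single t ε _)
    (fun l => ?_) ?_
  · rw [extTuple_castLE]
  · rw [← prod_kEig_tail hq hc t ε]
    refine Finset.prod_congr rfl fun j _ => ?_
    rw [extTuple_of_ge _ (by simp)]

theorem ite_extTuple {α : Type*} (h : N ≤ N') (d : ℕ → α) (e : Fin N → α) (i : Fin N) (a : α) (l : Fin N') :
    (if l = Fin.castLE h i then a else extTuple d N' e l) =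
      extTuple d N' (fun l => if l = i then a else e l) l := by
  by_cases hl : (l : ℕ) < N
  · simp [extTuple, hl, Fin.ext_iff]
  · have : l ≠ Fin.castLE h i := by rintro rfl; exact hl (by simp)
    rw [if_neg this, extTuple_of_ge _ (not_lt.1 hl), extTuple_of_ge _ (not_lt.1 hl)]

include hN hq hc in
theorem eSite_ext (ε : Fin n) (i : Fin N) (e : Fin N → Fin n) :
    eSite q ε (Fin.castLE h i) (spinVec (extTuple (fun i => aOf n (M - i)) N' e)) =
      extS N' (fun i => aOf n (M - i)) (eSite q ε i (spinVec e)) := by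
  refine siteOp_ext hN h (e' := fun l => if l = i then ε - 1 else e l)
    (c' := fun l => if l < Fin.castLE h i then 1 else if l = Fin.castLE h i then
      (if extTuple (fun i => aOf n (M - i)) N' e l = ε then 1 else 0)
      else kEig q 1 ε (extTuple (fun i => aOf n (M - i)) N' e l))
    (fun l => ?_) (fun l => eSite_single ε i l _) (fun l => ?_) ?_
  · rw [eSite_single, ite_extTuple]
  · simp only [extTuple_castLE, Fin.lt_def, Fin.ext_iff, Fin.val_castLE]
  · rw [← prod_kEig_tail hq hc 1 ε]
    refine Finset.prod_congr rfl fun j _ => ?_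
    have := val_castLE_ne (i := i) (l := N + j) (by omega) (by have := j.2; omega) h
    rw [if_neg this.1, if_neg this.2.1, extTuple_of_ge _ (by simp)]

include hN in
theorem fSite_ext (ε : Fin n) (i : Fin N) (e : Fin N → Fin n) :
    fSite q ε (Fin.castLE h i) (spinVec (extTuple (fun i => aOf n (M - i)) N' e)) =
      extS N' (fun i => aOf n (M - i)) (fSite q ε i (spinVec e)) := by
  refine siteOp_ext hN h (e' := fun l => if l = i then ε else e l)
    (c' := fun l => if l < Fin.castLE h i then
      kEig q (-1) ε (extTuple (fun i => aOf n (M - i)) N' e l) else if l = Fin.castLE h i then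
      (if extTuple (fun i => aOf n (M - i)) N' e l = ε - 1 then 1 else 0) else 1)
    (fun l => ?_) (fun l => fSite_single ε i l _) (fun l => ?_) ?_
  · rw [fSite_single, ite_extTuple]
  · simp only [extTuple_castLE, Fin.lt_def, Fin.ext_iff, Fin.val_castLE]
  · refine Finset.prod_eq_one fun j _ => ?_
    have := val_castLE_ne (i := i) (l := N + j) (by omega) (by have := j.2; omega) h
    rw [if_neg this.1, if_neg this.2.1]

include hq hq2 hN hc in
/-- A change of a spin in the vacuum tail creates a repeated factor. -/
theorem wedge_siteOp_tail {A' : Fin N' → Module.End ℂ (Fin n → ℂ)} {i : Fin N'} {c' : Fin N' → ℂ}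
    {x y : Fin n} (hxy : x ≠ y) (hi : N ≤ (i : ℕ)) (m : Fin N → ℤ) (e : Fin N → Fin n)
    (hA' : ∀ l, A' l (Pi.single (extTuple (fun i => aOf n (M - i)) N' e l) 1) = c' l •
      Pi.single (if l = i then x else extTuple (fun i => aOf n (M - i)) N' e l) (1 : ℂ))
    (h0 : aOf n (M - (i : ℕ)) ≠ y → c' i = 0) :
    wedgeMk q n N' (mono (extTuple (fun i => mOf n (M - i)) N' m) ⊗ₜ[ℂ]
      siteOp A' (spinVec (extTuple (fun i => aOf n (M - i)) N' e))) = 0 := by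
  rw [siteOp_spinVec hA', wedgeMk_smul_right]
  by_cases hy : aOf n (M - (i : ℕ)) = y
  · obtain ⟨j, hj⟩ := (bijective_tail hc).2 x
    let b : Fin N' := ⟨N + j, by have := j.2; omega⟩
    have hbi : b ≠ i := by
      intro hb
      rw [← hb] at hy
      exact hxy (hj.symm.trans hy)
    have hb : (fun l => if l = i then x else extTuple (fun i => aOf n (M - i)) N' e l) b = x := by
      dsimp only
      rw [if_neg hbi, extTuple_of_ge _ (by simp [b])]
      exact hj
    have hcon : ∀ l : Fin N', N ≤ (l : ℕ) → extTuple (fun i => mOf n (M - i)) N' m l = C :=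
      fun l hl => by rw [extTuple_of_ge _ hl]; exact hc _ hl (by have := l.2; omega)
    convert smul_zero _
    have hii : (fun l => if l = i then x else extTuple (fun i => aOf n (M - i)) N' e l) i = x :=
      if_pos rfl
    rcases lt_or_gt_of_ne hbi with hlt | hlt
    · rw [Fin.lt_def] at hlt
      exact wedgeMon_repeat hq hq2 (a := b) ((i : ℕ) - b - 1) (b := i) (by omega)
        (fun l h1 _ => hcon l (by rw [Fin.le_def] at h1; simp only [b] at h1; omega)) (hb.trans hii.symm)
    · rw [Fin.lt_def] at hlt
      exact wedgeMon_repeat hq hq2 (a := i) ((b : ℕ) - i - 1) (b := b) (by omega)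
        (fun l h1 _ => hcon l (by rw [Fin.le_def] at h1; omega)) (hii.trans hb.symm)
  · rw [Finset.prod_eq_zero (Finset.mem_univ i) (h0 hy), zero_smul]

include hn hq hq2 hN hc in
theorem wedge_eSite_tail (ε : Fin n) {i : Fin N'} (hi : N ≤ (i : ℕ)) (m : Fin N → ℤ) (e : Fin N → Fin n) :
    wedgeMk q n N' (mono (extTuple (fun i => mOf n (M - i)) N' m) ⊗ₜ[ℂ]
      eSite q ε i (spinVec (extTuple (fun i => aOf n (M - i)) N' e))) = 0 := by
  refine wedge_siteOp_tail hq hq2 hN hc (sub_one_ne hn ε) hi m e (fun l => eSite_single ε i l _) ?_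
  intro h'
  rw [if_neg (lt_irrefl i), if_pos rfl, extTuple_of_ge _ hi, if_neg h']

include hn hq hq2 hN hc in
theorem wedge_fSite_tail (ε : Fin n) {i : Fin N'} (hi : N ≤ (i : ℕ)) (m : Fin N → ℤ) (e : Fin N → Fin n) :
    wedgeMk q n N' (mono (extTuple (fun i => mOf n (M - i)) N' m) ⊗ₜ[ℂ]
      fSite q ε i (spinVec (extTuple (fun i => aOf n (M - i)) N' e))) = 0 := by
  refine wedge_siteOp_tail hq hq2 hN hc (sub_one_ne hn ε).symm hi m e (fun l => fSite_single ε i l _) ?_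
  intro h'
  rw [if_neg (lt_irrefl i), if_pos rfl, extTuple_of_ge _ hi, if_neg h']

variable {π : ∀ N, Uq q n →ₐ[ℂ] Module.End ℂ (Wedge q n N)}
  (hπ : ∀ N, IsLevelZeroAction q p n N (π N))
  {H : ∀ N, NZ → Module.End ℂ (Wedge q n N)} (hH : ∀ N, IsHamiltonian q p n N (H N))

include hq2 in
theorem wRel_spin {X' : Module.End ℂ (Wedge q n N')} {X : Module.End ℂ (Wedge q n N)}
    {S' : Module.End ℂ (Spin n N')} {S : Module.End ℂ (Spin n N)}
    (hX' : ∀ f v, X' (wedgeMk q n N' (f ⊗ₜ[ℂ] v)) = wedgeMk q n N' (f ⊗ₜ[ℂ] S' v))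
    (hX : ∀ f v, X (wedgeMk q n N (f ⊗ₜ[ℂ] v)) = wedgeMk q n N (f ⊗ₜ[ℂ] S v))
    (hS : ∀ e, S' (spinVec (extTuple (fun i => aOf n (M - i)) N' e)) =
      extS N' (fun i => aOf n (M - i)) (S (spinVec e))) :
    WRel n N N' n q M C hq hq2 h X' X := by
  refine ⟨fun f hf => wSpan_induction (fun m hm e => ?_) hf,
    fun f hf => wSpan_induction (fun m hm e => ?_) hf, fun f hf => ?_⟩
  · rw [wedgeMon, hX']
    exact wedgeMk_mem_wSpan (mono_mem hm) _
  · rw [wedgeMon, hX]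
    exact wedgeMk_mem_wSpan (mono_mem hm) _
  · have : X' ∘ₗ extW hq hq2 n M h = extW hq hq2 n M h ∘ₗ X := by
      refine wedge_end_ext fun t => ?_
      suffices e : (X' ∘ₗ extW hq hq2 n M h) ∘ₗ wedgeMk q n N = (extW hq hq2 n M h ∘ₗ X) ∘ₗ wedgeMk q n N from
        congrArg (fun A => A t) e
      refine ext_tens fun m e => ?_
      simp only [LinearMap.comp_apply]
      rw [extW_wedgeMk, extT_tmul, extS_spinVec, hX', hS, hX, extW_wedgeMk, extT_tmul]
    have e := congrArg (fun A => A f) this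
    simp only [LinearMap.comp_apply] at e
    rw [e, sub_self]
    exact Submodule.zero_mem _

include hn hp hN hc hπ in
theorem wRel_levelZero (x : Uq q n) :
    WRel n N N' n q M C hq hq2 h (π N' x) (π N x) := by
  have hL := closedExp_lowSet N' C n
  have hB := closedExp_belowSet N (C - 1)
  have hc' : ∀ i, N ≤ i → i < N' → (fun i : ℕ => mOf n (M - i)) i = C :=
    fun i h1 h2 => hc i h1 (by omega)
  refine uq_induction (P := fun x => WRel n N N' n q M C hq hq2 h (π N' x) (π N x))
    (fun x => ?_) (fun c => ?_) (fun x y hx hy => ?_) (fun x y hx hy => ?_) x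
  · cases x with
    | E ε =>
      have hy' := fun i => (lrel_yOp hN hc' hq hp h i).inverse (hL.biPres_yOp hq hp _) (hB.biPres_yOp hq hp _)
      have hyt := fun j : Fin n => (lrel_yOp_tail hN hc' hq hp (i := ⟨N + j, by have := j.2; omega⟩)
        (by simp)).inverse (hL.biPres_yOp hq hp _)
          (biPres_smul_one (mul_ne_zero (zpow_ne_zero _ hp) (zpow_ne_zero _ hq)))
      have := (sumOp_E hπ N' ε).extRel hq hq2 (M := M) (C := C) hN h (sumOp_E hπ N ε)
        (κ := fun j => if ε = 0 then
          (p ^ C * q ^ (-2 * ((N : ℤ) + N' - 1 - ((N + j : ℕ) : ℤ))))⁻¹ else 1) (τ := 0)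
        (fun i => ?_) (fun j => ?_) (eSite_ext hq hN h hc ε)
        (fun j m _ e => by
          rw [wedge_eSite_tail hn hq hq2 hN hc ε (by simp), Pi.zero_apply, zero_smul])
      · simpa using this
      · split_ifs
        · exact hy' i
        · exact ExtRel.one
      · split_ifs
        · have := hyt j
          rwa [inverse_smul_one (mul_ne_zero (zpow_ne_zero _ hp) (zpow_ne_zero _ hq))] at this
        · rw [one_smul]; exact ExtRel.one
    | F ε =>
      have := (sumOp_F hπ N' ε).extRel hq hq2 (M := M) (C := C) hN h (sumOp_F hπ N ε)
        (κ := fun j => if ε = 0 then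
          (p ^ C * q ^ (-2 * ((N : ℤ) + N' - 1 - ((N + j : ℕ) : ℤ)))) else 1) (τ := 0)
        (fun i => ?_) (fun j => ?_) (fSite_ext hN h ε)
        (fun j m _ e => by
          rw [wedge_fSite_tail hn hq hq2 hN hc ε (by simp), Pi.zero_apply, zero_smul])
      · simpa using this
      · split_ifs
        · exact lrel_yOp hN hc' hq hp h i
        · exact ExtRel.one
      · split_ifs
        · exact lrel_yOp_tail hN hc' hq hp (i := ⟨N + j, by have := j.2; omega⟩) (by simp)
        · rw [one_smul]; exact ExtRel.one
    | K ε => exact wRel_spin hq hq2 h (levelZero_K hπ N' ε) (levelZero_K hπ N ε) (kSite_ext hq hN hc 1 ε)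
    | Kinv ε =>
      exact wRel_spin hq hq2 h (levelZero_Kinv hπ N' ε) (levelZero_Kinv hπ N ε) (kSite_ext hq hN hc (-1) ε)
  · rw [AlgHom.commutes, AlgHom.commutes, Algebra.algebraMap_eq_smul_one, Algebra.algebraMap_eq_smul_one]
    exact ExtRel.algebraMap c
  · rw [map_add, map_add]; exact hx.add hy
  · rw [map_mul, map_mul]; exact hx.mul hy

include hq hq2 hp hN hc hH in
theorem wRel_ham (l : NZ) :
    WRel n N N' n q M C hq hq2 h (H N' l)
      (H N l + (∑ j : Fin n, p ^ ((l : ℤ) * C) * q ^ (-2 * (l : ℤ) * (N + j))) • 1) := by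
  have hL := closedExp_lowSet N' C n
  have hB := closedExp_belowSet N (C - 1)
  have hc' : ∀ i, N ≤ i → i < N' → (fun i : ℕ => mOf n (M - i)) i = C :=
    fun i h1 h2 => hc i h1 (by omega)
  have := (sumOp_ham hH N' l).extRel hq hq2 (M := M) (C := C) hN h (sumOp_ham hH N l)
    (κ := fun j => (p ^ C * q ^ (-2 * ((N : ℤ) + N' - 1 - ((N + j : ℕ) : ℤ)))) ^ (l : ℤ)) (τ := 1)
    (fun i => (lrel_yOp hN hc' hq hp h i).endZPow (hL.biPres_yOp hq hp _) (hB.biPres_yOp hq hp _) _)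
    (fun j => by
      have := (lrel_yOp_tail hN hc' hq hp (i := ⟨N + j, by have := j.2; omega⟩)
        (by simp)).endZPow (hL.biPres_yOp hq hp _)
          (biPres_smul_one (mul_ne_zero (zpow_ne_zero _ hp) (zpow_ne_zero _ hq))) l
      rwa [endZPow_smul_one (mul_ne_zero (zpow_ne_zero _ hp) (zpow_ne_zero _ hq))] at this)
    (fun i e => by rw [Module.End.one_apply, Module.End.one_apply, extS_spinVec])
    (fun j m _ e => by rw [Module.End.one_apply, Pi.one_apply, one_smul]; rfl)
  convert this using 3
  rw [← Equiv.sum_comp Fin.revPerm]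
  refine Finset.sum_congr rfl fun j _ => ?_
  have hj := j.2
  rw [Pi.one_apply, mul_one, mul_zpow, ← zpow_mul, ← zpow_mul, Fin.revPerm_apply, Fin.val_rev, mul_comm C]
  congr 2
  rw [Nat.cast_sub (by omega), hN]
  push_cast
  ring

end tail

/-! ### The spaces `V_M^{s+nr}` -/

section VMspaces

variable {n : ℕ} [NeZero n] {q : ℂ} {M : ℤ} {s : ℕ}

/-- The largest exponent in `V_M^{s+nr}`. -/
def vacC (n : ℕ) (M : ℤ) (s r : ℕ) : ℤ := ((s : ℤ) - M) / n + r

theorem vacC_succ (r : ℕ) : vacC n M s (r + 1) - 1 = vacC n M s r := by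
  simp only [vacC]; push_cast; ring

/-- The exponents of degree `k`. -/
def degSet (n : ℕ) (M : ℤ) (s r k : ℕ) : Set (Fin (s + n * r) → ℤ) :=
  {m | m ∈ belowSet _ (vacC n M s r) ∧ ∑ i : Fin (s + n * r), (mVac n M s i - m i) = k}

theorem closedExp_degSet (r k : ℕ) : ClosedExp (degSet n M s r k) := by
  intro m hm i j hij
  have hb := closedExp_belowSet _ _ m hm.1 i j hij
  have h2 := hm.2
  rw [Finset.sum_sub_distrib] at h2
  refine ⟨⟨hb.1, ?_⟩, fun ν hν => ⟨hb.2 ν hν, ?_⟩⟩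
  · rw [Finset.sum_sub_distrib]
    have := Equiv.sum_comp (Equiv.swap i j) m
    simp only [Function.comp_apply]
    rw [this, h2]
  · have h3 := hν.sum_eq hij id
    have h4 := hν.2.1
    have h5 := sum_pair_split hij m
    simp only [id] at h3
    rw [Finset.sum_sub_distrib]
    linarith

theorem succ_len (n s r : ℕ) : s + n * (r + 1) = s + n * r + n := by ring

variable (hs : s < n) (hMs : M ≡ s [ZMOD n])

include hMs in
theorem mOf_le_vacC {r : ℕ} {k : ℤ} :
    mOf n k ≤ vacC n M s r ↔ M - ((s + n * r : ℕ) : ℤ) < k := by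
  have hn := Nat.pos_of_ne_zero (NeZero.ne n)
  obtain ⟨t, ht⟩ := hMs.dvd
  have hn' : (n : ℤ) ≠ 0 := by exact_mod_cast hn.ne'
  rw [mOf_le_iff hn, vacC, ht, Int.mul_ediv_cancel_left _ hn']
  push_cast
  rw [mul_add]
  constructor <;> intro h <;> linarith

include hMs in
theorem mOf_tail {r i : ℕ} (h1 : s + n * r ≤ i) (h2 : i < s + n * r + n) :
    mOf n (M - i) = vacC n M s (r + 1) := by
  have a1 := (mOf_le_vacC (n := n) hMs (r := r) (k := M - i)).not
  have a2 := mOf_le_vacC (n := n) hMs (r := r + 1) (k := M - i)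
  rw [succ_len] at a2
  have := vacC_succ (n := n) (M := M) (s := s) r
  have := a1.2 (by omega)
  have := a2.2 (by omega)
  omega

theorem strictAnti_add_le {N : ℕ} {k : Fin N → ℤ} (hk : StrictAnti k) {i j : Fin N} (h : i ≤ j) :
    k j + ((j : ℤ) - i) ≤ k i := by
  have key : ∀ d : ℕ, ∀ j : Fin N, (j : ℕ) = i + d → k j + ((j : ℤ) - i) ≤ k i := by
    intro d
    induction d with
    | zero => intro j hj; have : j = i := Fin.ext hj; subst this; simp
    | succ d ih =>
      intro j hj
      have h1 := ih ⟨i + d, by omega⟩ rfl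
      have h2 := hk (show (⟨i + d, by omega⟩ : Fin N) < j by rw [Fin.lt_def]; dsimp only; omega)
      dsimp only at h1
      push_cast at h1
      omega
  rw [Fin.le_def] at h
  exact key (j - i) j (by omega)

theorem le_of_lt_vac {N : ℕ} {k : Fin N → ℤ} (hk : StrictAnti k) (hkM : ∀ i, M - N < k i) (i : Fin N) :
    M - i ≤ k i := by
  have hi := i.2
  have h1 := strictAnti_add_le hk (i := i) (j := ⟨N - 1, by omega⟩) (by rw [Fin.le_def]; dsimp only; omega)
  have h2 := hkM ⟨N - 1, by omega⟩
  dsimp only at h1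
  omega

theorem nStrict_mOf {ι : Type} {k : ι → ℤ} (hk : Function.Injective k) :
    NStrict n fun i => mOf n (k i) := by
  intro c
  have := Set.encard_le_encard_of_injOn (s := {i | mOf n (k i) = c}) (t := Set.univ)
    (f := fun i => aOf n (k i)) (fun _ _ => Set.mem_univ _) (fun i hi j hj h => by
      refine hk ?_
      rw [← uIndex_mOf_aOf (n := n) (k i), ← uIndex_mOf_aOf (n := n) (k j), hi.out, hj.out]
      exact congrArg _ h)
  simpa [Set.encard_univ] using this

include hs hMs in
theorem vLabel_iff {r : ℕ} {m : Fin (s + n * r) → ℤ} {e : Fin (s + n * r) → Fin n} :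
    VLabel M s r m e ↔ StrictAnti (kIdx m e) ∧ m ∈ belowSet _ (vacC n M s r) := by
  have hn := Nat.pos_of_ne_zero (NeZero.ne n)
  constructor
  · rintro ⟨⟨h1, -⟩, h2, h3⟩
    refine ⟨strictAnti_kIdx h1 h2, fun i => ?_⟩
    have hi := i.2
    let l : Fin (s + n * r) := ⟨s + n * r - 1, by omega⟩
    have hil : i ≤ l := by rw [Fin.le_def]; dsimp only [l]; omega
    refine (h1 hil).trans ((h3 l (by dsimp only [l]; omega)).trans ?_)
    rw [mVac_eq hs hMs, mOf_le_vacC hMs]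
    dsimp only [l]
    omega
  · rintro ⟨h1, h2⟩
    have e1 : (fun i => mOf n (kIdx m e i)) = m := by simp only [kIdx, mOf_uIndex]
    have e2 : (fun i => aOf n (kIdx m e i)) = e := by simp only [kIdx, aOf_uIndex]
    have h3 := mOf_monotone (n := n) h1
    have h4 := inE_aOf (n := n) h1
    have h5 := nStrict_mOf (n := n) h1.injective
    rw [e1] at h3 h5
    rw [e1, e2] at h4
    refine ⟨⟨h3, h5⟩, h4, fun i hi => ?_⟩
    rw [mVac_eq hs hMs]
    have h6 := h2 i
    rw [← congrFun e1 i] at h6 ⊢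
    rw [mOf_le_vacC hMs] at h6
    exact mOf_antitone hn (by omega)

variable (hq : q ≠ 0) (hq2 : q + q⁻¹ ≠ 0)

include hs hMs hq hq2 in
theorem span_vLabel {r : ℕ} {P : Set (Fin (s + n * r) → ℤ)} (hP : ClosedExp P)
    (hb : P ⊆ belowSet _ (vacC n M s r)) :
    Submodule.span ℂ {w : Wedge q n (s + n * r) | ∃ m e, VLabel M s r m e ∧ m ∈ P ∧ w = wedgeMon q m e} =
      wSpan q n P := by
  refine le_antisymm (Submodule.span_mono ?_) ?_
  · rintro _ ⟨m, e, -, h, rfl⟩; exact ⟨m, e, h, rfl⟩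
  · rw [wSpan_eq hq hq2 hP]
    refine Submodule.span_mono ?_
    rintro _ ⟨k, hk, hkP, rfl⟩
    refine ⟨_, _, (vLabel_iff hs hMs).2 ⟨?_, hb hkP⟩, hkP, rfl⟩
    rwa [kIdx_of]

include hs hMs hq hq2 in
theorem VM_eq (r : ℕ) : VM q n M s r = wSpan q n (belowSet _ (vacC n M s r)) := by
  rw [← span_vLabel hs hMs hq hq2 (closedExp_belowSet _ _) subset_rfl, VM]
  congr 1
  ext w
  refine exists₂_congr fun m e => and_congr_right fun h => ?_
  exact (and_iff_right ((vLabel_iff hs hMs).1 h).2).symm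

include hs hMs hq hq2 in
theorem VMdeg_eq (r k : ℕ) : VMdeg q n M s r k = wSpan q n (degSet n M s r k) := by
  rw [← span_vLabel hs hMs hq hq2 (closedExp_degSet _ _) fun _ h => h.1, VMdeg]
  congr 1
  ext w
  refine exists₂_congr fun m e => and_congr_right fun h => ?_
  exact and_congr_left fun _ => (and_iff_right ((vLabel_iff hs hMs).1 h).2).symm

theorem VMdeg_le (r k : ℕ) : VMdeg q n M s r k ≤ VM q n M s r :=
  Submodule.span_mono fun _ ⟨m, e, h1, _, h3⟩ => ⟨m, e, h1, h3⟩

include hs hMs hq hq2 in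
theorem VM_eq_wk (r : ℕ) : VM q n M s r = Submodule.span ℂ
    {w | ∃ k : Fin (s + n * r) → ℤ, StrictAnti k ∧ (∀ i, M - (s + n * r : ℕ) < k i) ∧ w = wk q n k} := by
  rw [VM_eq hs hMs hq hq2, wSpan_eq hq hq2 (closedExp_belowSet _ _)]
  simp only [belowSet, Set.mem_ofPred_eq, mOf_le_vacC hMs]

include hs hMs hq hq2 in
theorem VMdeg_eq_wk (r t : ℕ) : VMdeg q n M s r t = Submodule.span ℂ
    {w | ∃ k : Fin (s + n * r) → ℤ, StrictAnti k ∧ (∀ i, M - (s + n * r : ℕ) < k i) ∧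
      ∑ i : Fin (s + n * r), (mVac n M s i - mOf n (k i)) = t ∧ w = wk q n k} := by
  rw [VMdeg_eq hs hMs hq hq2, wSpan_eq hq hq2 (closedExp_degSet _ _)]
  simp only [degSet, belowSet, Set.mem_ofPred_eq, mOf_le_vacC hMs, and_assoc]

end VMspaces

/-! ### Truncation -/

section truncation

variable {n N N' : ℕ} [NeZero n] {q : ℂ} {M : ℤ} (hq : q ≠ 0) (hq2 : q + q⁻¹ ≠ 0)

theorem strictAnti_comp_castLE (h : N ≤ N') {k : Fin N' → ℤ} (hk : StrictAnti k) :
    StrictAnti (k ∘ Fin.castLE h) := fun _ _ hij => hk hij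

open scoped Classical in
/-- Removal of a vacuum tail; the normally ordered wedges without vacuum tail are sent to `0`. -/
def rhoW (n : ℕ) [NeZero n] (M : ℤ) (h : N ≤ N') : Wedge q n N' →ₗ[ℂ] Wedge q n N :=
  (wBasis hq hq2 n N').constr ℂ fun k =>
    if ∀ i : Fin N', N ≤ (i : ℕ) → k.1 i = M - i then wk q n (k.1 ∘ Fin.castLE h) else 0

open scoped Classical in
theorem rhoW_wk (h : N ≤ N') {k : Fin N' → ℤ} (hk : StrictAnti k) :
    rhoW hq hq2 n M h (wk q n k) =
      if ∀ i : Fin N', N ≤ (i : ℕ) → k i = M - i then wk q n (k ∘ Fin.castLE h) else 0 := by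
  have := (wBasis hq hq2 n N').constr_basis ℂ (fun k =>
    if ∀ i : Fin N', N ≤ (i : ℕ) → k.1 i = M - i then wk q n (k.1 ∘ Fin.castLE h) else 0) ⟨k, hk⟩
  rwa [wBasis_apply] at this

theorem rhoW_extW_wk (h : N ≤ N') {k : Fin N → ℤ} (hk : StrictAnti k) (hkM : ∀ i, M - N < k i) :
    rhoW hq hq2 n M h (extW hq hq2 n M h (wk q n k)) = wk q n k := by
  rw [extW_wk, rhoW_wk hq hq2 h (strictAnti_extK h hk hkM), if_pos, extK,
    extTuple_comp_castLE]
  exact fun i hi => extTuple_of_ge k hi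

end truncation

section projection

variable {n : ℕ} [NeZero n] {q : ℂ} {M : ℤ} {s : ℕ} (hs : s < n) (hMs : M ≡ s [ZMOD n])
  (hq : q ≠ 0) (hq2 : q + q⁻¹ ≠ 0)

theorem map_eq_of_span {W : Type*} [AddCommGroup W] [Module ℂ W] {W' : Type*} [AddCommGroup W']
    [Module ℂ W'] {S : Set W} {A B : W →ₗ[ℂ] W'} (h : ∀ x ∈ S, A x = B x) {w : W}
    (hw : w ∈ Submodule.span ℂ S) : A w = B w :=
  LinearMap.eqOn_span h hw

include hs hMs in
theorem rhoW_extW {N' r : ℕ} (h : s + n * r ≤ N') {w : Wedge q n (s + n * r)} (hw : w ∈ VM q n M s r) :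
    rhoW hq hq2 n M h (extW hq hq2 n M h w) = w := by
  rw [VM_eq_wk hs hMs hq hq2] at hw
  refine map_eq_of_span (A := rhoW hq hq2 n M h ∘ₗ extW hq hq2 n M h) (B := LinearMap.id) ?_ hw
  rintro _ ⟨k, hk, hkM, rfl⟩
  exact rhoW_extW_wk hq hq2 h hk hkM

include hs hMs in
theorem extW_mem_VMdeg {r t : ℕ} {w : Wedge q n (s + n * r)}
    (hw : w ∈ VMdeg q n M s r t) : extW hq hq2 n M (len_le n s r) w ∈ VMdeg q n M s (r + 1) t := by
  rw [VMdeg_eq_wk hs hMs hq hq2] at hw ⊢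
  have := Submodule.mem_map_of_mem (f := extW hq hq2 n M (len_le n s r)) hw
  rw [Submodule.map_span] at this
  refine Submodule.span_mono ?_ this
  rintro _ ⟨_, ⟨k, hk, hkM, hkt, rfl⟩, rfl⟩
  refine ⟨_, strictAnti_extK (len_le n s r) hk hkM, fun i => ?_, ?_, extW_wk hq hq2 M (len_le n s r) k⟩
  · have := len_le n s r
    simp only [extK, extTuple]
    split_ifs with hi
    · have := hkM ⟨i, hi⟩; omega
    · have := i.2; omega
  · rw [sum_univ_split (succ_len n s r), ← hkt]
    have h2 : ∀ j : Fin n, mVac n M s (s + n * r + j : ℕ) -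
        mOf n (extK M (s + n * (r + 1)) k ⟨s + n * r + j, by have := j.2; rw [succ_len]; omega⟩) = 0 := by
      intro j
      rw [extK, extTuple_of_ge _ (by simp), mVac_eq hs hMs, sub_self]
    simp only [h2, Finset.sum_const_zero, add_zero]
    refine Finset.sum_congr rfl fun i _ => ?_
    rw [extK, extTuple_castLE]
    rfl

include hMs in
/-- The vacuum tail is forced by its exponents. -/
theorem tail_eq {r : ℕ} {k : Fin (s + n * (r + 1)) → ℤ} (hk : StrictAnti k)
    (h : ∀ i : Fin (s + n * (r + 1)), s + n * r ≤ (i : ℕ) → mOf n (k i) = vacC n M s (r + 1))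
    (i : Fin (s + n * (r + 1))) (hi : s + n * r ≤ (i : ℕ)) : k i = M - i := by
  have hn := Nat.pos_of_ne_zero (NeZero.ne n)
  have hi2 := i.2
  have hl := succ_len n s r
  let a : Fin (s + n * (r + 1)) := ⟨s + n * r, by omega⟩
  let b : Fin (s + n * (r + 1)) := ⟨s + n * (r + 1) - 1, by omega⟩
  have h1 := strictAnti_add_le hk (i := a) (j := i) (by rw [Fin.le_def]; exact hi)
  have h2 := strictAnti_add_le hk (i := i) (j := b) (by rw [Fin.le_def]; dsimp only [b]; omega)
  have h3 := (mOf_le_vacC (n := n) hMs (r := r) (k := k a)).not.1 (by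
    rw [h a le_rfl]
    have := vacC_succ (n := n) (M := M) (s := s) r
    omega)
  have h4 := (mOf_le_vacC (n := n) hMs (r := r + 1) (k := k b)).1 (h b (by dsimp only [b]; omega)).le
  dsimp only [a, b] at h1 h2 h3 h4
  omega

include hMs in
theorem tail_iff {r : ℕ} {k : Fin (s + n * (r + 1)) → ℤ} (hk : StrictAnti k) :
    (∀ i : Fin (s + n * (r + 1)), s + n * r ≤ (i : ℕ) → k i = M - i) ↔
    ∀ i : Fin (s + n * (r + 1)), s + n * r ≤ (i : ℕ) → mOf n (k i) = vacC n M s (r + 1) := by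
  refine ⟨fun h i hi => ?_, fun h i hi => tail_eq hMs hk h i hi⟩
  rw [h i hi]
  exact mOf_tail hMs hi (i.2.trans_eq (succ_len n s r))

open scoped Classical in
include hs hMs in
theorem rhoW_wedgeMon {r : ℕ} {m : Fin (s + n * (r + 1)) → ℤ} {e : Fin (s + n * (r + 1)) → Fin n}
    (hme : VLabel M s (r + 1) m e) : rhoW hq hq2 n M (len_le n s r) (wedgeMon q m e) =
      if ∀ i : Fin (s + n * (r + 1)), s + n * r ≤ (i : ℕ) → m i = mVac n M s i then
        wedgeMon q (m ∘ Fin.castLE (len_le n s r)) (e ∘ Fin.castLE (len_le n s r)) else 0 := by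
  have hk := ((vLabel_iff hs hMs).1 hme).1
  rw [← wk_kIdx q m e, rhoW_wk hq hq2 _ hk, ← wk_kIdx]
  have : (∀ i : Fin (s + n * (r + 1)), s + n * r ≤ (i : ℕ) → m i = mVac n M s i) ↔
      ∀ i : Fin (s + n * (r + 1)), s + n * r ≤ (i : ℕ) → kIdx m e i = M - i := by
    rw [tail_iff hMs hk]
    refine forall₂_congr fun i hi => ?_
    rw [kIdx, mOf_uIndex, mVac_eq hs hMs, mOf_tail hMs hi (i.2.trans_eq (succ_len n s r))]
  simp only [this]
  rfl

include hs hMs in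
theorem IsProjection.eq_rhoW {r : ℕ} {ρ : VM q n M s (r + 1) →ₗ[ℂ] VM q n M s r}
    (hρ : IsProjection q n M s r ρ) (w : VM q n M s (r + 1)) :
    (ρ w : Wedge q n (s + n * r)) = rhoW hq hq2 n M (len_le n s r) w := by
  obtain ⟨w, hw⟩ := w
  refine Submodule.span_induction (p := fun x hx => (ρ ⟨x, hx⟩ : Wedge q n (s + n * r)) =
    rhoW hq hq2 n M (len_le n s r) x) ?_ ?_ ?_ ?_ hw
  · rintro x ⟨m, e, hme, rfl⟩
    rw [hρ m e hme _ rfl, rhoW_wedgeMon hs hMs hq hq2 hme]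
  · rw [map_zero]; exact map_zero ρ ▸ rfl
  · intro x y hx hy h1 h2
    rw [map_add, ← h1, ← h2, ← Submodule.coe_add, ← map_add]; rfl
  · intro c x hx h1
    rw [map_smul, ← h1, ← Submodule.coe_smul, ← map_smul]; rfl

include hs hMs in
theorem rhoW_mem_VM {r : ℕ} (w : Wedge q n (s + n * (r + 1))) :
    rhoW hq hq2 n M (len_le n s r) w ∈ VM q n M s r := by
  classical
  have hl := succ_len n s r
  have hn := Nat.pos_of_ne_zero (NeZero.ne n)
  have hw : w ∈ Submodule.span ℂ (Set.range fun k : SLabel (s + n * (r + 1)) => wk q n k.1) := by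
    rw [span_wk hq hq2]; trivial
  have := Submodule.mem_map_of_mem (f := rhoW hq hq2 n M (len_le n s r)) hw
  rw [Submodule.map_span] at this
  refine Submodule.span_le.2 ?_ this
  rintro _ ⟨_, ⟨k, rfl⟩, rfl⟩
  dsimp only
  rw [rhoW_wk hq hq2 _ k.2]
  split_ifs with h
  · rw [VM_eq_wk hs hMs hq hq2]
    refine Submodule.subset_span ⟨_, strictAnti_comp_castLE _ k.2, fun i => ?_, rfl⟩
    have h1 := h ⟨s + n * r, by omega⟩ le_rfl
    rw [← h1]
    exact k.2 (by rw [Fin.lt_def]; exact i.2)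
  · exact Submodule.zero_mem _

include hs hMs hq hq2 in
theorem existsUnique_projection (r : ℕ) :
    ∃! ρ : VM q n M s (r + 1) →ₗ[ℂ] VM q n M s r, IsProjection q n M s r ρ := by
  refine ⟨((rhoW hq hq2 n M (len_le n s r)).domRestrict _).codRestrict (VM q n M s r)
    fun w => rhoW_mem_VM hs hMs hq hq2 _, ?_, fun ρ hρ => LinearMap.ext fun w => Subtype.ext ?_⟩
  · intro m e hme w hw
    change rhoW hq hq2 n M (len_le n s r) w = _
    rw [hw, rhoW_wedgeMon hs hMs hq hq2 hme]
  · rw [hρ.eq_rhoW hs hMs hq hq2]; rfl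

/-! #### Wedges without vacuum tail -/

variable (q n M s) in
/-- The span of the wedges in `V_M^{s+n(r+1)}` without vacuum tail. -/
abbrev Low (r : ℕ) : Submodule ℂ (Wedge q n (s + n * (r + 1))) :=
  wSpan q n (lowSet _ (vacC n M s (r + 1)) n)

theorem cnt_tail {r : ℕ} {C : ℤ} {m : Fin (s + n * (r + 1)) → ℤ}
    (h : ∀ i : Fin (s + n * (r + 1)), s + n * r ≤ (i : ℕ) → m i = C) : n ≤ cnt C m := by
  rw [cnt, sum_univ_split (succ_len n s r)]
  refine le_trans ?_ (Nat.le_add_left _ _)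
  rw [Finset.sum_congr rfl fun j _ => if_pos (h _ (by simp))]
  simp

include hMs hq hq2 in
theorem rhoW_low {r : ℕ} {w : Wedge q n (s + n * (r + 1))} (hw : w ∈ Low n q M s r) :
    rhoW hq hq2 n M (len_le n s r) w = 0 := by
  rw [Low, wSpan_eq hq hq2 (closedExp_lowSet _ _ _)] at hw
  refine map_eq_of_span (A := rhoW hq hq2 n M (len_le n s r)) (B := 0) ?_ hw
  rintro _ ⟨k, hk, hkP, rfl⟩
  rw [rhoW_wk hq hq2 _ hk, if_neg, LinearMap.zero_apply]
  intro h
  exact absurd (cnt_tail ((tail_iff hMs hk).1 h)) (not_le.2 hkP.2)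

include hs hMs in
theorem sub_extW_rhoW {r : ℕ} {w : Wedge q n (s + n * (r + 1))} (hw : w ∈ VM q n M s (r + 1)) :
    w - extW hq hq2 n M (len_le n s r) (rhoW hq hq2 n M (len_le n s r) w) ∈ Low n q M s r := by
  classical
  rw [VM_eq_wk hs hMs hq hq2] at hw
  have := Submodule.mem_map_of_mem (f := LinearMap.id - extW hq hq2 n M (len_le n s r) ∘ₗ
    rhoW hq hq2 n M (len_le n s r)) hw
  rw [Submodule.map_span] at this
  refine Submodule.span_le.2 ?_ this
  rintro _ ⟨_, ⟨k, hk, hkM, rfl⟩, rfl⟩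
  simp only [LinearMap.sub_apply, LinearMap.id_apply, LinearMap.comp_apply]
  rw [rhoW_wk hq hq2 _ hk]
  split_ifs with h
  · rw [extW_wk, extK, extTuple_of_comp _ h, sub_self]
    exact Submodule.zero_mem _
  · rw [map_zero, sub_zero]
    refine Submodule.subset_span ⟨_, _, ⟨fun i => (mOf_le_vacC hMs).2 (hkM i), ?_⟩, rfl⟩
    rw [tail_iff hMs hk] at h
    push Not at h
    obtain ⟨i, hi, hne⟩ := h
    have hlt := lt_of_le_of_ne ((mOf_le_vacC hMs).2 (hkM i)) hne
    have hi2 := i.2.trans_eq (succ_len n s r)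
    rw [cnt, sum_univ_split (succ_len n s r), Finset.sum_eq_zero, zero_add]
    · calc _ < ∑ j : Fin n, 1 := by
            refine Finset.sum_lt_sum (fun j _ => by split_ifs <;> simp)
              ⟨⟨i - (s + n * r), by omega⟩, Finset.mem_univ _, ?_⟩
            rw [if_neg]
            · simp
            · have : (⟨s + n * r + (i - (s + n * r)), by omega⟩ : Fin (s + n * (r + 1))) = i :=
                Fin.ext (by dsimp only; omega)
              dsimp only
              rw [this]
              exact hlt.ne
        _ = n := by simp
    · intro j _
      rw [if_neg]
      refine ((mOf_monotone (n := n) hk (show Fin.castLE (len_le n s r) j ≤ i from ?_)).trans_lt hlt).ne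
      have := j.2
      rw [Fin.le_def, Fin.val_castLE]
      omega

end projection

/-! ### Semi-infinite labels -/

section siLabels

variable {n : ℕ} [NeZero n] {q : ℂ} {M : ℤ} {s : ℕ} (hs : s < n) (hMs : M ≡ s [ZMOD n])
  (hq : q ≠ 0) (hq2 : q + q⁻¹ ≠ 0)

/-- The first `N` entries of a semi-infinite label. -/
def cut (K : SIMon M) (N : ℕ) : Fin N → ℤ := fun i => K.1 i

theorem appendVac_cut {K : SIMon M} {N : ℕ} (h : ∀ i, N ≤ i → K.1 i = M - i) :
    appendVac M (cut K N) = K := by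
  refine Subtype.ext (funext fun i => ?_)
  simp only [appendVac, cut]
  split_ifs with hi
  · rfl
  · exact (h i (not_lt.1 hi)).symm

theorem cut_appendVac {N : ℕ} (k : Fin N → ℤ) : cut (appendVac M k) N = k := by
  funext i
  simp [cut, appendVac]

theorem extK_cut {K : SIMon M} {N N' : ℕ} (h : ∀ i, N ≤ i → K.1 i = M - i) :
    extK M N' (cut K N) = cut K N' := by
  funext i
  simp only [extK, extTuple, cut]
  split_ifs with hi
  · rfl
  · exact (h i (not_lt.1 hi)).symm

theorem strictAnti_cut {K : SIMon M} (hK : StrictAnti K.1) (N : ℕ) : StrictAnti (cut K N) :=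
  fun _ _ h => hK (by rwa [Fin.lt_def] at h)

theorem cut_gt {K : SIMon M} (hK : StrictAnti K.1) {N : ℕ} (h : ∀ i, N ≤ i → K.1 i = M - i)
    (i : Fin N) : M - N < cut K N i := by
  rw [← h N le_rfl]
  exact hK i.2

theorem strictAnti_appendVac {N : ℕ} {k : Fin N → ℤ} (hk : StrictAnti k) (hkM : ∀ i, M - N < k i) :
    StrictAnti (appendVac M k).1 := by
  intro i j hij
  simp only [appendVac]
  split_ifs with h1 h2 h2
  · exact hk (by rwa [Fin.lt_def])
  · omega
  · have := hkM ⟨i, h2⟩; omega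
  · omega

include hs hMs in
theorem siDegree_eq {K : SIMon M} {N : ℕ} (h : ∀ i, N ≤ i → K.1 i = M - i) :
    siDegree n s K = ∑ i : Fin N, (mVac n M s i - mOf n (cut K N i)) := by
  rw [siDegree, finsum_eq_sum_of_support_subset (s := Finset.range N), Finset.sum_range]
  · rfl
  · intro i hi
    by_contra hi'
    simp only [Finset.coe_range, Set.mem_Iio, not_lt] at hi'
    exact hi (by dsimp only; rw [h i hi', mVac_eq hs hMs, sub_self])

theorem vac_le {K : SIMon M} (hK : StrictAnti K.1) (i : ℕ) : M - i ≤ K.1 i := by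
  obtain ⟨L, hL⟩ := K.2
  have h1 := le_of_lt_vac (strictAnti_cut hK (max L (i + 1)))
    (cut_gt hK fun j hj => hL j ((le_max_left _ _).trans hj)) ⟨i, by omega⟩
  exact h1

include hs hMs in
/-- A normally ordered label of degree at most `r` has a vacuum tail from the position `s+nr` on. -/
theorem vac_of_degree {K : SIMon M} (hK : StrictAnti K.1) {r : ℕ} (h : siDegree n s K ≤ r) (i : ℕ)
    (hi : s + n * r ≤ i) : K.1 i = M - i := by
  have hn := Nat.pos_of_ne_zero (NeZero.ne n)
  have hanti : ∀ a b : ℕ, a ≤ b → K.1 b + ((b : ℤ) - a) ≤ K.1 a := fun a b hab =>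
    strictAnti_add_le (strictAnti_cut hK (b + 1)) (i := ⟨a, by omega⟩) (j := ⟨b, by omega⟩) hab
  have key : K.1 (s + n * r) = M - (s + n * r : ℕ) := by
    by_contra hne
    have h0 := vac_le hK (s + n * r)
    obtain ⟨L, hL⟩ := K.2
    have hL' : ∀ i, max L (s + n * r + 1) ≤ i → K.1 i = M - i := fun j hj => hL j (by omega)
    rw [siDegree_eq hs hMs hL'] at h
    set N := max L (s + n * r + 1) with hN
    let ι : Fin (r + 1) ↪ Fin N := ⟨fun j => ⟨s + n * j, by
        have := Nat.mul_le_mul_left n (show (j : ℕ) ≤ r by omega)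
        omega⟩, fun a b hab => Fin.ext (Nat.eq_of_mul_eq_mul_left hn (by
          simpa using congrArg Fin.val hab))⟩
    have hnn : ∀ i : Fin N, 0 ≤ mVac n M s i - mOf n (cut K N i) := by
      intro i
      rw [mVac_eq hs hMs, sub_nonneg]
      exact mOf_antitone hn (vac_le hK i)
    have h1 : ∑ j : Fin (r + 1), (mVac n M s (ι j) - mOf n (cut K N (ι j))) ≤
        ∑ i : Fin N, (mVac n M s i - mOf n (cut K N i)) := by
      rw [← Finset.sum_map Finset.univ ι fun i => mVac n M s i - mOf n (cut K N i)]
      exact Finset.sum_le_sum_of_subset_of_nonneg (Finset.subset_univ _) fun i _ _ => hnn i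
    have h2 : ∑ j : Fin (r + 1), (1 : ℤ) ≤
        ∑ j : Fin (r + 1), (mVac n M s (ι j) - mOf n (cut K N (ι j))) := by
      refine Finset.sum_le_sum fun j _ => ?_
      have e : ((ι j : Fin N) : ℕ) = s + n * j := rfl
      have hj := Nat.mul_le_mul_left n (show (j : ℕ) ≤ r by omega)
      have h3 := hanti (s + n * j) (s + n * r) (by omega)
      have h4 := (mOf_le_vacC (n := n) hMs (r := j) (k := K.1 (s + n * j))).2 (by omega)
      have h5 := vacC_succ (n := n) (M := M) (s := s) j
      rw [e, mVac_eq hs hMs, mOf_tail hMs le_rfl (by omega)]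
      simp only [cut, e]
      omega
    rw [Finset.sum_const, Finset.card_univ, Fintype.card_fin] at h2
    simp only [nsmul_eq_mul, mul_one] at h2
    push_cast at h2
    linarith
  have h1 := hanti _ _ hi
  have h2 := vac_le hK i
  omega

include hs hMs hq hq2 in
theorem low_inf_VMdeg {r t : ℕ} (ht : t ≤ r) {w : Wedge q n (s + n * (r + 1))}
    (h1 : w ∈ Low n q M s r) (h2 : w ∈ VMdeg q n M s (r + 1) t) : w = 0 := by
  rw [VMdeg_eq hs hMs hq hq2] at h2
  have h3 := wSpan_inf hq hq2 (closedExp_lowSet _ _ _) (closedExp_degSet _ _) h1 h2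
  rw [wSpan_eq hq hq2] at h3
  · rw [← Submodule.mem_bot ℂ, ← Submodule.span_empty (R := ℂ)]
    refine Submodule.span_mono ?_ h3
    rintro _ ⟨k, hk, ⟨hk1, hk2⟩, -⟩
    have hkM : ∀ i, M - (s + n * (r + 1) : ℕ) < k i := fun i => (mOf_le_vacC hMs).1 (hk1.1 i)
    have hK := strictAnti_appendVac hk hkM
    have hd := siDegree_eq (n := n) hs hMs (K := appendVac M k) (N := s + n * (r + 1)) (fun i hi => by
      simp [appendVac, Nat.not_lt.2 hi])
    rw [cut_appendVac, hk2.2] at hd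
    have h4 := fun i => vac_of_degree hs hMs hK (r := r) (by rw [hd]; exact_mod_cast ht) i
    have h5 : ∀ i : Fin (s + n * (r + 1)), s + n * r ≤ (i : ℕ) → k i = M - i := by
      intro i hi
      rw [← h4 i hi, ← congrFun (cut_appendVac (M := M) k) i]
      rfl
    exact absurd (cnt_tail ((tail_iff hMs hk).1 h5)) (not_le.2 hk1.2)
  · intro m hm i j hij
    exact ⟨⟨(closedExp_lowSet _ _ _ m hm.1 i j hij).1, (closedExp_degSet _ _ m hm.2 i j hij).1⟩,
      fun ν hν => ⟨(closedExp_lowSet _ _ _ m hm.1 i j hij).2 ν hν,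
        (closedExp_degSet _ _ m hm.2 i j hij).2 ν hν⟩⟩

end siLabels

/-! ### The Fock space -/

section fock

variable {n : ℕ} [NeZero n] {q : ℂ} {M : ℤ} {s : ℕ} (hs : s < n) (hMs : M ≡ s [ZMOD n])
  (hq : q ≠ 0) (hq2 : q + q⁻¹ ≠ 0)

theorem appendVac_injective (N : ℕ) :
    Function.Injective (appendVac M : (Fin N → ℤ) → SIMon M) := fun k k' h => by
  rw [← cut_appendVac (M := M) k, h, cut_appendVac]

theorem tensVac_injective (N : ℕ) : Function.Injective (tensVac n M N) := by
  have h : tensVac n M N = Finsupp.lmapDomain ℂ ℂ (fun me : (Fin N → ℤ) × (Fin N → Fin n) =>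
      appendVac M (kIdx me.1 me.2)) ∘ₗ (tensBasis n N).repr.toLinearMap := by
    refine (tensBasis n N).ext fun me => ?_
    simp [tensVac, Module.Basis.constr_basis]
    rfl
  rw [h]
  refine (Finsupp.mapDomain_injective fun me me' h => ?_).comp (tensBasis n N).repr.injective
  have := kIdx_injective (appendVac_injective N h)
  exact Prod.ext this.1 this.2

include hq hq2 in
theorem exists_extW_eq_zero {N : ℕ} {w : Wedge q n N} (hw : wedgeVac q n M N w = 0) :
    ∃ (N' : ℕ) (h : N ≤ N'), extW hq hq2 n M h w = 0 := by
  obtain ⟨t, rfl⟩ := (omega q n N).mkQ_surjective w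
  have h1 : tensVac n M N t ∈ ⨆ N : ℕ, (omega q n N).map (tensVac n M N) := by
    rw [← Submodule.Quotient.mk_eq_zero]; exact hw
  have hmono : Monotone fun N : ℕ => (omega q n N).map (tensVac n M N) := by
    rintro N N' h _ ⟨t, ht, rfl⟩
    exact ⟨_, omega_le_comap_extT hq hq2 h (fun i => mOf n (M - i)) (fun i => aOf n (M - i)) ht,
      tensVac_extT M h t⟩
  rw [Submodule.mem_iSup_of_directed _ hmono.directed_le] at h1
  obtain ⟨N1, h1⟩ := h1
  obtain ⟨t', ht', h2⟩ := hmono (le_max_right N N1) h1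
  refine ⟨max N N1, le_max_left _ _, ?_⟩
  change extW hq hq2 n M _ (wedgeMk q n N t) = 0
  rw [extW_wedgeMk, wedgeMk, Submodule.mkQ_apply, Submodule.Quotient.mk_eq_zero]
  have : t' = extT (max N N1) (fun i => mOf n (M - i)) (fun i => aOf n (M - i)) t :=
    tensVac_injective (M := M) (max N N1) (by rw [h2, tensVac_extT M (le_max_left N N1)])
  exact this ▸ ht'

include hs hMs hq hq2 in
theorem wedgeVac_eq_zero {r : ℕ} {w : Wedge q n (s + n * r)} (hw : w ∈ VM q n M s r)
    (h : wedgeVac q n M _ w = 0) : w = 0 := by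
  obtain ⟨N', h', h1⟩ := exists_extW_eq_zero hq hq2 h
  rw [← rhoW_extW hs hMs hq hq2 h' hw, h1, map_zero]

theorem siWedge_cut {K : SIMon M} {N : ℕ} (h : ∀ i, N ≤ i → K.1 i = M - i) :
    wedgeVac q n M N (wk q n (cut K N)) = siWedge q n K := by
  rw [wedgeVac_wk, appendVac_cut h]

theorem le_len (s r : ℕ) : r ≤ s + n * r :=
  (Nat.le_mul_of_pos_left r (Nat.pos_of_ne_zero (NeZero.ne n))).trans (Nat.le_add_left _ _)

/-- The labels of the normally ordered semi-infinite wedges. -/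
abbrev FLabel (M : ℤ) : Type := {K : SIMon M // StrictAnti K.1}

include hs hMs hq hq2 in
theorem linearIndependent_siWedge : LinearIndependent ℂ fun K : FLabel M => siWedge q n K.1 := by
  rw [linearIndependent_iff_finset_linearIndependent]
  intro S
  choose L hL using fun K : FLabel M => K.1.2
  set r := S.sup L
  have hr : ∀ K : S, ∀ i, s + n * r ≤ i → K.1.1.1 i = M - i := fun K i hi =>
    hL K i ((Finset.le_sup (f := L) K.2).trans ((le_len s r).trans hi))
  let f : S → SLabel (s + n * r) := fun K => ⟨cut K.1.1 _, strictAnti_cut K.1.2 _⟩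
  have hf : Function.Injective f := fun K K' h => by
    refine Subtype.ext (Subtype.ext ?_)
    rw [← appendVac_cut (hr K), ← appendVac_cut (hr K')]
    exact congrArg (fun k : SLabel (s + n * r) => appendVac M k.1) h
  have h1 := (linearIndependent_wk (n := n) hq hq2).comp f hf
  have h2 := h1.map (f := wedgeVac q n M (s + n * r)) (by
    rw [Submodule.disjoint_def]
    intro x hx hx'
    refine wedgeVac_eq_zero hs hMs hq hq2 ?_ hx'
    rw [VM_eq_wk hs hMs hq hq2]
    refine Submodule.span_mono ?_ hx
    rintro _ ⟨K, rfl⟩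
    exact ⟨_, strictAnti_cut K.1.2 _, cut_gt K.1.2 (hr K), rfl⟩)
  have e : (fun K : FLabel M => siWedge q n K.1) ∘ Subtype.val =
      wedgeVac q n M (s + n * r) ∘ (fun k => wk q n k.1) ∘ f := funext fun K => (siWedge_cut (hr K)).symm
  exact e ▸ h2

include hs hMs hq hq2 in
theorem span_siWedge : Submodule.span ℂ (Set.range fun K : FLabel M => siWedge q n K.1) = ⊤ := by
  rw [eq_top_iff]
  rintro x -
  obtain ⟨f, rfl⟩ := Submodule.mkQ_surjective _ x
  induction f using Finsupp.induction_linear with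
  | zero => rw [map_zero]; exact Submodule.zero_mem _
  | add f g hf hg => rw [map_add]; exact Submodule.add_mem _ hf hg
  | single K a =>
    rw [← mul_one a, ← smul_eq_mul, ← Finsupp.smul_single, map_smul]
    refine Submodule.smul_mem _ _ ?_
    change siWedge q n K ∈ _
    obtain ⟨L, hL⟩ := K.2
    set r := L + ∑ i ∈ Finset.range L, ((M - K.1 i).toNat + 1)
    have hr := le_len (n := n) s r
    have h1 : ∀ i, s + n * r ≤ i → K.1 i = M - i := fun i hi => hL i (by omega)
    rw [← siWedge_cut h1]
    have h2 : wk q n (cut K (s + n * r)) ∈ VM q n M s r := by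
      rw [VM_eq hs hMs hq hq2]
      refine Submodule.subset_span ⟨_, _, fun i => ?_, rfl⟩
      rw [mOf_le_vacC hMs, cut]
      by_cases hi : (i : ℕ) < L
      · have := Finset.single_le_sum (f := fun i => (M - K.1 i).toNat + 1) (fun _ _ => Nat.zero_le _)
          (Finset.mem_range.2 hi)
        omega
      · rw [hL i (not_lt.1 hi)]
        have := i.2
        omega
    rw [VM_eq_wk hs hMs hq hq2] at h2
    have h3 := Submodule.mem_map_of_mem (f := wedgeVac q n M (s + n * r)) h2
    rw [Submodule.map_span] at h3
    refine Submodule.span_mono ?_ h3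
    rintro _ ⟨_, ⟨k, hk, hkM, rfl⟩, rfl⟩
    exact ⟨⟨_, strictAnti_appendVac hk hkM⟩, (wedgeVac_wk M k).symm⟩

/-- The basis of the normally ordered semi-infinite wedges. -/
def fockBasis : Module.Basis (FLabel M) ℂ (Fock q n M) :=
  Module.Basis.mk (linearIndependent_siWedge hs hMs hq hq2) (span_siWedge hs hMs hq hq2).ge

theorem fockBasis_apply (K : FLabel M) : fockBasis hs hMs hq hq2 K = siWedge q n K.1 := by
  rw [fockBasis, Module.Basis.mk_apply]

theorem fockDeg_eq_span (t : ℕ) : fockDeg q n M s t =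
    Submodule.span ℂ ((fun K : FLabel M => siWedge q n K.1) '' {K | siDegree n s K.1 = t}) := by
  rw [fockDeg]
  congr 1
  ext w
  constructor
  · rintro ⟨K, hK, hKt, rfl⟩; exact ⟨⟨K, hK⟩, hKt, rfl⟩
  · rintro ⟨K, hKt, rfl⟩; exact ⟨K.1, K.2, hKt, rfl⟩

include hs hMs in
theorem siDegree_nonneg {K : SIMon M} (hK : StrictAnti K.1) : 0 ≤ siDegree n s K := by
  obtain ⟨L, hL⟩ := K.2
  rw [siDegree_eq hs hMs hL]
  refine Finset.sum_nonneg fun i _ => ?_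
  rw [mVac_eq hs hMs, sub_nonneg]
  exact mOf_antitone (Nat.pos_of_ne_zero (NeZero.ne n)) (vac_le hK i)

include hs hMs hq hq2 in
theorem isInternal_fockDeg : DirectSum.IsInternal fun t : ℕ => fockDeg q n M s t := by
  refine DirectSum.isInternal_submodule_of_iSupIndep_of_iSup_eq_top ?_ ?_
  · intro t
    have h1 : ⨆ (t' : ℕ) (_ : t' ≠ t), fockDeg q n M s t' ≤ Submodule.span ℂ
        ((fun K : FLabel M => siWedge q n K.1) '' {K | siDegree n s K.1 ≠ t}) := by
      refine iSup₂_le fun t' ht' => ?_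
      rw [fockDeg_eq_span]
      refine Submodule.span_mono (Set.image_mono fun K hK => ?_)
      have hK' : siDegree n s K.1 = t' := hK
      change siDegree n s K.1 ≠ t
      rw [hK']
      exact_mod_cast ht'
    have h2 : Disjoint (fockDeg q n M s t) (Submodule.span ℂ
        ((fun K : FLabel M => siWedge q n K.1) '' {K | siDegree n s K.1 ≠ t})) := by
      rw [fockDeg_eq_span]
      exact (linearIndependent_siWedge hs hMs hq hq2).disjoint_span_image
        (Set.disjoint_left.2 fun K h h' => h' h)
    exact h2.mono_right h1
  · rw [eq_top_iff, ← span_siWedge hs hMs hq hq2, Submodule.span_le]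
    rintro _ ⟨K, rfl⟩
    refine Submodule.mem_iSup_of_mem (siDegree n s K.1).toNat (Submodule.subset_span ⟨K.1, K.2, ?_, rfl⟩)
    exact (Int.toNat_of_nonneg (siDegree_nonneg hs hMs K.2)).symm

include hs hMs hq hq2 in
theorem wedgeVac_mem_fockDeg {r t : ℕ} {w : Wedge q n (s + n * r)} (hw : w ∈ VMdeg q n M s r t) :
    wedgeVac q n M _ w ∈ fockDeg q n M s t := by
  rw [VMdeg_eq_wk hs hMs hq hq2] at hw
  have h3 := Submodule.mem_map_of_mem (f := wedgeVac q n M (s + n * r)) hw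
  rw [Submodule.map_span] at h3
  refine Submodule.span_mono ?_ h3
  rintro _ ⟨_, ⟨k, hk, hkM, hkt, rfl⟩, rfl⟩
  refine ⟨_, strictAnti_appendVac hk hkM, ?_, wedgeVac_wk M k⟩
  rw [← hkt, siDegree_eq hs hMs (N := s + n * r) fun i hi => by simp [appendVac, Nat.not_lt.2 hi]]
  rw [cut_appendVac]

include hs hMs hq hq2 in
theorem wk_cut_mem {K : SIMon M} (hK : StrictAnti K.1) {r t : ℕ} (ht : siDegree n s K = t)
    (h : ∀ i, s + n * r ≤ i → K.1 i = M - i) : wk q n (cut K (s + n * r)) ∈ VMdeg q n M s r t := by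
  rw [VMdeg_eq_wk hs hMs hq hq2]
  refine Submodule.subset_span ⟨_, strictAnti_cut hK _, cut_gt hK h, ?_, rfl⟩
  rw [← ht, siDegree_eq hs hMs h]

include hs hMs hq hq2 in
theorem map_wedgeVac {r t : ℕ} (htr : t ≤ r) :
    (VMdeg q n M s r t).map (wedgeVac q n M (s + n * r)) = fockDeg q n M s t := by
  refine le_antisymm ?_ (Submodule.span_le.2 ?_)
  · rintro _ ⟨w, hw, rfl⟩
    exact wedgeVac_mem_fockDeg hs hMs hq hq2 hw
  · rintro _ ⟨K, hK, ht, rfl⟩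
    have h := vac_of_degree hs hMs hK (r := r) (by rw [ht]; exact_mod_cast htr)
    exact ⟨_, wk_cut_mem hs hMs hq hq2 hK ht h, siWedge_cut h⟩

/-! ### The projective limit -/

section limit

variable {ρ : ∀ r, VM q n M s (r + 1) →ₗ[ℂ] VM q n M s r} (hρ : ∀ r, IsProjection q n M s r (ρ r))

include hs hMs hq hq2 hρ in
theorem invLim_succ {t r : ℕ} (f : invLim q n M s ρ t) (htr : t ≤ r) :
    ((f : ∀ r, VM q n M s r) (r + 1) : Wedge q n _) =
      extW hq hq2 n M (len_le n s r) ((f : ∀ r, VM q n M s r) r) := by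
  have h1 := ((f.2 r).2)
  have h2 := sub_extW_rhoW hs hMs hq hq2 ((f : ∀ r, VM q n M s r) (r + 1)).2
  rw [← (hρ r).eq_rhoW hs hMs hq hq2, h1] at h2
  exact sub_eq_zero.1 (low_inf_VMdeg hs hMs hq hq2 htr h2
    (Submodule.sub_mem _ (f.2 (r + 1)).1 (extW_mem_VMdeg hs hMs hq hq2 (f.2 r).1)))

include hs hMs hq hq2 hρ in
theorem invLim_wedgeVac {t r : ℕ} (f : invLim q n M s ρ t) (htr : t ≤ r) :
    wedgeVac q n M _ ((f : ∀ r, VM q n M s r) r : Wedge q n (s + n * r)) =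
      wedgeVac q n M _ ((f : ∀ r, VM q n M s r) t : Wedge q n (s + n * t)) := by
  induction r, htr using Nat.le_induction with
  | base => rfl
  | succ r hr ih => rw [invLim_succ hs hMs hq hq2 hρ f hr, wedgeVac_extW, ih]

open scoped Classical in
include hs hMs hq hq2 hρ in
theorem exists_invLim_siWedge {K : SIMon M} (hK : StrictAnti K.1) {t : ℕ} (ht : siDegree n s K = t) :
    ∃ f : invLim q n M s ρ t, wedgeVac q n M _ ((f : ∀ r, VM q n M s r) t : Wedge q n (s + n * t)) =
      siWedge q n K := by
  have hmem : ∀ r, (if ∀ i, s + n * r ≤ i → K.1 i = M - i then wk q n (cut K (s + n * r)) else 0) ∈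
      VMdeg q n M s r t := by
    intro r
    split_ifs with h
    · exact wk_cut_mem hs hMs hq hq2 hK ht h
    · exact Submodule.zero_mem _
  refine ⟨⟨fun r => ⟨_, VMdeg_le r t (hmem r)⟩, fun r => ⟨hmem r, Subtype.ext ?_⟩⟩, ?_⟩
  · rw [(hρ r).eq_rhoW hs hMs hq hq2]
    have hl := len_le n s r
    dsimp only
    split_ifs with h1 h2 h2
    · rw [rhoW_wk hq hq2 _ (strictAnti_cut hK _), if_pos]
      · rfl
      · exact fun i hi => h2 i hi
    · rw [rhoW_wk hq hq2 _ (strictAnti_cut hK _), if_neg]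
      refine fun h3 => h2 fun i hi => ?_
      by_cases hi' : i < s + n * (r + 1)
      · exact h3 ⟨i, hi'⟩ hi
      · exact h1 i (not_lt.1 hi')
    · exact absurd (fun i hi => h2 i (hl.trans hi)) h1
    · exact map_zero _
  · have h := vac_of_degree hs hMs hK (r := t) (by rw [ht])
    dsimp only
    rw [if_pos h, siWedge_cut h]

include hs hMs hq hq2 hρ in
theorem exists_invLim_equiv (t : ℕ) : ∃ e : invLim q n M s ρ t ≃ₗ[ℂ] fockDeg q n M s t,
    ∀ (f : invLim q n M s ρ t) (r : ℕ), t ≤ r → ((e f : fockDeg q n M s t) : Fock q n M) =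
      wedgeVac q n M (s + n * r) ((f : ∀ r, VM q n M s r) r) := by
  let E : invLim q n M s ρ t →ₗ[ℂ] fockDeg q n M s t :=
    { toFun := fun f => ⟨_, wedgeVac_mem_fockDeg hs hMs hq hq2 (f.2 t).1⟩
      map_add' := fun f g => Subtype.ext (map_add (wedgeVac q n M (s + n * t)) _ _)
      map_smul' := fun c f => Subtype.ext (map_smul (wedgeVac q n M (s + n * t)) _ _) }
  have hE : ∀ f, ((E f : fockDeg q n M s t) : Fock q n M) =
      wedgeVac q n M (s + n * t) ((f : ∀ r, VM q n M s r) t) := fun f => rfl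
  have hinj : Function.Injective E := by
    intro f g hfg
    have h0 : ∀ r, t ≤ r → (f : ∀ r, VM q n M s r) r = (g : ∀ r, VM q n M s r) r := fun r hr => by
      refine Subtype.ext (sub_eq_zero.1 (wedgeVac_eq_zero hs hMs hq hq2
        (Submodule.sub_mem _ (Subtype.prop _) (Subtype.prop _)) ?_))
      rw [map_sub, invLim_wedgeVac hs hMs hq hq2 hρ f hr, invLim_wedgeVac hs hMs hq hq2 hρ g hr, ← hE,
        ← hE, hfg, sub_self]
    have h1 : ∀ d r, t ≤ r + d → (f : ∀ r, VM q n M s r) r = (g : ∀ r, VM q n M s r) r := by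
      intro d
      induction d with
      | zero => exact h0
      | succ d ih =>
        intro r hr
        rw [← (f.2 r).2, ← (g.2 r).2, ih (r + 1) (by omega)]
    exact Subtype.ext (funext fun r => h1 t r (by omega))
  have hsurj : Function.Surjective E := by
    rw [← LinearMap.range_eq_top, eq_top_iff]
    rintro ⟨w, hw⟩ -
    have : fockDeg q n M s t ≤ (LinearMap.range E).map (fockDeg q n M s t).subtype := by
      refine Submodule.span_le.2 ?_
      rintro _ ⟨K, hK, ht, rfl⟩
      obtain ⟨f, hf⟩ := exists_invLim_siWedge hs hMs hq hq2 hρ hK ht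
      exact ⟨E f, ⟨f, rfl⟩, hf⟩
    obtain ⟨w', hw', h⟩ := this hw
    have : w' = ⟨w, hw⟩ := Subtype.ext h
    exact this ▸ hw'
  refine ⟨LinearEquiv.ofBijective E ⟨hinj, hsurj⟩, fun f r hr => ?_⟩
  change ((E f : fockDeg q n M s t) : Fock q n M) = _
  rw [hE, invLim_wedgeVac hs hMs hq hq2 hρ f hr]

end limit

/-! ### Compatible families of operators -/

variable (M s) in
/-- Families of operators inducing operators on the projective limit. -/
structure Compat (T : ∀ r, Module.End ℂ (Wedge q n (s + n * r))) : Prop where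
  rel : ∀ r, WRel n (s + n * r) (s + n * (r + 1)) n q M (vacC n M s (r + 1)) hq hq2 (len_le n s r)
    (T (r + 1)) (T r)
  deg : ∀ r t, ∀ f ∈ VMdeg q n M s r t, T r f ∈ VMdeg q n M s r t

variable {hq hq2}
variable {T : ∀ r, Module.End ℂ (Wedge q n (s + n * r))} (hT : Compat M s hq hq2 T)

include hs hMs hT in
theorem Compat.mem {r : ℕ} {w : Wedge q n (s + n * r)} (hw : w ∈ VM q n M s r) : T r w ∈ VM q n M s r := by
  have := (hT.rel r).presB w
  rw [vacC_succ, ← VM_eq hs hMs hq hq2] at this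
  exact this hw

include hs hMs hT in
theorem Compat.sub_mem {r : ℕ} {w : Wedge q n (s + n * r)} (hw : w ∈ VM q n M s r) :
    T (r + 1) (extW hq hq2 n M (len_le n s r) w) - extW hq hq2 n M (len_le n s r) (T r w) ∈
      Low n q M s r := by
  have := (hT.rel r).rel w
  rw [vacC_succ, ← VM_eq hs hMs hq hq2] at this
  exact this hw

include hs hMs hT in
theorem Compat.extW {r t : ℕ} (htr : t ≤ r) {w : Wedge q n (s + n * r)} (hw : w ∈ VMdeg q n M s r t) :
    T (r + 1) (extW hq hq2 n M (len_le n s r) w) = LevelZero.extW hq hq2 n M (len_le n s r) (T r w) :=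
  sub_eq_zero.1 (low_inf_VMdeg hs hMs hq hq2 htr (hT.sub_mem hs hMs (VMdeg_le r t hw))
    (Submodule.sub_mem _ (hT.deg _ _ _ (extW_mem_VMdeg hs hMs hq hq2 hw))
      (extW_mem_VMdeg hs hMs hq hq2 (hT.deg _ _ _ hw))))

include hs hMs hT in
theorem Compat.rhoW {r : ℕ} {w : Wedge q n (s + n * (r + 1))} (hw : w ∈ VM q n M s (r + 1)) :
    rhoW hq hq2 n M (len_le n s r) (T (r + 1) w) = T r (LevelZero.rhoW hq hq2 n M (len_le n s r) w) := by
  have hR := rhoW_mem_VM hs hMs hq hq2 (r := r) w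
  have h1 := (hT.rel r).presL _ (sub_extW_rhoW hs hMs hq hq2 hw)
  have h2 := hT.sub_mem hs hMs hR
  have h3 := rhoW_low hMs hq hq2 (Submodule.add_mem _ h1 h2)
  rw [map_sub, sub_add_sub_cancel, map_sub, sub_eq_zero] at h3
  rw [h3, rhoW_extW hs hMs hq hq2 _ (hT.mem hs hMs hR)]

include hs hMs hT in
theorem Compat.exists_invLim {ρ : ∀ r, VM q n M s (r + 1) →ₗ[ℂ] VM q n M s r}
    (hρ : ∀ r, IsProjection q n M s r (ρ r)) {t : ℕ} (f : invLim q n M s ρ t) :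
    ∃ f' : invLim q n M s ρ t, ∀ r, ((f' : ∀ r, VM q n M s r) r : Wedge q n (s + n * r)) =
      T r ((f : ∀ r, VM q n M s r) r) := by
  refine ⟨⟨fun r => ⟨_, hT.mem hs hMs ((f : ∀ r, VM q n M s r) r).2⟩,
    fun r => ⟨hT.deg _ _ _ (f.2 r).1, Subtype.ext ?_⟩⟩, fun r => rfl⟩
  rw [(hρ r).eq_rhoW hs hMs hq hq2, hT.rhoW hs hMs (Subtype.prop _), ← (hρ r).eq_rhoW hs hMs hq hq2,
    (f.2 r).2]

/-- `X` is the operator on the Fock space induced by the family `T`. -/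
def IsLimit (M : ℤ) (s : ℕ) (T : ∀ r, Module.End ℂ (Wedge q n (s + n * r)))
    (X : Module.End ℂ (Fock q n M)) : Prop :=
  ∀ t r : ℕ, t ≤ r → ∀ f ∈ VMdeg q n M s r t,
    X (wedgeVac q n M (s + n * r) f) = wedgeVac q n M (s + n * r) (T r f)

include hs hMs hT in
theorem Compat.exists_isLimit : ∃ X, IsLimit M s T X := by
  let d : FLabel M → ℕ := fun K => (siDegree n s K.1).toNat
  have hd : ∀ K : FLabel M, siDegree n s K.1 = d K := fun K =>
    (Int.toNat_of_nonneg (siDegree_nonneg hs hMs K.2)).symm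
  have hvac : ∀ (K : FLabel M) (r : ℕ), d K ≤ r → ∀ i, s + n * r ≤ i → K.1.1 i = M - i :=
    fun K r hr => vac_of_degree hs hMs K.2 (by rw [hd]; exact_mod_cast hr)
  let X := (fockBasis hs hMs hq hq2).constr ℂ fun K =>
    wedgeVac q n M (s + n * d K) (T (d K) (wk q n (cut K.1 (s + n * d K))))
  have hX : ∀ K : FLabel M, X (siWedge q n K.1) =
      wedgeVac q n M (s + n * d K) (T (d K) (wk q n (cut K.1 (s + n * d K)))) := fun K => by
    rw [← fockBasis_apply hs hMs hq hq2, Module.Basis.constr_basis]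
  have key : ∀ (K : FLabel M) (r : ℕ), d K ≤ r →
      wedgeVac q n M (s + n * r) (T r (wk q n (cut K.1 (s + n * r)))) =
        wedgeVac q n M (s + n * d K) (T (d K) (wk q n (cut K.1 (s + n * d K)))) := by
    intro K r hr
    induction r, hr using Nat.le_induction with
    | base => rfl
    | succ r hr ih =>
      rw [← ih, ← extK_cut (hvac K r hr), ← extW_wk hq hq2 M (len_le n s r),
        hT.extW hs hMs hr (wk_cut_mem hs hMs hq hq2 K.2 (hd K) (hvac K r hr)), wedgeVac_extW]
  refine ⟨X, fun t r htr f hf => ?_⟩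
  rw [VMdeg_eq_wk hs hMs hq hq2] at hf
  refine map_eq_of_span (A := X ∘ₗ wedgeVac q n M (s + n * r)) (B := wedgeVac q n M (s + n * r) ∘ₗ T r)
    ?_ hf
  rintro _ ⟨k, hk, hkM, hkt, rfl⟩
  let K : FLabel M := ⟨_, strictAnti_appendVac hk hkM⟩
  have h1 : siDegree n s K.1 = t := by
    rw [← hkt, siDegree_eq hs hMs (N := s + n * r) fun i hi => by simp [K, appendVac, Nat.not_lt.2 hi]]
    rw [cut_appendVac]
  have h2 := key K r (by have := hd K; omega)
  rw [LinearMap.comp_apply, LinearMap.comp_apply, wedgeVac_wk]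
  rw [cut_appendVac] at h2
  rw [h2]
  exact hX K

variable (hq hq2) in
include hs hMs hq hq2 in
theorem fock_ext {W : Type*} [AddCommGroup W] [Module ℂ W] {X Y : Fock q n M →ₗ[ℂ] W}
    (h : ∀ t, ∀ f ∈ VMdeg q n M s t t, X (wedgeVac q n M (s + n * t) f) = Y (wedgeVac q n M (s + n * t) f)) :
    X = Y := by
  refine (fockBasis hs hMs hq hq2).ext fun K => ?_
  have hd := (Int.toNat_of_nonneg (siDegree_nonneg (n := n) hs hMs K.2)).symm
  have hv := vac_of_degree hs hMs K.2 hd.le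
  rw [fockBasis_apply, ← siWedge_cut hv]
  exact h _ _ (wk_cut_mem hs hMs hq hq2 K.2 hd hv)

variable (hq hq2) in
include hs hMs hq hq2 in
theorem IsLimit.unique {X Y : Module.End ℂ (Fock q n M)} (hX : IsLimit M s T X) (hY : IsLimit M s T Y) :
    X = Y :=
  fock_ext hs hMs hq hq2 fun t f hf => (hX t t le_rfl f hf).trans (hY t t le_rfl f hf).symm

theorem IsLimit.mul {T' : ∀ r, Module.End ℂ (Wedge q n (s + n * r))} {X X' : Module.End ℂ (Fock q n M)}
    (hX : IsLimit M s T X) (hX' : IsLimit M s T' X') (hT' : Compat M s hq hq2 T') :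
    IsLimit M s (fun r => T r * T' r) (X * X') := fun t r htr f hf => by
  rw [Module.End.mul_apply, hX' t r htr f hf, hX t r htr _ (hT'.deg _ _ _ hf), Module.End.mul_apply]

theorem IsLimit.add {T' : ∀ r, Module.End ℂ (Wedge q n (s + n * r))} {X X' : Module.End ℂ (Fock q n M)}
    (hX : IsLimit M s T X) (hX' : IsLimit M s T' X') :
    IsLimit M s (fun r => T r + T' r) (X + X') := fun t r htr f hf => by
  rw [LinearMap.add_apply, hX' t r htr f hf, hX t r htr f hf, LinearMap.add_apply, map_add]

theorem isLimit_algebraMap (c : ℂ) : IsLimit (q := q) (n := n) M s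
    (fun _ => algebraMap ℂ (Module.End ℂ (Wedge q n _)) c) (algebraMap ℂ _ c) :=
  fun t r _ f _ => by rw [Module.algebraMap_end_apply, Module.algebraMap_end_apply, map_smul]

include hs hMs in
theorem IsLimit.commute {T' : ∀ r, Module.End ℂ (Wedge q n (s + n * r))} {X X' : Module.End ℂ (Fock q n M)}
    (hX : IsLimit M s T X) (hX' : IsLimit M s T' X') (hT : Compat M s hq hq2 T)
    (hT' : Compat M s hq hq2 T') (h : ∀ r, Commute (T r) (T' r)) : Commute X X' := by
  have h1 := hX.mul hX' hT'
  have h2 := hX'.mul hX hT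
  have e : (fun r => T' r * T r) = fun r => T r * T' r := funext fun r => (h r).eq.symm
  rw [e] at h2
  exact h1.unique hs hMs hq hq2 h2

include hs hMs in
theorem IsLimit.mem_fockDeg {X : Module.End ℂ (Fock q n M)} (hX : IsLimit M s T X)
    (hT : Compat M s hq hq2 T) {t : ℕ} {w : Fock q n M} (hw : w ∈ fockDeg q n M s t) :
    X w ∈ fockDeg q n M s t := by
  rw [← map_wedgeVac hs hMs hq hq2 le_rfl] at hw
  obtain ⟨f, hf, rfl⟩ := hw
  rw [hX t t le_rfl f hf]
  exact wedgeVac_mem_fockDeg hs hMs hq hq2 (hT.deg _ _ _ hf)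

/-! ### The actions on the Fock space -/

variable {p : ℂ} (hn : 2 ≤ n) (hp : p ≠ 0) {π : ∀ N, Uq q n →ₐ[ℂ] Module.End ℂ (Wedge q n N)}
  (hπ : ∀ N, IsLevelZeroAction q p n N (π N))
  {H : ∀ N, NZ → Module.End ℂ (Wedge q n N)} (hH : ∀ N, IsHamiltonian q p n N (H N))

variable (hq hq2)

include hs hMs hn hp hπ in
theorem compat_levelZero (x : Uq q n) : Compat M s hq hq2 fun r => π (s + n * r) x :=
  ⟨fun r => wRel_levelZero hn hq hq2 hp (succ_len n s r) (len_le n s r)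
    (fun _ h1 h2 => mOf_tail hMs h1 h2) hπ x, fun r t f hf => by
      rw [VMdeg_eq hs hMs hq hq2] at hf ⊢
      exact levelZero_mem hq hπ hp (closedExp_degSet r t) x f hf⟩

include hs hMs in
theorem hVac_succ (r : ℕ) (l : ℤ) : hVac p q n M s (r + 1) l = hVac p q n M s r l +
    ∑ j : Fin n, p ^ (l * vacC n M s (r + 1)) * q ^ (-2 * l * (((s + n * r : ℕ) : ℤ) + j)) := by
  rw [hVac, hVac, succ_len, Finset.sum_range_add, Finset.sum_range (n := n)]
  congr 1
  refine Finset.sum_congr rfl fun j _ => ?_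
  rw [mVac_eq hs hMs, mOf_tail hMs (Nat.le_add_right _ _) (by have := j.2; omega)]
  push_cast
  rfl

theorem sub_smul_eq {V : Type*} [AddCommGroup V] [Module ℂ V] (x y : V) (a b : ℂ) :
    x - a • y = x + b • y + (-(a + b)) • y := by module

include hs hMs hp hH in
theorem compat_ham (l : NZ) : Compat M s hq hq2 fun r => gFin q p n M s H r l := by
  refine ⟨fun r => ?_, fun r t f hf => ?_⟩
  · have := (wRel_ham hq hq2 hp (succ_len n s r) (len_le n s r)
      (fun _ h1 h2 => mOf_tail hMs h1 h2) hH l).add (ExtRel.algebraMap (-hVac p q n M s (r + 1) l))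
    convert this using 1
    · exact (sub_eq_add_neg _ _).trans (congrArg _ (neg_smul _ _).symm)
    · rw [hVac_succ hs hMs]
      exact sub_smul_eq _ _ _ _
  · have h1 := hf
    rw [VMdeg_eq hs hMs hq hq2] at hf
    have h2 := ham_mem hq hH hp (closedExp_degSet r t) l f hf
    rw [← VMdeg_eq hs hMs hq hq2] at h2
    exact Submodule.sub_mem _ h2 (Submodule.smul_mem _ _ h1)

include hs hMs hq hq2 hn hp hπ in
theorem existsUnique_fockAction :
    ∃! Θ : Uq q n →ₐ[ℂ] Module.End ℂ (Fock q n M), IsFockAction q n M s π Θ := by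
  have hC := compat_levelZero hs hMs hq hq2 hn hp hπ
  choose X hX using fun x => (hC x).exists_isLimit hs hMs
  have hu := fun x {Y} (hY : IsLimit M s (fun r => π (s + n * r) x) Y) =>
    (hX x).unique hs hMs hq hq2 hY
  let Θ : Uq q n →ₐ[ℂ] Module.End ℂ (Fock q n M) :=
    { toFun := X
      map_one' := hu 1 (by simpa using isLimit_algebraMap (q := q) (n := n) (M := M) (s := s) 1)
      map_mul' := fun x y => hu _ (by simpa using (hX x).mul (hX y) (hC y))
      map_zero' := hu 0 (by simpa using isLimit_algebraMap (q := q) (n := n) (M := M) (s := s) 0)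
      map_add' := fun x y => hu _ (by simpa using (hX x).add (hX y))
      commutes' := fun c => hu _ (by simpa using isLimit_algebraMap (q := q) (n := n) (M := M) (s := s) c) }
  refine ⟨Θ, fun t r htr f hf x => hX x t r htr f hf, fun Θ' hΘ' => AlgHom.ext fun x => ?_⟩
  exact (hu x fun t r htr f hf => hΘ' t r htr f hf x).symm

include hs hMs hq hq2 hp hH in
theorem existsUnique_fockHamiltonian :
    ∃! G : NZ → Module.End ℂ (Fock q n M), IsFockHamiltonian q p n M s H G := by
  have hC := compat_ham hs hMs hq hq2 hp hH
  choose X hX using fun x => (hC x).exists_isLimit hs hMs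
  refine ⟨X, fun t r htr f hf l => hX l t r htr f hf, fun G' hG' => funext fun l => ?_⟩
  exact IsLimit.unique hs hMs hq hq2 (fun t r htr f hf => hG' t r htr f hf l) (hX l)

theorem commute_of_tens {N : ℕ} {X Y : Module.End ℂ (Wedge q n N)} {A B : Module.End ℂ (Tens n N)}
    (hX : ∀ f, X (wedgeMk q n N f) = wedgeMk q n N (A f))
    (hY : ∀ f, Y (wedgeMk q n N f) = wedgeMk q n N (B f)) (h : Commute A B) : Commute X Y :=
  wedge_end_ext fun t => by
    rw [Module.End.mul_apply, Module.End.mul_apply, hY, hX, hX, hY, ← Module.End.mul_apply, h.eq,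
      Module.End.mul_apply]

include hq hp in
theorem yOp_ham_comm {N : ℕ} (i : Fin N) (l : ℤ) :
    Commute (yOp q p i) (∑ j, endZPow (yOp q p j) l) :=
  Commute.sum_right _ _ _ fun j _ => commute_endZPow (yOp_comm hq hp i j) l

include hq hp in
theorem ham_genTens_comm {N : ℕ} (l : ℤ) (x : QGen n) :
    Commute (hamTens q p n N l) (genTens q p n N x) := by
  have hy := fun i : Fin N => (yOp_ham_comm hq hp i l)
  cases x with
  | K ε => exact polyOp_spinOp_comm _ _
  | Kinv ε => exact polyOp_spinOp_comm _ _
  | E ε =>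
    rw [genTens_E]
    refine Commute.sum_right _ _ _ fun i _ => Commute.mul_right (polyOp_comm ?_) (polyOp_spinOp_comm _ _)
    exact (commute_one_ite fun _ => (Commute.ringInverse_right' (hy i).symm).symm).symm
  | F ε =>
    rw [genTens_F]
    refine Commute.sum_right _ _ _ fun i _ => Commute.mul_right (polyOp_comm ?_) (polyOp_spinOp_comm _ _)
    exact (commute_one_ite fun _ => hy i).symm

include hq hp hH in
theorem ham_comm (N : ℕ) (l l' : NZ) : Commute (H N l) (H N l') := by
  refine commute_of_tens (hH N l) (hH N l') (polyOp_comm ?_)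
  refine Commute.sum_left _ _ _ fun i _ => ?_
  exact (commute_endZPow (yOp_ham_comm hq hp i _).symm l).symm

include hq hp hπ hH in
theorem ham_levelZero_comm (N : ℕ) (l : NZ) (x : Uq q n) : Commute (H N l) (π N x) := by
  refine uq_induction (P := fun x => Commute (H N l) (π N x)) (fun x => ?_) (fun c => ?_)
    (fun x y hx hy => ?_) (fun x y hx hy => ?_) x
  · exact commute_of_tens (hH N l) (hπ N x) (ham_genTens_comm hq hp l x)
  · rw [AlgHom.commutes]; exact (Algebra.commutes c _).symm
  · rw [map_add]; exact hx.add_right hy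
  · rw [map_mul]; exact hx.mul_right hy

theorem gFin_comm {r : ℕ} {l : NZ} {Y : Module.End ℂ (Wedge q n (s + n * r))}
    (h : Commute (H (s + n * r) l) Y) : Commute (gFin q p n M s H r l) Y :=
  h.sub_left ((Commute.one_left Y).smul_left _)

end fock

/-! ### The partial order on exponents -/

section order

variable {N : ℕ}

/-- `ν⁺ ≼ λ⁺`, expressed by means of the convex functions `x ↦ max (x - t) 0`. -/
def ConvLE (ν μ : Fin N → ℤ) : Prop :=
  ∑ i, ν i = ∑ i, μ i ∧ ∀ t : ℤ, ∑ i, max (ν i - t) 0 ≤ ∑ i, max (μ i - t) 0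

/-- A partial order on exponents that is contained in `MacLT`. -/
def TriLT (ν μ : Fin N → ℤ) : Prop :=
  ConvLE ν μ ∧ (sqSum ν < sqSum μ ∨
    sortDesc ν = sortDesc μ ∧ ∃ i, μ i < ν i ∧ ∀ j, i < j → ν j = μ j)

theorem sum_sortDesc (μ : Fin N → ℤ) (φ : ℤ → ℤ) : ∑ i, φ (sortDesc μ i) = ∑ i, φ (μ i) :=
  (Equiv.sum_comp (Fin.revPerm.trans (Tuple.sort μ)) fun i => φ (μ i))

theorem sum_eq_of_sortDesc {ν μ : Fin N → ℤ} (h : sortDesc ν = sortDesc μ) (φ : ℤ → ℤ) :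
    ∑ i, φ (ν i) = ∑ i, φ (μ i) := by
  rw [← sum_sortDesc ν, h, sum_sortDesc]

theorem sqSum_of_sortDesc {ν μ : Fin N → ℤ} (h : sortDesc ν = sortDesc μ) : sqSum ν = sqSum μ :=
  sum_eq_of_sortDesc h (· ^ 2)

theorem antitone_sortDesc (μ : Fin N → ℤ) : Antitone (sortDesc μ) := fun _ _ h =>
  Tuple.monotone_sort μ (Fin.rev_le_rev.2 h)

theorem sortDesc_comp (μ : Fin N → ℤ) (σ : Equiv.Perm (Fin N)) : sortDesc (μ ∘ σ) = sortDesc μ := by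
  funext i
  exact congrFun (Tuple.comp_perm_comp_sort_eq_comp_sort (f := μ) (σ := σ)) (Fin.rev i)

theorem TriLT.sqSum_le {ν μ : Fin N → ℤ} (h : TriLT ν μ) : sqSum ν ≤ sqSum μ :=
  h.2.elim le_of_lt fun h => (sqSum_of_sortDesc h.1).le

theorem TriLT.trans {ν μ κ : Fin N → ℤ} (h : TriLT ν μ) (h' : TriLT μ κ) : TriLT ν κ := by
  refine ⟨⟨h.1.1.trans h'.1.1, fun t => (h.1.2 t).trans (h'.1.2 t)⟩, ?_⟩
  rcases h.2 with h1 | ⟨h1, i, hi, hi'⟩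
  · exact Or.inl (h1.trans_le h'.sqSum_le)
  · rcases h'.2 with h2 | ⟨h2, j, hj, hj'⟩
    · exact Or.inl (h.sqSum_le.trans_lt h2)
    · refine Or.inr ⟨h1.trans h2, max i j, ?_, fun l hl => ?_⟩
      · rcases lt_trichotomy i j with hij | rfl | hij
        · rwa [max_eq_right hij.le, hi' j hij]
        · rw [max_self]; exact hj.trans hi
        · rwa [max_eq_left hij.le, ← hj' i hij]
      · rw [hi' l ((le_max_left _ _).trans_lt hl), hj' l ((le_max_right _ _).trans_lt hl)]

theorem TriLT.irrefl (μ : Fin N → ℤ) : ¬ TriLT μ μ := fun h =>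
  h.2.elim (lt_irrefl _) fun ⟨_, _, h, _⟩ => lt_irrefl _ h

theorem finite_triLT (μ : Fin N → ℤ) : {ν | TriLT ν μ}.Finite := by
  refine (Set.Finite.pi fun _ : Fin N => Set.finite_Icc (-sqSum μ) (sqSum μ)).subset fun ν hν i _ => ?_
  have h1 : ν i ^ 2 ≤ sqSum ν :=
    Finset.single_le_sum (f := fun i => ν i ^ 2) (fun _ _ => sq_nonneg _) (Finset.mem_univ i)
  have h2 := h1.trans hν.sqSum_le
  have h3 := Int.le_self_sq (ν i)
  have h4 := Int.le_self_sq (-ν i)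
  rw [neg_sq] at h4
  exact Set.mem_Icc.2 ⟨by linarith, by linarith⟩

theorem Inner.triLT {i j : Fin N} (hij : i ≠ j) {μ ν κ : Fin N → ℤ} (h : Inner i j μ ν)
    (hκ : κ = μ ∨ κ = μ ∘ Equiv.swap i j) : TriLT ν κ := by
  have hs : ∀ φ : ℤ → ℤ, ∑ l, φ (κ l) = ∑ l, φ (μ l) := fun φ => by
    rcases hκ with rfl | rfl
    · rfl
    · exact Equiv.sum_comp (Equiv.swap i j) fun l => φ (μ l)
  have h2 := h.2
  refine ⟨⟨?_, fun t => ?_⟩, Or.inl ((h.sqSum_lt hij).trans_le (hs (· ^ 2)).ge)⟩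
  · rw [hs fun x => x, h.sum_eq hij fun x => x, sum_pair_split hij]
    omega
  · rw [hs fun x => max (x - t) 0, h.sum_eq hij fun x => max (x - t) 0, sum_pair_split hij]
    omega

theorem triLT_swap {i j : Fin N} (hij : i < j) {μ : Fin N → ℤ} (h : μ j < μ i) :
    TriLT (μ ∘ Equiv.swap i j) μ := by
  refine ⟨⟨Equiv.sum_comp (Equiv.swap i j) μ, fun t =>
    (Equiv.sum_comp (Equiv.swap i j) fun l => max (μ l - t) 0).le⟩,
    Or.inr ⟨sortDesc_comp _ _, j, by simpa using h, fun l hl => ?_⟩⟩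
  rw [Function.comp_apply, Equiv.swap_apply_of_ne_of_ne (hij.trans hl).ne' hl.ne']

theorem TriLT.macLT {ν μ : Fin N → ℤ} (h : TriLT ν μ) : MacLT ν μ := by
  rcases h.2 with h2 | ⟨h2, i, hi, hi'⟩
  · refine Or.inl ⟨fun h' => h2.ne (sqSum_of_sortDesc h'), fun i => ?_, ?_⟩
    · set a := sortDesc ν
      set b := sortDesc μ
      have h3 := h.1.2 (b i)
      rw [← sum_sortDesc ν fun x => max (x - b i) 0, ← sum_sortDesc μ fun x => max (x - b i) 0] at h3
      have h4 : ∑ j, max (b j - b i) 0 = ∑ j ∈ Finset.Iic i, (b j - b i) := by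
        rw [← Finset.sum_subset (Finset.subset_univ (Finset.Iic i)) fun j _ hj => ?_]
        · exact Finset.sum_congr rfl fun j hj => max_eq_left
            (sub_nonneg.2 (antitone_sortDesc μ (Finset.mem_Iic.1 hj)))
        · rw [Finset.mem_Iic, not_le] at hj
          exact max_eq_right (sub_nonpos.2 (antitone_sortDesc μ hj.le))
      have h5 : ∑ j ∈ Finset.Iic i, (a j - b i) ≤ ∑ j, max (a j - b i) 0 :=
        (Finset.sum_le_sum fun j _ => le_max_left _ 0).trans
          (Finset.sum_le_univ_sum_of_nonneg fun j => le_max_right _ _)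
      rw [Finset.sum_sub_distrib] at h4 h5
      linarith
    · rw [sum_sortDesc ν fun x => x, sum_sortDesc μ fun x => x]; exact h.1.1
  · exact Or.inr ⟨h2, i, by omega, fun j hj => by rw [hi' j hj, sub_self]⟩

theorem TriLT.sqSum_lt_of_monotone {ν m : Fin N → ℤ} (hm : Monotone m) (h : TriLT ν m) :
    sqSum ν < sqSum m := by
  refine h.2.resolve_right fun ⟨h2, i, hi, hi'⟩ => ?_
  refine (Finset.sum_lt_sum (fun j _ => ?_) ⟨i, Finset.mem_univ i, ?_⟩).ne'
    (sum_eq_of_sortDesc h2 fun x => max (x - m i) 0)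
  · rcases le_or_gt j i with hj | hj
    · have := hm hj
      omega
    · rw [hi' j hj]
  · omega

end order

/-! ### Triangular operators -/

section triangular

variable {N : ℕ}

/-- `A` is triangular with diagonal entries `d`. -/
def Tri (A : Module.End ℂ (Laurent N)) (d : (Fin N → ℤ) → ℂ) : Prop :=
  ∀ μ, A (mono μ) - d μ • mono μ ∈ monoSpan {ν | TriLT ν μ}

variable {A B : Module.End ℂ (Laurent N)} {d d' : (Fin N → ℤ) → ℂ}

theorem Tri.mem (hA : Tri A d) {μ : Fin N → ℤ} {f : Laurent N} (hf : f ∈ monoSpan {ν | TriLT ν μ}) :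
    A f ∈ monoSpan {ν | TriLT ν μ} := by
  refine monoSpan_induction (fun ν hν => ?_) f hf
  have := Submodule.add_mem _ (monoSpan_mono (fun κ hκ => TriLT.trans hκ hν) (hA ν))
    (Submodule.smul_mem _ (d ν) (mono_mem hν))
  rwa [sub_add_cancel] at this

theorem Tri.mul (hA : Tri A d) (hB : Tri B d') : Tri (A * B) fun μ => d μ * d' μ := fun μ => by
  have := Submodule.add_mem _ (hA.mem (hB μ)) (Submodule.smul_mem _ (d' μ) (hA μ))
  rw [map_sub, map_smul] at this
  convert this using 1
  rw [Module.End.mul_apply]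
  module

theorem Tri.one : Tri (1 : Module.End ℂ (Laurent N)) fun _ => 1 := fun μ => by simp

theorem Tri.list_prod {ι : Type*} {l : List ι} {A : ι → Module.End ℂ (Laurent N)}
    {d : ι → (Fin N → ℤ) → ℂ} (h : ∀ j ∈ l, Tri (A j) (d j)) :
    Tri (l.map A).prod fun μ => (l.map fun j => d j μ).prod := by
  induction l with
  | nil => exact Tri.one
  | cons a l ih =>
    simp only [List.map_cons, List.prod_cons]
    exact (h a (by simp)).mul (ih fun j hj => h j (by simp [hj]))

theorem monoSpan_inner_le {i j : Fin N} (hij : i ≠ j) {μ κ : Fin N → ℤ}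
    (hκ : κ = μ ∨ κ = μ ∘ Equiv.swap i j) :
    monoSpan {ν | Inner i j μ ν} ≤ monoSpan {ν | TriLT ν κ} :=
  monoSpan_mono fun _ h => Inner.triLT hij h hκ

theorem swapVar_inner {i j : Fin N} (hij : i ≠ j) {μ : Fin N → ℤ} {f : Laurent N}
    (hf : f ∈ monoSpan {ν | Inner i j μ ν}) : swapVar i j f ∈ monoSpan {ν | TriLT ν μ} := by
  refine monoSpan_induction (fun ν hν => ?_) f hf
  rw [swapVar_mono]
  have h := Inner.triLT hij hν (Or.inl rfl)
  refine mono_mem ⟨⟨(Equiv.sum_comp (Equiv.swap i j) ν).trans h.1.1, fun t =>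
    (Equiv.sum_comp (Equiv.swap i j) fun l => max (ν l - t) 0).trans_le (h.1.2 t)⟩, Or.inl ?_⟩
  rw [sqSum_swap]; exact Inner.sqSum_lt hij hν

variable {q p : ℂ}

theorem tri_xi {i j : Fin N} (hij : i < j) :
    Tri (xi q i j) fun μ => if μ i < μ j then q⁻¹ else q := fun μ => by
  beta_reduce
  rw [xi, Module.End.mul_apply]
  rcases lt_trichotomy (μ i) (μ j) with h | h | h
  · have := swapVar_inner hij.ne (heckeG_mono_lt q hij.ne h)
    rwa [map_sub, map_smul, swapVar_mono, comp_swap_swap, ← if_pos (t := q⁻¹) (e := q) h] at this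
  · rw [heckeG_mono_eq q h, map_smul, swapVar_mono, comp_swap_of_eq h, if_neg h.not_lt, sub_self]
    exact Submodule.zero_mem _
  · have := Submodule.add_mem _ (swapVar_inner hij.ne (heckeG_mono_gt q hij.ne h))
      (Submodule.smul_mem _ (q - q⁻¹) (mono_mem (triLT_swap hij h)))
    rw [map_sub, map_add, map_smul, map_smul, swapVar_mono, swapVar_mono, comp_swap_swap] at this
    rw [if_neg h.not_gt]
    convert this using 1
    module

theorem tri_xiInv {i j : Fin N} (hij : i < j) :
    Tri (xiInv q i j) fun μ => if μ i < μ j then q else q⁻¹ := fun μ => by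
  beta_reduce
  rw [xiInv, Module.End.mul_apply, swapVar_mono, heckeGInv, LinearMap.sub_apply,
    LinearMap.smul_apply, Module.End.one_apply]
  have hin := monoSpan_inner_le hij.ne (μ := μ ∘ Equiv.swap i j) (κ := μ)
    (Or.inr (comp_swap_swap i j μ).symm)
  rcases lt_trichotomy (μ i) (μ j) with h | h | h
  · have := hin (heckeG_mono_gt q hij.ne (by simpa using h))
    rw [comp_swap_swap] at this
    rw [if_pos h]
    convert this using 1
    module
  · rw [comp_swap_of_eq h, heckeG_mono_eq q h, if_neg h.not_lt]
    convert Submodule.zero_mem _ using 1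
    module
  · have := Submodule.sub_mem _ (hin (heckeG_mono_lt q hij.ne (by simpa using h)))
      (Submodule.smul_mem _ (q - q⁻¹) (mono_mem (triLT_swap hij h)))
    rw [comp_swap_swap] at this
    rw [if_neg h.not_gt]
    convert this using 1
    module

theorem tri_macY (hq : q ≠ 0) (i : Fin N) : Tri (macY q p i) fun μ => zeta q p μ i := by
  have h := ((Tri.list_prod (l := (List.finRange N).filter fun j => i < j)
    (A := fun j => Ring.inverse (xi q i j)) (d := fun j μ => if μ i < μ j then q else q⁻¹)
    fun j hj => ?_).mul (B := pShift p i) (d' := fun μ => p ^ μ i)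
    fun μ => by rw [pShift_mono, sub_self]; exact Submodule.zero_mem _).mul
    (Tri.list_prod (l := (List.finRange N).filter fun j => j < i)
    (A := fun j => xi q j i) (d := fun j μ => if μ j < μ i then q⁻¹ else q)
    fun j hj => tri_xi (by simpa using hj))
  · refine (congrArg (Tri _) (funext fun μ => ?_)).mpr h
    let P : Fin N → Prop := fun j => μ i < μ j ∨ (μ j = μ i ∧ j ≤ i)
    have e1 : ∏ j, (if P j then q else q⁻¹) = q ^ (2 * (pos μ i : ℤ) - N) := by
      rw [Finset.prod_ite, Finset.prod_const, Finset.prod_const, inv_pow, ← zpow_natCast, ← zpow_natCast,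
        ← zpow_neg, ← zpow_add₀ hq]
      congr 1
      have := Finset.card_filter_add_card_filter_not (s := Finset.univ) fun j => P j
      rw [Finset.card_univ, Fintype.card_fin] at this
      have h' : pos μ i = (Finset.univ.filter fun j => P j).card := rfl
      omega
    have e2 : ∀ (Q : Fin N → Prop) [DecidablePred Q] (f : Fin N → ℂ),
        (((List.finRange N).filter fun j => Q j).map f).prod = ∏ j, if Q j then f j else 1 := by
      intro Q _ f
      rw [← List.prod_toFinset _ ((List.nodup_finRange N).filter _), ← Finset.prod_filter]
      congr 1
      ext; simp
    rw [e2, e2, zeta, mul_right_comm, ← Finset.prod_mul_distrib, mul_comm]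
    congr 1
    rw [zpow_sub_one₀ hq, ← e1, mul_inv_eq_iff_eq_mul₀ hq,
      ← Fintype.prod_ite_eq i fun _ => q, ← Finset.prod_mul_distrib]
    refine Finset.prod_congr rfl fun j _ => ?_
    rcases lt_trichotomy i j with hj | rfl | hj
    · have : P j ↔ μ i < μ j := by simp [P, hj.not_ge]
      simp [this, hj, hj.not_gt, hj.ne]
    · simp [P]
    · have : P j ↔ ¬ μ j < μ i := by simp only [P, hj.le, and_true]; omega
      by_cases h' : μ j < μ i <;> simp [this, hj, hj.not_gt, hj.ne', h']
  · have hj : i < j := by simpa using hj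
    rw [inverse_xi hq hj.ne]
    exact tri_xiInv hj

end triangular

/-! ### Joint eigenvectors -/

section joint

variable {V ι : Type*} [AddCommGroup V] [Module ℂ V] {Y : ι → Module.End ℂ V}

theorem exists_separator (hY : ∀ i j, Commute (Y i) (Y j)) (z : ι → ℂ) (X : Finset (ι → ℂ)) (hz : z ∉ X) :
    ∃ P : Module.End ℂ V, (∀ f, (∀ i, Y i f = z i • f) → P f = f) ∧
      (∀ χ ∈ X, ∀ f, (∀ i, Y i f = χ i • f) → P f = 0) ∧ (∀ i, Commute (Y i) P) ∧
      ∀ U : Submodule ℂ V, (∀ i, ∀ f ∈ U, Y i f ∈ U) → ∀ v, (∀ i, Y i v - z i • v ∈ U) → P v - v ∈ U := by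
  classical
  induction X using Finset.induction_on with
  | empty => exact ⟨1, by simp, by simp, by simp, by simp⟩
  | insert χ X _ ih =>
    obtain ⟨P, h1, h2, h3, h4⟩ := ih fun h => hz (Finset.mem_insert_of_mem h)
    obtain ⟨k, hk⟩ : ∃ k, z k ≠ χ k := by
      by_contra! h
      exact hz (Finset.mem_insert.2 (Or.inl (funext h)))
    have hk' := sub_ne_zero.2 hk
    let R : Module.End ℂ V := (z k - χ k)⁻¹ • (Y k - χ k • 1)
    have hR : ∀ f, R f = (z k - χ k)⁻¹ • (Y k f - χ k • f) := fun f => rfl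
    have hR' : ∀ f, R f = f + (z k - χ k)⁻¹ • (Y k f - z k • f) := fun f => by
      have : f = (z k - χ k)⁻¹ • (z k - χ k) • f := (inv_smul_smul₀ hk' f).symm
      rw [hR]
      conv_rhs => enter [1]; rw [this]
      module
    refine ⟨P * R, fun f hf => ?_, fun χ' hχ' f hf => ?_, fun i => (h3 i).mul_right
      (((hY i k).sub_right ((Commute.one_right _).smul_right _)).smul_right _), fun U hU v hv => ?_⟩
    · rw [Module.End.mul_apply, hR', hf k, sub_self, smul_zero, add_zero, h1 f hf]
    · rw [Module.End.mul_apply, hR, hf k, ← sub_smul, map_smul, map_smul]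
      rcases Finset.mem_insert.1 hχ' with rfl | h
      · rw [sub_self, zero_smul, smul_zero]
      · rw [h2 χ' h f hf, smul_zero, smul_zero]
    · have hu := U.smul_mem (z k - χ k)⁻¹ (hv k)
      have hv' : ∀ i, Y i (R v) - z i • R v ∈ U := fun i => by
        rw [hR']
        have := U.add_mem (hv i) (U.sub_mem (hU i _ hu) (U.smul_mem (z i) hu))
        convert this using 1
        rw [map_add]; module
      have := U.add_mem (h4 U hU _ hv') hu
      rw [Module.End.mul_apply]
      convert this using 1
      rw [hR' v]; module

end joint

/-! ### The joint spectrum of the operators `Y_i` -/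

section spectrum

variable {N : ℕ} {q p : ℂ} (hq : q ≠ 0) (hp : p ≠ 0)
  (hg : ∀ a b : ℕ, 0 < b → p ^ b ≠ q ^ (2 * a))

include hq hp hg in
theorem le_of_zeta_eq {ν μ : Fin N → ℤ} {σ : Equiv.Perm (Fin N)}
    (h : ∀ k, zeta q p ν k = zeta q p μ (σ k)) (k : Fin N) : ν k ≤ μ (σ k) := by
  have key : ∀ k, μ (σ k) < ν k → pos μ (σ k) < pos ν k := by
    intro k hk
    by_contra! hle
    refine hg (pos μ (σ k) - pos ν k) (ν k - μ (σ k)).toNat (by omega) ?_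
    have e := h k
    rw [zeta, zeta, ← eq_div_iff (zpow_ne_zero _ hq), mul_div_assoc, ← zpow_sub₀ hq, mul_comm,
      ← div_eq_iff (zpow_ne_zero _ hp), ← zpow_sub₀ hp] at e
    rw [← zpow_natCast, ← zpow_natCast, Int.toNat_of_nonneg (by omega), e]
    congr 1
    push_cast [Nat.cast_sub hle]
    ring
  by_contra! hk
  obtain ⟨k, hk, hmin⟩ := Finset.exists_min_image (Finset.univ.filter fun k => μ (σ k) < ν k) (pos ν)
    ⟨k, by simpa using hk⟩
  simp only [Finset.mem_filter, Finset.mem_univ, true_and] at hk hmin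
  refine (key k hk).not_ge (Finset.card_le_card_of_injOn σ (fun j hj => ?_) σ.injective.injOn)
  simp only [Finset.coe_filter, Finset.mem_univ, true_and, Set.mem_ofPred_eq] at hj ⊢
  rcases eq_or_ne j k with rfl | hjk
  · exact Or.inr ⟨rfl, le_rfl⟩
  · have hlt : pos ν j < pos ν k := by
      refine Finset.card_lt_card (Finset.ssubset_iff_of_subset (fun l hl => ?_) |>.2 ⟨k, ?_, ?_⟩)
      · simp only [Finset.mem_filter, Finset.mem_univ, true_and] at hl ⊢
        omega
      · simp
      · simp only [Finset.mem_filter, Finset.mem_univ, true_and]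
        omega
    have : ν j ≤ μ (σ j) := not_lt.1 fun h' => (hmin j h').not_gt hlt
    omega

include hq hp hg in
theorem eq_of_zeta_eq {ν μ : Fin N → ℤ} {σ : Equiv.Perm (Fin N)}
    (h : zeta q p ν = zeta q p μ ∘ σ) : ν = μ ∘ σ :=
  funext fun k => (le_of_zeta_eq hq hp hg (congrFun h) k).antisymm <| by
    simpa using le_of_zeta_eq hq hp hg (ν := μ) (σ := σ.symm) (fun k => by simp [h]) (σ k)

variable (q p) in
/-- `f` is a joint eigenvector of the `Y_i` with leading term `z^μ`. -/
def IsLeading (μ : Fin N → ℤ) (f : Laurent N) : Prop :=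
  f - mono μ ∈ monoSpan {ν | TriLT ν μ} ∧ ∀ i, macY q p i f = zeta q p μ i • f

theorem wellFounded_triLT : WellFounded (TriLT (N := N)) :=
  Subrelation.wf (r := InvImage (· < ·) fun μ : Fin N → ℤ => {ν | TriLT ν μ}.ncard)
    (fun {ν μ} h => Set.ncard_lt_ncard (s := {κ | TriLT κ ν}) ⟨fun _ hκ => TriLT.trans hκ h,
      fun h' => TriLT.irrefl ν (h' h)⟩ (finite_triLT μ)) (InvImage.wf _ wellFounded_lt)

theorem mono_mem_span {L : Set (Fin N → ℤ)} (hL : ∀ ν ∈ L, ∀ κ, TriLT κ ν → κ ∈ L)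
    {S : Set (Laurent N)} (hS : ∀ ν ∈ L, ∃ f ∈ S, f - mono ν ∈ monoSpan {κ | TriLT κ ν})
    (ν : Fin N → ℤ) : ν ∈ L → mono ν ∈ Submodule.span ℂ S := by
  induction ν using wellFounded_triLT.induction with
  | _ ν ih =>
    intro hν
    obtain ⟨f, hf, h⟩ := hS ν hν
    rw [← sub_sub_self f (mono ν)]
    exact Submodule.sub_mem _ (Submodule.subset_span hf)
      (monoSpan_induction (A := LinearMap.id) (fun κ hκ => ih κ hκ (hL ν hν κ hκ)) _ h)

include hq hp hg in
theorem exists_isLeading (μ : Fin N → ℤ) : ∃ f, IsLeading q p μ f := by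
  induction μ using wellFounded_triLT.induction with
  | _ μ ih =>
    obtain ⟨P, -, h2, h3, h4⟩ := exists_separator (macY_comm hq hp (N := N)) (zeta q p μ)
      ((finite_triLT μ).toFinset.image (zeta q p)) (by
        simp only [Finset.mem_image, Set.Finite.mem_toFinset, not_exists, not_and]
        intro ν hν h
        have := eq_of_zeta_eq hq hp hg (σ := 1) (by simpa using h)
        rw [Equiv.Perm.coe_one, Function.comp_id] at this
        exact TriLT.irrefl μ (this ▸ hν))
    have htri := fun i : Fin N => tri_macY (q := q) (p := p) hq i
    refine ⟨P (mono μ), h4 _ (fun i f hf => (htri i).mem hf) _ fun i => htri i μ, fun i => ?_⟩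
    have h5 : P (macY q p i (mono μ) - zeta q p μ i • mono μ) = 0 := by
      have hle : Submodule.span ℂ {f | ∃ κ, TriLT κ μ ∧ IsLeading q p κ f} ≤ LinearMap.ker P := by
        rw [Submodule.span_le]
        rintro f ⟨κ, hκ, hf⟩
        exact h2 _ (Finset.mem_image_of_mem _ ((finite_triLT μ).mem_toFinset.2 hκ)) f hf.2
      refine hle (monoSpan_induction (A := LinearMap.id) (mono_mem_span
        (fun ν hν κ hκ => hκ.trans hν) fun ν hν => ?_) _ (htri i μ))
      obtain ⟨f, hf⟩ := ih ν hν
      exact ⟨f, ⟨ν, hν, hf⟩, hf.1⟩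
    rw [map_sub, map_smul, sub_eq_zero] at h5
    rw [← h5]
    exact LinearMap.congr_fun (h3 i).eq (mono μ)

theorem IsLeading.coeffAt_eq {μ : Fin N → ℤ} {f : Laurent N} (hf : IsLeading q p μ f) :
    coeffAt μ f = 1 := by
  have := coeffAt_eq_zero hf.1 (TriLT.irrefl μ)
  rw [map_sub, coeffAt_mono, if_pos rfl] at this
  exact sub_eq_zero.1 this

include hq hp hg in
/-- A joint eigenspace of the `Y_i` is spanned by a vector with a leading term. -/
theorem eq_smul_of_eigen {z : Fin N → ℂ} {μ : Fin N → ℤ} (hz : ∀ ν, zeta q p ν = z → ν = μ)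
    {Φ f : Laurent N} (hΦ : IsLeading q p μ Φ) (hf : ∀ i, macY q p i f = z i • f) :
    f = coeffAt μ f • Φ := by
  classical
  choose Ψ' hΨ' using exists_isLeading (N := N) hq hp hg
  let Ψ := Function.update Ψ' μ Φ
  have hΨ : ∀ ν, IsLeading q p ν (Ψ ν) := fun ν => by
    rcases eq_or_ne ν μ with rfl | h
    · simpa [Ψ] using hΦ
    · simpa [Ψ, h] using hΨ' ν
  have hf' : f ∈ Submodule.span ℂ (Set.range Ψ) := by
    rw [eq_sum_mono f]
    exact Submodule.sum_mem _ fun ν _ => Submodule.smul_mem _ _ (mono_mem_span (L := Set.univ)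
      (S := Set.range Ψ) (fun _ _ _ _ => trivial) (fun ν _ => ⟨Ψ ν, ⟨ν, rfl⟩, (hΨ ν).1⟩) ν trivial)
  rw [Finsupp.mem_span_range_iff_exists_finsupp] at hf'
  obtain ⟨c, hc⟩ := hf'
  obtain ⟨P, h1, h2, -, -⟩ := exists_separator (macY_comm hq hp (N := N)) z
    (((insert μ c.support).image (zeta q p)).erase z) (Finset.notMem_erase _ _)
  have hP : f = c μ • P Φ := by
    rw [← h1 f hf, ← hc, Finsupp.sum, map_sum, Finset.sum_eq_single μ]
    · rw [map_smul]; simp [Ψ]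
    · intro ν hν hne
      rw [map_smul, h2 _ (Finset.mem_erase.2 ⟨fun h => hne (hz ν h),
        Finset.mem_image_of_mem _ (Finset.mem_insert_of_mem hν)⟩) _ (hΨ ν).2, smul_zero]
    · intro h
      rw [Finsupp.notMem_support_iff.1 h, zero_smul, map_zero]
  by_cases h : zeta q p μ = z
  · rw [h1 Φ fun i => h ▸ hΦ.2 i] at hP
    have h4 := congrArg (coeffAt μ) hP
    rw [map_smul, hΦ.coeffAt_eq, smul_eq_mul, mul_one] at h4
    rw [h4]; exact hP
  · rw [h2 _ (Finset.mem_erase.2 ⟨h, Finset.mem_image_of_mem _ (Finset.mem_insert_self _ _)⟩) _ hΦ.2,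
      smul_zero] at hP
    rw [hP, map_zero, zero_smul]

include hq hp hg in
theorem isMacdonald_iff {μ : Fin N → ℤ} {f Φ : Laurent N} (hΦ : IsLeading q p μ Φ) :
    IsMacdonald q p μ f ↔ f = Φ := by
  constructor
  · rintro ⟨h1, h2, -⟩
    have := eq_smul_of_eigen hq hp hg (fun ν h => eq_of_zeta_eq (σ := 1) hq hp hg h) hΦ h1
    rwa [Equiv.Perm.coe_one, Function.comp_id, show coeffAt μ f = 1 from h2, one_smul] at this
  · rintro rfl
    refine ⟨hΦ.2, hΦ.coeffAt_eq, fun ν hν h => ?_⟩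
    by_contra h'
    have := coeffAt_eq_zero hΦ.1 (μ := ν) fun h => h' (TriLT.macLT h)
    rw [map_sub, coeffAt_mono, if_neg hν.symm, sub_zero] at this
    exact h this

theorem IsLeading.sub_mem {m : Fin N → ℤ} (hm : Monotone m) {Φ : Laurent N} (hΦ : IsLeading q p m Φ) :
    Φ - mono m ∈ monoSpan {ν | sqSum ν < sqSum m} :=
  monoSpan_mono (fun _ h => TriLT.sqSum_lt_of_monotone hm h) hΦ.1

include hq hp hg in
theorem IsLeading.heckeG_eq {m : Fin N → ℤ} (hm : Monotone m) {Φ : Laurent N} (hΦ : IsLeading q p m Φ)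
    {i j : Fin N} (hij : (i : ℕ) + 1 = j) (h : m i = m j) : heckeG q i j Φ = q • Φ := by
  have hne := ne_of_succ hij
  have hpos : pos m j = pos m i + 1 := by
    have e : (Finset.univ.filter fun l => m j < m l ∨ (m l = m j ∧ l ≤ j)) =
        insert j (Finset.univ.filter fun l => m i < m l ∨ (m l = m i ∧ l ≤ i)) := by
      ext l
      simp only [Finset.mem_filter, Finset.mem_univ, true_and, Finset.mem_insert, Fin.le_def, Fin.ext_iff, h]
      rcases eq_or_ne l j with rfl | hl
      · simp
      · have := Fin.val_ne_of_ne hl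
        omega
    rw [pos, e, Finset.card_insert_of_notMem, pos]
    simp only [Finset.mem_filter, Finset.mem_univ, true_and, Fin.le_def]
    omega
  have hζ : zeta q p m j = q ^ 2 * zeta q p m i := by
    rw [zeta, zeta, hpos, h, mul_left_comm, ← zpow_natCast q 2, ← zpow_add₀ hq]
    congr 2
    push_cast; ring
  have hi := hΦ.2 i
  have hj := hΦ.2 j
  set g := heckeG q i j
  set a := zeta q p m i
  have hinv : ∀ f, g (g f) = (q - q⁻¹) • g f + f := fun f => by
    have := LinearMap.congr_fun (heckeG_mul_inv hq hne) f
    rw [Module.End.mul_apply, heckeGInv, LinearMap.sub_apply, map_sub, sub_eq_iff_eq_add] at this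
    rw [this, Module.End.one_apply, LinearMap.smul_apply, map_smul, add_comm]; rfl
  have hinv' : ∀ f, heckeGInv q i j (g f) = f := fun f => LinearMap.congr_fun (heckeGInv_mul hq hne) f
  have hY : ∀ f, macY q p j f = g (macY q p i (g f)) := fun f => by rw [macY_succ hq hij]; rfl
  have hgi : macY q p i (g Φ) = (q ^ 2 * a) • (g Φ - (q - q⁻¹) • Φ) := by
    rw [← hinv' (macY q p i (g Φ)), ← hY, hj, hζ, map_smul]; rfl
  have hgj : macY q p j (g Φ) = (q - q⁻¹) • (q ^ 2 * a) • Φ + a • g Φ := by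
    rw [hY, hinv, map_add, map_add, map_smul, map_smul, ← hY, hj, hi, map_smul, hζ]
  have hΨ : ∀ l, macY q p l (g Φ - q • Φ) = (zeta q p m ∘ Equiv.swap i j) l • (g Φ - q • Φ) := by
    intro l
    rw [Function.comp_apply, map_sub, map_smul]
    rcases eq_or_ne l i with rfl | hli
    · rw [Equiv.swap_apply_left, hgi, hi, hζ]
      match_scalars <;> field_simp <;> ring
    · rcases eq_or_ne l j with rfl | hlj
      · rw [Equiv.swap_apply_right, hgj, hj, hζ]
        match_scalars <;> field_simp <;> ring
      · rw [Equiv.swap_apply_of_ne_of_ne hli hlj, ← Module.End.mul_apply,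
          ← (heckeG_macY_comm hq hp hij hli hlj).eq, Module.End.mul_apply, hΦ.2 l, map_smul]
        module
  have h5 := eq_smul_of_eigen hq hp hg (fun ν h' => (eq_of_zeta_eq hq hp hg h').trans
    (comp_swap_of_eq h)) hΦ hΨ
  have h6 : g Φ - q • Φ ∈ monoSpan {ν | sqSum ν < sqSum m} := by
    have hu := hΦ.sub_mem hm
    have := Submodule.sub_mem _ ((closedExp_sqSum_lt (sqSum m)).heckeG_mem (q := q) hne _ hu)
      (Submodule.smul_mem _ q hu)
    rw [map_sub, heckeG_mono_eq q h] at this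
    convert this using 1
    module
  rw [coeffAt_eq_zero h6 (by simp), zero_smul] at h5
  exact sub_eq_zero.1 h5

end spectrum

/-! ### The spaces `E^m` -/

section components

variable {N n : ℕ} [NeZero n] {q p : ℂ} (hq : q ≠ 0) (hq2 : q + q⁻¹ ≠ 0) (hp : p ≠ 0)
  (hg : ∀ a b : ℕ, 0 < b → p ^ b ≠ q ^ (2 * a)) {m : Fin N → ℤ} (hm : Monotone m)
  {Φ : Laurent N} (hΦ : IsLeading q p m Φ)

include hq hq2 hp hg hm hΦ in
theorem wedgeMk_mem_emod (v : Spin n N) : wedgeMk q n N (Φ ⊗ₜ[ℂ] v) ∈ Emod q p n m := by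
  have key : ∀ d, ∀ e : Fin N → Fin n, ascents (kIdx m e) < d →
      wedgeMk q n N (Φ ⊗ₜ[ℂ] spinVec e) ∈ Emod q p n m := by
    intro d
    induction d with
    | zero => exact fun _ h => absurd h (Nat.not_lt_zero _)
    | succ d ih =>
      intro e hd
      by_cases he : InE m e
      · exact Submodule.subset_span ⟨Φ, e, (isMacdonald_iff hq hp hg hΦ).2 rfl, he, rfl⟩
      · unfold InE at he
        push Not at he
        obtain ⟨i, j, hij, h, hle⟩ := he
        have hE := hΦ.heckeG_eq hq hp hg hm hij h
        rcases hle.eq_or_lt with h' | h'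
        · rw [wedgeMk_eigen_eq hq hq2 hij hE h']; exact Submodule.zero_mem _
        · rw [wedgeMk_eigen_lt hq hij hE h']
          refine Submodule.smul_mem _ _ (ih _ ?_)
          have := ascents_swap hij ((kIdx_lt_iff h e).2 h')
          rw [kIdx_swap h]
          omega
  have hle : (⊤ : Submodule ℂ (Spin n N)) ≤ (Emod q p n m).comap
      (wedgeMk q n N ∘ₗ TensorProduct.mk ℂ (Laurent N) (Spin n N) Φ) := by
    rw [← (spinBasis n N).span_eq, Submodule.span_le]
    rintro _ ⟨e, rfl⟩
    rw [spinBasis_apply]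
    exact key _ e (Nat.lt_succ_self _)
  exact hle trivial

include hq hq2 hm hΦ in
theorem linearIndependent_emod : LinearIndependent ℂ
    (fun e : {e : Fin N → Fin n // InE m e} => wedgeMk q n N (Φ ⊗ₜ[ℂ] spinVec e.1)) := by
  choose F hF1 hF2 hF3 using fun e : {e : Fin N → Fin n // InE m e} =>
    exists_wedgeForm (q := q) hq hq2 hm e.2
  have hF : ∀ e e', F e (wedgeMk q n N (Φ ⊗ₜ[ℂ] spinVec e')) = F e (wedgeMon q m e') := fun e e' => by
    have := hF3 e _ (hΦ.sub_mem hm) (spinVec e')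
    rw [TensorProduct.sub_tmul, map_sub, map_sub] at this
    exact sub_eq_zero.1 this
  rw [linearIndependent_iff']
  intro s g hg e he
  have h1 := congrArg (F e) hg
  rw [map_sum, Finset.sum_eq_single e, map_smul, map_zero, hF, hF1, smul_eq_mul, mul_one] at h1
  · exact h1
  · intro e' _ hne
    rw [map_smul, hF, hF2 e _ _ hm e'.2 (Or.inr fun h => hne (Subtype.ext h)), smul_zero]
  · exact fun h => absurd he h

include hq hp in
theorem IsLeading.exists_yOp_eigen {μ : Fin N → ℤ} {f : Laurent N} (hf : IsLeading q p μ f) (i : Fin N) :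
    (∃ c : ℂ, yOp q p i f = c • f) ∧ ∃ c : ℂ, Ring.inverse (yOp q p i) f = c • f := by
  have h1 : yOp q p i f = (q ^ (1 - (N : ℤ)) * zeta q p μ i) • f := by
    rw [yOp, LinearMap.smul_apply, hf.2, smul_smul]
  have hc : q ^ (1 - (N : ℤ)) * zeta q p μ i ≠ 0 :=
    mul_ne_zero (zpow_ne_zero _ hq) (mul_ne_zero (zpow_ne_zero _ hp) (zpow_ne_zero _ hq))
  refine ⟨⟨_, h1⟩, (q ^ (1 - (N : ℤ)) * zeta q p μ i)⁻¹, ?_⟩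
  have h2 := LinearMap.congr_fun (Ring.inverse_mul_cancel _ (isUnit_yOp hq hp i)) f
  rw [Module.End.mul_apply, h1, map_smul, Module.End.one_apply] at h2
  rw [eq_inv_smul_iff₀ hc, h2]

include hq hq2 hp hg hm hΦ in
theorem SumOp.emod_mem {A : Fin N → Module.End ℂ (Laurent N)} {S : Fin N → Module.End ℂ (Spin n N)}
    {X : Module.End ℂ (Wedge q n N)} (hX : SumOp A S X) (hA : ∀ i, ∃ c : ℂ, A i Φ = c • Φ) (v : Spin n N) :
    X (wedgeMk q n N (Φ ⊗ₜ[ℂ] v)) ∈ Emod q p n m := by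
  rw [hX]
  refine Submodule.sum_mem _ fun i _ => ?_
  obtain ⟨c, hc⟩ := hA i
  rw [hc, wedgeMk_smul_left]
  exact Submodule.smul_mem _ _ (wedgeMk_mem_emod hq hq2 hp hg hm hΦ _)

include hq hq2 hp hg hm hΦ in
theorem levelZero_emod {π : ∀ N, Uq q n →ₐ[ℂ] Module.End ℂ (Wedge q n N)}
    (hπ : ∀ N, IsLevelZeroAction q p n N (π N)) (x : Uq q n) :
    ∀ w ∈ Emod q p n m, π N x w ∈ Emod q p n m := by
  refine uq_induction (P := fun x => ∀ w ∈ Emod q p n m, π N x w ∈ Emod q p n m)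
    (fun x => ?_) (fun c w hw => ?_) (fun x y hx hy w hw => ?_) (fun x y hx hy w hw => ?_) x
  · suffices h : ∀ v : Spin n N, π N (Uq.gen q x) (wedgeMk q n N (Φ ⊗ₜ[ℂ] v)) ∈ Emod q p n m by
      intro w hw
      have hle : Emod q p n m ≤ (Emod q p n m).comap (π N (Uq.gen q x)) := by
        refine Submodule.span_le.2 ?_
        rintro _ ⟨Ψ, e, hΨ, -, rfl⟩
        rw [(isMacdonald_iff hq hp hg hΦ).1 hΨ]
        exact h _
      exact hle hw
    intro v
    cases x with
    | E ε =>
      refine (sumOp_E hπ N ε).emod_mem hq hq2 hp hg hm hΦ (fun i => ?_) v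
      split_ifs
      exacts [(hΦ.exists_yOp_eigen hq hp i).2, ⟨1, by simp⟩]
    | F ε =>
      refine (sumOp_F hπ N ε).emod_mem hq hq2 hp hg hm hΦ (fun i => ?_) v
      split_ifs
      exacts [(hΦ.exists_yOp_eigen hq hp i).1, ⟨1, by simp⟩]
    | K ε => rw [levelZero_K hπ]; exact wedgeMk_mem_emod hq hq2 hp hg hm hΦ _
    | Kinv ε => rw [levelZero_Kinv hπ]; exact wedgeMk_mem_emod hq hq2 hp hg hm hΦ _
  · rw [AlgHom.commutes]; exact Submodule.smul_mem _ c hw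
  · rw [map_add]; exact Submodule.add_mem _ (hx w hw) (hy w hw)
  · rw [map_mul]; exact hx _ (hy w hw)

end components

/-! ### The components of the Fock space -/

section fockComponents

variable {n : ℕ} [NeZero n] {M : ℤ} {s : ℕ} (hs : s < n) (hMs : M ≡ s [ZMOD n]) {m : ℕ → ℤ}
  (hm : InMinf n M s m)

include hm in
theorem InMinf.succ_le (i : ℕ) : m i + 1 ≤ m (i + n) := by
  by_contra! h
  have h1 : ((Finset.Icc i (i + n) : Finset ℕ) : Set ℕ) ⊆ {j | m j = m i} := fun j hj => by
    simp only [Finset.coe_Icc, Set.mem_Icc] at hj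
    have h2 := hm.1 hj.1
    have h3 := hm.1 hj.2
    change m j = m i
    omega
  have h2 := (Set.encard_le_encard h1).trans (hm.2.1 (m i))
  rw [Set.encard_coe_eq_coe_finsetCard, Nat.card_Icc, Nat.cast_le] at h2
  omega

include hs hMs hm in
theorem InMinf.sub_le (i a : ℕ) : mVac n M s (i + n * a) - m (i + n * a) ≤ mVac n M s i - m i := by
  induction a with
  | zero => simp
  | succ a ih =>
    have h1 := hm.succ_le (i + n * a)
    have hn : (n : ℤ) ≠ 0 := by exact_mod_cast NeZero.ne n
    have h2 : mVac n M s (i + n * (a + 1)) = mVac n M s (i + n * a) + 1 := by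
      rw [mVac_eq hs hMs, mVac_eq hs hMs, mOf, mOf, show M - ((i + n * (a + 1) : ℕ) : ℤ) - 1 =
        M - ((i + n * a : ℕ) : ℤ) - 1 + n * (-1) by push_cast; ring, Int.add_mul_ediv_left _ _ hn]
      ring
    rw [show i + n * (a + 1) = i + n * a + n by ring] at h2 ⊢
    omega

include hs hMs hm in
theorem InMinf.le_mVac (i : ℕ) : m i ≤ mVac n M s i := by
  obtain ⟨L, hL⟩ := hm.2.2
  have := hm.sub_le hs hMs i L
  rw [hL (i + n * L) (le_add_left (Nat.le_mul_of_pos_left L (NeZero.pos n)))] at this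
  omega

include hs hMs hm in
theorem InMinf.degInf_eq {L : ℕ} (hL : ∀ i, L ≤ i → m i = mVac n M s i) :
    (degInf n M s m : ℤ) = ∑ i ∈ Finset.range L, (mVac n M s i - m i) := by
  rw [degInf, finsum_eq_sum_of_support_subset (s := Finset.range L)]
  · exact Int.toNat_of_nonneg (Finset.sum_nonneg fun i _ => sub_nonneg.2 (hm.le_mVac hs hMs i))
  · intro i hi
    by_contra hi'
    simp only [Finset.coe_range, Set.mem_Iio, not_lt] at hi'
    exact hi (by simp [hL i hi'])

include hs hMs hm in
theorem InMinf.eq_mVac {i : ℕ} (hi : s + n * degInf n M s m ≤ i) : m i = mVac n M s i := by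
  by_contra hne
  have h0 := hm.le_mVac hs hMs i
  obtain ⟨L, hL⟩ := hm.2.2
  set t := degInf n M s m with ht
  have hdeg := hm.degInf_eq hs hMs (L := max L (i + 1)) fun j hj => hL j (by omega)
  have hn := NeZero.pos n
  have hna : ∀ a, a < t + 1 → n * a ≤ i := fun a ha => by
    have := Nat.mul_le_mul_left n (Nat.lt_succ_iff.1 ha)
    omega
  have h1 : ∑ j ∈ (Finset.range (t + 1)).image (fun a => i - n * a), (mVac n M s j - m j) ≤
      ∑ j ∈ Finset.range (max L (i + 1)), (mVac n M s j - m j) :=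
    Finset.sum_le_sum_of_subset_of_nonneg (fun j hj => by
      obtain ⟨a, -, rfl⟩ := Finset.mem_image.1 hj
      exact Finset.mem_range.2 (by omega)) fun j _ _ => sub_nonneg.2 (hm.le_mVac hs hMs j)
  have h2 : ∑ a ∈ Finset.range (t + 1), (1 : ℤ) ≤
      ∑ j ∈ (Finset.range (t + 1)).image (fun a => i - n * a), (mVac n M s j - m j) := by
    rw [Finset.sum_image]
    · refine Finset.sum_le_sum fun a ha => ?_
      have := hm.sub_le hs hMs (i - n * a) a
      rw [Nat.sub_add_cancel (hna a (Finset.mem_range.1 ha))] at this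
      omega
    · intro a ha b hb hab
      have h1 := hna a (by simpa using ha)
      have h2 := hna b (by simpa using hb)
      exact Nat.eq_of_mul_eq_mul_left hn (by dsimp only at hab; omega)
  simp only [Finset.sum_const, Finset.card_range, mul_one, nsmul_eq_mul] at h2
  push_cast at h2
  omega

variable {q p : ℂ} (hq : q ≠ 0) (hq2 : q + q⁻¹ ≠ 0) (hp : p ≠ 0)
  (hg : ∀ a b : ℕ, 0 < b → p ^ b ≠ q ^ (2 * a))

include hs hMs hm hq hq2 hp hg in
theorem ecut_le : Ecut q p n M s m ≤ VMdeg q n M s (degInf n M s m) (degInf n M s m) := by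
  set t := degInf n M s m with ht
  obtain ⟨Φ, hΦ⟩ := exists_isLeading hq hp hg (trunc m (s + n * t))
  have hmem : trunc m (s + n * t) ∈ degSet n M s t t := by
    refine ⟨fun i => (hm.le_mVac hs hMs i).trans ?_, ?_⟩
    · rw [mVac_eq hs hMs, mOf_le_vacC hMs]
      have := i.2
      omega
    · rw [ht, hm.degInf_eq hs hMs fun i hi => hm.eq_mVac hs hMs hi, Finset.sum_range]; rfl
  have hlow : ∀ ν, TriLT ν (trunc m (s + n * t)) → ν ∈ degSet n M s t t := by
    refine fun ν hν => ⟨fun i => ?_, ?_⟩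
    · have h1 := hν.1.2 (vacC n M s t)
      rw [Finset.sum_eq_zero (f := fun i => max (trunc m _ i - _) 0) fun i _ =>
        max_eq_right (sub_nonpos.2 (hmem.1 i))] at h1
      have h2 := (Finset.single_le_sum (f := fun i => max (ν i - vacC n M s t) 0)
        (fun _ _ => le_max_right _ _) (Finset.mem_univ i)).trans h1
      exact sub_nonpos.1 ((le_max_left _ _).trans h2)
    · rw [Finset.sum_sub_distrib, hν.1.1, ← Finset.sum_sub_distrib]; exact hmem.2
  have hf : Φ ∈ monoSpan (degSet n M s t t) := by
    have := Submodule.add_mem _ (monoSpan_mono hlow hΦ.1) (mono_mem hmem)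
    rwa [sub_add_cancel] at this
  rw [VMdeg_eq hs hMs hq hq2]
  refine Submodule.span_le.2 ?_
  rintro _ ⟨Ψ, e, hΨ, -, rfl⟩
  rw [(isMacdonald_iff hq hp hg hΦ).1 hΨ]
  exact wedgeMk_mem_wSpan hf _

include hs hMs hm hq hq2 hp hg in
theorem exists_fockComp_equiv {π : ∀ N, Uq q n →ₐ[ℂ] Module.End ℂ (Wedge q n N)}
    (hπ : ∀ N, IsLevelZeroAction q p n N (π N)) {Θ : Uq q n →ₐ[ℂ] Module.End ℂ (Fock q n M)}
    (hΘ : IsFockAction q n M s π Θ) :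
    ∃ (hF : ∀ x, ∀ w ∈ fockComp q p n M s m, Θ x w ∈ fockComp q p n M s m)
      (hE : ∀ x, ∀ w ∈ Ecut q p n M s m, π (s + n * degInf n M s m) x w ∈ Ecut q p n M s m)
      (e : fockComp q p n M s m ≃ₗ[ℂ] Ecut q p n M s m),
      ∀ x w, e ((Θ x).restrict (hF x) w) =
        (π (s + n * degInf n M s m) x).restrict (hE x) (e w) := by
  have hle := ecut_le hs hMs hm hq hq2 hp hg
  obtain ⟨Φ, hΦ⟩ := exists_isLeading hq hp hg (trunc m (s + n * degInf n M s m))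
  have hE := levelZero_emod hq hq2 hp hg (fun i j h => hm.1 h) hΦ hπ
  have hΘ' := fun x w hw => hΘ _ _ le_rfl w (hle hw) x
  have hF : ∀ x, ∀ w ∈ fockComp q p n M s m, Θ x w ∈ fockComp q p n M s m := by
    rintro x _ ⟨w, hw, rfl⟩
    exact ⟨_, hE x w hw, (hΘ' x w hw).symm⟩
  let A : Ecut q p n M s m →ₗ[ℂ] fockComp q p n M s m :=
    (wedgeVac q n M _).restrict fun w hw => Submodule.mem_map_of_mem hw
  have hA : Function.Bijective A := by
    constructor
    · intro u v huv
      refine Subtype.ext (sub_eq_zero.1 (wedgeVac_eq_zero hs hMs hq hq2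
        (Submodule.sub_mem _ (VMdeg_le _ _ (hle u.2)) (VMdeg_le _ _ (hle v.2))) ?_))
      rw [map_sub]
      exact sub_eq_zero.2 (congrArg Subtype.val huv)
    · rintro ⟨_, w, hw, rfl⟩
      exact ⟨⟨w, hw⟩, rfl⟩
  let e := LinearEquiv.ofBijective A hA
  refine ⟨hF, hE, e.symm, fun x w => ?_⟩
  rw [LinearEquiv.symm_apply_eq]
  obtain ⟨u, rfl⟩ := e.surjective w
  rw [LinearEquiv.symm_apply_apply]
  exact Subtype.ext (hΘ' x u u.2)

end fockComponents

end LevelZero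

end

theorem propositionp (n : ℕ) [NeZero n] (hn : 2 ≤ n) (q p : ℂ) (hq0 : q ≠ 0)
    (hq : ∀ a : ℕ, 0 < a → q ^ a = 1 → q = 1) (hp0 : p ≠ 0)
    (M : ℤ) (s : ℕ) (hs : s < n) (hMs : M ≡ s [ZMOD n]) :
    -- the projections, the finite level-0 actions and the finite Hamiltonians are well defined
    (∀ r, ∃! ρ : VM q n M s (r + 1) →ₗ[ℂ] VM q n M s r, IsProjection q n M s r ρ) ∧
    (∀ N, ∃! φ : Uq q n →ₐ[ℂ] Module.End ℂ (Wedge q n N), IsLevelZeroAction q p n N φ) ∧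
    (∀ N, ∃! h : NZ → Module.End ℂ (Wedge q n N), IsHamiltonian q p n N h) ∧
    ∀ (ρ : ∀ r, VM q n M s (r + 1) →ₗ[ℂ] VM q n M s r)
      (π : ∀ N, Uq q n →ₐ[ℂ] Module.End ℂ (Wedge q n N))
      (h : ∀ N, NZ → Module.End ℂ (Wedge q n N)),
      (∀ r, IsProjection q n M s r (ρ r)) → (∀ N, IsLevelZeroAction q p n N (π N)) →
      (∀ N, IsHamiltonian q p n N (h N)) →
      -- the map `f ↦ f_r ∧ |M - s - nr⟩` is independent of `r ≥ k` and an isomorphism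
      (∀ k : ℕ, ∃ e : invLim q n M s ρ k ≃ₗ[ℂ] fockDeg q n M s k,
        ∀ (f : invLim q n M s ρ k) (r : ℕ), k ≤ r →
          ((e f : fockDeg q n M s k) : Fock q n M) =
            wedgeVac q n M (s + n * r) ((f : ∀ r, VM q n M s r) r)) ∧
      DirectSum.IsInternal (fun k : ℕ => fockDeg q n M s k) ∧
      -- the actions on the projective limits are well defined
      (∀ (k : ℕ) (f : invLim q n M s ρ k) (x : Uq q n), ∃ f' : invLim q n M s ρ k, ∀ r,
        ((f' : ∀ r, VM q n M s r) r : Wedge q n (s + n * r)) =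
          π (s + n * r) x ((f : ∀ r, VM q n M s r) r)) ∧
      (∀ (k : ℕ) (f : invLim q n M s ρ k) (l : NZ), ∃ f' : invLim q n M s ρ k, ∀ r,
        ((f' : ∀ r, VM q n M s r) r : Wedge q n (s + n * r)) =
          gFin q p n M s h r l ((f : ∀ r, VM q n M s r) r)) ∧
      -- they yield well-defined actions on the Fock space
      (∃! Θ : Uq q n →ₐ[ℂ] Module.End ℂ (Fock q n M), IsFockAction q n M s π Θ) ∧
      (∃! G : NZ → Module.End ℂ (Fock q n M), IsFockHamiltonian q p n M s h G) ∧
      ∀ (Θ : Uq q n →ₐ[ℂ] Module.End ℂ (Fock q n M)) (G : NZ → Module.End ℂ (Fock q n M)),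
        IsFockAction q n M s π Θ → IsFockHamiltonian q p n M s h G →
        (∀ k, ∀ w ∈ fockDeg q n M s k,
          (∀ x, Θ x w ∈ fockDeg q n M s k) ∧ ∀ l, G l w ∈ fockDeg q n M s k) ∧
        (∀ l l', Commute (G l) (G l')) ∧ (∀ l x, Commute (G l) (Θ x)) ∧
        -- the components `𝓕_M^m`, for generic `p`
        ((∀ a b : ℕ, 0 < b → p ^ b ≠ q ^ (2 * a)) →
          ∀ m : ℕ → ℤ, InMinf n M s m →
            (∃! Φ, IsMacdonald q p (trunc m (s + n * degInf n M s m)) Φ) ∧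
            (∀ Φ, IsMacdonald q p (trunc m (s + n * degInf n M s m)) Φ →
              LinearIndependent ℂ (fun e : {e : Fin (s + n * degInf n M s m) → Fin n //
                  InE (trunc m (s + n * degInf n M s m)) e} =>
                wedgeMk q n (s + n * degInf n M s m) (Φ ⊗ₜ[ℂ] spinVec e.1))) ∧
            ∃ (hF : ∀ x, ∀ w ∈ fockComp q p n M s m, Θ x w ∈ fockComp q p n M s m)
              (hE : ∀ x, ∀ w ∈ Ecut q p n M s m, π (s + n * degInf n M s m) x w ∈ Ecut q p n M s m)
              (e : fockComp q p n M s m ≃ₗ[ℂ] Ecut q p n M s m),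
              ∀ x w, e ((Θ x).restrict (hF x) w) =
                (π (s + n * degInf n M s m) x).restrict (hE x) (e w)) := by
  have hq2 := add_inv_ne_zero hq0 hq
  refine ⟨fun r => existsUnique_projection hs hMs hq0 hq2 r, existsUnique_levelZero hn hq0 hq hp0,
    existsUnique_hamiltonian hq0 hq hp0, fun ρ π h hρ hπ hh => ?_⟩
  have hcπ := compat_levelZero hs hMs hq0 hq2 hn hp0 hπ
  have hch := compat_ham hs hMs hq0 hq2 hp0 hh
  refine ⟨fun k => exists_invLim_equiv hs hMs hq0 hq2 hρ k, isInternal_fockDeg hs hMs hq0 hq2,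
    fun k f x => (hcπ x).exists_invLim hs hMs hρ f, fun k f l => (hch l).exists_invLim hs hMs hρ f,
    existsUnique_fockAction hs hMs hq0 hq2 hn hp0 hπ,
    existsUnique_fockHamiltonian hs hMs hq0 hq2 hp0 hh, fun Θ G hΘ hG => ?_⟩
  have hlΘ : ∀ x, IsLimit M s (fun r => π (s + n * r) x) (Θ x) :=
    fun x t r htr f hf => hΘ t r htr f hf x
  have hlG : ∀ l, IsLimit M s (fun r => gFin q p n M s h r l) (G l) :=
    fun l t r htr f hf => hG t r htr f hf l
  refine ⟨fun k w hw => ⟨fun x => (hlΘ x).mem_fockDeg hs hMs (hcπ x) hw,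
      fun l => (hlG l).mem_fockDeg hs hMs (hch l) hw⟩,
    fun l l' => (hlG l).commute hs hMs (hlG l') (hch l) (hch l') fun r =>
      gFin_comm (gFin_comm (ham_comm hq0 hp0 hh _ l' l)).symm,
    fun l x => (hlG l).commute hs hMs (hlΘ x) (hch l) (hcπ x) fun r =>
      gFin_comm (ham_levelZero_comm hq0 hp0 hπ hh _ l x), fun hg m hm => ?_⟩
  obtain ⟨Φ, hΦ⟩ := exists_isLeading hq0 hp0 hg (trunc m (s + n * degInf n M s m))
  have hM := fun Ψ => isMacdonald_iff (f := Ψ) hq0 hp0 hg hΦ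
  refine ⟨⟨Φ, (hM Φ).2 rfl, fun Ψ => (hM Ψ).1⟩, fun Ψ hΨ => ?_,
    exists_fockComp_equiv hs hMs hm hq0 hq2 hp0 hg hπ hΘ⟩
  rw [(hM Ψ).1 hΨ]
  exact linearIndependent_emod hq0 hq2 (fun i j h => hm.1 h) hΦ
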